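/- **Setting.** Let $\Lambda\in\mathbb R$. A conformal completion à la Penrose of a physical space-time with cosmological constant $\Lambda$ is a smooth 4-manifold $M$ with boundary $\mathscr J$, with a smooth Lorentzian metric $g_{\alpha\beta}$ of signature $(-,+,+,+)$ and a smooth function $\Omega$ such that $\Omega>0$ on the interior $\hat M$, and $\Omega=0$, $N_\alpha:=\nabla_\alpha\Omega\neq0$ on $\mathscr J$. The physical metric $\hat g_{\alpha\beta}=\Omega^{-2}g_{\alpha\beta}$ on $\hat M$ satisfies $\hat R_{\mu\nu}-\frac12\hat R\,\hat g_{\mu\nu}+\Lambda\hat g_{\mu\nu}=\frac{8\pi G}{c^4}\hat T_{\mu\nu}$, where the trace $\hat g^{\mu\nu}\hat T_{\mu\nu}$ tends to $0$ at $\mathscr J$ (equivalently, $N_\alpha N^\alpha=-\Lambda/3$ on $\mathscr J$). The conformal gauge is chosen with $\nabla_\alpha N_\beta=0$ on $\mathscr J$. There is a smooth rescaled Weyl tensor $d$ on $M$, defined by $C_{\alpha\beta\gamma}{}^\delta=\Omega\, d_{\alpha\beta\gamma}{}^\delta$, where $C$ is the Weyl tensor of $g$; $\hat C_{\alpha\beta\gamma\delta}$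 is the fully covariant Weyl tensor of $\hat g$. Let $\gamma:[\lambda_1,0]\to M$, $\lambda_1<0$, be a smooth affinely parametrised null geodesic of $g$ with $\gamma(\lambda)\in\hat M$ for $\lambda<0$, with endpoint $p_0=\gamma(0)\in\mathscr J$, and with tangent vector $\ell^\alpha$ at $p_0$ normalised by $\ell^\mu N_\mu=-1$. (If $\hat M$ is time-oriented and $\gamma$ is future-directed, then $p_0\in\mathscr J^+$.) By smoothness, $\Omega$ has a Taylor expansion in powers of $\lambda$ along $\gamma$; put $\Omega_i=\frac{d^i}{d\lambda^i}\Omega(\gamma(\lambda))|_{\lambda=0}$. All expansions below are asymptotic as $\lambda\to0^-$. Let $k^\alpha=N^\alpha-\frac{\Lambda}{6}\ell^\alpha$ at $p_0$. Let $t_\alpha{}^\beta(\lambda_i,\lambda_j)$ and $\hat t_\alpha{}^\beta(\lambda_i,\lambda_j)$ be the parallel propagators along $\gamma$ of the Levi-Civita connections of $g$ and $\hat g$, mapping covectors at $\gamma(\lambda_j)$ to covectors at $\gamma(\lambda_i)$. Put $L_\alpha{}^\beta=t_\alpha{}^\mu(0,\lambda_1)\,\hat t_\mu{}^\rho(\lambda_1,\lambda)\,t_\rho{}^\beta(\lambda,0)$.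 Let ${}^{L}\!\hat C_{\alpha\beta\gamma\delta}(\lambda)$ be the tensor at $p_0$ obtained from $\hat C_{\alpha\beta\gamma\delta}|_{\gamma(\lambda)}$ by transport to $p_0$ with $t(0,\lambda)$ on every index, followed by $L$ on every index. A *Weyl-tensor candidate* is a tensor with all the algebraic symmetries of a Weyl tensor, including vanishing traces. **Theorem.** The vector $k$ is null and $k^\mu\ell_\mu=-1$. There are tensors $C^{(a)}_{\alpha\beta\gamma\delta}(\lambda)$ ($a=0,\dots,4$, $\lambda_1\le\lambda<0$) and $C^{(a,b)}_{\alpha\beta\gamma\delta}$ ($b=0,1,2,\dots$) at $p_0$ such that the following hold. 1. ${}^{L}\!\hat C=\Omega\,C^{(4)}+\Omega^2C^{(3)}+\Omega^3C^{(2)}+\Omega^4C^{(1)}+\Omega^5C^{(0)}$, with $\Omega$ evaluated at $\gamma(\lambda)$. 2. Each $C^{(a)}$ is a Weyl-tensor candidate. In every null tetrad containing $\ell$ and $k$, its only possibly non-vanishing Weyl scalar is $\psi_a$. For it $\ell$ is a principal null direction (PND) of multiplicity at least $a$, and $k$ one of multiplicity at least $4-a$. (Convention: $\psi_0=C(\ell,m,\ell,m)$,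 …, $\psi_4=C(k,\bar m,k,\bar m)$.) 3. $C^{(a)}=\sum_{b=0}^{n}C^{(a,b)}\lambda^b+\mathcal O(\lambda^{n+1})$ for every $n$. The scalar $\psi_a$ of $C^{(a,0)}$ equals $\Omega(\gamma(\lambda_1))^{-(6-a)}$ times the scalar $\phi_a$ of $d|_{p_0}$. 4. With $P^\alpha{}_\beta=\delta^\alpha_\beta+k^\alpha\ell_\beta+\ell^\alpha k_\beta$, $$C^{(4,0)}_{\alpha\beta\gamma\delta}=\frac{4}{\Omega(\gamma(\lambda_1))^2}\,d_{\mu\nu\rho\sigma}k^\nu k^\sigma P^\mu{}_{[\alpha}\ell_{\beta]}P^\rho{}_{[\gamma}\ell_{\delta]}.$$ 5. ${}^{L}\!\hat C=\lambda\, d^{(N)}+\lambda^2e^{(III)}+\lambda^3f^{(II/D)}+\lambda^4g^{(I)}+\lambda^5h^{(I)}+\mathcal O(\lambda^6)$, where $$d^{(N)}=-C^{(4,0)},\qquad e^{(III)}=C^{(3,0)}+\tfrac{\Omega_2}{2}C^{(4,0)}-C^{(4,1)},$$ $$f^{(II/D)}=-C^{(2,0)}-\Omega_2C^{(3,0)}+\tfrac{\Omega_3}{6}C^{(4,0)}+C^{(3,1)}-C^{(4,2)}+\tfrac{\Omega_2}{2}C^{(4,1)},$$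 $$g^{(I)}=C^{(1,0)}+\tfrac{3\Omega_2}{2}C^{(2,0)}+\Big(\tfrac{\Omega_2^2}{4}-\tfrac{\Omega_3}{3}\Big)C^{(3,0)}+\tfrac{\Omega_4}{4!}C^{(4,0)}-C^{(2,1)}+C^{(3,2)}-C^{(4,3)}+\tfrac{\Omega_2}{2}C^{(4,2)}-\Omega_2C^{(3,1)}+\tfrac{\Omega_3}{6}C^{(4,1)},$$ $$\begin{aligned}h^{(I)}={}&-C^{(0,0)}-2\Omega_2C^{(1,0)}+\Big(\tfrac{\Omega_3}{2}-\tfrac34\Omega_2^2\Big)C^{(2,0)}+\Big(\tfrac16\Omega_2\Omega_3-\tfrac{\Omega_4}{12}\Big)C^{(3,0)}+\tfrac{\Omega_5}{5!}C^{(4,0)}\\&+C^{(1,1)}-C^{(2,2)}+C^{(3,3)}-C^{(4,4)}+\tfrac32\Omega_2C^{(2,1)}-\Omega_2C^{(3,2)}+\tfrac{\Omega_2}{2}C^{(4,3)}+\tfrac{\Omega_2^2}{4}C^{(3,1)}\\&-\tfrac{\Omega_3}{3}C^{(3,1)}+\tfrac{\Omega_3}{6}C^{(4,2)}+\tfrac{\Omega_4}{4!}C^{(4,1)}.\end{aligned}$$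 6. These five tensors are Weyl-tensor candidates of the generic Petrov types indicated. That is, $d^{(N)},e^{(III)},f^{(II/D)},g^{(I)},h^{(I)}$ belong to the spaces of Weyl-tensor candidates for which $\ell$ is a PND of multiplicity at least $4,3,2,1,0$ respectively, and in these spaces the tensors of Petrov type N, III, II or D, I, I respectively form a relatively open and dense subset. -/

import Mathlib

open Set Filter Topology Asymptotics
open scoped Manifold ContDiff

noncomputable section

namespace Peeling

/-! ## Algebra in a four-dimensional Lorentzian vector space -/

section Algebra

variable {V : Type*} [AddCommGroup V] [Module ℝ V]

/-- Real-valued functions of four vectors; tensors of type `(0,4)` are the multilinear ones. -/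
abbrev Tens4 (V : Type*) := V → V → V → V → ℝ

/-- `g` is a symmetric bilinear form of signature `(-,+,+,+)`. -/
def IsLorentzian (g : LinearMap.BilinForm ℝ V) : Prop :=
  ∃ b : Module.Basis (Fin 4) ℝ V, ∀ i j : Fin 4,
    g (b i) (b j) = if i = j then (if i = 0 then -1 else 1) else 0

/-- The trace `g^{αγ} W_{αβγδ} u^β v^δ`, computed in a basis. -/
def trace13 (g : LinearMap.BilinForm ℝ V) (b : Module.Basis (Fin 4) ℝ V) (W : Tens4 V)
    (u v : V) : ℝ :=
  ∑ i, ∑ j, (Matrix.of fun i j : Fin 4 => g (b i) (b j))⁻¹ i j * W (b i) u (b j) v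

/-- A Weyl-tensor candidate: a tensor of type `(0,4)` with all the algebraic properties of a
Weyl tensor. Linearity in the other three slots follows from the symmetries. -/
structure IsWeylCandidate (g : LinearMap.BilinForm ℝ V) (W : Tens4 V) : Prop where
  linear : ∀ b c d, IsLinearMap ℝ fun a => W a b c d
  antisymm₁₂ : ∀ a b c d, W b a c d = -W a b c d
  antisymm₃₄ : ∀ a b c d, W a b d c = -W a b c d
  pair_symm : ∀ a b c d, W c d a b = W a b c d
  cyclic : ∀ a b c d, W a b c d + W b c a d + W c a b d = 0
  traceless : ∀ (b : Module.Basis (Fin 4) ℝ V) (u v : V), trace13 g b W u v = 0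

/-- The Bel-Debever conditions for the null vector `n` to span a principal null direction (PND)
of `W` of multiplicity at least `m`, for `m ≤ 4`:
* `m = 1`: `n_[ε W_α]βγ[δ n_ζ] n^β n^γ = 0`;
* `m = 2`: `W_αβγ[δ n_ζ] n^β n^γ = 0`;
* `m = 3`: `W_αβγ[δ n_ζ] n^γ = 0`;
* `m = 4`: `W_αβγδ n^γ = 0`.
A form `X_δ` satisfies `X_[δ n_ζ] = 0` exactly when it vanishes on the vectors orthogonal
to `n`. -/
def BelDebever (g : LinearMap.BilinForm ℝ V) (W : Tens4 V) (n : V) : ℕ → Prop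
  | 0 => True
  | 1 => ∀ a d, g n a = 0 → g n d = 0 → W a n n d = 0
  | 2 => ∀ a d, g n d = 0 → W a n n d = 0
  | 3 => ∀ a b d, g n d = 0 → W a b n d = 0
  | _ => ∀ a b d, W a b n d = 0

/-- `n` is a nonzero null vector spanning a PND of `W` of multiplicity at least `m`. -/
def IsPND (g : LinearMap.BilinForm ℝ V) (W : Tens4 V) (n : V) (m : ℕ) : Prop :=
  n ≠ 0 ∧ g n n = 0 ∧ BelDebever g W n m

/-- Petrov type N: nonzero, with a quadruple PND. -/
def IsTypeN (g : LinearMap.BilinForm ℝ V) (W : Tens4 V) : Prop :=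
  W ≠ 0 ∧ ∃ n, IsPND g W n 4

/-- Petrov type III: some PND has multiplicity exactly 3. -/
def IsTypeIII (g : LinearMap.BilinForm ℝ V) (W : Tens4 V) : Prop :=
  (∃ n, IsPND g W n 3) ∧ ¬∃ n, IsPND g W n 4

/-- Petrov type II or D: the largest multiplicity of a PND is 2. -/
def IsTypeIIorD (g : LinearMap.BilinForm ℝ V) (W : Tens4 V) : Prop :=
  (∃ n, IsPND g W n 2) ∧ ¬∃ n, IsPND g W n 3

/-- Petrov type I: there is no repeated PND. -/
def IsTypeI (g : LinearMap.BilinForm ℝ V) (W : Tens4 V) : Prop :=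
  ¬∃ n, IsPND g W n 2

/-- The space of Weyl-tensor candidates for which `n` spans a PND of multiplicity at
least `m` (no condition on `n` if `m = 0`). -/
def alignedCandidates (g : LinearMap.BilinForm ℝ V) (n : V) (m : ℕ) : Set (Tens4 V) :=
  {W | IsWeylCandidate g W ∧ BelDebever g W n m}

/-- `P` is generic in `A`: it holds on a relatively open and dense subset of `A`. -/
def IsGenericIn (A : Set (Tens4 V)) (P : Tens4 V → Prop) : Prop :=
  (∃ U : Set (Tens4 V), IsOpen U ∧ {W | W ∈ A ∧ P W} = A ∩ U) ∧
    A ⊆ closure {W | W ∈ A ∧ P W}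

/-- `W` belongs to the space of Weyl-tensor candidates for which `n` spans a PND of multiplicity
at least `m`, and `P` is the Petrov type of a generic element of this space. -/
def HasGenericType (g : LinearMap.BilinForm ℝ V) (n : V) (m : ℕ) (P : Tens4 V → Prop)
    (W : Tens4 V) : Prop :=
  W ∈ alignedCandidates g n m ∧ IsGenericIn (alignedCandidates g n m) P

/-- `l`, `k` are null with `l · k = -1`, and `e₁`, `e₂` are orthonormal and orthogonal to both.
The complex null vector of the tetrad is `m = (e₁ + i e₂)/√2`. -/
structure IsNullTetrad (g : LinearMap.BilinForm ℝ V) (l k e₁ e₂ : V) : Prop where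
  ll : g l l = 0
  kk : g k k = 0
  lk : g l k = -1
  e₁e₁ : g e₁ e₁ = 1
  e₂e₂ : g e₂ e₂ = 1
  e₁e₂ : g e₁ e₂ = 0
  le₁ : g l e₁ = 0
  le₂ : g l e₂ = 0
  ke₁ : g k e₁ = 0
  ke₂ : g k e₂ = 0

/-- Complex-linear extension of a linear form, evaluated at `z.1 + i z.2`. -/
def cext₁ (f : V → ℝ) (z : V × V) : ℂ := ⟨f z.1, f z.2⟩

/-- Complex-bilinear extension of a bilinear form, evaluated at `z.1 + i z.2`, `w.1 + i w.2`. -/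
def cext₂ (f : V → V → ℝ) (z w : V × V) : ℂ :=
  ⟨f z.1 w.1 - f z.2 w.2, f z.1 w.2 + f z.2 w.1⟩

/-- The five complex Weyl scalars of `W` in the null tetrad `(l, k, m, m̄)`:
`ψ₀ = W(l,m,l,m)`, `ψ₁ = W(l,k,l,m)`, `ψ₂ = W(l,m,m̄,k)`, `ψ₃ = W(l,k,m̄,k)`,
`ψ₄ = W(k,m̄,k,m̄)`. -/
def weylScalar (W : Tens4 V) (l k e₁ e₂ : V) : Fin 5 → ℂ :=
  let m : V × V := ((√2)⁻¹ • e₁, (√2)⁻¹ • e₂)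
  let mbar : V × V := ((√2)⁻¹ • e₁, -((√2)⁻¹ • e₂))
  ![cext₂ (fun x y => W l x l y) m m,
    cext₁ (fun x => W l k l x) m,
    cext₂ (fun x y => W l x y k) m mbar,
    cext₁ (fun x => W l k x k) mbar,
    cext₂ (fun x y => W k x k y) mbar mbar]

/-- The projector `P^α_β = δ^α_β + k^α l_β + l^α k_β` orthogonal to the plane of `l` and `k`. -/
def planeProj (g : LinearMap.BilinForm ℝ V) (l k u : V) : V :=
  u + g l u • k + g k u • l

/-- `4 D_{μνρσ} k^ν k^σ P^μ_[α l_β] P^ρ_[γ l_δ]`, where brackets are antisymmetrisation with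
weight one half. -/
def typeNProj (g : LinearMap.BilinForm ℝ V) (l k : V) (D : Tens4 V) : Tens4 V :=
  fun a b c d =>
    let Q : V → V → V := fun x y =>
      (1 / 2 : ℝ) • (g l y • planeProj g l k x - g l x • planeProj g l k y)
    4 * D (Q a b) k (Q c d) k

end Algebra

/-! ## The coefficients of the expansion -/

section Coefficients

variable {X : Type*} [AddCommGroup X] [Module ℝ X]

/-- Coefficient of the first power. Here and below `c a b` stands for `C^(a,b)` and `w i`
for the `i`-th derivative `Ω_i`. -/
def coeffN (c : Fin 5 → ℕ → X) : X := -c 4 0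

/-- Coefficient of the second power. -/
def coeffIII (w : ℕ → ℝ) (c : Fin 5 → ℕ → X) : X :=
  c 3 0 + (w 2 / 2) • c 4 0 - c 4 1

/-- Coefficient of the third power. -/
def coeffIID (w : ℕ → ℝ) (c : Fin 5 → ℕ → X) : X :=
  -c 2 0 - w 2 • c 3 0 + (w 3 / 6) • c 4 0 + c 3 1 - c 4 2 + (w 2 / 2) • c 4 1

/-- Coefficient of the fourth power. -/
def coeffI₄ (w : ℕ → ℝ) (c : Fin 5 → ℕ → X) : X :=
  c 1 0 + (3 * w 2 / 2) • c 2 0 + (w 2 ^ 2 / 4 - w 3 / 3) • c 3 0 + (w 4 / 24) • c 4 0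
    - c 2 1 + c 3 2 - c 4 3 + (w 2 / 2) • c 4 2 - w 2 • c 3 1 + (w 3 / 6) • c 4 1

/-- Coefficient of the fifth power. -/
def coeffI₅ (w : ℕ → ℝ) (c : Fin 5 → ℕ → X) : X :=
  -c 0 0 - (2 * w 2) • c 1 0 + (w 3 / 2 - 3 / 4 * w 2 ^ 2) • c 2 0
    + (w 2 * w 3 / 6 - w 4 / 12) • c 3 0 + (w 5 / 120) • c 4 0
    + c 1 1 - c 2 2 + c 3 3 - c 4 4
    + (3 / 2 * w 2) • c 2 1 - w 2 • c 3 2 + (w 2 / 2) • c 4 3 + (w 2 ^ 2 / 4) • c 3 1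
    - (w 3 / 3) • c 3 1 + (w 3 / 6) • c 4 2 + (w 4 / 24) • c 4 1

end Coefficients

/-! ## Curvature in coordinates -/

section Coordinates

/-- The model vector space of a four-manifold. -/
abbrev E4 := EuclideanSpace ℝ (Fin 4)

/-- The model of four-manifolds with boundary. -/
abbrev I4 : ModelWithCorners ℝ E4 (EuclideanHalfSpace 4) := 𝓡∂ 4

/-- The coordinate vector `∂_i`. -/
def coordVec (i : Fin 4) : E4 := EuclideanSpace.single i 1

/-- Partial derivative `∂_i f` (one-sided at the boundary of the coordinate half-space). -/
def pd (f : E4 → ℝ) (i : Fin 4) (y : E4) : ℝ := fderivWithin ℝ f (range I4) y (coordVec i)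

/-- Christoffel symbol `Γ^k_{ij}` of the metric with component matrix `G`. -/
def christoffel (G : E4 → Matrix (Fin 4) (Fin 4) ℝ) (y : E4) (k i j : Fin 4) : ℝ :=
  1 / 2 * ∑ l, (G y)⁻¹ k l *
    (pd (fun z => G z l j) i y + pd (fun z => G z l i) j y - pd (fun z => G z i j) l y)

/-- `R_{abc}^d`, with the convention `(∇_a ∇_b - ∇_b ∇_a) v_c = R_{abc}^d v_d`. -/
def riemannUp (G : E4 → Matrix (Fin 4) (Fin 4) ℝ) (y : E4) (a b c d : Fin 4) : ℝ :=
  pd (fun z => christoffel G z d a c) b y - pd (fun z => christoffel G z d b c) a y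
    + ∑ s, (christoffel G y s a c * christoffel G y d s b
      - christoffel G y s b c * christoffel G y d s a)

/-- `R_{abcd}`. -/
def riemann (G : E4 → Matrix (Fin 4) (Fin 4) ℝ) (y : E4) (a b c d : Fin 4) : ℝ :=
  ∑ s, riemannUp G y a b c s * G y s d

/-- Ricci tensor `R_{ac} = R_{abc}^b`. -/
def ricci (G : E4 → Matrix (Fin 4) (Fin 4) ℝ) (y : E4) (a c : Fin 4) : ℝ :=
  ∑ b, riemannUp G y a b c b

/-- Scalar curvature. -/
def scalarCurv (G : E4 → Matrix (Fin 4) (Fin 4) ℝ) (y : E4) : ℝ :=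
  ∑ a, ∑ c, (G y)⁻¹ a c * ricci G y a c

/-- Components `C_{abcd}` of the Weyl tensor in dimension four. -/
def weylCoord (G : E4 → Matrix (Fin 4) (Fin 4) ℝ) (y : E4) (a b c d : Fin 4) : ℝ :=
  riemann G y a b c d
    - 1 / 2 * (G y a c * ricci G y b d - G y a d * ricci G y b c
      - G y b c * ricci G y a d + G y b d * ricci G y a c)
    + scalarCurv G y / 6 * (G y a c * G y b d - G y a d * G y b c)

end Coordinates

/-! ## Tensor fields, parallel transport and curvature on a four-manifold with boundary -/

section Manifold

variable {M : Type*} [TopologicalSpace M] [ChartedSpace (EuclideanHalfSpace 4) M]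
  [IsManifold I4 ∞ M]

/-- The coordinate vector `∂_i` of the chart at `x`, as a tangent vector at the point `p` of the
domain of that chart. -/
def chartVec (x p : M) (i : Fin 4) : TangentSpace I4 p :=
  tangentCoordChange I4 x p p (coordVec i)

/-- Component matrix, in the chart at `x`, of a field of bilinear forms. -/
def comps (B : ∀ p : M, LinearMap.BilinForm ℝ (TangentSpace I4 p)) (x : M) (y : E4) :
    Matrix (Fin 4) (Fin 4) ℝ :=
  Matrix.of fun i j =>
    B ((extChartAt I4 x).symm y) (chartVec x _ i) (chartVec x _ j)

/-- Component `a` of a tangent vector at `p` in the chart at `p`. -/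
def vecComp {p : M} (u : TangentSpace I4 p) (a : Fin 4) : ℝ := (show E4 from u) a

/-- The fully covariant Weyl tensor of the metric `g` at `p`. -/
def weyl (g : ∀ p : M, LinearMap.BilinForm ℝ (TangentSpace I4 p)) (p : M) :
    Tens4 (TangentSpace I4 p) :=
  fun u v w x => ∑ a, ∑ b, ∑ c, ∑ d,
    weylCoord (comps g p) (extChartAt I4 p p) a b c d *
      vecComp u a * vecComp v b * vecComp w c * vecComp x d

/-- The trace `g^{αβ} B_{αβ}` at `p`. -/
def metricTrace (g B : ∀ p : M, LinearMap.BilinForm ℝ (TangentSpace I4 p)) (p : M) : ℝ :=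
  ∑ i, ∑ j, (comps g p (extChartAt I4 p p))⁻¹ i j * comps B p (extChartAt I4 p p) i j

/-- The differential `N_α = ∇_α f` of a function. -/
def differential (f : M → ℝ) (p : M) (u : TangentSpace I4 p) : ℝ :=
  (mfderiv I4 𝓘(ℝ, ℝ) f p u : ℝ)

/-- The gradient `N^α = g^{αβ} ∇_β f`. -/
def gradient (g : ∀ p : M, LinearMap.BilinForm ℝ (TangentSpace I4 p)) (f : M → ℝ) (p : M) :
    TangentSpace I4 p :=
  ∑ i, (∑ j, (comps g p (extChartAt I4 p p))⁻¹ i j * differential f p (chartVec p p j)) •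
    chartVec p p i

/-- Components `∇_i ∇_j f` of the Hessian at `p`, in the chart at `p`. -/
def hessian (g : ∀ p : M, LinearMap.BilinForm ℝ (TangentSpace I4 p)) (f : M → ℝ) (p : M)
    (i j : Fin 4) : ℝ :=
  let F : E4 → ℝ := fun y => f ((extChartAt I4 p).symm y)
  pd (pd F j) i (extChartAt I4 p p)
    - ∑ k, christoffel (comps g p) (extChartAt I4 p p) k i j * pd F k (extChartAt I4 p p)

/-- The tangent vector of a curve with parameter set `s`. -/
def velocity (γ : ℝ → M) (s : Set ℝ) (t : ℝ) : TangentSpace I4 (γ t) :=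
  mfderivWithin 𝓘(ℝ, ℝ) I4 γ s t (show TangentSpace 𝓘(ℝ, ℝ) t from (1 : ℝ))

/-- The vector field `V` along the curve `γ` is parallel with respect to the Levi-Civita
connection of `g` on the parameter set `s`: at each `t ∈ s`, in the chart at `γ t`,
`dV^k/dt = - Γ^k_{ij} γ'^i V^j`. -/
def IsParallelAlong (g : ∀ p : M, LinearMap.BilinForm ℝ (TangentSpace I4 p)) (γ : ℝ → M)
    (s : Set ℝ) (V : ∀ t : ℝ, TangentSpace I4 (γ t)) : Prop :=
  ∀ t ∈ s, HasDerivWithinAt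
    (fun r : ℝ => (tangentCoordChange I4 (γ r) (γ t) (γ r) (V r) : E4))
    (-∑ k, (∑ i, ∑ j, christoffel (comps g (γ t)) (extChartAt I4 (γ t) (γ t)) k i j *
      vecComp (velocity γ s t) i * vecComp (V t) j) • coordVec k)
    s t

open Classical in
/-- Parallel transport of vectors along `γ` from `γ a` to `γ b`, for `a`, `b` in the
interval `s`. As a bitensor this is the parallel propagator `t_α^β(a, b)`, which maps covectors
at `γ b` to covectors at `γ a` by composition. -/
def propagator (g : ∀ p : M, LinearMap.BilinForm ℝ (TangentSpace I4 p)) (γ : ℝ → M)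
    (s : Set ℝ) (a b : ℝ) (v : TangentSpace I4 (γ a)) : TangentSpace I4 (γ b) :=
  if h : ∃ V : ∀ t : ℝ, TangentSpace I4 (γ t), IsParallelAlong g γ s V ∧ V a = v
  then Classical.choose h b else 0

/-- The physical metric `Ω⁻² g`; it is used only where `Ω > 0`. -/
def physMetric (g : ∀ p : M, LinearMap.BilinForm ℝ (TangentSpace I4 p)) (Ω : M → ℝ) (p : M) :
    LinearMap.BilinForm ℝ (TangentSpace I4 p) :=
  (Ω p ^ 2)⁻¹ • g p

variable (M) in
/-- A conformal completion à la Penrose of a physical space-time with cosmological constant `Λ`.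
The manifold `M` has boundary `𝒥`, the physical space-time is the interior of `M` with the metric
`Ω⁻² g`, and the partial gauge `∇_α N_β = 0` on `𝒥` is chosen, where `N_α = ∇_α Ω`. -/
structure PenroseCompletion (Λ : ℝ) where
  /-- the conformal metric -/
  g : ∀ p : M, LinearMap.BilinForm ℝ (TangentSpace I4 p)
  /-- the conformal factor -/
  Ω : M → ℝ
  /-- the coupling constant `8πG/c⁴` -/
  κ : ℝ
  /-- the energy-momentum tensor of the physical space-time -/
  T : ∀ p : M, LinearMap.BilinForm ℝ (TangentSpace I4 p)
  /-- the rescaled Weyl tensor, fully covariant -/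
  d : ∀ p : M, TangentSpace I4 p →ₗ[ℝ] TangentSpace I4 p →ₗ[ℝ] TangentSpace I4 p →ₗ[ℝ]
    TangentSpace I4 p →ₗ[ℝ] ℝ
  lorentzian : ∀ p, IsLorentzian (g p)
  smooth_g : ∀ (x : M) (i j : Fin 4),
    ContDiffOn ℝ ∞ (fun y => comps g x y i j) (extChartAt I4 x).target
  smooth_Ω : ContMDiff I4 𝓘(ℝ, ℝ) ∞ Ω
  Ω_pos : ∀ p ∈ I4.interior M, 0 < Ω p
  Ω_zero : ∀ p ∈ I4.boundary M, Ω p = 0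
  dΩ_ne_zero : ∀ p ∈ I4.boundary M, ∃ u, differential Ω p u ≠ 0
  κ_pos : 0 < κ
  /-- the Einstein field equations of the physical metric -/
  einstein : ∀ p ∈ I4.interior M, ∀ i j : Fin 4,
    ricci (comps (physMetric g Ω) p) (extChartAt I4 p p) i j
      - 1 / 2 * comps (physMetric g Ω) p (extChartAt I4 p p) i j *
          scalarCurv (comps (physMetric g Ω) p) (extChartAt I4 p p)
      + Λ * comps (physMetric g Ω) p (extChartAt I4 p p) i j
      = κ * comps T p (extChartAt I4 p p) i j
  /-- the trace of the energy-momentum tensor tends to zero at `𝒥` -/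
  matter_decay : ∀ p ∈ I4.boundary M,
    Tendsto (fun q => metricTrace (physMetric g Ω) T q) (𝓝[I4.interior M] p) (𝓝 0)
  /-- the partial gauge choice `∇_α N_β = 0` on `𝒥` -/
  gauge : ∀ p ∈ I4.boundary M, ∀ i j : Fin 4, hessian g Ω p i j = 0
  /-- `C_{αβγδ} = Ω d_{αβγδ}` -/
  weyl_eq : ∀ (p : M) (u v w x : TangentSpace I4 p), weyl g p u v w x = Ω p * d p u v w x
  smooth_d : ∀ (x : M) (i j k l : Fin 4),
    ContDiffOn ℝ ∞ (fun y => d ((extChartAt I4 x).symm y) (chartVec x _ i) (chartVec x _ j)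
      (chartVec x _ k) (chartVec x _ l)) (extChartAt I4 x).target

namespace PenroseCompletion

variable {Λ : ℝ} (S : PenroseCompletion M Λ)

/-- The physical metric. -/
def ghat (p : M) : LinearMap.BilinForm ℝ (TangentSpace I4 p) := physMetric S.g S.Ω p

/-- The vector field `N^α`. -/
def N (p : M) : TangentSpace I4 p := gradient S.g S.Ω p

/-- The rescaled Weyl tensor as a function of four vectors. -/
def dTens (p : M) : Tens4 (TangentSpace I4 p) := fun u v w x => S.d p u v w x

/-- `γ` is a null geodesic of the conformal metric with affine parameter in `[t₁, 0]`, contained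
in the physical space-time except for its endpoint `γ 0 ∈ 𝒥`, and with tangent vector `ℓ`
normalised by `ℓ^μ N_μ = -1` at that endpoint. -/
structure IsNullGeodesicToScri (γ : ℝ → M) (t₁ : ℝ) : Prop where
  neg : t₁ < 0
  smooth : ContMDiffOn 𝓘(ℝ, ℝ) I4 ∞ γ (Icc t₁ 0)
  geodesic : IsParallelAlong S.g γ (Icc t₁ 0) (velocity γ (Icc t₁ 0))
  null : ∀ t ∈ Icc t₁ 0, S.g (γ t) (velocity γ (Icc t₁ 0) t) (velocity γ (Icc t₁ 0) t) = 0
  physical : ∀ t ∈ Ico t₁ 0, γ t ∈ I4.interior M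
  endpoint : γ 0 ∈ I4.boundary M
  normalised : differential S.Ω (γ 0) (velocity γ (Icc t₁ 0) 0) = -1

/-- The transpose of the automorphism
`L_α^β = t_α^μ(0, t₁) t̂_μ^ρ(t₁, t) t_ρ^β(t, 0)` of the cotangent space at `γ 0`, that is
`u^α ↦ u^α L_α^β`: conformal transport from `γ 0` to `γ t₁`, physical transport from `γ t₁` to
`γ t`, conformal transport from `γ t` to `γ 0`. -/
def L (γ : ℝ → M) (t₁ t : ℝ) (u : TangentSpace I4 (γ 0)) : TangentSpace I4 (γ 0) :=
  propagator S.g γ (Icc t₁ 0) t 0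
    (propagator S.ghat γ (Ico t₁ 0) t₁ t
      (propagator S.g γ (Icc t₁ 0) 0 t₁ u))

/-- Conformal parallel transport to `γ 0` of a covariant tensor at `γ t`. -/
def toEndpoint (γ : ℝ → M) (t₁ t : ℝ) (W : Tens4 (TangentSpace I4 (γ t))) :
    Tens4 (TangentSpace I4 (γ 0)) :=
  let P : TangentSpace I4 (γ 0) → TangentSpace I4 (γ t) := propagator S.g γ (Icc t₁ 0) 0 t
  fun u v w x => W (P u) (P v) (P w) (P x)

/-- The fully covariant physical Weyl tensor at `γ t`, transported to `γ 0` with the conformal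
propagator and then acted upon by `L` on every index. -/
def transportedWeyl (γ : ℝ → M) (t₁ t : ℝ) : Tens4 (TangentSpace I4 (γ 0)) :=
  fun u v w x => S.toEndpoint γ t₁ t (weyl S.ghat (γ t))
    (S.L γ t₁ t u) (S.L γ t₁ t v) (S.L γ t₁ t w) (S.L γ t₁ t x)

/-- The derivative `Ω_i` of order `i` of `Ω` along `γ` at the endpoint. -/
def derivΩ (γ : ℝ → M) (t₁ : ℝ) (i : ℕ) : ℝ :=
  iteratedDerivWithin i (fun t => S.Ω (γ t)) (Icc t₁ 0) 0

/-- The vector `k^α = N^α - (Λ/6) ℓ^α` at the endpoint. -/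
def kVec (γ : ℝ → M) (t₁ : ℝ) : TangentSpace I4 (γ 0) :=
  S.N (γ 0) - (Λ / 6) • velocity γ (Icc t₁ 0) 0

end PenroseCompletion

end Manifold

end Peeling

end

/-! Take a null frame `(l, k, e₁, e₂)` that is parallel for `g` along `γ`, with `l` the tangent of
`γ` and `k` the given vector at the endpoint. Conformal propagators act trivially on components in
this frame, so `L` is just physical transport from `γ t₁` to `γ t`, read in components. The physical
connection differs from that of `g` by terms in `dΩ/Ω`. Along a null geodesic the resulting linear
system is triangular and has explicit solutions (`isParallelOn_ghat`): a boost of the plane of `l`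
and `k`, a null rotation about `l` and an overall scale. The boost factor is `s = Ω(t)/Ω(t₁)`; the
parameters of the null rotation are `Ω Qᵢ` with `Qᵢ` the primitive of `N(eᵢ)/Ω²` that vanishes at
`t₁`.

A Weyl-tensor candidate amounts to five complex numbers `c a`, the coefficients of a trace-free
quadratic form on the three-dimensional complex space of self-dual bivectors
(`IsWeylCandidate.eq_frameWeyl`). The transport multiplies the three bivector components by `s³`,
`s²`, `s` up to the null rotation, hence `c a` by `s^(6-a)` (`weylForm_boostRot`). The covariant
Weyl tensor scales by `Ω⁻²` under the conformal change, so the physical one is `Ω⁻¹ d`. Together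
these give the powers `Ω^(5-a)` of the peeling decomposition (`transportedWeyl_eq`).

The components of `d` and `Ω` are smooth up to the endpoint; only the null rotation needs care.
There `N = k + (Λ/6) l` is orthogonal to `e₁` and `e₂`, and the derivative of `N(eᵢ)` vanishes
because the Hessian of `Ω` does. So `N(eᵢ)` has a double zero, `N(eᵢ)/Ω²` has neither pole nor
logarithmic primitive, and `Ω Qᵢ` tends to zero with a full expansion (`hasExpansion_primitive`,
`hasExpansion_shift`). In the limit component `a` is therefore that of `d`, up to a power of
`Ω(t₁)`. Substituting the Taylor series of `Ω` yields the five coefficients (`peeling_expansion`).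

That `k` is null rests on `N·N = -Λ/3` at the boundary (`g_N_N`): the trace of the field equations
gives the physical scalar curvature, and in the conformal formula for it only `-12 N·N` survives as
`Ω → 0`.

For genericity, `l` has multiplicity at least `m` exactly when `c 0, …, c (m-1)` vanish. Among these
tensors, types N, III and II/D mean `c m ≠ 0` for `m = 4, 3, 2`. For type I, having a repeated
principal null direction is a closed condition by compactness of the sphere of directions, and it
forces a discriminant to vanish that is not identically zero on the aligned tensors. -/

noncomputable section

namespace Peeling

/-! ### Weyl tensors as quadratic forms on self-dual bivectors. -/

section FrameAlgebra

/-- Component `Z₁ = p₀₂ - i p₀₃` of a bivector along the first self-dual null bivector. -/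
def selfDual₁ (u v : Fin 4 → ℝ) : ℂ := ⟨u 0 * v 2 - u 2 * v 0, -(u 0 * v 3 - u 3 * v 0)⟩

/-- Component `Z₂ = p₁₂ + i p₁₃` of a bivector along the second self-dual null bivector. -/
def selfDual₂ (u v : Fin 4 → ℝ) : ℂ := ⟨u 1 * v 2 - u 2 * v 1, u 1 * v 3 - u 3 * v 1⟩

/-- Component `Z₃ = p₀₁ - i p₂₃` of a bivector along the third self-dual bivector. -/
def selfDual₃ (u v : Fin 4 → ℝ) : ℂ := ⟨u 0 * v 1 - u 1 * v 0, -(u 2 * v 3 - u 3 * v 2)⟩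

/-- The Weyl tensor with given complex components, in coordinates with respect to a null tetrad
`(l, k, e₁, e₂)`. -/
def weylForm (c : Fin 5 → ℂ) (u v w x : Fin 4 → ℝ) : ℝ :=
  (c 0 * (selfDual₁ u v * selfDual₁ w x)
    + c 1 * (selfDual₁ u v * selfDual₃ w x + selfDual₃ u v * selfDual₁ w x)
    + c 2 * (selfDual₃ u v * selfDual₃ w x
      - (selfDual₁ u v * selfDual₂ w x + selfDual₂ u v * selfDual₁ w x) / 2)
    + c 3 * (selfDual₂ u v * selfDual₃ w x + selfDual₃ u v * selfDual₂ w x)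
    + c 4 * (selfDual₂ u v * selfDual₂ w x)).re

/-- Expanded into real polynomials so that every algebraic symmetry of `weylForm` becomes an
identity for `ring`. -/
lemma weylForm_eq (c : Fin 5 → ℂ) (u v w x : Fin 4 → ℝ) :
    weylForm c u v w x =
      ((c 0).re * ((u 0 * v 2 - u 2 * v 0) * (w 0 * x 2 - w 2 * x 0)
          - (u 0 * v 3 - u 3 * v 0) * (w 0 * x 3 - w 3 * x 0))
        + (c 0).im * ((u 0 * v 2 - u 2 * v 0) * (w 0 * x 3 - w 3 * x 0)
          + (u 0 * v 3 - u 3 * v 0) * (w 0 * x 2 - w 2 * x 0)))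
      + ((c 1).re * ((u 0 * v 2 - u 2 * v 0) * (w 0 * x 1 - w 1 * x 0)
            + (u 0 * v 1 - u 1 * v 0) * (w 0 * x 2 - w 2 * x 0)
            - (u 0 * v 3 - u 3 * v 0) * (w 2 * x 3 - w 3 * x 2)
            - (u 2 * v 3 - u 3 * v 2) * (w 0 * x 3 - w 3 * x 0))
        + (c 1).im * ((u 0 * v 2 - u 2 * v 0) * (w 2 * x 3 - w 3 * x 2)
            + (u 2 * v 3 - u 3 * v 2) * (w 0 * x 2 - w 2 * x 0)
            + (u 0 * v 3 - u 3 * v 0) * (w 0 * x 1 - w 1 * x 0)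
            + (u 0 * v 1 - u 1 * v 0) * (w 0 * x 3 - w 3 * x 0)))
      + ((c 2).re * ((u 0 * v 1 - u 1 * v 0) * (w 0 * x 1 - w 1 * x 0)
            - (u 2 * v 3 - u 3 * v 2) * (w 2 * x 3 - w 3 * x 2)
            - ((u 0 * v 2 - u 2 * v 0) * (w 1 * x 2 - w 2 * x 1)
              + (u 1 * v 2 - u 2 * v 1) * (w 0 * x 2 - w 2 * x 0)
              + (u 0 * v 3 - u 3 * v 0) * (w 1 * x 3 - w 3 * x 1)
              + (u 1 * v 3 - u 3 * v 1) * (w 0 * x 3 - w 3 * x 0)) / 2)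
        + (c 2).im * ((u 0 * v 1 - u 1 * v 0) * (w 2 * x 3 - w 3 * x 2)
            + (u 2 * v 3 - u 3 * v 2) * (w 0 * x 1 - w 1 * x 0)
            + ((u 0 * v 2 - u 2 * v 0) * (w 1 * x 3 - w 3 * x 1)
              + (u 1 * v 3 - u 3 * v 1) * (w 0 * x 2 - w 2 * x 0)
              - (u 0 * v 3 - u 3 * v 0) * (w 1 * x 2 - w 2 * x 1)
              - (u 1 * v 2 - u 2 * v 1) * (w 0 * x 3 - w 3 * x 0)) / 2))
      + ((c 3).re * ((u 1 * v 2 - u 2 * v 1) * (w 0 * x 1 - w 1 * x 0)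
            + (u 0 * v 1 - u 1 * v 0) * (w 1 * x 2 - w 2 * x 1)
            + (u 1 * v 3 - u 3 * v 1) * (w 2 * x 3 - w 3 * x 2)
            + (u 2 * v 3 - u 3 * v 2) * (w 1 * x 3 - w 3 * x 1))
        - (c 3).im * ((u 1 * v 3 - u 3 * v 1) * (w 0 * x 1 - w 1 * x 0)
            + (u 0 * v 1 - u 1 * v 0) * (w 1 * x 3 - w 3 * x 1)
            - (u 1 * v 2 - u 2 * v 1) * (w 2 * x 3 - w 3 * x 2)
            - (u 2 * v 3 - u 3 * v 2) * (w 1 * x 2 - w 2 * x 1)))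
      + ((c 4).re * ((u 1 * v 2 - u 2 * v 1) * (w 1 * x 2 - w 2 * x 1)
          - (u 1 * v 3 - u 3 * v 1) * (w 1 * x 3 - w 3 * x 1))
        - (c 4).im * ((u 1 * v 2 - u 2 * v 1) * (w 1 * x 3 - w 3 * x 1)
          + (u 1 * v 3 - u 3 * v 1) * (w 1 * x 2 - w 2 * x 1))) := by
  have h2 : (2 : ℂ)⁻¹ = ((1 / 2 : ℝ) : ℂ) := by norm_num
  simp only [weylForm, selfDual₁, selfDual₂, selfDual₃, div_eq_mul_inv, h2, Complex.add_re,
    Complex.sub_re, Complex.mul_re, Complex.add_im, Complex.mul_im, Complex.sub_im,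
    Complex.ofReal_re, Complex.ofReal_im]
  ring

lemma weylForm_add_left (c : Fin 5 → ℂ) (u u' v w x : Fin 4 → ℝ) :
    weylForm c (u + u') v w x = weylForm c u v w x + weylForm c u' v w x := by
  simp only [weylForm_eq, Pi.add_apply]; ring

lemma weylForm_smul_left (c : Fin 5 → ℂ) (r : ℝ) (u v w x : Fin 4 → ℝ) :
    weylForm c (r • u) v w x = r * weylForm c u v w x := by
  simp only [weylForm_eq, Pi.smul_apply, smul_eq_mul]; ring

lemma weylForm_swap₁₂ (c : Fin 5 → ℂ) (u v w x : Fin 4 → ℝ) :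
    weylForm c v u w x = -weylForm c u v w x := by
  simp only [weylForm_eq]; ring

lemma weylForm_swap₃₄ (c : Fin 5 → ℂ) (u v w x : Fin 4 → ℝ) :
    weylForm c u v x w = -weylForm c u v w x := by
  simp only [weylForm_eq]; ring

lemma weylForm_pair_symm (c : Fin 5 → ℂ) (u v w x : Fin 4 → ℝ) :
    weylForm c w x u v = weylForm c u v w x := by
  simp only [weylForm_eq]; ring

lemma weylForm_cyclic (c : Fin 5 → ℂ) (u v w x : Fin 4 → ℝ) :
    weylForm c u v w x + weylForm c v w u x + weylForm c w u v x = 0 := by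
  simp only [weylForm_eq]; ring

lemma weylForm_add (c c' : Fin 5 → ℂ) (u v w x : Fin 4 → ℝ) :
    weylForm (c + c') u v w x = weylForm c u v w x + weylForm c' u v w x := by
  simp only [weylForm_eq, Pi.add_apply, Complex.add_re, Complex.add_im]; ring

lemma weylForm_smul (r : ℝ) (c : Fin 5 → ℂ) (u v w x : Fin 4 → ℝ) :
    weylForm (r • c) u v w x = r * weylForm c u v w x := by
  simp only [weylForm_eq, Pi.smul_apply, Complex.real_smul, Complex.mul_re, Complex.mul_im,
    Complex.ofReal_re, Complex.ofReal_im]; ring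

variable {V : Type*} [AddCommGroup V] [Module ℝ V]

/-- A null tetrad that is a basis, for a symmetric form. -/
structure IsNullFrame (g : LinearMap.BilinForm ℝ V) (l k e₁ e₂ : V) : Prop
    extends IsNullTetrad g l k e₁ e₂ where
  symm : ∀ u v, g u v = g v u
  expand : ∀ u, u = (-g k u) • l + (-g l u) • k + g e₁ u • e₁ + g e₂ u • e₂

/-- Coordinates with respect to a null tetrad. -/
def frameCoord (g : LinearMap.BilinForm ℝ V) (l k e₁ e₂ u : V) : Fin 4 → ℝ :=
  ![-g k u, -g l u, g e₁ u, g e₂ u]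

/-- The vector with given coordinates with respect to a null tetrad. -/
def frameVec (l k e₁ e₂ : V) (u : Fin 4 → ℝ) : V := u 0 • l + u 1 • k + u 2 • e₁ + u 3 • e₂

lemma frameCoord_add (g : LinearMap.BilinForm ℝ V) (l k e₁ e₂ u v : V) :
    frameCoord g l k e₁ e₂ (u + v) = frameCoord g l k e₁ e₂ u + frameCoord g l k e₁ e₂ v := by
  ext i; fin_cases i <;> simp [frameCoord] <;> ring

lemma frameCoord_smul (g : LinearMap.BilinForm ℝ V) (l k e₁ e₂ : V) (r : ℝ) (u : V) :
    frameCoord g l k e₁ e₂ (r • u) = r • frameCoord g l k e₁ e₂ u := by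
  ext i; fin_cases i <;> simp [frameCoord]

namespace IsNullFrame

variable {g : LinearMap.BilinForm ℝ V} {l k e₁ e₂ : V} (hF : IsNullFrame g l k e₁ e₂)
include hF

lemma kl : g k l = -1 := by rw [hF.symm, hF.lk]
lemma e₁l : g e₁ l = 0 := by rw [hF.symm, hF.le₁]
lemma e₂l : g e₂ l = 0 := by rw [hF.symm, hF.le₂]
lemma e₁k : g e₁ k = 0 := by rw [hF.symm, hF.ke₁]
lemma e₂k : g e₂ k = 0 := by rw [hF.symm, hF.ke₂]
lemma e₂e₁ : g e₂ e₁ = 0 := by rw [hF.symm, hF.e₁e₂]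

lemma coord_l : frameCoord g l k e₁ e₂ l = ![1, 0, 0, 0] := by
  simp [frameCoord, hF.kl, hF.ll, hF.e₁l, hF.e₂l]
lemma coord_k : frameCoord g l k e₁ e₂ k = ![0, 1, 0, 0] := by
  simp [frameCoord, hF.kk, hF.lk, hF.e₁k, hF.e₂k]
lemma coord_e₁ : frameCoord g l k e₁ e₂ e₁ = ![0, 0, 1, 0] := by
  simp [frameCoord, hF.ke₁, hF.le₁, hF.e₁e₁, hF.e₂e₁]
lemma coord_e₂ : frameCoord g l k e₁ e₂ e₂ = ![0, 0, 0, 1] := by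
  simp [frameCoord, hF.ke₂, hF.le₂, hF.e₁e₂, hF.e₂e₂]

lemma coord_frameVec (u : Fin 4 → ℝ) :
    frameCoord g l k e₁ e₂ (frameVec l k e₁ e₂ u) = u := by
  simp only [frameVec, frameCoord_add, frameCoord_smul, hF.coord_l, hF.coord_k, hF.coord_e₁,
    hF.coord_e₂]
  ext i; fin_cases i <;> simp

lemma frameVec_coord (u : V) : frameVec l k e₁ e₂ (frameCoord g l k e₁ e₂ u) = u := by
  conv_rhs => rw [hF.expand u]
  simp [frameVec, frameCoord]

lemma inner_eq (u v : V) :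
    g u v = -(g k u * g l v) - g l u * g k v + g e₁ u * g e₁ v + g e₂ u * g e₂ v := by
  conv_lhs => rw [hF.expand u]
  simp only [map_add, LinearMap.add_apply, map_smul, LinearMap.smul_apply, smul_eq_mul]
  ring

/-- The trace of a bilinear expression in an arbitrary basis, computed in a null frame. -/
lemma trace_eq (b : Module.Basis (Fin 4) ℝ V) (B : V →ₗ[ℝ] V →ₗ[ℝ] ℝ) :
    ∑ i, ∑ j, (Matrix.of fun i j : Fin 4 => g (b i) (b j))⁻¹ i j * B (b i) (b j) =
      -B l k - B k l + B e₁ e₁ + B e₂ e₂ := by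
  -- The inverse metric is `-l⊗k - k⊗l + e₁⊗e₁ + e₂⊗e₂`, here with its components in the basis `b`;
  -- the expansion of each `b m` in the frame shows that it inverts the Gram matrix.
  set H : Matrix (Fin 4) (Fin 4) ℝ := Matrix.of fun i j =>
    -(b.repr l i * b.repr k j) - b.repr k i * b.repr l j + b.repr e₁ i * b.repr e₁ j
      + b.repr e₂ i * b.repr e₂ j with hH
  have key : ∀ (u v : V), ∑ j, b.repr u j * g (b j) v = g u v := by
    intro u v
    conv_rhs => rw [← b.sum_repr u]
    simp only [map_sum, LinearMap.sum_apply, map_smul, LinearMap.smul_apply, smul_eq_mul]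
  have hinv : (Matrix.of fun i j : Fin 4 => g (b i) (b j))⁻¹ = H := by
    apply Matrix.inv_eq_left_inv
    ext i m
    have hm : ∑ j, H i j * g (b j) (b m) =
        b.repr l i * (-g k (b m)) + b.repr k i * (-g l (b m)) + b.repr e₁ i * g e₁ (b m)
          + b.repr e₂ i * g e₂ (b m) := by
      rw [← key k, ← key l, ← key e₁, ← key e₂]
      simp only [hH, Matrix.of_apply, ← Finset.sum_neg_distrib, Finset.mul_sum,
        ← Finset.sum_add_distrib]
      exact Finset.sum_congr rfl fun j _ => by ring
    have he := congrArg (fun v => b.repr v i) (hF.expand (b m))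
    simp only [map_add, map_smul, Finsupp.add_apply, Finsupp.smul_apply, smul_eq_mul,
      Module.Basis.repr_self] at he
    rw [Matrix.mul_apply]
    simp only [Matrix.of_apply]
    rw [hm, Matrix.one_apply]
    rw [Finsupp.single_apply] at he
    by_cases him : i = m
    · subst him; simp at he ⊢; linarith
    · rw [if_neg (Ne.symm him)] at he; rw [if_neg him]; linarith
  have keyB : ∀ u v : V, B u v = ∑ i, ∑ j, b.repr u i * b.repr v j * B (b i) (b j) := by
    intro u v
    conv_lhs => rw [← b.sum_repr u, ← b.sum_repr v]
    simp only [map_sum, LinearMap.sum_apply, map_smul, LinearMap.smul_apply, smul_eq_mul,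
      Finset.mul_sum]
    rw [Finset.sum_comm]
    exact Finset.sum_congr rfl fun i _ => Finset.sum_congr rfl fun j _ => by ring
  rw [hinv, keyB l k, keyB k l, keyB e₁ e₁, keyB e₂ e₂]
  simp only [← Finset.sum_neg_distrib, ← Finset.sum_add_distrib, sub_eq_add_neg]
  refine Finset.sum_congr rfl fun i _ => Finset.sum_congr rfl fun j _ => ?_
  simp only [hH, Matrix.of_apply]; ring

end IsNullFrame

namespace IsWeylCandidate

variable {g : LinearMap.BilinForm ℝ V} {W : Tens4 V} (hW : IsWeylCandidate g W)
include hW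

lemma linear₃ (a b d : V) : IsLinearMap ℝ fun c => W a b c d := by
  have h := hW.linear d a b
  constructor
  · intro x y; have := h.map_add x y; simpa only [hW.pair_symm a b] using this
  · intro r x; have := h.map_smul r x; simpa only [hW.pair_symm a b] using this

lemma trace_frame {l k e₁ e₂ : V} (hF : IsNullFrame g l k e₁ e₂)
    (b : Module.Basis (Fin 4) ℝ V) (u v : V) :
    -W l u k v - W k u l v + W e₁ u e₁ v + W e₂ u e₂ v = 0 := by
  let B : V →ₗ[ℝ] V →ₗ[ℝ] ℝ := LinearMap.mk₂ ℝ (fun x y => W x u y v)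
    (fun x x' y => (hW.linear u y v).map_add x x') (fun r x y => (hW.linear u y v).map_smul r x)
    (fun x y y' => (hW.linear₃ x u v).map_add y y')
    (fun r x y => (hW.linear₃ x u v).map_smul r y)
  have := hF.trace_eq b B
  have h0 := hW.traceless b u v
  unfold trace13 at h0
  have e : ∀ x y, B x y = W x u y v := fun x y => rfl
  simp only [e] at this
  linarith

end IsWeylCandidate

/-- The tensor with given complex components with respect to a null frame. -/
def frameWeyl (g : LinearMap.BilinForm ℝ V) (l k e₁ e₂ : V) (c : Fin 5 → ℂ) : Tens4 V :=
  fun u v w x => weylForm c (frameCoord g l k e₁ e₂ u) (frameCoord g l k e₁ e₂ v)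
    (frameCoord g l k e₁ e₂ w) (frameCoord g l k e₁ e₂ x)

/-- The complex components of a Weyl-tensor candidate. -/
def weylComp (W : Tens4 V) (l k e₁ e₂ : V) : Fin 5 → ℂ :=
  ![⟨W l e₁ l e₁, W l e₁ l e₂⟩, ⟨W l k l e₁, W l k l e₂⟩, ⟨W l k l k, W l k e₁ e₂⟩,
    ⟨W l k k e₁, -W l k k e₂⟩, ⟨W k e₁ k e₁, -W k e₁ k e₂⟩]

/-- A complex quadratic form on self-dual bivectors has one complex trace, whose real and imaginary
parts obstruct tracelessness and the cyclic identity. The combination `Z₃² - Z₁Z₂` multiplying `c 2`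
is what makes it vanish. -/
lemma IsNullFrame.isWeylCandidate {g : LinearMap.BilinForm ℝ V} {l k e₁ e₂ : V}
    (hF : IsNullFrame g l k e₁ e₂) (c : Fin 5 → ℂ) :
    IsWeylCandidate g (frameWeyl g l k e₁ e₂ c) where
  linear b c' d := by
    constructor
    · intro x y; simp only [frameWeyl, frameCoord_add, weylForm_add_left]
    · intro r x; simp only [frameWeyl, frameCoord_smul, weylForm_smul_left, smul_eq_mul]
  antisymm₁₂ _ _ _ _ := weylForm_swap₁₂ ..
  antisymm₃₄ _ _ _ _ := weylForm_swap₃₄ ..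
  pair_symm _ _ _ _ := weylForm_pair_symm ..
  cyclic _ _ _ _ := weylForm_cyclic ..
  traceless b u v := by
    have hl : ∀ u w x, IsLinearMap ℝ fun v => frameWeyl g l k e₁ e₂ c v u w x := fun b c' d => by
      constructor
      · intro x y; simp only [frameWeyl, frameCoord_add, weylForm_add_left]
      · intro r x; simp only [frameWeyl, frameCoord_smul, weylForm_smul_left, smul_eq_mul]
    have hp : ∀ u v w x, frameWeyl g l k e₁ e₂ c w x u v = frameWeyl g l k e₁ e₂ c u v w x :=
      fun u v w x => weylForm_pair_symm ..
    let B : V →ₗ[ℝ] V →ₗ[ℝ] ℝ := LinearMap.mk₂ ℝ (fun x y => frameWeyl g l k e₁ e₂ c x u y v)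
      (fun x x' y => (hl u y v).map_add x x') (fun r x y => (hl u y v).map_smul r x)
      (fun x y y' => by simpa only [hp] using (hl v x u).map_add y y')
      (fun r x y => by simpa only [hp] using (hl v x u).map_smul r y)
    have := hF.trace_eq b B
    have e : ∀ x y, B x y = frameWeyl g l k e₁ e₂ c x u y v := fun x y => rfl
    simp only [e] at this
    rw [trace13, this]
    simp only [frameWeyl, hF.coord_l, hF.coord_k, hF.coord_e₁, hF.coord_e₂, weylForm_eq]
    simp
    ring

end FrameAlgebra

/-! ### Components in a null frame: reconstruction, null rotations, multiplicities. -/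

section FrameAlgebra

variable {V : Type*} [AddCommGroup V] [Module ℝ V]

/-- Expansion of an alternating bilinear expression in the bivectors of a null frame. -/
lemma IsNullFrame.alternating_expand {g : LinearMap.BilinForm ℝ V} {l k e₁ e₂ : V}
    (hF : IsNullFrame g l k e₁ e₂) {A : V → V → ℝ} (hl : ∀ v, IsLinearMap ℝ fun u => A u v)
    (ha : ∀ u v, A v u = -A u v) {x y : Fin 4 → ℝ} {u v : V}
    (hx : x = frameCoord g l k e₁ e₂ u) (hy : y = frameCoord g l k e₁ e₂ v) :
    A u v = (x 0 * y 1 - x 1 * y 0) * A l k + (x 0 * y 2 - x 2 * y 0) * A l e₁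
      + (x 0 * y 3 - x 3 * y 0) * A l e₂ + (x 1 * y 2 - x 2 * y 1) * A k e₁
      + (x 1 * y 3 - x 3 * y 1) * A k e₂ + (x 2 * y 3 - x 3 * y 2) * A e₁ e₂ := by
  have hu := hF.frameVec_coord u
  have hv := hF.frameVec_coord v
  rw [← hx] at hu
  rw [← hy] at hv
  have hadd : ∀ a b c, A (a + b) c = A a c + A b c := fun a b c => (hl c).map_add a b
  have hsmul : ∀ (r : ℝ) a c, A (r • a) c = r * A a c := fun r a c => (hl c).map_smul r a
  have hadd' : ∀ a b c, A c (a + b) = A c a + A c b := fun a b c => by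
    rw [ha _ c, hadd, ha c a, ha c b]; ring
  have hsmul' : ∀ (r : ℝ) a c, A c (r • a) = r * A c a := fun r a c => by
    rw [ha _ c, hsmul, ha c a]; ring
  have h0 : ∀ a, A a a = 0 := fun a => by linarith [ha a a]
  rw [← hu, ← hv]
  simp only [frameVec, hadd, hsmul, hadd', hsmul', h0]
  rw [ha l k, ha l e₁, ha l e₂, ha k e₁, ha k e₂, ha e₁ e₂]
  ring

/-- A Weyl-tensor candidate is determined by its complex components. -/
lemma IsWeylCandidate.eq_frameWeyl {g : LinearMap.BilinForm ℝ V} {W : Tens4 V}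
    (hW : IsWeylCandidate g W) {l k e₁ e₂ : V} (hF : IsNullFrame g l k e₁ e₂)
    (b : Module.Basis (Fin 4) ℝ V) : W = frameWeyl g l k e₁ e₂ (weylComp W l k e₁ e₂) := by
  have tr := fun u v => hW.trace_frame hF b u v
  have s12 := hW.antisymm₁₂
  have s34 := hW.antisymm₃₄
  have ps := hW.pair_symm
  have z12 : ∀ a c d, W a a c d = 0 := fun a c d => by linarith [s12 a a c d]
  have z34 : ∀ a c d, W c d a a = 0 := fun a c d => by linarith [s34 c d a a]
  have t00 := tr l l
  have t01 := tr l k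
  have t02 := tr l e₁
  have t03 := tr l e₂
  have t11 := tr k k
  have t12 := tr k e₁
  have t13 := tr k e₂
  have t22 := tr e₁ e₁
  have t23 := tr e₁ e₂
  have t33 := tr e₂ e₂
  have cy := hW.cyclic l k e₁ e₂
  simp only [z12, z34, s12 l k, s12 l e₁, s12 l e₂, s12 k e₁, s12 k e₂, s12 e₁ e₂,
    s34 _ _ l e₁, s34 _ _ l e₂, s34 _ _ k e₁, s34 _ _ k e₂, s34 _ _ e₁ e₂]
    at t00 t01 t02 t03 t11 t12 t13 t22 t23 t33 cy
  simp only [ps l e₁ k e₁, ps l e₂ k e₁, ps l e₂ k e₂]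
    at t00 t01 t02 t03 t11 t12 t13 t22 t23 t33 cy
  -- A symmetric form on the six bivectors has 21 components. Ten trace equations and one cyclic
  -- identity eliminate eleven of them; the ten left are the real and imaginary parts recorded in
  -- `weylComp`.
  have r1 : W l e₁ k e₁ = -W l k l k / 2 := by linarith
  have r2 : W l e₂ k e₂ = -W l k l k / 2 := by linarith
  have r3 : W e₁ e₂ e₁ e₂ = -W l k l k := by linarith
  have r4 : W l e₁ k e₂ = W l k e₁ e₂ / 2 := by linarith
  have r5 : W l e₂ k e₁ = -W l k e₁ e₂ / 2 := by linarith
  have r6 : W l e₂ l e₂ = -W l e₁ l e₁ := by linarith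
  have r7 : W k e₂ k e₂ = -W k e₁ k e₁ := by linarith
  have r8 : W l e₁ e₁ e₂ = W l k l e₂ := by linarith
  have r9 : W l e₂ e₁ e₂ = -W l k l e₁ := by linarith
  have r10 : W k e₁ e₁ e₂ = -W l k k e₂ := by linarith
  have r11 : W k e₂ e₁ e₂ = W l k k e₁ := by linarith
  funext u v w x
  have e1 : ∀ w x, W u v w x = _ := fun w x => hF.alternating_expand (A := fun u v => W u v w x)
    (fun v => hW.linear v w x) (fun u v => s12 u v w x) rfl rfl
  have e2 : ∀ u v, W u v w x = _ := fun u v => hF.alternating_expand (A := fun w x => W u v w x)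
    (fun x => hW.linear₃ u v x) (fun w x => s34 u v w x) rfl rfl
  rw [e1]
  simp only [e2]
  rw [ps l k l e₁, ps l k l e₂, ps l k k e₁, ps l k k e₂, ps l k e₁ e₂, ps l e₁ l e₂,
    ps l e₁ k e₁, ps l e₁ k e₂, ps l e₁ e₁ e₂, ps l e₂ k e₁, ps l e₂ k e₂, ps l e₂ e₁ e₂,
    ps k e₁ k e₂, ps k e₁ e₁ e₂, ps k e₂ e₁ e₂, r1, r2, r3, r4, r5, r6, r7, r8, r9, r10, r11]
  have c0 : weylComp W l k e₁ e₂ 0 = ⟨W l e₁ l e₁, W l e₁ l e₂⟩ := rfl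
  have c1 : weylComp W l k e₁ e₂ 1 = ⟨W l k l e₁, W l k l e₂⟩ := rfl
  have c2 : weylComp W l k e₁ e₂ 2 = ⟨W l k l k, W l k e₁ e₂⟩ := rfl
  have c3 : weylComp W l k e₁ e₂ 3 = ⟨W l k k e₁, -W l k k e₂⟩ := rfl
  have c4 : weylComp W l k e₁ e₂ 4 = ⟨W k e₁ k e₁, -W k e₁ k e₂⟩ := rfl
  rw [frameWeyl, weylForm_eq, c0, c1, c2, c3, c4]
  ring

/-- The Lorentz transformation composed of a boost in the plane of `l` and `k` by `s` and a null
rotation about `l` with parameters `q₂`, `q₃`, up to an overall factor. -/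
def boostRot (s q₂ q₃ : ℝ) (u : Fin 4 → ℝ) : Fin 4 → ℝ :=
  ![s ^ 2 * u 0 + s * (q₂ * u 2 + q₃ * u 3) + u 1 * (q₂ ^ 2 + q₃ ^ 2) / 2, u 1,
    s * u 2 + u 1 * q₂, s * u 3 + u 1 * q₃]

/-- The action of a null rotation about `l` on complex components. -/
def nullRot (r : ℂ) (c : Fin 5 → ℂ) : Fin 5 → ℂ :=
  ![c 0, c 1 + r * c 0, c 2 + 2 * r * c 1 + r ^ 2 * c 0,
    c 3 - 3 / 2 * r * c 2 - 3 / 2 * r ^ 2 * c 1 - r ^ 3 * c 0 / 2,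
    c 4 - 2 * r * c 3 + 3 / 2 * r ^ 2 * c 2 + r ^ 3 * c 1 + r ^ 4 * c 0 / 4]

/-- On self-dual components the map is triangular, with diagonal entries `s³`, `s`, `s²` for `Z₁`,
`Z₂`, `Z₃`. The monomials multiplying `c a` all have weight `6 - a`, and the off-diagonal entries
produce `nullRot`. These weights are the source of peeling. -/
lemma weylForm_boostRot (s q₂ q₃ : ℝ) (c : Fin 5 → ℂ) (u v w x : Fin 4 → ℝ) :
    weylForm c (boostRot s q₂ q₃ u) (boostRot s q₂ q₃ v) (boostRot s q₂ q₃ w)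
        (boostRot s q₂ q₃ x) =
      weylForm (fun a => (s : ℂ) ^ (6 - (a : ℕ)) * nullRot ⟨q₂, -q₃⟩ c a) u v w x := by
  have h1 : ∀ u v, selfDual₁ (boostRot s q₂ q₃ u) (boostRot s q₂ q₃ v) =
      s ^ 3 * selfDual₁ u v + s ^ 2 * ⟨q₂, -q₃⟩ * selfDual₃ u v
        - s * ⟨q₂, -q₃⟩ ^ 2 / 2 * selfDual₂ u v := by
    intro u v
    have h2 : (2 : ℂ)⁻¹ = ((1 / 2 : ℝ) : ℂ) := by norm_num
    apply Complex.ext <;>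
    simp only [selfDual₁, selfDual₂, selfDual₃, div_eq_mul_inv, h2, Complex.add_re,
      Complex.sub_re, Complex.mul_re, Complex.add_im, Complex.mul_im, Complex.sub_im,
      Complex.ofReal_re, Complex.ofReal_im, pow_succ, pow_zero, one_mul] <;>
    simp [boostRot] <;> ring
  have h2 : ∀ u v, selfDual₂ (boostRot s q₂ q₃ u) (boostRot s q₂ q₃ v) =
      s * selfDual₂ u v := by
    intro u v
    apply Complex.ext <;>
    simp only [selfDual₂, Complex.mul_re, Complex.mul_im, Complex.ofReal_re,
      Complex.ofReal_im] <;>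
    simp [boostRot] <;> ring
  have h3 : ∀ u v, selfDual₃ (boostRot s q₂ q₃ u) (boostRot s q₂ q₃ v) =
      s ^ 2 * selfDual₃ u v - s * ⟨q₂, -q₃⟩ * selfDual₂ u v := by
    intro u v
    apply Complex.ext <;>
    simp only [selfDual₂, selfDual₃, Complex.sub_re, Complex.mul_re, Complex.mul_im,
      Complex.sub_im, Complex.ofReal_re, Complex.ofReal_im, pow_succ, pow_zero, one_mul] <;>
    simp [boostRot] <;> ring
  simp only [weylForm, h1, h2, h3]
  congr 1
  generalize (⟨q₂, -q₃⟩ : ℂ) = r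
  simp [nullRot]
  ring

section

variable {g : LinearMap.BilinForm ℝ V} {l k e₁ e₂ : V} (hF : IsNullFrame g l k e₁ e₂)
include hF

/-- Transversal vectors of any tetrad sharing `l` and `k` have no `l` or `k` component, so different
boost weights cannot mix. This makes later statements independent of the choice of `e₁`, `e₂`. -/
lemma IsNullFrame.weylScalar_congr {c c' : Fin 5 → ℂ} {f₁ f₂ : V}
    (hT : IsNullTetrad g l k f₁ f₂) {b : Fin 5} (h : c b = c' b) :
    weylScalar (frameWeyl g l k e₁ e₂ c) l k f₁ f₂ b =
      weylScalar (frameWeyl g l k e₁ e₂ c') l k f₁ f₂ b := by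
  have c1 : ∀ f, g l f = 0 → g k f = 0 →
      frameCoord g l k e₁ e₂ f = ![0, 0, g e₁ f, g e₂ f] := fun f h h' => by
    simp [frameCoord, h, h']
  have n : ∀ f : V, frameCoord g l k e₁ e₂ (-f) = -frameCoord g l k e₁ e₂ f := fun f => by
    rw [← neg_one_smul ℝ f, frameCoord_smul, neg_one_smul]
  fin_cases b <;>
  · simp only [Fin.zero_eta, Fin.mk_one, Fin.reduceFinMk] at h
    simp [weylScalar, cext₁, cext₂, frameWeyl, frameCoord_smul, n, hF.coord_l, hF.coord_k,
      c1 _ hT.le₁ hT.ke₁, c1 _ hT.le₂ hT.ke₂, weylForm_eq, h]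

lemma IsNullFrame.weylScalar_eq_zero {c : Fin 5 → ℂ} {f₁ f₂ : V}
    (hT : IsNullTetrad g l k f₁ f₂) {b : Fin 5} (h : c b = 0) :
    weylScalar (frameWeyl g l k e₁ e₂ c) l k f₁ f₂ b = 0 := by
  rw [hF.weylScalar_congr hT (c' := 0) h]
  have : frameWeyl g l k e₁ e₂ 0 = 0 := by
    funext u v w x; simp [frameWeyl, weylForm]
  rw [this]
  fin_cases b <;> simp [weylScalar, cext₁, cext₂] <;> rfl

lemma IsNullFrame.belDebever_l {c : Fin 5 → ℂ} {m : ℕ} (hm : m ≤ 4)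
    (hc : ∀ i : Fin 5, (i : ℕ) < m → c i = 0) : BelDebever g (frameWeyl g l k e₁ e₂ c) l m := by
  have hl := hF.coord_l
  have h1 : ∀ d, g l d = 0 → frameCoord g l k e₁ e₂ d 1 = 0 := fun d h => by simp [frameCoord, h]
  have h0 : 0 < m → c 0 = 0 := fun h => hc 0 (by simpa using h)
  have h1' : 1 < m → c 1 = 0 := fun h => hc 1 (by simpa using h)
  have h2 : 2 < m → c 2 = 0 := fun h => hc 2 (by simpa using h)
  have h3 : 3 < m → c 3 = 0 := fun h => hc 3 (by simpa using h)
  interval_cases m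
  · trivial
  · intro a d ha hd
    simp [frameWeyl, weylForm_eq, hl, h1 a ha, h1 d hd, h0 (by norm_num)]
  · intro a d hd
    simp [frameWeyl, weylForm_eq, hl, h1 d hd, h0 (by norm_num), h1' (by norm_num)]
  · intro a b d hd
    simp [frameWeyl, weylForm_eq, hl, h1 d hd, h0 (by norm_num), h1' (by norm_num),
      h2 (by norm_num)]
  · intro a b d
    simp [frameWeyl, weylForm_eq, hl, h0 (by norm_num), h1' (by norm_num),
      h2 (by norm_num), h3 (by norm_num)]

lemma IsNullFrame.belDebever_k {c : Fin 5 → ℂ} {m : ℕ} (hm : m ≤ 4)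
    (hc : ∀ i : Fin 5, 4 < m + (i : ℕ) → c i = 0) :
    BelDebever g (frameWeyl g l k e₁ e₂ c) k m := by
  have hk := hF.coord_k
  have h1 : ∀ d, g k d = 0 → frameCoord g l k e₁ e₂ d 0 = 0 := fun d h => by simp [frameCoord, h]
  have h4 : 0 < m → c 4 = 0 := fun h => hc 4 (by simpa using h)
  have h3 : 1 < m → c 3 = 0 := fun h => hc 3 (by simp; omega)
  have h2 : 2 < m → c 2 = 0 := fun h => hc 2 (by simp; omega)
  have h1' : 3 < m → c 1 = 0 := fun h => hc 1 (by simp; omega)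
  interval_cases m
  · trivial
  · intro a d ha hd
    simp [frameWeyl, weylForm_eq, hk, h1 a ha, h1 d hd, h4 (by norm_num)]
  · intro a d hd
    simp [frameWeyl, weylForm_eq, hk, h1 d hd, h4 (by norm_num), h3 (by norm_num)]
  · intro a b d hd
    simp [frameWeyl, weylForm_eq, hk, h1 d hd, h4 (by norm_num), h3 (by norm_num),
      h2 (by norm_num)]
  · intro a b d
    simp [frameWeyl, weylForm_eq, hk, h4 (by norm_num), h3 (by norm_num),
      h2 (by norm_num), h1' (by norm_num)]

/-- The Bel-Debever conditions, tested on frame vectors, read off the real and imaginary parts of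
the components one by one; together with `belDebever_l` this characterises alignment by `c i = 0`
for `i < m`. -/
lemma IsNullFrame.comp_eq_zero {c : Fin 5 → ℂ} {m : ℕ} (hm : m ≤ 4)
    (h : BelDebever g (frameWeyl g l k e₁ e₂ c) l m) (i : Fin 5) (hi : (i : ℕ) < m) :
    c i = 0 := by
  have e1 : g l e₁ = 0 := hF.le₁
  have e2 : g l e₂ = 0 := hF.le₂
  have l0 : g l l = 0 := hF.ll
  have hco := And.intro hF.coord_l (And.intro hF.coord_k (And.intro hF.coord_e₁ hF.coord_e₂))
  interval_cases m
  · omega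
  · have a1 := h e₁ e₁ e1 e1
    have a2 := h e₁ e₂ e1 e2
    simp [frameWeyl, weylForm_eq, hco] at a1 a2
    fin_cases i <;> simp at hi ⊢
    exact Complex.ext a1 a2
  · have a1 := h e₁ e₁ e1
    have a2 := h e₁ e₂ e2
    have b1 := h k e₁ e1
    have b2 := h k e₂ e2
    simp [frameWeyl, weylForm_eq, hco] at a1 a2 b1 b2
    fin_cases i <;> simp at hi ⊢
    exacts [Complex.ext a1 a2, Complex.ext b1 b2]
  · have a1 := h l e₁ e₁ e1
    have a2 := h l e₁ e₂ e2
    have b1 := h l k e₁ e1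
    have b2 := h l k e₂ e2
    have d1 := h k e₁ e₁ e1
    have d2 := h k e₁ e₂ e2
    simp [frameWeyl, weylForm_eq, hco] at a1 a2 b1 b2 d1 d2
    fin_cases i <;> simp at hi ⊢
    exacts [Complex.ext a1 a2, Complex.ext b1 b2, Complex.ext d1 d2]
  · have a1 := h l e₁ e₁
    have a2 := h l e₁ e₂
    have b1 := h l k e₁
    have b2 := h l k e₂
    have d1 := h k e₁ e₁
    have d2 := h k e₁ e₂
    have f1 := h k e₁ k
    have f2 := h k e₂ k
    simp [frameWeyl, weylForm_eq, hco] at a1 a2 b1 b2 d1 d2 f1 f2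
    fin_cases i <;> simp at hi ⊢
    exacts [Complex.ext a1 a2, Complex.ext b1 b2, Complex.ext d1 d2, Complex.ext f1 f2]

/-- With `k` in two slots and purely transversal vectors in the other two, only `c 4` is seen. The
factor 4 compensates the two weights one half of the antisymmetrisations. -/
lemma IsNullFrame.typeNProj_frameWeyl (c : Fin 5 → ℂ) :
    typeNProj g l k (frameWeyl g l k e₁ e₂ c) = frameWeyl g l k e₁ e₂ (Pi.single 4 (c 4)) := by
  have hP : ∀ u, frameCoord g l k e₁ e₂ (planeProj g l k u) =
      ![0, 0, frameCoord g l k e₁ e₂ u 2, frameCoord g l k e₁ e₂ u 3] := fun u => by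
    rw [planeProj, frameCoord_add, frameCoord_add, frameCoord_smul, frameCoord_smul, hF.coord_l,
      hF.coord_k]
    ext i; fin_cases i <;> simp [frameCoord]
  have hs : ∀ u v : V, frameCoord g l k e₁ e₂ (u - v) =
      frameCoord g l k e₁ e₂ u - frameCoord g l k e₁ e₂ v := fun u v => by
    rw [sub_eq_add_neg, ← neg_one_smul ℝ v, frameCoord_add, frameCoord_smul, neg_one_smul,
      sub_eq_add_neg]
  have h1 : ∀ u, g l u = -frameCoord g l k e₁ e₂ u 1 := fun u => by simp [frameCoord]
  funext u v w x
  simp only [typeNProj, frameWeyl, frameCoord_smul, hs, hP, hF.coord_k, h1]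
  generalize frameCoord g l k e₁ e₂ u = u
  generalize frameCoord g l k e₁ e₂ v = v
  generalize frameCoord g l k e₁ e₂ w = w
  generalize frameCoord g l k e₁ e₂ x = x
  simp [weylForm_eq]
  ring

end

end FrameAlgebra

/-! ### Linear algebra of Lorentzian forms and existence of null tetrads. -/

section Lorentzian

variable {V : Type*} [AddCommGroup V] [Module ℝ V] {g : LinearMap.BilinForm ℝ V}

lemma IsLorentzian.exists_coord (hg : IsLorentzian g) :
    ∃ b : Module.Basis (Fin 4) ℝ V, ∀ u v, g u v = -(b.repr u 0 * b.repr v 0)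
      + b.repr u 1 * b.repr v 1 + b.repr u 2 * b.repr v 2 + b.repr u 3 * b.repr v 3 := by
  obtain ⟨b, hb⟩ := hg
  refine ⟨b, fun u v => ?_⟩
  conv_lhs => rw [← b.sum_repr u, ← b.sum_repr v]
  simp only [map_sum, LinearMap.sum_apply, map_smul, LinearMap.smul_apply, smul_eq_mul, hb]
  simp [Fin.sum_univ_four]
  ring

lemma IsLorentzian.symm (hg : IsLorentzian g) (u v : V) : g u v = g v u := by
  obtain ⟨b, hb⟩ := hg.exists_coord
  rw [hb, hb]; ring

lemma IsLorentzian.finrank_eq (hg : IsLorentzian g) : Module.finrank ℝ V = 4 := by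
  obtain ⟨b, -⟩ := hg
  simpa using Module.finrank_eq_card_basis b

lemma IsLorentzian.eq_zero_of_forall (hg : IsLorentzian g) {u : V} (h : ∀ v, g u v = 0) :
    u = 0 := by
  obtain ⟨b, hb⟩ := hg
  have hs : ∀ i, g u (b i) = b.repr u i * (if i = 0 then -1 else 1) := fun i => by
    conv_lhs => rw [← b.sum_repr u]
    simp only [map_sum, LinearMap.sum_apply, map_smul, LinearMap.smul_apply, smul_eq_mul, hb]
    simp
  apply b.repr.injective
  ext i
  have := hs i
  rw [h] at this
  split_ifs at this <;> simp at this ⊢ <;> linarith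

/-- Cauchy-Schwarz for the spatial parts bounds `(t₀ u₀)²` by a product that is strictly smaller
than it unless `u₀ = 0`. -/
lemma eq_zero_of_timelike_orthogonal {t₀ t₁ t₂ t₃ u₀ u₁ u₂ u₃ : ℝ}
    (ht : t₁ ^ 2 + t₂ ^ 2 + t₃ ^ 2 < t₀ ^ 2) (htu : t₁ * u₁ + t₂ * u₂ + t₃ * u₃ = t₀ * u₀)
    (hu : u₁ ^ 2 + u₂ ^ 2 + u₃ ^ 2 ≤ u₀ ^ 2) : u₀ = 0 ∧ u₁ = 0 ∧ u₂ = 0 ∧ u₃ = 0 := by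
  have hcs : (t₀ * u₀) ^ 2 ≤ (t₁ ^ 2 + t₂ ^ 2 + t₃ ^ 2) * (u₁ ^ 2 + u₂ ^ 2 + u₃ ^ 2) := by
    rw [← htu]
    nlinarith [sq_nonneg (t₁ * u₂ - t₂ * u₁), sq_nonneg (t₁ * u₃ - t₃ * u₁),
      sq_nonneg (t₂ * u₃ - t₃ * u₂)]
  have h1 := mul_le_mul_of_nonneg_left hu (by positivity : 0 ≤ t₁ ^ 2 + t₂ ^ 2 + t₃ ^ 2)
  have h2 : u₀ ^ 2 = 0 := by
    by_contra h0
    have h3 := mul_lt_mul_of_pos_right ht (lt_of_le_of_ne (sq_nonneg u₀) (Ne.symm h0))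
    rw [mul_pow] at hcs
    linarith
  have p1 := sq_nonneg u₁
  have p2 := sq_nonneg u₂
  have p3 := sq_nonneg u₃
  exact ⟨by simpa using h2, pow_eq_zero_iff (two_ne_zero) |>.1 (by linarith),
    pow_eq_zero_iff (two_ne_zero) |>.1 (by linarith),
    pow_eq_zero_iff (two_ne_zero) |>.1 (by linarith)⟩

/-- Vectors orthogonal to a timelike vector are spacelike. -/
lemma IsLorentzian.pos_of_orthogonal (hg : IsLorentzian g) {t u : V} (ht : g t t < 0)
    (htu : g t u = 0) (hu : u ≠ 0) : 0 < g u u := by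
  obtain ⟨b, hb⟩ := hg.exists_coord
  rw [hb] at ht htu ⊢
  by_contra hn
  obtain ⟨u0, u1, u2, u3⟩ := eq_zero_of_timelike_orthogonal (t₀ := b.repr t 0)
    (t₁ := b.repr t 1) (t₂ := b.repr t 2) (t₃ := b.repr t 3) (u₀ := b.repr u 0)
    (u₁ := b.repr u 1) (u₂ := b.repr u 2) (u₃ := b.repr u 3) (by linarith) (by linarith)
    (by linarith)
  apply hu
  apply b.repr.injective
  ext i
  fin_cases i <;> simp [u0, u1, u2, u3]

/-- In dimension four there is a nonzero vector orthogonal to three given vectors. -/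
lemma IsLorentzian.exists_orthogonal (hg : IsLorentzian g) (x y z : V) :
    ∃ u : V, u ≠ 0 ∧ g x u = 0 ∧ g y u = 0 ∧ g z u = 0 := by
  have hfin := hg.finrank_eq
  have : FiniteDimensional ℝ V := Module.finite_of_finrank_eq_succ hfin
  let f : V →ₗ[ℝ] (Fin 3 → ℝ) := LinearMap.pi ![g x, g y, g z]
  have hf : ¬ Function.Injective f := fun h => by
    have := LinearMap.finrank_le_finrank_of_injective h
    simp [hfin] at this
  rw [← LinearMap.ker_eq_bot, Submodule.eq_bot_iff] at hf
  push Not at hf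
  obtain ⟨u, hu, hu0⟩ := hf
  have h := fun i => congrFun (LinearMap.mem_ker.1 hu) i
  exact ⟨u, hu0, h 0, h 1, h 2⟩

/-- The vector `l + k` is timelike, so `g` is positive on the orthogonal complement of the plane of
`l` and `k`. Two successive dimension counts give orthogonal vectors there, which can then be
normalised. -/
lemma IsLorentzian.exists_nullTetrad (hg : IsLorentzian g) {l k : V} (hll : g l l = 0)
    (hkk : g k k = 0) (hlk : g l k = -1) : ∃ e₁ e₂, IsNullTetrad g l k e₁ e₂ := by
  have ht : g (l + k) (l + k) < 0 := by
    simp [hll, hkk, hlk, hg.symm k l]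
  have hn : ∀ u, u ≠ 0 → g l u = 0 → g k u = 0 → ∃ c : ℝ, g (c • u) (c • u) = 1 := by
    intro u hu h1 h2
    have hp := hg.pos_of_orthogonal ht (by simp [h1, h2]) hu
    refine ⟨(√(g u u))⁻¹, ?_⟩
    have := Real.mul_self_sqrt hp.le
    have h0 : √(g u u) ≠ 0 := (Real.sqrt_pos.2 hp).ne'
    simp only [map_smul, LinearMap.smul_apply, smul_eq_mul]
    field_simp
    nlinarith
  obtain ⟨u, hu, h1, h2, -⟩ := hg.exists_orthogonal l k k
  obtain ⟨c, hc⟩ := hn u hu h1 h2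
  obtain ⟨w, hw, h3, h4, h5⟩ := hg.exists_orthogonal l k (c • u)
  obtain ⟨c', hc'⟩ := hn w hw h3 h4
  exact ⟨c • u, c' • w, hll, hkk, hlk, hc, hc', by rw [map_smul, h5, smul_zero],
    by rw [map_smul, h1, smul_zero], by rw [map_smul, h3, smul_zero],
    by rw [map_smul, h2, smul_zero], by rw [map_smul, h4, smul_zero]⟩

/-- The products within a tetrad force linear independence, hence a basis in dimension four; the
same products identify the coefficients of the expansion. -/
lemma IsNullTetrad.isNullFrame (hg : IsLorentzian g) {l k e₁ e₂ : V}
    (hT : IsNullTetrad g l k e₁ e₂) : IsNullFrame g l k e₁ e₂ where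
  toIsNullTetrad := hT
  symm := hg.symm
  expand u := by
    obtain ⟨ll, kk, lk, e11, e22, e12, l1, l2, k1, k2⟩ := hT
    have s := hg.symm
    have kl : g k l = -1 := by rw [s, lk]
    have h1l : g e₁ l = 0 := by rw [s, l1]
    have h2l : g e₂ l = 0 := by rw [s, l2]
    have h1k : g e₁ k = 0 := by rw [s, k1]
    have h2k : g e₂ k = 0 := by rw [s, k2]
    have h21 : g e₂ e₁ = 0 := by rw [s, e12]
    have hfin := hg.finrank_eq
    have hli : LinearIndependent ℝ ![l, k, e₁, e₂] := by
      rw [Fintype.linearIndependent_iff]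
      intro c hc
      simp only [Fin.sum_univ_four, Matrix.cons_val_zero, Matrix.cons_val_one,
        Matrix.cons_val] at hc
      have a0 := congrArg (g k) hc
      have a1 := congrArg (g l) hc
      have a2 := congrArg (g e₁) hc
      have a3 := congrArg (g e₂) hc
      simp [ll, kk, lk, e11, e22, e12, l1, l2, k1, k2, kl, h1l, h2l, h1k, h2k, h21]
        at a0 a1 a2 a3
      intro i
      fin_cases i <;> simp [a0, a1, a2, a3]
    let b := basisOfLinearIndependentOfCardEqFinrank hli (by simp [hfin])
    have hb : ∀ i, b i = ![l, k, e₁, e₂] i := fun i => by simp [b]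
    have hu := b.sum_repr u
    simp only [hb, Fin.sum_univ_four, Matrix.cons_val_zero, Matrix.cons_val_one,
        Matrix.cons_val] at hu
    have a0 := congrArg (g k) hu
    have a1 := congrArg (g l) hu
    have a2 := congrArg (g e₁) hu
    have a3 := congrArg (g e₂) hu
    simp only [map_add, map_smul, smul_eq_mul, ll, kk, lk, e11, e22, e12, l1, l2, k1, k2, kl,
      h1l, h2l, h1k, h2k, h21, mul_zero, mul_one, zero_add, add_zero, mul_neg] at a0 a1 a2 a3
    rw [← a0, ← a1, ← a2, ← a3, neg_neg, neg_neg]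
    exact hu.symm

end Lorentzian

/-! ### Repeated principal null directions and the discriminant, in components. -/

section Genericity

/-- The Lorentzian form in coordinates with respect to a null tetrad. -/
def nullForm (u v : Fin 4 → ℝ) : ℝ := -(u 0 * v 1 + u 1 * v 0) + u 2 * v 2 + u 3 * v 3

lemma weylForm_smul₄ (c : Fin 5 → ℂ) (r : ℝ) (u v w x : Fin 4 → ℝ) :
    weylForm c u v w (r • x) = r * weylForm c u v w x := by
  simp only [weylForm_eq, Pi.smul_apply, smul_eq_mul]; ring

lemma weylForm_sub₄ (c : Fin 5 → ℂ) (u v w x x' : Fin 4 → ℝ) :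
    weylForm c u v w (x - x') = weylForm c u v w x - weylForm c u v w x' := by
  simp only [weylForm_eq, Pi.sub_apply]; ring

lemma weylForm_smul₂₃ (c : Fin 5 → ℂ) (r : ℝ) (u v x : Fin 4 → ℝ) :
    weylForm c u (r • v) (r • v) x = r ^ 2 * weylForm c u v v x := by
  simp only [weylForm_eq, Pi.smul_apply, smul_eq_mul]; ring

lemma exists_nullForm_ne_zero {n : Fin 4 → ℝ} (hn : n ≠ 0) : ∃ f, nullForm n f ≠ 0 := by
  by_contra! h
  apply hn
  have h0 := h ![0, 1, 0, 0]
  have h1 := h ![1, 0, 0, 0]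
  have h2 := h ![0, 0, 1, 0]
  have h3 := h ![0, 0, 0, 1]
  simp [nullForm] at h0 h1 h2 h3
  ext i; fin_cases i <;> simp [h0, h1, h2, h3]

/-- The discriminant `I³ - 27 J²` of the quartic whose roots are the principal null
directions. -/
def petrovDisc (c : Fin 5 → ℂ) : ℂ :=
  (c 0 * c 4 + 2 * c 1 * c 3 + 3 / 4 * c 2 ^ 2) ^ 3
    - 27 * (c 0 * c 2 * c 4 / 2 - c 1 * c 2 * c 3 / 2 - c 2 ^ 3 / 8 - c 4 * c 1 ^ 2 / 2
      - c 0 * c 3 ^ 2 / 2) ^ 2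

/-- The value of the quadratic form of `weylForm` before taking the real part, at the self-dual
bivector of `(u, v)` and the bivector with components `z₁, z₂, z₃`. -/
def weylContract (c : Fin 5 → ℂ) (u v : Fin 4 → ℝ) (z₁ z₂ z₃ : ℂ) : ℂ :=
  c 0 * (selfDual₁ u v * z₁) + c 1 * (selfDual₁ u v * z₃ + selfDual₃ u v * z₁)
    + c 2 * (selfDual₃ u v * z₃ - (selfDual₁ u v * z₂ + selfDual₂ u v * z₁) / 2)
    + c 3 * (selfDual₂ u v * z₃ + selfDual₃ u v * z₂) + c 4 * (selfDual₂ u v * z₂)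

lemma weylForm_eq_weylContract (c : Fin 5 → ℂ) (u v w x : Fin 4 → ℝ) :
    weylForm c u v w x =
      (weylContract c u v (selfDual₁ w x) (selfDual₂ w x) (selfDual₃ w x)).re := rfl

/-- Two vectors orthogonal to `n` are chosen so that the self-dual parts of their bivectors with `n`
are `z` and `-i z`. The two real equations are then the real and imaginary parts of one complex
equation. The triple `z` satisfies `z₃² + 2 z₁ z₂ = 0`, as for any null bivector. -/
lemma weylContract_eq_zero {c : Fin 5 → ℂ} {n u v : Fin 4 → ℝ} (hn : nullForm n n = 0)
    (h : ∀ d, nullForm n d = 0 → weylForm c u v n d = 0) {ζ : ℂ} (hζ : ζ = ⟨n 2, n 3⟩) :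
    weylContract c u v (n 0 ^ 2) (-ζ ^ 2 / 2) (n 0 * ζ) = 0 := by
  have hn' : n 0 * n 1 = (n 2 ^ 2 + n 3 ^ 2) / 2 := by unfold nullForm at hn; linarith
  have h1 := h ![0, n 2, n 0, 0] (by simp [nullForm]; ring)
  have h2 := h ![0, n 3, 0, n 0] (by simp [nullForm]; ring)
  rw [weylForm_eq_weylContract] at h1 h2
  have ei : (2 : ℂ)⁻¹ = ((1 / 2 : ℝ) : ℂ) := by norm_num
  have a1 : selfDual₁ n ![0, n 2, n 0, 0] = n 0 ^ 2 := by
    apply Complex.ext <;> simp [selfDual₁, pow_two]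
  have a2 : selfDual₂ n ![0, n 2, n 0, 0] = -ζ ^ 2 / 2 := by
    rw [div_eq_mul_inv, ei, hζ]
    apply Complex.ext <;> (simp [selfDual₂, pow_two]) <;> linarith
  have a3 : selfDual₃ n ![0, n 2, n 0, 0] = n 0 * ζ := by
    rw [hζ]
    apply Complex.ext <;> simp [selfDual₃] <;> ring
  have b1 : selfDual₁ n ![0, n 3, 0, n 0] = -Complex.I * n 0 ^ 2 := by
    apply Complex.ext <;> simp [selfDual₁, pow_two]
  have b2 : selfDual₂ n ![0, n 3, 0, n 0] = -Complex.I * (-ζ ^ 2 / 2) := by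
    rw [div_eq_mul_inv, ei, hζ]
    apply Complex.ext <;> (simp [selfDual₂, pow_two]) <;> linarith
  have b3 : selfDual₃ n ![0, n 3, 0, n 0] = -Complex.I * (n 0 * ζ) := by
    rw [hζ]
    apply Complex.ext <;> simp [selfDual₃] <;> ring
  rw [a1, a2, a3] at h1
  rw [b1, b2, b3] at h2
  have h3 : weylContract c u v (-Complex.I * n 0 ^ 2) (-Complex.I * (-ζ ^ 2 / 2))
      (-Complex.I * (n 0 * ζ)) =
      -Complex.I * weylContract c u v (n 0 ^ 2) (-ζ ^ 2 / 2) (n 0 * ζ) := by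
    unfold weylContract; ring
  rw [h3] at h2
  apply Complex.ext
  · exact h1
  · simpa using h2

/-- A null vector without `l` component is a multiple of `k`; this is the point at infinity in the
parametrisation of null directions by `ζ / n 0`. -/
lemma eq_smul_of_nullForm {n : Fin 4 → ℝ} (hn : nullForm n n = 0) (h0 : n 0 = 0) :
    n 2 = 0 ∧ n 3 = 0 := by
  simp only [nullForm, h0] at hn
  constructor <;> nlinarith [sq_nonneg (n 2), sq_nonneg (n 3)]

/-- A repeated principal null direction is a double root of the quartic. -/
lemma petrovDisc_eq_zero {c : Fin 5 → ℂ} {n : Fin 4 → ℝ} (hn0 : n ≠ 0) (hn : nullForm n n = 0)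
    (h : ∀ a d, nullForm n d = 0 → weylForm c a n n d = 0) : petrovDisc c = 0 := by
  -- The quartic is `c₀ + 2 c₁ y + (3/2) c₂ y² - c₃ y³ + c₄ y⁴/4` with `y = ζ / n 0`. The direction
  -- of `k` is `y = ∞`, where a double root means `c₃ = c₄ = 0`.
  by_cases h0 : n 0 = 0
  · obtain ⟨h2, h3⟩ := eq_smul_of_nullForm hn h0
    have h1 : n 1 ≠ 0 := fun h1 => hn0 (by ext i; fin_cases i <;> simp [h0, h1, h2, h3])
    have hd : ∀ d : Fin 4 → ℝ, d 0 = 0 → nullForm n d = 0 := fun d hd => by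
      simp [nullForm, h0, h2, h3, hd]
    have p1 := h ![0, 0, 1, 0] ![0, 0, 1, 0] (hd _ rfl)
    have p2 := h ![0, 0, 1, 0] ![0, 0, 0, 1] (hd _ rfl)
    have p3 := h ![1, 0, 0, 0] ![0, 0, 1, 0] (hd _ rfl)
    have p4 := h ![1, 0, 0, 0] ![0, 0, 0, 1] (hd _ rfl)
    simp [weylForm_eq, h0, h2, h3, h1] at p1 p2 p3 p4
    have c4 : c 4 = 0 := Complex.ext p1 p2
    have c3 : c 3 = 0 := Complex.ext p3 p4
    rw [petrovDisc, c3, c4]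
    ring
  · set ζ : ℂ := ⟨n 2, n 3⟩ with hζ
    -- With `k` in the first slot the condition says that the derivative of the quartic vanishes at
    -- `y`; the next line, with a vector orthogonal to `n`, says that the quartic itself does.
    -- Solving for `c 1` and `c 0` turns the vanishing of the discriminant into a polynomial
    -- identity.
    have e1 := weylContract_eq_zero hn (h ![0, 1, 0, 0]) hζ
    have e0 := weylContract_eq_zero hn (h ![0, n 2, n 0, 0]) hζ
    have hn' : n 0 * n 1 = (n 2 ^ 2 + n 3 ^ 2) / 2 := by unfold nullForm at hn; linarith
    have ei : (2 : ℂ)⁻¹ = ((1 / 2 : ℝ) : ℂ) := by norm_num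
    have k1 : selfDual₁ ![0, 1, 0, 0] n = 0 := by
      apply Complex.ext <;> simp [selfDual₁]
    have k2 : selfDual₂ ![0, 1, 0, 0] n = ζ := by
      rw [hζ]; apply Complex.ext <;> simp [selfDual₂]
    have k3 : selfDual₃ ![0, 1, 0, 0] n = -n 0 := by
      apply Complex.ext <;> simp [selfDual₃]
    have d1 : selfDual₁ ![0, n 2, n 0, 0] n = -(n 0 : ℂ) ^ 2 := by
      apply Complex.ext <;> simp [selfDual₁, pow_two]
    have d2 : selfDual₂ ![0, n 2, n 0, 0] n = ζ ^ 2 / 2 := by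
      rw [div_eq_mul_inv, ei, hζ]
      apply Complex.ext <;> (simp [selfDual₂, pow_two]) <;> linarith
    have d3 : selfDual₃ ![0, n 2, n 0, 0] n = -(n 0 * ζ) := by
      rw [hζ]
      apply Complex.ext <;> simp [selfDual₃] <;> ring
    rw [weylContract, k1, k2, k3] at e1
    rw [weylContract, d1, d2, d3] at e0
    have hc : (n 0 : ℂ) ≠ 0 := by exact_mod_cast h0
    generalize (n 0 : ℂ) = r at *
    obtain ⟨y, hy⟩ : ∃ y, ζ = r * y := ⟨ζ / r, by field_simp⟩
    rw [hy] at e0 e1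
    have c1 : c 1 = -(3 / 2) * c 2 * y + 3 / 2 * c 3 * y ^ 2 - c 4 * y ^ 3 / 2 := by
      have : r ^ 3 * (c 1 - (-(3 / 2) * c 2 * y + 3 / 2 * c 3 * y ^ 2 - c 4 * y ^ 3 / 2)) = 0 := by
        linear_combination -e1
      exact sub_eq_zero.1 ((mul_eq_zero.1 this).resolve_left (pow_ne_zero _ hc))
    have c0 : c 0 = -2 * c 1 * y - 3 / 2 * c 2 * y ^ 2 + c 3 * y ^ 3 - c 4 * y ^ 4 / 4 := by
      have : r ^ 4 * (c 0 - (-2 * c 1 * y - 3 / 2 * c 2 * y ^ 2 + c 3 * y ^ 3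
          - c 4 * y ^ 4 / 4)) = 0 := by
        linear_combination -e0
      exact sub_eq_zero.1 ((mul_eq_zero.1 this).resolve_left (pow_ne_zero _ hc))
    rw [petrovDisc, c0, c1]
    ring

/-- If `l` is already a double direction, a triple direction in any position forces `c 2 = 0`. Off
`k`, one test gives `c 2 ζ² = 0`, and another settles `ζ = 0`, where `n` is a multiple of `l`. -/
lemma comp₂_eq_zero {c : Fin 5 → ℂ} (c0 : c 0 = 0) (c1 : c 1 = 0) {n : Fin 4 → ℝ} (hn0 : n ≠ 0)
    (hn : nullForm n n = 0) (h : ∀ a b d, nullForm n d = 0 → weylForm c a b n d = 0) :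
    c 2 = 0 := by
  by_cases h0 : n 0 = 0
  · obtain ⟨h2, h3⟩ := eq_smul_of_nullForm hn h0
    have h1 : n 1 ≠ 0 := fun h1 => hn0 (by ext i; fin_cases i <;> simp [h0, h1, h2, h3])
    have hd : ∀ d : Fin 4 → ℝ, d 0 = 0 → nullForm n d = 0 := fun d hd => by
      simp [nullForm, h0, h2, h3, hd]
    have p1 := h ![1, 0, 0, 0] ![0, 0, 1, 0] ![0, 0, 1, 0] (hd _ rfl)
    have p2 := h ![1, 0, 0, 0] ![0, 0, 1, 0] ![0, 0, 0, 1] (hd _ rfl)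
    simp [weylForm_eq, h0, h2, h3, h1] at p1 p2
    exact Complex.ext p1 p2
  · have e1 := weylContract_eq_zero hn (h ![1, 0, 0, 0] ![0, 0, 1, 0]) rfl
    have e2 := weylContract_eq_zero hn (h ![0, 1, 0, 0] ![0, 0, 1, 0]) rfl
    have hc : (n 0 : ℂ) ≠ 0 := by exact_mod_cast h0
    have z1 : (⟨1, 0⟩ : ℂ) = 1 := rfl
    have z0 : (⟨0, 0⟩ : ℂ) = 0 := rfl
    simp [weylContract, selfDual₁, selfDual₂, selfDual₃, c0, c1, z1, z0] at e1 e2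
    rcases e1 with e1 | e1
    · exact e1
    · rw [e1] at e2
      simpa [hc] using e2

lemma comp₃_eq_zero {c : Fin 5 → ℂ} (c0 : c 0 = 0) (c1 : c 1 = 0) (c2 : c 2 = 0)
    {n : Fin 4 → ℝ} (hn0 : n ≠ 0) (hn : nullForm n n = 0)
    (h : ∀ a b d, weylForm c a b n d = 0) : c 3 = 0 := by
  by_cases h0 : n 0 = 0
  · obtain ⟨h2, h3⟩ := eq_smul_of_nullForm hn h0
    have h1 : n 1 ≠ 0 := fun h1 => hn0 (by ext i; fin_cases i <;> simp [h0, h1, h2, h3])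
    have p1 := h ![1, 0, 0, 0] ![0, 1, 0, 0] ![0, 0, 1, 0]
    have p2 := h ![1, 0, 0, 0] ![0, 1, 0, 0] ![0, 0, 0, 1]
    simp [weylForm_eq, h0, h2, h3, h1] at p1 p2
    exact Complex.ext p1 p2
  · have e1 := weylContract_eq_zero hn (fun d _ => h ![1, 0, 0, 0] ![0, 1, 0, 0] d) rfl
    have z1 : (⟨1, 0⟩ : ℂ) = 1 := rfl
    have z0 : (⟨0, 0⟩ : ℂ) = 0 := rfl
    simp [weylContract, selfDual₁, selfDual₂, selfDual₃, c0, c1, c2, z1, z0] at e1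
    rcases e1 with e1 | e1
    · exact e1
    -- Here `ζ = 0`, so `n` is a multiple of `l` and the previous test is empty; contraction with
    -- `k` in the first and last slots still detects `c 3`.
    · have h2 : n 2 = 0 := congrArg Complex.re e1
      have h3 : n 3 = 0 := congrArg Complex.im e1
      have p1 := h ![0, 1, 0, 0] ![0, 0, 1, 0] ![0, 1, 0, 0]
      have p2 := h ![0, 1, 0, 0] ![0, 0, 0, 1] ![0, 1, 0, 0]
      simp [weylForm_eq, h0, h2, h3] at p1 p2
      exact Complex.ext p1 p2

/-- Components for which there is a repeated principal null direction. -/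
def HasRepeated (c : Fin 5 → ℂ) : Prop :=
  ∃ n, n ≠ 0 ∧ nullForm n n = 0 ∧ ∀ a d, nullForm n d = 0 → weylForm c a n n d = 0

/-- The direction can be normalised to the compact unit sphere, and projecting a closed set along a
compact factor gives a closed set. -/
lemma isClosed_hasRepeated : IsClosed {c | HasRepeated c} := by
  let K := {n : Fin 4 → ℝ // n ∈ Metric.sphere (0 : Fin 4 → ℝ) 1}
  have : CompactSpace K := isCompact_iff_compactSpace.1 (isCompact_sphere _ _)
  -- Vanishing on the vectors orthogonal to `n` is restated as proportionality to `nullForm n`, an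
  -- equation for all `d` and `f`. Unlike a condition on the moving hyperplane, it is visibly
  -- closed.
  let F : Set (K × (Fin 5 → ℂ)) := {p | nullForm p.1.1 p.1.1 = 0 ∧
    ∀ a d f, weylForm p.2 a p.1.1 p.1.1 d * nullForm p.1.1 f =
      weylForm p.2 a p.1.1 p.1.1 f * nullForm p.1.1 d}
  have hF : IsClosed F := by
    have hn : ∀ i, Continuous fun p : K × (Fin 5 → ℂ) => p.1.1 i := fun i =>
      (continuous_apply i).comp (continuous_subtype_val.comp continuous_fst)
    have hc : ∀ i, Continuous fun p : K × (Fin 5 → ℂ) => (p.2 i).re := fun i => by fun_prop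
    have hc' : ∀ i, Continuous fun p : K × (Fin 5 → ℂ) => (p.2 i).im := fun i => by fun_prop
    have hw : ∀ a d, Continuous fun p : K × (Fin 5 → ℂ) => weylForm p.2 a p.1.1 p.1.1 d :=
      fun a d => by simp only [weylForm_eq]; fun_prop
    have he : ∀ f, Continuous fun p : K × (Fin 5 → ℂ) => nullForm p.1.1 f :=
      fun f => by simp only [nullForm]; fun_prop
    have he' : Continuous fun p : K × (Fin 5 → ℂ) => nullForm p.1.1 p.1.1 := by
      simp only [nullForm]; fun_prop
    have hFe : F = {p | nullForm p.1.1 p.1.1 = 0} ∩ ⋂ a, ⋂ d, ⋂ f,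
        {p | weylForm p.2 a p.1.1 p.1.1 d * nullForm p.1.1 f =
          weylForm p.2 a p.1.1 p.1.1 f * nullForm p.1.1 d} := by
      ext p; simp [F]
    rw [hFe]
    apply IsClosed.inter
    · exact isClosed_eq he' continuous_const
    · exact isClosed_iInter fun a => isClosed_iInter fun d => isClosed_iInter fun f =>
        isClosed_eq ((hw a d).mul (he f)) ((hw a f).mul (he d))
  have hp := isClosedMap_snd_of_compactSpace F hF
  convert hp using 1
  ext c
  simp only [mem_ofPred_eq, mem_image, Prod.exists, exists_eq_right]
  constructor
  · rintro ⟨n, hn0, hn, h⟩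
    have hnn : ‖n‖ ≠ 0 := norm_ne_zero_iff.2 hn0
    have hs : ∀ x, nullForm (‖n‖⁻¹ • n) x = ‖n‖⁻¹ * nullForm n x := fun x => by
      simp only [nullForm, Pi.smul_apply, smul_eq_mul]; ring
    refine ⟨⟨‖n‖⁻¹ • n, by simp [norm_smul, hnn]⟩, ?_, fun a d f => ?_⟩
    · have : nullForm n (‖n‖⁻¹ • n) = ‖n‖⁻¹ * nullForm n n := by
        simp only [nullForm, Pi.smul_apply, smul_eq_mul]; ring
      simp only [hs, this, hn, mul_zero]
    · have := h a (nullForm n f • d - nullForm n d • f) (by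
        simp only [nullForm, Pi.smul_apply, Pi.sub_apply, smul_eq_mul]; ring)
      rw [weylForm_sub₄, weylForm_smul₄, weylForm_smul₄] at this
      simp only [hs, weylForm_smul₂₃]
      linear_combination (‖n‖⁻¹) ^ 3 * this
  · rintro ⟨⟨n, hK⟩, hn, h⟩
    have hn0 : n ≠ 0 := fun h0 => by simp [h0] at hK
    refine ⟨n, hn0, hn, fun a d hd => ?_⟩
    obtain ⟨f, hf⟩ := exists_nullForm_ne_zero hn0
    have := h a d f
    simp only [hd, mul_zero] at this
    exact (mul_eq_zero.1 this).resolve_right hf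

lemma not_hasRepeated {c : Fin 5 → ℂ} (h : petrovDisc c ≠ 0) : ¬HasRepeated c :=
  fun ⟨_, hn0, hn, hr⟩ => h (petrovDisc_eq_zero hn0 hn hr)

/-- Components with a non-vanishing discriminant are dense in the aligned ones. -/
lemma mem_closure_petrovDisc_ne_zero {m : ℕ} (hm : m ≤ 1) {c : Fin 5 → ℂ}
    (hc : ∀ i : Fin 5, (i : ℕ) < m → c i = 0) :
    c ∈ closure {c' : Fin 5 → ℂ | (∀ i : Fin 5, (i : ℕ) < m → c' i = 0) ∧ petrovDisc c' ≠ 0} := by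
  -- A point with `c' 0 = 0` and discriminant `-27/4`. On the line from `c` to `c'`, which stays
  -- among the aligned components, the discriminant is a nonzero polynomial in `ε` and has finitely
  -- many zeros.
  let c' : Fin 5 → ℂ := ![0, 1, 0, 0, 1]
  let L : ℝ → Fin 5 → ℂ := fun ε => c + (ε : ℂ) • (c' - c)
  obtain ⟨q, hq⟩ : ∃ q : Fin 5 → Polynomial ℂ, ∀ (ε : ℝ) i, L ε i = (q i).eval (ε : ℂ) :=
    ⟨fun i => Polynomial.C (c i) + Polynomial.X * Polynomial.C (c' i - c i), fun ε i => by
      simp [L]⟩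
  obtain ⟨P, hP⟩ : ∃ P : Polynomial ℂ, ∀ ε : ℝ, petrovDisc (L ε) = P.eval (ε : ℂ) := by
    refine ⟨(q 0 * q 4 + Polynomial.C 2 * q 1 * q 3 + Polynomial.C (3 / 4) * q 2 ^ 2) ^ 3
      - Polynomial.C 27 * (Polynomial.C (1 / 2) * (q 0 * q 2 * q 4) -
        Polynomial.C (1 / 2) * (q 1 * q 2 * q 3) - Polynomial.C (1 / 8) * q 2 ^ 3
        - Polynomial.C (1 / 2) * (q 4 * q 1 ^ 2)
        - Polynomial.C (1 / 2) * (q 0 * q 3 ^ 2)) ^ 2, fun ε => ?_⟩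
    simp only [petrovDisc, hq, Polynomial.eval_add, Polynomial.eval_sub, Polynomial.eval_mul,
      Polynomial.eval_pow, Polynomial.eval_C]
    ring
  have hP0 : P ≠ 0 := fun h => by
    have h1 := hP 1
    have hL1 : L 1 = c' := by simp [L]
    rw [h, hL1] at h1
    simp [petrovDisc, c'] at h1
  have hev : ∀ᶠ ε : ℝ in 𝓝[≠] 0, petrovDisc (L ε) ≠ 0 := by
    have hfin : {ε : ℝ | P.eval (ε : ℂ) = 0}.Finite := by
      have := (Polynomial.finite_setOfPred_isRoot hP0).preimage
        (f := fun ε : ℝ => (ε : ℂ)) Complex.ofReal_injective.injOn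
      exact this
    have : {ε : ℝ | P.eval (ε : ℂ) = 0}ᶜ ∈ 𝓝[≠] (0 : ℝ) :=
      nhdsNE_le_cofinite 0 hfin.compl_mem_cofinite
    filter_upwards [this] with ε hε
    rw [hP]; exact hε
  have hL : Continuous L := by fun_prop
  have hL0 : Tendsto L (𝓝[≠] 0) (𝓝 c) := by
    have : L 0 = c := by simp [L]
    rw [← this]
    exact hL.continuousAt.tendsto.mono_left nhdsWithin_le_nhds
  refine mem_closure_of_tendsto hL0 ?_
  filter_upwards [hev] with ε hε
  refine ⟨fun i hi => ?_, hε⟩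
  have h1 := hc i hi
  have : c' i = 0 := by
    have : i = 0 := by ext; simp; omega
    simp [this, c']
  simp [L, h1, this]

end Genericity

/-! ### Generic Petrov types of aligned Weyl-tensor candidates. -/

section GenericTypes

variable {V : Type*} [AddCommGroup V] [Module ℝ V] {g : LinearMap.BilinForm ℝ V} {l k e₁ e₂ : V}

omit [AddCommGroup V] [Module ℝ V] in
lemma continuous_weylComp (l k e₁ e₂ : V) :
    Continuous fun W : Tens4 V => weylComp W l k e₁ e₂ := by
  have h : ∀ a b c d : V, Continuous fun W : Tens4 V => W a b c d := fun a b c d => by fun_prop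
  have h2 : ∀ f f' : Tens4 V → ℝ, Continuous f → Continuous f' →
      Continuous fun W => (⟨f W, f' W⟩ : ℂ) := fun f f' hf hf' => by
    have : (fun W => (⟨f W, f' W⟩ : ℂ)) = fun W => (f W : ℂ) + f' W * Complex.I := by
      funext W; apply Complex.ext <;> simp
    rw [this]
    fun_prop
  refine continuous_pi fun i => ?_
  fin_cases i
  · exact h2 _ _ (h _ _ _ _) (h _ _ _ _)
  · exact h2 _ _ (h _ _ _ _) (h _ _ _ _)
  · exact h2 _ _ (h _ _ _ _) (h _ _ _ _)
  · exact h2 _ _ (h _ _ _ _) (h _ _ _ _).neg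
  · exact h2 _ _ (h _ _ _ _) (h _ _ _ _).neg

lemma continuous_frameWeyl (g : LinearMap.BilinForm ℝ V) (l k e₁ e₂ : V) :
    Continuous fun c : Fin 5 → ℂ => frameWeyl g l k e₁ e₂ c := by
  refine continuous_pi fun u => continuous_pi fun v => continuous_pi fun w =>
    continuous_pi fun x => ?_
  simp only [frameWeyl, weylForm_eq]
  fun_prop

variable (hg : IsLorentzian g) (hF : IsNullFrame g l k e₁ e₂)
include hF

lemma weylComp_frameWeyl (c : Fin 5 → ℂ) :
    weylComp (frameWeyl g l k e₁ e₂ c) l k e₁ e₂ = c := by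
  have hco := And.intro hF.coord_l (And.intro hF.coord_k (And.intro hF.coord_e₁ hF.coord_e₂))
  ext i
  fin_cases i <;> apply Complex.ext <;> simp [weylComp, frameWeyl, weylForm_eq, hco]

include hg

/-- Aligned candidates form a linear space parametrised by components, so questions of Petrov type
become questions in `ℂ⁵`. -/
lemma mem_alignedCandidates_iff {m : ℕ} (hm : m ≤ 4) (W : Tens4 V) :
    W ∈ alignedCandidates g l m ↔
      ∃ c : Fin 5 → ℂ, (∀ i : Fin 5, (i : ℕ) < m → c i = 0) ∧ W = frameWeyl g l k e₁ e₂ c := by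
  obtain ⟨b, -⟩ := id hg
  constructor
  · rintro ⟨hW, hB⟩
    have e := hW.eq_frameWeyl hF b
    rw [e] at hB
    exact ⟨_, hF.comp_eq_zero hm hB, e⟩
  · rintro ⟨c, hc, rfl⟩
    exact ⟨hF.isWeylCandidate c, hF.belDebever_l hm hc⟩

/-- Genericity among aligned candidates can be checked on complex components. -/
lemma isGenericIn_of_comp {m : ℕ} (hm : m ≤ 4) {P : Tens4 V → Prop} {O : Set (Fin 5 → ℂ)}
    (hO : IsOpen O)
    (hP : ∀ c : Fin 5 → ℂ, (∀ i : Fin 5, (i : ℕ) < m → c i = 0) →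
      (P (frameWeyl g l k e₁ e₂ c) ↔ c ∈ O))
    (hd : ∀ c : Fin 5 → ℂ, (∀ i : Fin 5, (i : ℕ) < m → c i = 0) →
      c ∈ closure {c' | (∀ i : Fin 5, (i : ℕ) < m → c' i = 0) ∧ c' ∈ O}) :
    IsGenericIn (alignedCandidates g l m) P := by
  -- `weylComp` is evaluation at frame vectors and so is continuous on all functions of four vectors
  -- with the pointwise topology; the open set `U` is its preimage of `O`.
  refine ⟨⟨_, hO.preimage (continuous_weylComp l k e₁ e₂), ?_⟩, ?_⟩
  · ext W
    simp only [mem_ofPred_eq, mem_inter_iff, mem_preimage]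
    refine and_congr_right fun hW => ?_
    obtain ⟨c, hc, rfl⟩ := (mem_alignedCandidates_iff hg hF hm W).1 hW
    rw [weylComp_frameWeyl hF, hP c hc]
  · intro W hW
    obtain ⟨c, hc, rfl⟩ := (mem_alignedCandidates_iff hg hF hm W).1 hW
    refine map_mem_closure (continuous_frameWeyl g l k e₁ e₂) (hd c hc) ?_
    rintro c' ⟨h1, h2⟩
    exact ⟨(mem_alignedCandidates_iff hg hF hm _).2 ⟨c', h1, rfl⟩, (hP c' h1).2 h2⟩

omit hg in
lemma frameCoord_ne_zero {n : V} (hn : n ≠ 0) : frameCoord g l k e₁ e₂ n ≠ 0 := fun h => by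
  apply hn
  rw [← hF.frameVec_coord n, h]
  simp [frameVec]

omit hg in
lemma nullForm_frameCoord (u v : V) :
    nullForm (frameCoord g l k e₁ e₂ u) (frameCoord g l k e₁ e₂ v) = g u v := by
  rw [hF.inner_eq u v]
  simp [nullForm, frameCoord]
  ring

omit hg in
lemma forall_frameCoord {p : V → Prop} {q : (Fin 4 → ℝ) → Prop}
    (h : ∀ u, p u ↔ q (frameCoord g l k e₁ e₂ u)) : (∀ u, p u) ↔ ∀ x, q x :=
  ⟨fun hp x => by
    have := (h _).1 (hp (frameVec l k e₁ e₂ x))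
    rwa [hF.coord_frameVec] at this, fun hq u => (h u).2 (hq _)⟩

omit hg in
lemma exists_isPND_two_iff (c : Fin 5 → ℂ) :
    (∃ n, IsPND g (frameWeyl g l k e₁ e₂ c) n 2) ↔ HasRepeated c := by
  have hb : ∀ n, BelDebever g (frameWeyl g l k e₁ e₂ c) n 2 ↔
      ∀ a d, nullForm (frameCoord g l k e₁ e₂ n) d = 0 →
        weylForm c a (frameCoord g l k e₁ e₂ n) (frameCoord g l k e₁ e₂ n) d = 0 := fun n =>
    forall_frameCoord hF fun a => forall_frameCoord hF fun d => by
      rw [nullForm_frameCoord hF]; rfl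
  constructor
  · rintro ⟨n, hn0, hn, h⟩
    exact ⟨_, frameCoord_ne_zero hF hn0, by rw [nullForm_frameCoord hF, hn], (hb n).1 h⟩
  · rintro ⟨x, hx0, hx, h⟩
    refine ⟨frameVec l k e₁ e₂ x, fun h0 => hx0 ?_, ?_, ?_⟩
    · rw [← hF.coord_frameVec x, h0]
      ext i; fin_cases i <;> simp [frameCoord]
    · rw [← nullForm_frameCoord hF, hF.coord_frameVec, hx]
    · rw [hb, hF.coord_frameVec]; exact h

-- Adding a real `ε` to component `m` keeps the lower components zero, and at most one value of `ε`
-- makes component `m` vanish.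
omit [AddCommGroup V] [Module ℝ V] hg hF in
lemma mem_closure_comp_ne_zero (m : Fin 5) {c : Fin 5 → ℂ}
    (hc : ∀ i : Fin 5, (i : ℕ) < m → c i = 0) :
    c ∈ closure {c' | (∀ i : Fin 5, (i : ℕ) < m → c' i = 0) ∧ c' ∈ {c : Fin 5 → ℂ | c m ≠ 0}} := by
  let L : ℝ → Fin 5 → ℂ := fun ε => c + (ε : ℂ) • Pi.single m 1
  have hL : Continuous L := by fun_prop
  have hL0 : Tendsto L (𝓝[≠] 0) (𝓝 c) := by
    have : L 0 = c := by simp [L]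
    rw [← this]
    exact hL.continuousAt.tendsto.mono_left nhdsWithin_le_nhds
  refine mem_closure_of_tendsto hL0 ?_
  have hfin : {ε : ℝ | c m + ε = 0}.Finite :=
    (Set.subsingleton_of_forall_eq (-(c m)).re fun ε hε => by
      have : (ε : ℂ) = -c m := by rw [eq_neg_iff_add_eq_zero, add_comm]; exact hε
      rw [← this, Complex.ofReal_re]).finite
  filter_upwards [nhdsNE_le_cofinite 0 hfin.compl_mem_cofinite] with ε hε
  refine ⟨fun i hi => ?_, ?_⟩
  · have : i ≠ m := fun h => by simp [h] at hi
    simp [L, hc i hi, this]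
  · simpa [L] using hε

/-- Openness comes from compactness and density from the discriminant, so the converse (vanishing
discriminant gives a repeated direction) is never needed. -/
lemma isGenericIn_typeI {m : ℕ} (hm : m ≤ 1) :
    IsGenericIn (alignedCandidates g l m) (IsTypeI g) := by
  refine isGenericIn_of_comp hg hF (by omega) isClosed_hasRepeated.isOpen_compl
    (fun c _ => ?_) fun c hc => ?_
  · rw [IsTypeI, exists_isPND_two_iff hF]; rfl
  · refine closure_mono ?_ (mem_closure_petrovDisc_ne_zero hm hc)
    rintro c' ⟨h1, h2⟩
    exact ⟨h1, not_hasRepeated h2⟩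

omit hg in
lemma l_ne_zero : l ≠ 0 := fun h => by
  have := hF.lk
  simp [h] at this

omit hg in
lemma isPND_l {c : Fin 5 → ℂ} {m : ℕ} (hm : m ≤ 4)
    (hc : ∀ i : Fin 5, (i : ℕ) < m → c i = 0) : IsPND g (frameWeyl g l k e₁ e₂ c) l m :=
  ⟨l_ne_zero hF, hF.ll, hF.belDebever_l hm hc⟩

/-- In this space only `c 4` is free, and type N amounts to `c 4 ≠ 0`. -/
lemma isGenericIn_typeN : IsGenericIn (alignedCandidates g l 4) (IsTypeN g) := by
  refine isGenericIn_of_comp hg hF le_rfl (isOpen_ne_fun (continuous_apply (4 : Fin 5))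
    continuous_const) (fun c hc => ?_) fun c hc => mem_closure_comp_ne_zero 4 hc
  constructor
  · rintro ⟨h, -⟩ h4
    apply h
    have : c = 0 := by
      ext1 i
      by_cases hi : (i : ℕ) < 4
      · exact hc i hi
      · have : i = 4 := by ext; simp; omega
        rw [this]; exact h4
    rw [this]
    funext u v w x; simp [frameWeyl, weylForm]
  · refine fun h => ⟨fun h0 => h ?_, l, isPND_l hF le_rfl hc⟩
    rw [← weylComp_frameWeyl hF c, h0]
    simp [weylComp]; rfl

/-- Type III amounts to `c 3 ≠ 0`: if `c 3 = 0` then `l` is quadruple, and `comp₃_eq_zero` excludes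
quadruple directions elsewhere. -/
lemma isGenericIn_typeIII : IsGenericIn (alignedCandidates g l 3) (IsTypeIII g) := by
  refine isGenericIn_of_comp hg hF (by omega) (isOpen_ne_fun (continuous_apply (3 : Fin 5))
    continuous_const) (fun c hc => ?_) fun c hc => mem_closure_comp_ne_zero 3 hc
  constructor
  · rintro ⟨-, h⟩ h3
    refine h ⟨l, isPND_l hF le_rfl fun i hi => ?_⟩
    by_cases hi : (i : ℕ) < 3
    · exact hc i hi
    · have : i = 3 := by ext; simp; omega
      rw [this]; exact h3
  · refine fun h => ⟨⟨l, isPND_l hF (by omega) hc⟩, ?_⟩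
    rintro ⟨n, hn0, hn, hB⟩
    refine h (comp₃_eq_zero (hc 0 (by norm_num)) (hc 1 (by norm_num)) (hc 2 (by norm_num))
      (frameCoord_ne_zero hF hn0) (by rw [nullForm_frameCoord hF, hn]) fun a b d => ?_)
    have := hB (frameVec l k e₁ e₂ a) (frameVec l k e₁ e₂ b) (frameVec l k e₁ e₂ d)
    simpa only [frameWeyl, hF.coord_frameVec] using this

/-- Type II or D amounts to `c 2 ≠ 0`, by the same argument one order lower, with `comp₂_eq_zero`.
-/
lemma isGenericIn_typeIIorD : IsGenericIn (alignedCandidates g l 2) (IsTypeIIorD g) := by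
  refine isGenericIn_of_comp hg hF (by omega) (isOpen_ne_fun (continuous_apply (2 : Fin 5))
    continuous_const) (fun c hc => ?_) fun c hc => mem_closure_comp_ne_zero 2 hc
  constructor
  · rintro ⟨-, h⟩ h2
    refine h ⟨l, isPND_l hF (by omega) fun i hi => ?_⟩
    by_cases hi : (i : ℕ) < 2
    · exact hc i hi
    · have : i = 2 := by ext; simp; omega
      rw [this]; exact h2
  · refine fun h => ⟨⟨l, isPND_l hF (by omega) hc⟩, ?_⟩
    rintro ⟨n, hn0, hn, hB⟩
    refine h (comp₂_eq_zero (hc 0 (by norm_num)) (hc 1 (by norm_num))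
      (frameCoord_ne_zero hF hn0) (by rw [nullForm_frameCoord hF, hn]) fun a b d hd => ?_)
    have := hB (frameVec l k e₁ e₂ a) (frameVec l k e₁ e₂ b) (frameVec l k e₁ e₂ d)
      (by rw [← nullForm_frameCoord hF, hF.coord_frameVec, hd])
    simpa only [frameWeyl, hF.coord_frameVec] using this

end GenericTypes

/-! ### Calculus of one-sided asymptotic expansions. -/

section Expansions

lemma isBigO_pow_left_of_le {m n : ℕ} (h : m ≤ n) :
    (fun t : ℝ => t ^ n) =O[𝓝[<] (0 : ℝ)] fun t => t ^ m := by
  obtain ⟨k, rfl⟩ := Nat.exists_eq_add_of_le h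
  have : (fun t : ℝ => t ^ k) =O[𝓝[<] (0 : ℝ)] fun _ => (1 : ℝ) :=
    ((continuous_pow k).continuousAt.tendsto.isBigO_one ℝ).mono nhdsWithin_le_nhds
  simpa [pow_add] using (isBigO_refl (fun t : ℝ => t ^ m) _).mul this

lemma isBigO_one_of_continuous {E : Type*} [NormedAddCommGroup E] {f : ℝ → E}
    (hf : ContinuousAt f 0) : f =O[𝓝[<] (0 : ℝ)] fun _ => (1 : ℝ) :=
  (hf.tendsto.isBigO_one ℝ).mono nhdsWithin_le_nhds

lemma isBigO_ofReal_pow (n : ℕ) :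
    (fun t : ℝ => (t : ℂ) ^ n) =O[𝓝[<] (0 : ℝ)] fun t => t ^ n :=
  IsBigO.of_bound 1 (Eventually.of_forall fun t => by simp)

lemma isBigO_polynomial (p : Polynomial ℂ) :
    (fun t : ℝ => p.eval (t : ℂ)) =O[𝓝[<] (0 : ℝ)] fun _ => (1 : ℝ) :=
  isBigO_one_of_continuous (by
    have : Continuous fun t : ℝ => p.eval (t : ℂ) := p.continuous.comp Complex.continuous_ofReal
    exact this.continuousAt)

/-- A polynomial which is `O(t^m)` is divisible by `X^m`. -/
lemma X_pow_dvd_of_isBigO {m : ℕ} : ∀ {p : Polynomial ℂ},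
    (fun t : ℝ => p.eval (t : ℂ)) =O[𝓝[<] (0 : ℝ)] (fun t => t ^ m) → Polynomial.X ^ m ∣ p := by
  induction m with
  | zero => intro p _; simp
  | succ m ih =>
    intro p hp
    have h0 : p.eval 0 = 0 := by
      have h1 : Tendsto (fun t : ℝ => p.eval (t : ℂ)) (𝓝[<] 0) (𝓝 0) := by
        refine hp.trans_tendsto ?_
        have : ContinuousAt (fun t : ℝ => t ^ (m + 1)) 0 := by fun_prop
        have := this.tendsto.mono_left (nhdsWithin_le_nhds (s := Iio 0))
        simpa using this
      have h2 : Tendsto (fun t : ℝ => p.eval (t : ℂ)) (𝓝[<] 0) (𝓝 (p.eval ((0 : ℝ) : ℂ))) := by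
        have : Continuous fun t : ℝ => p.eval (t : ℂ) :=
          p.continuous.comp Complex.continuous_ofReal
        exact this.continuousAt.tendsto.mono_left nhdsWithin_le_nhds
      simpa using tendsto_nhds_unique h2 h1
    obtain ⟨q, rfl⟩ := Polynomial.dvd_iff_isRoot.2 (show p.IsRoot 0 from h0)
    simp only [Polynomial.C_0, sub_zero] at hp ⊢
    rw [pow_succ']
    refine mul_dvd_mul_left _ (ih ?_)
    have h3 : (fun t : ℝ => t⁻¹) =O[𝓝[<] (0 : ℝ)] fun t => t⁻¹ := isBigO_refl _ _
    have h4 : (fun t : ℝ => ((t⁻¹ : ℝ) : ℂ)) =O[𝓝[<] (0 : ℝ)] fun t => t⁻¹ :=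
      IsBigO.of_bound 1 (Eventually.of_forall fun t => by simp)
    refine (h4.mul hp).congr' ?_ ?_
    · filter_upwards [self_mem_nhdsWithin] with t ht
      have : (t : ℂ) ≠ 0 := by exact_mod_cast (ne_of_lt ht)
      simp [this]
    · filter_upwards [self_mem_nhdsWithin] with t ht
      have : t ≠ 0 := ne_of_lt ht
      rw [pow_succ']
      field_simp

/-- `f` has an asymptotic expansion to all orders in powers of `t` as `t → 0⁻`. -/
def HasExpansion (f : ℝ → ℂ) : Prop :=
  ∀ n : ℕ, ∃ p : Polynomial ℂ,
    (fun t : ℝ => f t - p.eval (t : ℂ)) =O[𝓝[<] (0 : ℝ)] fun t => t ^ (n + 1)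

namespace HasExpansion

lemma congr' {f g : ℝ → ℂ} (hf : HasExpansion f) (h : f =ᶠ[𝓝[<] (0 : ℝ)] g) :
    HasExpansion g := fun n => by
  obtain ⟨p, hp⟩ := hf n
  exact ⟨p, hp.congr' (h.mono fun t ht => by simp [ht]) EventuallyEq.rfl⟩

lemma polynomial (p : Polynomial ℂ) : HasExpansion fun t => p.eval (t : ℂ) := fun n =>
  ⟨p, by simpa using isBigO_zero _ _⟩

lemma const (c : ℂ) : HasExpansion fun _ => c := by
  simpa using polynomial (Polynomial.C c)

lemma isBigO_one {f : ℝ → ℂ} (hf : HasExpansion f) :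
    f =O[𝓝[<] (0 : ℝ)] fun _ => (1 : ℝ) := by
  obtain ⟨p, hp⟩ := hf 0
  have h1 := hp.trans (isBigO_pow_left_of_le (Nat.zero_le (0 + 1)))
  simp only [pow_zero] at h1
  simpa using h1.add (isBigO_polynomial p)

lemma add {f g : ℝ → ℂ} (hf : HasExpansion f) (hg : HasExpansion g) :
    HasExpansion fun t => f t + g t := fun n => by
  obtain ⟨p, hp⟩ := hf n
  obtain ⟨q, hq⟩ := hg n
  refine ⟨p + q, (hp.add hq).congr_left fun t => ?_⟩
  simp; ring

lemma mul {f g : ℝ → ℂ} (hf : HasExpansion f) (hg : HasExpansion g) :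
    HasExpansion fun t => f t * g t := fun n => by
  obtain ⟨p, hp⟩ := hf n
  obtain ⟨q, hq⟩ := hg n
  refine ⟨p * q, ?_⟩
  have h1 := hp.mul hg.isBigO_one
  have h2 := (isBigO_polynomial p).mul hq
  simp only [mul_one, one_mul] at h1 h2
  refine (h1.add h2).congr_left fun t => ?_
  simp; ring

lemma const_mul {f : ℝ → ℂ} (c : ℂ) (hf : HasExpansion f) : HasExpansion fun t => c * f t :=
  (const c).mul hf

lemma neg {f : ℝ → ℂ} (hf : HasExpansion f) : HasExpansion fun t => -f t := by
  simpa using hf.const_mul (-1)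

lemma sub {f g : ℝ → ℂ} (hf : HasExpansion f) (hg : HasExpansion g) :
    HasExpansion fun t => f t - g t := by
  simpa only [sub_eq_add_neg] using hf.add hg.neg

lemma pow {f : ℝ → ℂ} (hf : HasExpansion f) (n : ℕ) : HasExpansion fun t => f t ^ n := by
  induction n with
  | zero => simpa using const 1
  | succ n ih => simpa only [pow_succ] using ih.mul hf

/-- Division by a power of `t`. -/
lemma div_pow {f g : ℝ → ℂ} {m : ℕ} (hf : HasExpansion f)
    (h : f =O[𝓝[<] (0 : ℝ)] fun t => t ^ m)
    (hg : ∀ᶠ t : ℝ in 𝓝[<] (0 : ℝ), (t : ℂ) ^ m * g t = f t) : HasExpansion g := fun n => by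
  obtain ⟨p, hp⟩ := hf (m + n)
  have h1 : (fun t : ℝ => p.eval (t : ℂ)) =O[𝓝[<] (0 : ℝ)] fun t => t ^ m := by
    simpa using h.sub (hp.trans (isBigO_pow_left_of_le (by omega)))
  -- The approximation is taken to order `m + n`, so that after the factor `X ^ m` is removed the
  -- quotient is still known to order `n`.
  obtain ⟨q, rfl⟩ := X_pow_dvd_of_isBigO h1
  refine ⟨q, ?_⟩
  have h4 : (fun t : ℝ => (((t ^ m)⁻¹ : ℝ) : ℂ)) =O[𝓝[<] (0 : ℝ)] fun t => (t ^ m)⁻¹ :=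
    IsBigO.of_bound 1 (Eventually.of_forall fun t => by simp)
  refine (h4.mul hp).congr' ?_ ?_
  · filter_upwards [self_mem_nhdsWithin, hg] with t ht hgt
    have : (t : ℂ) ≠ 0 := by exact_mod_cast (ne_of_lt ht)
    rw [← hgt]
    simp only [Complex.ofReal_inv, Complex.ofReal_pow, Polynomial.eval_mul, Polynomial.eval_pow,
      Polynomial.eval_X]
    field_simp
  · filter_upwards [self_mem_nhdsWithin] with t ht
    have : t ≠ 0 := ne_of_lt ht
    rw [add_assoc, pow_add]
    field_simp

/-- The inverse of a function with a nonzero limit. -/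
lemma inv {f : ℝ → ℂ} {c : ℂ} (hf : HasExpansion f) (hc : c ≠ 0)
    (h : Tendsto f (𝓝[<] 0) (𝓝 c)) : HasExpansion fun t => (f t)⁻¹ := fun n => by
  obtain ⟨p, hp⟩ := hf n
  have hp0 : p.eval 0 ≠ 0 := by
    have h1 : Tendsto (fun t : ℝ => f t - p.eval (t : ℂ)) (𝓝[<] 0) (𝓝 0) := by
      refine hp.trans_tendsto ?_
      have : ContinuousAt (fun t : ℝ => t ^ (n + 1)) 0 := by fun_prop
      simpa using this.tendsto.mono_left (nhdsWithin_le_nhds (s := Iio 0))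
    have h2 : Tendsto (fun t : ℝ => p.eval (t : ℂ)) (𝓝[<] 0) (𝓝 (p.eval ((0 : ℝ) : ℂ))) := by
      have : Continuous fun t : ℝ => p.eval (t : ℂ) := p.continuous.comp Complex.continuous_ofReal
      exact this.continuousAt.tendsto.mono_left nhdsWithin_le_nhds
    have h3 := tendsto_nhds_unique h1 (h.sub h2)
    intro h0
    simp [h0] at h3
    exact hc h3.symm
  -- Since `p 0 ≠ 0`, Bézout gives `q p + r X^(n+1) = 1`; thus `q` inverts `p` modulo `X^(n+1)` and
  -- approximates the inverse function.
  have hcop : IsCoprime p (Polynomial.X ^ (n + 1)) := by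
    apply IsCoprime.pow_right
    rw [isCoprime_comm, Polynomial.irreducible_X.coprime_iff_not_dvd, Polynomial.X_dvd_iff,
      Polynomial.coeff_zero_eq_eval_zero]
    exact hp0
  obtain ⟨q, r, hqr⟩ := hcop
  refine ⟨q, ?_⟩
  have hinv : (fun t => (f t)⁻¹) =O[𝓝[<] (0 : ℝ)] fun _ => (1 : ℝ) :=
    (h.inv₀ hc).isBigO_one ℝ
  have h1 : (fun t : ℝ => r.eval (t : ℂ) * (t : ℂ) ^ (n + 1) -
      q.eval (t : ℂ) * (f t - p.eval (t : ℂ))) =O[𝓝[<] (0 : ℝ)] fun t => t ^ (n + 1) := by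
    refine IsBigO.sub ?_ ?_
    · simpa using (isBigO_polynomial r).mul (isBigO_ofReal_pow (n + 1))
    · simpa using (isBigO_polynomial q).mul hp
  have h2 := hinv.mul h1
  simp only [one_mul] at h2
  refine h2.congr' ?_ EventuallyEq.rfl
  filter_upwards [h.eventually_ne hc] with t ht
  have := congrArg (Polynomial.eval (t : ℂ)) hqr
  simp only [Polynomial.eval_add, Polynomial.eval_mul, Polynomial.eval_pow, Polynomial.eval_X,
    Polynomial.eval_one] at this
  field_simp
  linear_combination this

/-- A primitive of a function with an asymptotic expansion has an asymptotic expansion. -/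
lemma of_hasDerivAt {f F : ℝ → ℂ} {a : ℝ} (ha : a < 0) (hf : HasExpansion f)
    (h : ∀ t ∈ Ioo a 0, HasDerivAt F (f t) t) : HasExpansion F := fun n => by
  obtain ⟨p, hp⟩ := hf n
  obtain ⟨P, hP⟩ : ∃ P : Polynomial ℂ, P.derivative = p := by
    refine ⟨p.sum fun i c => Polynomial.monomial (i + 1) (c / (i + 1)), ?_⟩
    conv_rhs => rw [← p.sum_monomial_eq]
    rw [Polynomial.sum, Polynomial.derivative_sum, Polynomial.sum]
    refine Finset.sum_congr rfl fun i _ => ?_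
    rw [Polynomial.derivative_monomial]
    have : (i : ℂ) + 1 ≠ 0 := by exact_mod_cast Nat.succ_ne_zero i
    congr 1
    push_cast
    field_simp
  -- With `P` a primitive of the approximating polynomial `p`, it remains to show that `F - P`
  -- converges to a constant at the rate dictated by its derivative. The endpoint `e` below is at
  -- least `-1`, so that `|t| ≤ 1` and surplus powers can be dropped.
  obtain ⟨C, hC⟩ := hp.bound
  obtain ⟨b, hb, hbC⟩ := mem_nhdsLT_iff_exists_Ioo_subset.1 hC
  set e := max (max a b) (-1) with he
  have he0 : e < 0 := max_lt (max_lt ha hb) (by norm_num)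
  have hG : ∀ t ∈ Ioo e 0, HasDerivAt (fun t : ℝ => F t - P.eval (t : ℂ))
      (f t - p.eval (t : ℂ)) t := fun t ht => by
    refine (h t ⟨lt_of_le_of_lt ((le_max_left _ _).trans (le_max_left _ _)) ht.1, ht.2⟩).sub ?_
    have h1 := (P.hasDerivAt (t : ℂ)).comp_ofReal
    rwa [hP] at h1
  set G : ℝ → ℂ := fun t => F t - P.eval (t : ℂ) with hGdef
  have hbd : ∀ t ∈ Ioo e 0, ‖f t - p.eval (t : ℂ)‖ ≤ C * |t| ^ (n + 1) := fun t ht => by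
    have := hbC ⟨lt_of_le_of_lt ((le_max_right _ _).trans (le_max_left _ _)) ht.1, ht.2⟩
    simpa using this
  have hC0 : 0 ≤ C := by
    have hm : e / 2 ∈ Ioo e 0 := ⟨by linarith, by linarith⟩
    have h1 := (norm_nonneg _).trans (hbd _ hm)
    have h2 : 0 < |e / 2| ^ (n + 1) := pow_pos (abs_pos.2 (by linarith)) _
    exact nonneg_of_mul_nonneg_left h1 h2
  have hmv : ∀ s ∈ Ioo e 0, ∀ t ∈ Ico s 0, ‖G t - G s‖ ≤ C * |s| ^ (n + 1) * |t - s| := by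
    intro s hs t ht
    have := (convex_Ico s 0).norm_image_sub_le_of_norm_hasDerivWithin_le (f := G)
      (f' := fun t => f t - p.eval (t : ℂ)) (C := C * |s| ^ (n + 1)) (x := s) (y := t)
      (fun x hx => (hG x ⟨lt_of_lt_of_le hs.1 hx.1, hx.2⟩).hasDerivWithinAt)
      (fun x hx => (hbd x ⟨lt_of_lt_of_le hs.1 hx.1, hx.2⟩).trans (by
        have h1 : |x| ≤ |s| := by
          rw [abs_of_neg hx.2, abs_of_neg hs.2]; linarith [hx.1]
        gcongr)) ⟨le_rfl, hs.2⟩ ht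
    simpa using this
  -- Nothing is assumed about `F` at the endpoint. Its constant of integration is obtained as a
  -- limit, which exists because `G` is Lipschitz and hence maps the Cauchy filter at `0` to a
  -- Cauchy filter.
  have hlim : ∃ c, Tendsto G (𝓝[<] 0) (𝓝 c) := by
    rw [← cauchy_map_iff_exists_tendsto]
    have hcau : Cauchy (𝓝[<] (0 : ℝ)) := cauchy_nhds.mono nhdsWithin_le_nhds
    refine hcau.map_of_le (s := Ioo e 0) ?_ (le_principal_iff.2 (Ioo_mem_nhdsLT he0))
    have hL : LipschitzOnWith (Real.toNNReal C) G (Ioo e 0) := by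
      refine LipschitzOnWith.of_dist_le_mul fun x hx y hy => ?_
      rw [Real.coe_toNNReal _ hC0]
      wlog hxy : x ≤ y generalizing x y
      · rw [dist_comm, dist_comm x]; exact this y hy x hx (le_of_not_ge hxy)
      rw [dist_comm, dist_comm x, dist_eq_norm, Real.dist_eq]
      refine (hmv x hx y ⟨hxy, hy.2⟩).trans ?_
      have h1 : |x| ≤ 1 := by
        rw [abs_of_neg hx.2]; linarith [hx.1, le_max_right (max a b) (-1)]
      have h2 : |x| ^ (n + 1) ≤ 1 := pow_le_one₀ (abs_nonneg _) h1
      exact mul_le_mul_of_nonneg_right (by nlinarith) (abs_nonneg _)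
    exact hL.uniformContinuousOn
  obtain ⟨c, hc⟩ := hlim
  refine ⟨P + Polynomial.C c, ?_⟩
  refine IsBigO.of_bound C ?_
  filter_upwards [Ioo_mem_nhdsLT he0] with s hs
  have h1 : ‖c - G s‖ ≤ C * |s| ^ (n + 1) * |0 - s| := by
    have t1 : Tendsto (fun t => ‖G t - G s‖) (𝓝[<] 0) (𝓝 ‖c - G s‖) :=
      (hc.sub tendsto_const_nhds).norm
    have t2 : Tendsto (fun t : ℝ => C * |s| ^ (n + 1) * |t - s|) (𝓝[<] 0)
        (𝓝 (C * |s| ^ (n + 1) * |0 - s|)) := by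
      have : ContinuousAt (fun t : ℝ => C * |s| ^ (n + 1) * |t - s|) 0 := by fun_prop
      exact this.tendsto.mono_left nhdsWithin_le_nhds
    refine le_of_tendsto_of_tendsto t1 t2 ?_
    filter_upwards [Ioo_mem_nhdsLT hs.2] with t ht
    exact hmv s hs t ⟨ht.1.le, ht.2⟩
  have h2 : |0 - s| ≤ 1 := by
    rw [zero_sub, abs_neg, abs_of_neg hs.2]; linarith [hs.1, le_max_right (max a b) (-1)]
  have h3 : 0 ≤ C * |s| ^ (n + 1) := by positivity
  have e1 : F s - (P + Polynomial.C c).eval (s : ℂ) = -(c - G s) := by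
    simp [hGdef]; ring
  rw [e1, norm_neg, norm_pow, Real.norm_eq_abs]
  nlinarith

/-- The coefficients of the expansion. -/
lemma exists_coeff {f : ℝ → ℂ} (hf : HasExpansion f) : ∃ c : ℕ → ℂ, ∀ n : ℕ,
    (fun t : ℝ => f t - ∑ i ∈ Finset.range (n + 1), (t : ℂ) ^ i * c i)
      =O[𝓝[<] (0 : ℝ)] fun t => t ^ (n + 1) := by
  choose p hp using hf
  refine ⟨fun i => (p i).coeff i, fun n => ?_⟩
  -- Approximating polynomials of different orders agree up to the lower order, so the diagonal
  -- coefficients define one sequence valid for all orders.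
  have hco : ∀ i ≤ n, (p i).coeff i = (p n).coeff i := fun i hi => by
    have h1 : (fun t : ℝ => (p i - p n).eval (t : ℂ)) =O[𝓝[<] (0 : ℝ)] fun t => t ^ (i + 1) := by
      refine (((hp n).trans (isBigO_pow_left_of_le (by omega))).sub (hp i)).congr_left
        fun t => ?_
      simp
    have h2 := (Polynomial.X_pow_dvd_iff.1 (X_pow_dvd_of_isBigO h1)) i (by omega)
    rw [Polynomial.coeff_sub] at h2
    exact sub_eq_zero.1 h2
  obtain ⟨q, hq⟩ : Polynomial.X ^ (n + 1) ∣
      p n - ∑ i ∈ Finset.range (n + 1), Polynomial.C ((p n).coeff i) * Polynomial.X ^ i := by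
    rw [Polynomial.X_pow_dvd_iff]
    intro d hd
    simp [Polynomial.coeff_X_pow, hd]
  have h3 : (fun t : ℝ => (t : ℂ) ^ (n + 1) * q.eval (t : ℂ)) =O[𝓝[<] (0 : ℝ)]
      fun t => t ^ (n + 1) := by
    simpa using (isBigO_ofReal_pow (n + 1)).mul (isBigO_polynomial q)
  refine ((hp n).add h3).congr_left fun t => ?_
  have h4 := congrArg (Polynomial.eval (t : ℂ)) hq
  simp only [Polynomial.eval_sub, Polynomial.eval_finsetSum, Polynomial.eval_mul,
    Polynomial.eval_pow, Polynomial.eval_X, Polynomial.eval_C] at h4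
  rw [← h4]
  have h5 : ∑ i ∈ Finset.range (n + 1), (t : ℂ) ^ i * (p i).coeff i =
      ∑ i ∈ Finset.range (n + 1), (p n).coeff i * (t : ℂ) ^ i :=
    Finset.sum_congr rfl fun i hi => by
      rw [hco i (by simpa [Nat.lt_succ_iff] using hi), mul_comm]
  rw [h5]
  ring

end HasExpansion

/-- Taylor expansion at the right end of an interval. -/
lemma isBigO_taylor {f : ℝ → ℝ} {a : ℝ} (ha : a < 0) (hf : ContDiffOn ℝ ∞ f (Icc a 0)) (n : ℕ) :
    (fun t : ℝ => f t - ∑ i ∈ Finset.range (n + 1),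
      t ^ i * (iteratedDerivWithin i f (Icc a 0) 0 / i.factorial))
      =O[𝓝[<] (0 : ℝ)] fun t => t ^ (n + 1) := by
  -- Taylor's theorem is used one order higher: its remainder is `o(t^(n+1))`, and the extra term is
  -- itself `O(t^(n+1))`.
  have h1 := (taylor_isLittleO (n := n + 1) (convex_Icc a 0) (right_mem_Icc.2 ha.le)
    (hf.of_le (by exact_mod_cast le_top))).isBigO
  have hle : 𝓝[<] (0 : ℝ) ≤ 𝓝[Icc a 0] 0 := by
    refine le_inf nhdsWithin_le_nhds (le_principal_iff.2 ?_)
    filter_upwards [Ioo_mem_nhdsLT ha] with t ht using ⟨ht.1.le, ht.2.le⟩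
  have h2 := h1.mono hle
  simp only [sub_zero] at h2
  have h3 : (fun t : ℝ => t ^ (n + 1) * (iteratedDerivWithin (n + 1) f (Icc a 0) 0 /
      (n + 1).factorial)) =O[𝓝[<] (0 : ℝ)] fun t => t ^ (n + 1) := by
    simpa using (isBigO_refl (fun t : ℝ => t ^ (n + 1)) (𝓝[<] (0 : ℝ))).mul
      (isBigO_one_of_continuous (f := fun _ => iteratedDerivWithin (n + 1) f (Icc a 0) 0 /
      (n + 1).factorial) continuousAt_const)
  refine (h2.add h3).congr_left fun t => ?_
  rw [taylor_within_apply, Finset.sum_range_succ _ (n + 1)]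
  simp only [sub_zero, smul_eq_mul]
  have : ∑ i ∈ Finset.range (n + 1), ((i.factorial : ℝ)⁻¹ * t ^ i) *
      iteratedDerivWithin i f (Icc a 0) 0 = ∑ i ∈ Finset.range (n + 1),
      t ^ i * (iteratedDerivWithin i f (Icc a 0) 0 / i.factorial) :=
    Finset.sum_congr rfl fun i _ => by ring
  rw [this]
  ring

lemma hasExpansion_of_contDiffOn {f : ℝ → ℝ} {a : ℝ} (ha : a < 0)
    (hf : ContDiffOn ℝ ∞ f (Icc a 0)) : HasExpansion fun t => (f t : ℂ) := fun n => by
  refine ⟨∑ i ∈ Finset.range (n + 1), Polynomial.C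
    ((iteratedDerivWithin i f (Icc a 0) 0 / i.factorial : ℝ) : ℂ) * Polynomial.X ^ i, ?_⟩
  refine IsBigO.trans (IsBigO.of_bound 1 (Eventually.of_forall fun t => ?_))
    (isBigO_taylor ha hf n)
  rw [one_mul, ← Complex.norm_real]
  apply le_of_eq
  congr 1
  push_cast
  rw [Polynomial.eval_finsetSum]
  congr 1
  exact Finset.sum_congr rfl fun i _ => by
    rw [Polynomial.eval_mul, Polynomial.eval_C, Polynomial.eval_pow, Polynomial.eval_X, mul_comm]

end Expansions

/-! ### Substituting the Taylor series of the conformal factor. -/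

section Peeling

/-- `f` agrees up to `O(t⁶)` with the polynomial with given coefficients. -/
def HasTrunc (f : ℝ → ℝ) (a : Fin 6 → ℝ) : Prop :=
  (fun t : ℝ => f t - (a 0 + a 1 * t + a 2 * t ^ 2 + a 3 * t ^ 3 + a 4 * t ^ 4 + a 5 * t ^ 5))
    =O[𝓝[<] (0 : ℝ)] fun t => t ^ 6

/-- Truncated product of polynomials. -/
def truncMul (a b : Fin 6 → ℝ) : Fin 6 → ℝ :=
  ![a 0 * b 0, a 0 * b 1 + a 1 * b 0, a 0 * b 2 + a 1 * b 1 + a 2 * b 0,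
    a 0 * b 3 + a 1 * b 2 + a 2 * b 1 + a 3 * b 0,
    a 0 * b 4 + a 1 * b 3 + a 2 * b 2 + a 3 * b 1 + a 4 * b 0,
    a 0 * b 5 + a 1 * b 4 + a 2 * b 3 + a 3 * b 2 + a 4 * b 1 + a 5 * b 0]

lemma HasTrunc.isBigO_one {f : ℝ → ℝ} {a : Fin 6 → ℝ} (h : HasTrunc f a) :
    f =O[𝓝[<] (0 : ℝ)] fun _ => (1 : ℝ) := by
  have h1 := h.trans (isBigO_pow_left_of_le (Nat.zero_le 6))
  simp only [pow_zero] at h1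
  have h2 := isBigO_one_of_continuous (f := fun t : ℝ =>
    a 0 + a 1 * t + a 2 * t ^ 2 + a 3 * t ^ 3 + a 4 * t ^ 4 + a 5 * t ^ 5) (by fun_prop)
  exact (h1.add h2).congr_left fun t => by ring

lemma HasTrunc.add {f g : ℝ → ℝ} {a b : Fin 6 → ℝ} (hf : HasTrunc f a) (hg : HasTrunc g b) :
    HasTrunc (fun t => f t + g t) (a + b) :=
  (IsBigO.add hf hg).congr_left fun t => by simp only [Pi.add_apply]; ring

lemma HasTrunc.mul {f g : ℝ → ℝ} {a b : Fin 6 → ℝ} (hf : HasTrunc f a) (hg : HasTrunc g b) :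
    HasTrunc (fun t => f t * g t) (truncMul a b) := by
  have h1 := IsBigO.mul hf hg.isBigO_one
  have h2 := (isBigO_one_of_continuous (f := fun t : ℝ =>
    a 0 + a 1 * t + a 2 * t ^ 2 + a 3 * t ^ 3 + a 4 * t ^ 4 + a 5 * t ^ 5) (by fun_prop)).mul hg
  -- The terms of degree 6 to 10 in the product of the two quintic polynomials, written as `t ^ 6`
  -- times a bounded factor.
  have h3 := (isBigO_refl (fun t : ℝ => t ^ 6) (𝓝[<] (0 : ℝ))).mul
    (isBigO_one_of_continuous (f := fun t : ℝ =>
      (a 1 * b 5 + a 2 * b 4 + a 3 * b 3 + a 4 * b 2 + a 5 * b 1)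
      + (a 2 * b 5 + a 3 * b 4 + a 4 * b 3 + a 5 * b 2) * t
      + (a 3 * b 5 + a 4 * b 4 + a 5 * b 3) * t ^ 2
      + (a 4 * b 5 + a 5 * b 4) * t ^ 3 + a 5 * b 5 * t ^ 4) (by fun_prop))
  simp only [mul_one, one_mul] at h1 h2 h3
  refine ((h1.add h2).add h3).congr_left fun t => ?_
  simp [truncMul]
  ring

lemma hasTrunc_of_expansion {f : ℝ → ℝ} {c : ℕ → ℝ}
    (h : (fun t : ℝ => f t - ∑ i ∈ Finset.range 6, t ^ i * c i) =O[𝓝[<] (0 : ℝ)]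
      fun t => t ^ 6) : HasTrunc f ![c 0, c 1, c 2, c 3, c 4, c 5] :=
  h.congr_left fun t => by
    simp [Finset.sum_range_succ]
    ring

/-- Substitution of the expansion of the conformal factor into the five-term decomposition. -/
lemma peeling_expansion {Ω : ℝ → ℝ} {w : ℕ → ℝ} {F : Fin 5 → ℝ → ℝ} {c : Fin 5 → ℕ → ℝ}
    (hΩ : (fun t : ℝ => Ω t - ∑ i ∈ Finset.range 6, t ^ i * (w i / i.factorial))
      =O[𝓝[<] (0 : ℝ)] fun t => t ^ 6)
    (w0 : w 0 = 0) (w1 : w 1 = -1)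
    (hF : ∀ a, (fun t : ℝ => F a t - ∑ i ∈ Finset.range 6, t ^ i * c a i)
      =O[𝓝[<] (0 : ℝ)] fun t => t ^ 6) :
    (fun t : ℝ => ∑ a : Fin 5, Ω t ^ (5 - (a : ℕ)) * F a t -
      (t * coeffN c + t ^ 2 * coeffIII w c + t ^ 3 * coeffIID w c + t ^ 4 * coeffI₄ w c
        + t ^ 5 * coeffI₅ w c)) =O[𝓝[<] (0 : ℝ)] fun t => t ^ 6 := by
  have o1 := hasTrunc_of_expansion hΩ
  simp [w0, w1, Nat.factorial] at o1
  have hf := fun a => hasTrunc_of_expansion (hF a)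
  -- Truncated powers of `Ω`. As `Ω` starts at `-t`, its power `5 - a` starts at order `5 - a`,
  -- which decides what enters each coefficient.
  have o2 := o1.mul o1
  have o3 := o2.mul o1
  have o4 := o3.mul o1
  have o5 := o4.mul o1
  have h := ((((o5.mul (hf 0)).add (o4.mul (hf 1))).add (o3.mul (hf 2))).add
    (o2.mul (hf 3))).add (o1.mul (hf 4))
  refine IsBigO.congr_left h fun t => ?_
  simp [Fin.sum_univ_five, truncMul, coeffN, coeffIII, coeffIID, coeffI₄, coeffI₅]
  ring

end Peeling

/-! ### Levi-Civita connection and curvature, coordinate-free, on domains with boundary. -/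

section LocalGeometry

variable {E : Type*} [NormedAddCommGroup E] [NormedSpace ℝ E]
variable {F : Type*} [NormedAddCommGroup F] [NormedSpace ℝ F]

/-- The product rule for a varying bilinear map and varying arguments, with the derivative kept
abstract except for its values; it serves to differentiate tensor identities. -/
lemma hasFDerivWithinAt_bilin {B : E → E →L[ℝ] E →L[ℝ] F} {a b : E → E} {s : Set E} {y : E}
    {B' : E →L[ℝ] E →L[ℝ] E →L[ℝ] F} {a' b' : E →L[ℝ] E} (hB : HasFDerivWithinAt B B' s y)
    (ha : HasFDerivWithinAt a a' s y) (hb : HasFDerivWithinAt b b' s y) :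
    ∃ L : E →L[ℝ] F, HasFDerivWithinAt (fun z => B z (a z) (b z)) L s y ∧
      ∀ u, L u = B' u (a y) (b y) + B y (a' u) (b y) + B y (a y) (b' u) := by
  refine ⟨_, (hB.clm_apply ha).clm_apply hb, fun u => ?_⟩
  simp
  abel

/-- Admissible domains of differentiation: relatively open parts of a half-space, for
instance. -/
structure IsRegularDomain (s : Set E) : Prop where
  unique : UniqueDiffOn ℝ s
  closure_interior : s ⊆ closure (interior s)

/-- Second derivatives commute even at boundary points, because these are limits of interior points.
-/
lemma IsRegularDomain.symm_second {s : Set E} (hs : IsRegularDomain s) {f : E → F}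
    (hf : ContDiffOn ℝ ∞ f s) {y : E} (hy : y ∈ s) (u v : E) :
    fderivWithin ℝ (fderivWithin ℝ f s) s y u v = fderivWithin ℝ (fderivWithin ℝ f s) s y v u :=
  (hf y hy).isSymmSndFDerivWithinAt
    (by simpa using (WithTop.coe_le_coe.2 le_top : ((2 : ℕ∞) : WithTop ℕ∞) ≤ ((⊤ : ℕ∞) : WithTop ℕ∞))) hs.unique (hs.closure_interior hy) hy u v

/-- Licence to differentiate an identity that holds on `s`, including at its boundary points:
derivatives within `s` are unique. -/
lemma IsRegularDomain.fderiv_eq {s : Set E} (hs : IsRegularDomain s) {f g : E → F} {y : E}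
    (hy : y ∈ s) {L L' : E →L[ℝ] F} (hf : HasFDerivWithinAt f L s y)
    (hg : HasFDerivWithinAt g L' s y) (h : ∀ z ∈ s, f z = g z) : L = L' :=
  (hs.unique y hy).eq hf (hg.congr h (h y hy))

/-- A smooth symmetric non-degenerate metric with its Levi-Civita connection. -/
structure LocalGeometry (s : Set E) (g : E → E →L[ℝ] E →L[ℝ] ℝ) (Γ : E → E →L[ℝ] E →L[ℝ] E) :
    Prop where
  regular : IsRegularDomain s
  symm : ∀ y ∈ s, ∀ u v, g y u v = g y v u
  nondeg : ∀ y ∈ s, ∀ u, (∀ v, g y u v = 0) → u = 0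
  smooth_g : ContDiffOn ℝ ∞ g s
  smooth_Γ : ContDiffOn ℝ ∞ Γ s
  koszul : ∀ y ∈ s, ∀ u v w, 2 * g y (Γ y u v) w = fderivWithin ℝ g s y u v w
    + fderivWithin ℝ g s y v u w - fderivWithin ℝ g s y w u v

lemma hasFDerivWithinAt_of_contDiffOn {f : E → F} {s : Set E} (hf : ContDiffOn ℝ ∞ f s)
    {y : E} (hy : y ∈ s) : HasFDerivWithinAt f (fderivWithin ℝ f s y) s y :=
  ((hf.differentiableOn (by simp)) y hy).hasFDerivWithinAt

/-- The curvature `R(u, v) w` of a connection. -/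
def curv (Γ : E → E →L[ℝ] E →L[ℝ] E) (s : Set E) (y u v w : E) : E :=
  fderivWithin ℝ Γ s y u v w - fderivWithin ℝ Γ s y v u w + Γ y u (Γ y v w) - Γ y v (Γ y u w)

namespace LocalGeometry

variable {s : Set E} {g : E → E →L[ℝ] E →L[ℝ] ℝ} {Γ : E → E →L[ℝ] E →L[ℝ] E}
  (hG : LocalGeometry s g Γ)
include hG

lemma eq_of_inner {y : E} (hy : y ∈ s) {u v : E} (h : ∀ w, g y u w = g y v w) : u = v := by
  rw [← sub_eq_zero]
  exact hG.nondeg y hy _ fun w => by simp [h w]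

lemma deriv_symm {y : E} (hy : y ∈ s) (u v w : E) :
    fderivWithin ℝ g s y u v w = fderivWithin ℝ g s y u w v := by
  have h1 := hasFDerivWithinAt_of_contDiffOn hG.smooth_g hy
  obtain ⟨L, hL, hLu⟩ := hasFDerivWithinAt_bilin h1 (hasFDerivWithinAt_const v y s)
    (hasFDerivWithinAt_const w y s)
  obtain ⟨L', hL', hLu'⟩ := hasFDerivWithinAt_bilin h1 (hasFDerivWithinAt_const w y s)
    (hasFDerivWithinAt_const v y s)
  have h2 := hG.regular.fderiv_eq hy hL hL' fun z hz => hG.symm z hz v w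
  have h3 := hLu u
  rw [h2, hLu' u] at h3
  simpa using h3.symm

lemma christoffel_symm {y : E} (hy : y ∈ s) (u v : E) : Γ y u v = Γ y v u :=
  hG.eq_of_inner hy fun w => by
    have h1 := hG.koszul y hy u v w
    have h2 := hG.koszul y hy v u w
    have h3 := hG.deriv_symm hy w u v
    linarith

/-- Compatibility of the connection with the metric. -/
lemma compat {y : E} (hy : y ∈ s) (u v w : E) :
    fderivWithin ℝ g s y u v w = g y (Γ y u v) w + g y v (Γ y u w) := by
  have h1 := hG.koszul y hy u v w
  have h2 := hG.koszul y hy u w v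
  have h3 := hG.symm y hy v (Γ y u w)
  have h4 := hG.deriv_symm hy u v w
  have h5 := hG.deriv_symm hy v u w
  have h6 := hG.deriv_symm hy w u v
  linarith

lemma deriv_christoffel_symm {y : E} (hy : y ∈ s) (u v w : E) :
    fderivWithin ℝ Γ s y u v w = fderivWithin ℝ Γ s y u w v := by
  have h1 := hasFDerivWithinAt_of_contDiffOn hG.smooth_Γ hy
  obtain ⟨L, hL, hLu⟩ := hasFDerivWithinAt_bilin h1 (hasFDerivWithinAt_const v y s)
    (hasFDerivWithinAt_const w y s)
  obtain ⟨L', hL', hLu'⟩ := hasFDerivWithinAt_bilin h1 (hasFDerivWithinAt_const w y s)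
    (hasFDerivWithinAt_const v y s)
  have h2 := hG.regular.fderiv_eq hy hL hL' fun z hz => hG.christoffel_symm hz v w
  have h3 := hLu u
  rw [h2, hLu' u] at h3
  simpa using h3.symm

lemma curv_bianchi {y : E} (hy : y ∈ s) (u v w : E) :
    curv Γ s y u v w + curv Γ s y v w u + curv Γ s y w u v = 0 := by
  simp only [curv]
  rw [hG.deriv_christoffel_symm hy w u v, hG.deriv_christoffel_symm hy u v w,
    hG.deriv_christoffel_symm hy v w u, hG.christoffel_symm hy w u, hG.christoffel_symm hy v w,
    hG.christoffel_symm hy u v]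
  abel

set_option maxSynthPendingDepth 3 in
/-- The curvature is skew with respect to the metric. -/
lemma curv_skew {y : E} (hy : y ∈ s) (u v w x : E) :
    g y (curv Γ s y u v w) x = -g y w (curv Γ s y u v x) := by
  have hg' := hasFDerivWithinAt_of_contDiffOn hG.smooth_g hy
  have hΓ' := hasFDerivWithinAt_of_contDiffOn hG.smooth_Γ hy
  have hgg : ContDiffOn ℝ ∞ (fderivWithin ℝ g s) s :=
    hG.smooth_g.fderivWithin hG.regular.unique (by simp)
  -- Metric compatibility is differentiated once more. The left side is symmetric in `u` and `v`,
  -- and the antisymmetric part of the right side is the skewness of the curvature.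
  have key : ∀ u v, fderivWithin ℝ (fderivWithin ℝ g s) s y u v w x =
      (g y (Γ y u (Γ y v w)) x + g y (Γ y v w) (Γ y u x) + g y (fderivWithin ℝ Γ s y u v w) x)
      + (g y (Γ y u w) (Γ y v x) + g y w (Γ y u (Γ y v x))
        + g y w (fderivWithin ℝ Γ s y u v x)) := by
    intro u v
    obtain ⟨L0, hL0, hL0'⟩ := hasFDerivWithinAt_bilin (hasFDerivWithinAt_of_contDiffOn hgg hy)
      (hasFDerivWithinAt_const v y s) (hasFDerivWithinAt_const w y s)
    have h1 := hL0.clm_apply (hasFDerivWithinAt_const x y s)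
    have hΓv : ∀ w, ∃ L : E →L[ℝ] E, HasFDerivWithinAt (fun z => Γ z v w) L s y ∧
        ∀ u, L u = fderivWithin ℝ Γ s y u v w := fun w => by
      obtain ⟨L, hL, hLu⟩ := hasFDerivWithinAt_bilin hΓ' (hasFDerivWithinAt_const v y s)
        (hasFDerivWithinAt_const w y s)
      exact ⟨L, hL, fun u => by simpa using hLu u⟩
    obtain ⟨Lw, hLw, hLw'⟩ := hΓv w
    obtain ⟨Lx, hLx, hLx'⟩ := hΓv x
    obtain ⟨L1, hL1, hL1'⟩ := hasFDerivWithinAt_bilin hg' hLw (hasFDerivWithinAt_const x y s)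
    obtain ⟨L2, hL2, hL2'⟩ := hasFDerivWithinAt_bilin hg' (hasFDerivWithinAt_const w y s) hLx
    have h2 := hG.regular.fderiv_eq hy h1 (hL1.add hL2) fun z hz => hG.compat hz v w x
    have h3 := congrArg (fun L => L u) h2
    simp [hL0', hL1', hL2', hLw', hLx'] at h3
    rw [h3, hG.compat hy, hG.compat hy]
  have h1 := key u v
  have h2 := key v u
  have h3 := hG.regular.symm_second hG.smooth_g hy u v
  rw [h3] at h1
  simp only [curv, map_sub, map_add, sub_apply, add_apply]
  linarith

omit hG in
lemma curv_antisymm (y u v w : E) : curv Γ s y v u w = -curv Γ s y u v w := by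
  simp only [curv]; abel

/-- Pair symmetry of the curvature tensor. -/
lemma curv_pair {y : E} (hy : y ∈ s) (u v w x : E) :
    g y (curv Γ s y u v w) x = g y (curv Γ s y w x u) v := by
  have a : ∀ u v w x, g y (curv Γ s y v u w) x = -g y (curv Γ s y u v w) x := fun u v w x => by
    rw [curv_antisymm]; simp
  have b : ∀ u v w x, g y (curv Γ s y u v x) w = -g y (curv Γ s y u v w) x := fun u v w x => by
    rw [hG.curv_skew hy u v w x, hG.symm y hy]; simp
  have c : ∀ u v w x, g y (curv Γ s y u v w) x + g y (curv Γ s y v w u) x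
      + g y (curv Γ s y w u v) x = 0 := fun u v w x => by
    have := congrArg (fun z => g y z x) (hG.curv_bianchi hy u v w)
    simpa using this
  -- The classical octahedron argument: the four cyclic identities, combined with the two
  -- antisymmetries.
  linarith [c u v w x, c v w x u, c w x u v, c x u v w, a u v w x, a v w x u, a w x u v, a x u v w,
    b u v w x, b v w x u, b w x u v, b x u v w, a u w v x, b u w v x, a v x w u, b v x w u,
    a u w x v, a v x u w, b v x u w, b w u v x, b x v w u]

/-- Transformation law of the connection under a change of coordinates. -/
lemma transform {s' : Set E} {g' : E → E →L[ℝ] E →L[ℝ] ℝ} {Γ' : E → E →L[ℝ] E →L[ℝ] E}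
    (hG' : LocalGeometry s' g' Γ') {φ : E → E} (hφ : ContDiffOn ℝ ∞ φ s) (hm : MapsTo φ s s')
    (hg : ∀ y ∈ s, ∀ u v, g y u v =
      g' (φ y) (fderivWithin ℝ φ s y u) (fderivWithin ℝ φ s y v))
    (hsurj : ∀ y ∈ s, Function.Surjective (fderivWithin ℝ φ s y)) {y : E} (hy : y ∈ s) (u v : E) :
    fderivWithin ℝ φ s y (Γ y u v) =
      Γ' (φ y) (fderivWithin ℝ φ s y u) (fderivWithin ℝ φ s y v)
        + fderivWithin ℝ (fderivWithin ℝ φ s) s y u v := by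
  have hJ : ContDiffOn ℝ ∞ (fderivWithin ℝ φ s) s := hφ.fderivWithin hG.regular.unique (by simp)
  have hφ' := hasFDerivWithinAt_of_contDiffOn hφ hy
  have hJ' := hasFDerivWithinAt_of_contDiffOn hJ hy
  have hg' := hasFDerivWithinAt_of_contDiffOn hG.smooth_g hy
  have hgφ := (hasFDerivWithinAt_of_contDiffOn hG'.smooth_g (hm hy)).comp y hφ' hm
  -- The pull-back relation of the metrics is differentiated. In the Koszul combination all but one
  -- pair of second-derivative terms of `φ` cancel, leaving the inhomogeneous term of the
  -- transformation law.
  have key : ∀ u v w, fderivWithin ℝ g s y u v w =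
      fderivWithin ℝ g' s' (φ y) (fderivWithin ℝ φ s y u) (fderivWithin ℝ φ s y v)
        (fderivWithin ℝ φ s y w)
      + g' (φ y) (fderivWithin ℝ (fderivWithin ℝ φ s) s y u v) (fderivWithin ℝ φ s y w)
      + g' (φ y) (fderivWithin ℝ φ s y v) (fderivWithin ℝ (fderivWithin ℝ φ s) s y u w) := by
    intro u v w
    obtain ⟨L1, hL1, hL1'⟩ := hasFDerivWithinAt_bilin hg' (hasFDerivWithinAt_const v y s)
      (hasFDerivWithinAt_const w y s)
    obtain ⟨L2, hL2, hL2'⟩ := hasFDerivWithinAt_bilin hgφ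
      (hJ'.clm_apply (hasFDerivWithinAt_const v y s))
      (hJ'.clm_apply (hasFDerivWithinAt_const w y s))
    have h2 := hG.regular.fderiv_eq hy hL1 hL2 fun z hz => hg z hz v w
    have h3 := congrArg (fun L => L u) h2
    simpa [hL1', hL2'] using h3
  have hsym := fun u v => hG.regular.symm_second hφ hy u v
  apply hG'.eq_of_inner (hm hy)
  intro x
  obtain ⟨w, rfl⟩ := hsurj y hy x
  rw [← hg y hy, map_add, add_apply]
  have h1 := hG.koszul y hy u v w
  have h2 := hG'.koszul _ (hm hy) (fderivWithin ℝ φ s y u) (fderivWithin ℝ φ s y v)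
    (fderivWithin ℝ φ s y w)
  rw [key u v w, key v u w, key w u v, hsym v u, hsym w u, hsym w v] at h1
  have h3 := hG'.symm _ (hm hy) (fderivWithin ℝ φ s y v)
    (fderivWithin ℝ (fderivWithin ℝ φ s) s y u w)
  linarith

/-- Covariance of the curvature under a change of coordinates. -/
lemma curv_transform {s' : Set E} {g' : E → E →L[ℝ] E →L[ℝ] ℝ} {Γ' : E → E →L[ℝ] E →L[ℝ] E}
    (hG' : LocalGeometry s' g' Γ') {φ : E → E} (hφ : ContDiffOn ℝ ∞ φ s) (hm : MapsTo φ s s')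
    (hg : ∀ y ∈ s, ∀ u v, g y u v =
      g' (φ y) (fderivWithin ℝ φ s y u) (fderivWithin ℝ φ s y v))
    (hsurj : ∀ y ∈ s, Function.Surjective (fderivWithin ℝ φ s y)) {y : E} (hy : y ∈ s)
    (u v w : E) :
    fderivWithin ℝ φ s y (curv Γ s y u v w) =
      curv Γ' s' (φ y) (fderivWithin ℝ φ s y u) (fderivWithin ℝ φ s y v)
        (fderivWithin ℝ φ s y w) := by
  have T := fun {y : E} (hy : y ∈ s) u v => hG.transform hG' hφ hm hg hsurj hy u v
  have hJ : ContDiffOn ℝ ∞ (fderivWithin ℝ φ s) s := hφ.fderivWithin hG.regular.unique (by simp)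
  have hH : ContDiffOn ℝ ∞ (fderivWithin ℝ (fderivWithin ℝ φ s) s) s :=
    hJ.fderivWithin hG.regular.unique (by simp)
  have hφ' := hasFDerivWithinAt_of_contDiffOn hφ hy
  have hJ' := hasFDerivWithinAt_of_contDiffOn hJ hy
  have hH' := hasFDerivWithinAt_of_contDiffOn hH hy
  have hΓ' := hasFDerivWithinAt_of_contDiffOn hG.smooth_Γ hy
  have hΓφ := (hasFDerivWithinAt_of_contDiffOn hG'.smooth_Γ (hm hy)).comp y hφ' hm
  -- The transformation law of the connection is differentiated. Antisymmetrising in `u` and `v`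
  -- removes the third derivatives of `φ`, and the terms with second derivatives cancel against
  -- those from the quadratic part of the curvature.
  have key : ∀ u v w, fderivWithin ℝ φ s y (fderivWithin ℝ Γ s y u v w) +
      fderivWithin ℝ (fderivWithin ℝ φ s) s y u (Γ y v w) =
      fderivWithin ℝ Γ' s' (φ y) (fderivWithin ℝ φ s y u) (fderivWithin ℝ φ s y v)
        (fderivWithin ℝ φ s y w)
      + Γ' (φ y) (fderivWithin ℝ (fderivWithin ℝ φ s) s y u v) (fderivWithin ℝ φ s y w)
      + Γ' (φ y) (fderivWithin ℝ φ s y v) (fderivWithin ℝ (fderivWithin ℝ φ s) s y u w)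
      + fderivWithin ℝ (fderivWithin ℝ (fderivWithin ℝ φ s) s) s y u v w := by
    intro u v w
    obtain ⟨L0, hL0, hL0'⟩ := hasFDerivWithinAt_bilin hΓ' (hasFDerivWithinAt_const v y s)
      (hasFDerivWithinAt_const w y s)
    have hL1 := hJ'.clm_apply hL0
    obtain ⟨L2, hL2, hL2'⟩ := hasFDerivWithinAt_bilin hΓφ
      (hJ'.clm_apply (hasFDerivWithinAt_const v y s))
      (hJ'.clm_apply (hasFDerivWithinAt_const w y s))
    obtain ⟨L3, hL3, hL3'⟩ := hasFDerivWithinAt_bilin hH' (hasFDerivWithinAt_const v y s)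
      (hasFDerivWithinAt_const w y s)
    have h2 := hG.regular.fderiv_eq hy hL1 (hL2.add hL3) fun z hz => T hz v w
    have h3 := congrArg (fun L => L u) h2
    simpa [hL0', hL2', hL3'] using h3
  have hsym := fun u v => hG.regular.symm_second hφ hy u v
  have hsym3 : fderivWithin ℝ (fderivWithin ℝ (fderivWithin ℝ φ s) s) s y u v w =
      fderivWithin ℝ (fderivWithin ℝ (fderivWithin ℝ φ s) s) s y v u w := by
    rw [hG.regular.symm_second hJ hy u v]
  have k1 := eq_sub_of_add_eq (key u v w)
  have k2 := eq_sub_of_add_eq (key v u w)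
  simp only [curv, map_sub, map_add, T hy, k1, k2]
  rw [hsym3, hsym v u]
  abel

end LocalGeometry

end LocalGeometry

/-! ### Connection and curvature of a conformally related metric. -/

section Conformal

variable {E : Type*} [NormedAddCommGroup E] [NormedSpace ℝ E]
  {s : Set E} {g ĝ : E → E →L[ℝ] E →L[ℝ] ℝ} {Γ Γ' : E → E →L[ℝ] E →L[ℝ] E}

namespace LocalGeometry

variable (hG : LocalGeometry s g Γ)
include hG

/-- Connection of the conformally related metric `Ω⁻² g`. -/
lemma christoffel_conformal (hG' : LocalGeometry s ĝ Γ') {Ω : E → ℝ} (hΩ : ContDiffOn ℝ ∞ Ω s)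
    (hΩ0 : ∀ y ∈ s, Ω y ≠ 0) (hĝ : ∀ y ∈ s, ∀ u v, ĝ y u v = (Ω y ^ 2)⁻¹ * g y u v)
    {N : E → E} (hN : ∀ y ∈ s, ∀ u, g y (N y) u = fderivWithin ℝ Ω s y u) {y : E} (hy : y ∈ s)
    (u v : E) :
    Γ' y u v = Γ y u v - ((Ω y)⁻¹ * fderivWithin ℝ Ω s y u) • v
      - ((Ω y)⁻¹ * fderivWithin ℝ Ω s y v) • u + ((Ω y)⁻¹ * g y u v) • N y := by
  have h0 := hΩ0 y hy
  have hΩ' := hasFDerivWithinAt_of_contDiffOn hΩ hy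
  have hg' := hasFDerivWithinAt_of_contDiffOn hG.smooth_g hy
  have hĝ' := hasFDerivWithinAt_of_contDiffOn hG'.smooth_g hy
  have key : ∀ u v w, fderivWithin ℝ ĝ s y u v w = (Ω y ^ 2)⁻¹ * fderivWithin ℝ g s y u v w
      - 2 * (Ω y ^ 3)⁻¹ * fderivWithin ℝ Ω s y u * g y v w := by
    intro u v w
    obtain ⟨L1, hL1, hL1'⟩ := hasFDerivWithinAt_bilin hĝ' (hasFDerivWithinAt_const v y s)
      (hasFDerivWithinAt_const w y s)
    obtain ⟨L2, hL2, hL2'⟩ := hasFDerivWithinAt_bilin hg' (hasFDerivWithinAt_const v y s)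
      (hasFDerivWithinAt_const w y s)
    have hi := (hasDerivAt_inv (pow_ne_zero 2 h0)).comp_hasFDerivWithinAt y (hΩ'.pow 2)
    have h2 := hG.regular.fderiv_eq hy hL1 (hi.mul hL2) fun z hz => hĝ z hz v w
    have h3 := congrArg (fun L => L u) h2
    simp [hL1', hL2'] at h3
    rw [h3]
    field_simp
    ring
  refine hG'.eq_of_inner hy fun w => ?_
  have k1 := hG'.koszul y hy u v w
  have k2 := hG.koszul y hy u v w
  rw [key, key, key] at k1
  have k3 := hN y hy w
  have k4 := hG.symm y hy v u
  have k5 := hG.symm y hy u w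
  have k6 := hG.symm y hy v w
  simp only [hĝ y hy, map_sub, map_add, map_smul, sub_apply, add_apply, smul_apply, smul_eq_mul]
  rw [hĝ y hy] at k1
  rw [k3]
  have : 2 * ((Ω y ^ 2)⁻¹ * g y (Γ' y u v) w) = 2 * ((Ω y ^ 2)⁻¹ * (g y (Γ y u v) w
      - (Ω y)⁻¹ * fderivWithin ℝ Ω s y u * g y v w - (Ω y)⁻¹ * fderivWithin ℝ Ω s y v * g y u w
      + (Ω y)⁻¹ * g y u v * fderivWithin ℝ Ω s y w)) := by
    have e : 2 * ((Ω y ^ 2)⁻¹ * g y (Γ' y u v) w) = (Ω y ^ 2)⁻¹ * (2 * g y (Γ y u v) w)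
      - 2 * (Ω y ^ 3)⁻¹ * fderivWithin ℝ Ω s y u * g y v w
      - 2 * (Ω y ^ 3)⁻¹ * fderivWithin ℝ Ω s y v * g y u w
      + 2 * (Ω y ^ 3)⁻¹ * fderivWithin ℝ Ω s y w * g y u v := by
      rw [k2]
      linarith
    rw [e]
    field_simp
  linarith

/-- Curvature of a connection that differs from the Levi-Civita connection by the tensor of a
conformal rescaling. -/
lemma curv_add {θ : E → E →L[ℝ] ℝ} {τ : E → E} (hθ : ContDiffOn ℝ ∞ θ s)
    (hτ : ContDiffOn ℝ ∞ τ s) (hθτ : ∀ y ∈ s, ∀ u, g y (τ y) u = θ y u)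
    (hΓ' : ContDiffOn ℝ ∞ Γ' s)
    (hΓ : ∀ y ∈ s, ∀ u v, Γ' y u v = Γ y u v + θ y u • v + θ y v • u - g y u v • τ y)
    {y : E} (hy : y ∈ s)
    (hsym : ∀ u v, fderivWithin ℝ θ s y u v = fderivWithin ℝ θ s y v u) (u v w : E) :
    curv Γ' s y u v w = curv Γ s y u v w
      + (fderivWithin ℝ θ s y u w - θ y (Γ y u w) - θ y u * θ y w + θ y (τ y) * g y u w) • v
      - (fderivWithin ℝ θ s y v w - θ y (Γ y v w) - θ y v * θ y w + θ y (τ y) * g y v w) • u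
      - g y v w • (fderivWithin ℝ τ s y u + Γ y u (τ y) - θ y u • τ y)
      + g y u w • (fderivWithin ℝ τ s y v + Γ y v (τ y) - θ y v • τ y) := by
  have key : ∀ u v w, fderivWithin ℝ Γ' s y u v w = fderivWithin ℝ Γ s y u v w
      + fderivWithin ℝ θ s y u v • w + fderivWithin ℝ θ s y u w • v
      - (g y v w • fderivWithin ℝ τ s y u
        + (g y (Γ y u v) w + g y v (Γ y u w)) • τ y) := by
    intro u v w
    obtain ⟨L1, hL1, hL1'⟩ := hasFDerivWithinAt_bilin (hasFDerivWithinAt_of_contDiffOn hΓ' hy)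
      (hasFDerivWithinAt_const v y s) (hasFDerivWithinAt_const w y s)
    obtain ⟨L2, hL2, hL2'⟩ := hasFDerivWithinAt_bilin
      (hasFDerivWithinAt_of_contDiffOn hG.smooth_Γ hy)
      (hasFDerivWithinAt_const v y s) (hasFDerivWithinAt_const w y s)
    obtain ⟨L3, hL3, hL3'⟩ := hasFDerivWithinAt_bilin
      (hasFDerivWithinAt_of_contDiffOn hG.smooth_g hy)
      (hasFDerivWithinAt_const v y s) (hasFDerivWithinAt_const w y s)
    have hθ' := fun v : E => (hasFDerivWithinAt_of_contDiffOn hθ hy).clm_apply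
      (hasFDerivWithinAt_const v y s)
    have hτ' := hasFDerivWithinAt_of_contDiffOn hτ hy
    have h2 := hG.regular.fderiv_eq hy hL1 (((hL2.add ((hθ' v).smul_const w)).add
      ((hθ' w).smul_const v)).sub (hL3.smul hτ')) fun z hz => hΓ z hz v w
    have h3 := congrArg (fun L => L u) h2
    simpa [hL1', hL2', hL3', hG.compat hy] using h3
  have e1 : ∀ v w, g y (τ y) (Γ y v w) = θ y (Γ y v w) := fun v w => hθτ y hy _
  have e2 : ∀ v, g y v (τ y) = θ y v := fun v => by rw [hG.symm y hy, hθτ y hy]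
  have e3 := hG.christoffel_symm hy v u
  have e4 := hG.symm y hy v u
  simp only [curv, key, hΓ y hy, map_add, map_sub, map_smul,
    smul_eq_mul, e2, hsym v u, e3, e4, smul_add, smul_sub, add_smul, sub_smul, smul_smul]
  module

/-- Curvature of the conformally related metric `Ω⁻² g`. -/
lemma curv_conformal (hG' : LocalGeometry s ĝ Γ') {Ω : E → ℝ} (hΩ : ContDiffOn ℝ ∞ Ω s)
    (hΩ0 : ∀ y ∈ s, Ω y ≠ 0) (hĝ : ∀ y ∈ s, ∀ u v, ĝ y u v = (Ω y ^ 2)⁻¹ * g y u v)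
    {N : E → E} (hNs : ContDiffOn ℝ ∞ N s)
    (hN : ∀ y ∈ s, ∀ u, g y (N y) u = fderivWithin ℝ Ω s y u) {y : E} (hy : y ∈ s) {K : E → E}
    (hK : ∀ u, K u = -(Ω y)⁻¹ • (fderivWithin ℝ N s y u + Γ y u (N y))
      + ((Ω y ^ 2)⁻¹ * fderivWithin ℝ Ω s y (N y) / 2) • u) :
    (∀ u v, g y (K u) v = g y (K v) u) ∧
    (∀ u v, g y (K u) v = -(Ω y)⁻¹ *
      (fderivWithin ℝ (fderivWithin ℝ Ω s) s y u v - fderivWithin ℝ Ω s y (Γ y u v))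
        + (Ω y ^ 2)⁻¹ * fderivWithin ℝ Ω s y (N y) / 2 * g y u v) ∧
    ∀ u v w, curv Γ' s y u v w = curv Γ s y u v w + g y (K u) w • v - g y (K v) w • u
      - g y v w • K u + g y u w • K v := by
  have h0 := hΩ0 y hy
  have hdΩ : ContDiffOn ℝ ∞ (fderivWithin ℝ Ω s) s :=
    hΩ.fderivWithin hG.regular.unique (by simp)
  have hsymΩ := fun u v => hG.regular.symm_second hΩ hy u v
  have hinv : ContDiffOn ℝ ∞ (fun z => -(Ω z)⁻¹) s := (hΩ.inv hΩ0).neg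
  have hi : HasFDerivWithinAt (fun z => -(Ω z)⁻¹) ((Ω y ^ 2)⁻¹ • fderivWithin ℝ Ω s y) s y := by
    have := ((hasDerivAt_inv h0).comp_hasFDerivWithinAt y
      (hasFDerivWithinAt_of_contDiffOn hΩ hy)).neg
    refine this.congr_fderiv ?_
    ext u
    simp
  -- `θ` is the differential of `-log |Ω|`, hence has symmetric derivative, and `τ` is its metric
  -- dual; the new connection thereby has the shape required by `curv_add`.
  set θ : E → E →L[ℝ] ℝ := fun z => -(Ω z)⁻¹ • fderivWithin ℝ Ω s z with hθdef
  set τ : E → E := fun z => -(Ω z)⁻¹ • N z with hτdef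
  have hθ : ContDiffOn ℝ ∞ θ s := hinv.smul hdΩ
  have hτ : ContDiffOn ℝ ∞ τ s := hinv.smul hNs
  have dθ : ∀ u v, fderivWithin ℝ θ s y u v =
      -(Ω y)⁻¹ * fderivWithin ℝ (fderivWithin ℝ Ω s) s y u v
        + (Ω y ^ 2)⁻¹ * fderivWithin ℝ Ω s y u * fderivWithin ℝ Ω s y v := by
    intro u v
    have h2 := hG.regular.fderiv_eq hy (hasFDerivWithinAt_of_contDiffOn hθ hy)
      (hi.smul (hasFDerivWithinAt_of_contDiffOn hdΩ hy)) fun z hz => rfl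
    have h3 := congrArg (fun L => L u v) h2
    simpa using h3
  have dτ : ∀ u, fderivWithin ℝ τ s y u = -(Ω y)⁻¹ • fderivWithin ℝ N s y u
        + ((Ω y ^ 2)⁻¹ * fderivWithin ℝ Ω s y u) • N y := by
    intro u
    have h2 := hG.regular.fderiv_eq hy (hasFDerivWithinAt_of_contDiffOn hτ hy)
      (hi.smul (hasFDerivWithinAt_of_contDiffOn hNs hy)) fun z hz => rfl
    have h3 := congrArg (fun L => L u) h2
    simpa using h3
  have hθτ : ∀ z ∈ s, ∀ u, g z (τ z) u = θ z u := fun z hz u => by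
    simp [hθdef, hτdef, hN z hz]
  have hΓ : ∀ z ∈ s, ∀ u v, Γ' z u v = Γ z u v + θ z u • v + θ z v • u - g z u v • τ z := by
    intro z hz u v
    rw [hG.christoffel_conformal hG' hΩ hΩ0 hĝ hN hz]
    simp only [hθdef, hτdef, smul_apply, smul_eq_mul]
    module
  have hsym : ∀ u v, fderivWithin ℝ θ s y u v = fderivWithin ℝ θ s y v u := fun u v => by
    rw [dθ, dθ, hsymΩ u v]; ring
  have hc := hG.curv_add hθ hτ hθτ hG'.smooth_Γ hΓ hy hsym
  have dN : ∀ u v, g y (fderivWithin ℝ N s y u + Γ y u (N y)) v =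
      fderivWithin ℝ (fderivWithin ℝ Ω s) s y u v - fderivWithin ℝ Ω s y (Γ y u v) := by
    intro u v
    obtain ⟨L1, hL1, hL1'⟩ := hasFDerivWithinAt_bilin
      (hasFDerivWithinAt_of_contDiffOn hG.smooth_g hy)
      (hasFDerivWithinAt_of_contDiffOn hNs hy) (hasFDerivWithinAt_const v y s)
    have h2 := hG.regular.fderiv_eq hy hL1 ((hasFDerivWithinAt_of_contDiffOn hdΩ hy).clm_apply
      (hasFDerivWithinAt_const v y s)) fun z hz => hN z hz v
    have h3 := congrArg (fun L => L u) h2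
    simp [hL1', hG.compat hy] at h3
    rw [← h3, map_add, add_apply, ← hN y hy]
    ring
  have hKi : ∀ u v, g y (K u) v = -(Ω y)⁻¹ *
      (fderivWithin ℝ (fderivWithin ℝ Ω s) s y u v - fderivWithin ℝ Ω s y (Γ y u v))
        + (Ω y ^ 2)⁻¹ * fderivWithin ℝ Ω s y (N y) / 2 * g y u v := by
    intro u v
    rw [hK, map_add, map_smul, map_smul, add_apply, smul_apply, smul_apply, dN]
    simp only [smul_eq_mul]
  refine ⟨fun u v => ?_, hKi, fun u v w => ?_⟩
  · rw [hKi, hKi, hsymΩ u v, hG.christoffel_symm hy u v, hG.symm y hy u v]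
  -- The term `|θ|² g` is split in halves: one is absorbed in `K`, and the leftovers in `e1` and
  -- `e2` cancel in the final sum, which leaves a curvature change that is linear in `K`.
  · have e1 : ∀ u w, fderivWithin ℝ θ s y u w - θ y (Γ y u w) - θ y u * θ y w
        + θ y (τ y) * g y u w =
        g y (K u) w + (Ω y ^ 2)⁻¹ * fderivWithin ℝ Ω s y (N y) / 2 * g y u w := by
      intro u w
      rw [hKi, dθ]
      simp only [hθdef, hτdef, smul_apply, smul_eq_mul, map_smul]
      field_simp
      ring
    have e2 : ∀ u, fderivWithin ℝ τ s y u + Γ y u (τ y) - θ y u • τ y =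
        K u - ((Ω y ^ 2)⁻¹ * fderivWithin ℝ Ω s y (N y) / 2) • u := by
      intro u
      rw [hK, dτ]
      simp only [hθdef, hτdef, smul_apply, smul_eq_mul, map_smul, smul_smul]
      have : (-(Ω y)⁻¹ * fderivWithin ℝ Ω s y u * -(Ω y)⁻¹) =
        (Ω y ^ 2)⁻¹ * fderivWithin ℝ Ω s y u := by field_simp
      rw [this]
      module
    rw [hc, e1, e1, e2, e2]
    module

end LocalGeometry

end Conformal

/-! ### From component matrices to the coordinate-free setting. -/

section Bridge

/-- The bilinear form with given component matrix. -/
def bil (G : E4 → Matrix (Fin 4) (Fin 4) ℝ) (y : E4) : E4 →L[ℝ] E4 →L[ℝ] ℝ :=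
  ∑ i, ∑ j, G y i j • (EuclideanSpace.proj (𝕜 := ℝ) i : E4 →L[ℝ] ℝ).smulRight
    (EuclideanSpace.proj (𝕜 := ℝ) j : E4 →L[ℝ] ℝ)

/-- The connection with the Christoffel symbols of a component matrix. -/
def chr (G : E4 → Matrix (Fin 4) (Fin 4) ℝ) (y : E4) : E4 →L[ℝ] E4 →L[ℝ] E4 :=
  ∑ k, ∑ i, ∑ j, christoffel G y k i j •
    (EuclideanSpace.proj (𝕜 := ℝ) i : E4 →L[ℝ] ℝ).smulRight
      ((EuclideanSpace.proj (𝕜 := ℝ) j : E4 →L[ℝ] ℝ).smulRight (coordVec k))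

lemma bil_apply (G : E4 → Matrix (Fin 4) (Fin 4) ℝ) (y u v : E4) :
    bil G y u v = ∑ i, ∑ j, G y i j * u i * v j := by
  simp [bil, mul_assoc]

lemma coordVec_apply (i j : Fin 4) : coordVec i j = if j = i then 1 else 0 := by
  simp [coordVec]

lemma sum_coordVec (u : E4) : ∑ i, u i • coordVec i = u := by
  ext j
  simp [coordVec_apply]

lemma bil_coordVec (G : E4 → Matrix (Fin 4) (Fin 4) ℝ) (y : E4) (i j : Fin 4) :
    bil G y (coordVec i) (coordVec j) = G y i j := by
  simp [bil_apply, coordVec_apply]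

lemma chr_apply (G : E4 → Matrix (Fin 4) (Fin 4) ℝ) (y u v : E4) :
    chr G y u v = ∑ k, (∑ i, ∑ j, christoffel G y k i j * u i * v j) • coordVec k := by
  simp [chr, smul_smul, Finset.sum_smul, mul_assoc]

lemma chr_coordVec (G : E4 → Matrix (Fin 4) (Fin 4) ℝ) (y : E4) (i j k : Fin 4) :
    chr G y (coordVec i) (coordVec j) k = christoffel G y k i j := by
  simp [chr_apply, coordVec_apply]

/-- Relatively open parts of the model half-space. -/
structure IsRelOpen (s : Set E4) : Prop where
  subset : s ⊆ range I4
  mem_nhds : ∀ y ∈ s, s ∈ 𝓝[range I4] y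

lemma IsRelOpen.eq_inter {s : Set E4} (hs : IsRelOpen s) :
    ∃ U : Set E4, IsOpen U ∧ s = U ∩ range I4 := by
  refine ⟨interior (s ∪ (range I4)ᶜ), isOpen_interior, ?_⟩
  ext y
  constructor
  · intro hy
    refine ⟨?_, hs.subset hy⟩
    rw [mem_interior_iff_mem_nhds]
    have := hs.mem_nhds y hy
    rw [mem_nhdsWithin_iff_eventually] at this
    filter_upwards [this] with z hz
    by_cases h : z ∈ range I4
    · exact Or.inl (hz h)
    · exact Or.inr h
  · rintro ⟨h1, h2⟩
    rcases interior_subset h1 with h | h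
    · exact h
    · exact absurd h2 h

lemma IsRelOpen.isRegularDomain {s : Set E4} (hs : IsRelOpen s) : IsRegularDomain s := by
  obtain ⟨U, hU, rfl⟩ := hs.eq_inter
  refine ⟨?_, ?_⟩
  · rw [inter_comm]
    exact I4.uniqueDiffOn.inter hU
  · intro y hy
    have h1 : y ∈ closure (interior (range I4)) := I4.range_subset_closure_interior hy.2
    rw [interior_inter, hU.interior_eq]
    exact hU.inter_closure ⟨hy.1, h1⟩

lemma IsRelOpen.eventuallyEq {s : Set E4} (hs : IsRelOpen s) {y : E4} (hy : y ∈ s) :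
    range I4 =ᶠ[𝓝 y] s := by
  have := hs.mem_nhds y hy
  rw [mem_nhdsWithin_iff_eventually] at this
  filter_upwards [this] with z hz
  exact propext ⟨hz, fun h => hs.subset h⟩

lemma IsRelOpen.fderivWithin_eq {F : Type*} [NormedAddCommGroup F] [NormedSpace ℝ F] {s : Set E4}
    (hs : IsRelOpen s) (f : E4 → F) {y : E4} (hy : y ∈ s) :
    fderivWithin ℝ f (range I4) y = fderivWithin ℝ f s y :=
  fderivWithin_congr_set (hs.eventuallyEq hy)

lemma eq_of_coordVec {F : Type*} [AddCommGroup F] [Module ℝ F] {f g : E4 → F}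
    (hf : IsLinearMap ℝ f) (hg : IsLinearMap ℝ g) (h : ∀ i, f (coordVec i) = g (coordVec i))
    (u : E4) : f u = g u := by
  have : ∀ f : E4 → F, IsLinearMap ℝ f → f u = ∑ i, u i • f (coordVec i) := fun f hf => by
    have h1 := map_sum (hf.mk' f) (fun i => u i • coordVec i) Finset.univ
    rw [sum_coordVec] at h1
    simp only [IsLinearMap.mk'_apply, hf.map_smul] at h1
    exact h1
  rw [this f hf, this g hg]
  simp [h]

/-- Partial derivatives are defined within the whole half-space; near a point of a relatively open
part they may be taken within that part. -/
lemma IsRelOpen.pd_eq {s : Set E4} (hs : IsRelOpen s) (f : E4 → ℝ) (i : Fin 4) {y : E4}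
    (hy : y ∈ s) : pd f i y = fderivWithin ℝ f s y (coordVec i) := by
  rw [pd, hs.fderivWithin_eq f hy]

lemma IsRelOpen.contDiffOn_pd {s : Set E4} (hs : IsRelOpen s) {f : E4 → ℝ}
    (hf : ContDiffOn ℝ ∞ f s) (i : Fin 4) : ContDiffOn ℝ ∞ (pd f i) s := by
  have h1 : ContDiffOn ℝ ∞ (fun y => fderivWithin ℝ f s y (coordVec i)) s :=
    (hf.fderivWithin hs.isRegularDomain.unique (by simp)).clm_apply contDiffOn_const
  exact h1.congr fun y hy => hs.pd_eq f i hy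

/-- Cramer's rule: entries of the inverse are polynomials in the entries of `G` divided by the
determinant. -/
lemma contDiffOn_matrix_inv {s : Set E4} {G : E4 → Matrix (Fin 4) (Fin 4) ℝ}
    (hG : ∀ i j, ContDiffOn ℝ ∞ (fun y => G y i j) s) (hdet : ∀ y ∈ s, (G y).det ≠ 0)
    (i j : Fin 4) : ContDiffOn ℝ ∞ (fun y => (G y)⁻¹ i j) s := by
  have hd : ∀ H : E4 → Matrix (Fin 4) (Fin 4) ℝ, (∀ i j, ContDiffOn ℝ ∞ (fun y => H y i j) s) →
      ContDiffOn ℝ ∞ (fun y => (H y).det) s := fun H hH => by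
    simp only [Matrix.det_apply']
    exact ContDiffOn.sum fun σ _ => contDiffOn_const.mul (contDiffOn_prod fun i _ => hH _ _)
  simp only [Matrix.inv_def, Matrix.smul_apply, smul_eq_mul, Ring.inverse_eq_inv',
    Matrix.adjugate_apply]
  refine ((hd G hG).inv hdet).mul (hd _ fun a b => ?_)
  by_cases h : a = j
  · subst h
    simp only [Matrix.updateRow_self]
    exact contDiffOn_const
  · simp only [Matrix.updateRow_ne h]
    exact hG a b

lemma contDiffOn_christoffel {s : Set E4} (hs : IsRelOpen s)
    {G : E4 → Matrix (Fin 4) (Fin 4) ℝ}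
    (hG : ∀ i j, ContDiffOn ℝ ∞ (fun y => G y i j) s) (hdet : ∀ y ∈ s, (G y).det ≠ 0)
    (k i j : Fin 4) : ContDiffOn ℝ ∞ (fun y => christoffel G y k i j) s :=
  contDiffOn_const.mul (ContDiffOn.sum fun l _ => (contDiffOn_matrix_inv hG hdet k l).mul
    (((hs.contDiffOn_pd (hG l j) i).add (hs.contDiffOn_pd (hG l i) j)).sub
      (hs.contDiffOn_pd (hG i j) l)))

/-- Smooth symmetric non-degenerate component matrices. -/
structure IsMetricMatrix (s : Set E4) (G : E4 → Matrix (Fin 4) (Fin 4) ℝ) : Prop where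
  relOpen : IsRelOpen s
  smooth : ∀ i j, ContDiffOn ℝ ∞ (fun y => G y i j) s
  det_ne : ∀ y ∈ s, (G y).det ≠ 0
  symm : ∀ y ∈ s, ∀ i j, G y i j = G y j i

namespace IsMetricMatrix

variable {s : Set E4} {G : E4 → Matrix (Fin 4) (Fin 4) ℝ} (hG : IsMetricMatrix s G)
include hG

set_option maxSynthPendingDepth 3 in
lemma contDiffOn_bil : ContDiffOn ℝ ∞ (bil G) s :=
  ContDiffOn.sum fun i _ => ContDiffOn.sum fun j _ => (hG.smooth i j).smul contDiffOn_const

set_option maxSynthPendingDepth 3 in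
lemma contDiffOn_chr : ContDiffOn ℝ ∞ (chr G) s :=
  ContDiffOn.sum fun k _ => ContDiffOn.sum fun i _ => ContDiffOn.sum fun j _ =>
    (contDiffOn_christoffel hG.relOpen hG.smooth hG.det_ne k i j).smul contDiffOn_const

lemma fderivWithin_bil {y : E4} (hy : y ∈ s) (u : E4) (i j : Fin 4) :
    fderivWithin ℝ (bil G) s y u (coordVec i) (coordVec j) =
      fderivWithin ℝ (fun z => G z i j) s y u := by
  obtain ⟨L, hL, hL'⟩ := hasFDerivWithinAt_bilin
    (hasFDerivWithinAt_of_contDiffOn hG.contDiffOn_bil hy)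
    (hasFDerivWithinAt_const (coordVec i) y s) (hasFDerivWithinAt_const (coordVec j) y s)
  have h := hG.relOpen.isRegularDomain.fderiv_eq hy hL
    (hasFDerivWithinAt_of_contDiffOn (hG.smooth i j) hy) fun z _ => bil_coordVec G z i j
  rw [← h, hL']
  simp

lemma fderivWithin_chr {y : E4} (hy : y ∈ s) (u : E4) (i j k : Fin 4) :
    fderivWithin ℝ (chr G) s y u (coordVec i) (coordVec j) k =
      fderivWithin ℝ (fun z => christoffel G z k i j) s y u := by
  obtain ⟨L, hL, hL'⟩ := hasFDerivWithinAt_bilin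
    (hasFDerivWithinAt_of_contDiffOn hG.contDiffOn_chr hy)
    (hasFDerivWithinAt_const (coordVec i) y s) (hasFDerivWithinAt_const (coordVec j) y s)
  have h := hG.relOpen.isRegularDomain.fderiv_eq hy
    (((EuclideanSpace.proj (𝕜 := ℝ) k : E4 →L[ℝ] ℝ).hasFDerivAt.comp_hasFDerivWithinAt y hL))
    (hasFDerivWithinAt_of_contDiffOn
      (contDiffOn_christoffel hG.relOpen hG.smooth hG.det_ne k i j) hy)
    fun z _ => chr_coordVec G z i j k
  rw [← h]
  simp [hL']

lemma mul_inv {y : E4} (hy : y ∈ s) (i j : Fin 4) :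
    ∑ k, G y i k * (G y)⁻¹ k j = if i = j then 1 else 0 := by
  have := Matrix.mul_nonsing_inv (G y) (isUnit_iff_ne_zero.2 (hG.det_ne y hy))
  have h := congrFun (congrFun this i) j
  rwa [Matrix.mul_apply, Matrix.one_apply] at h

lemma inv_mul {y : E4} (hy : y ∈ s) (i j : Fin 4) :
    ∑ k, (G y)⁻¹ i k * G y k j = if i = j then 1 else 0 := by
  have := Matrix.nonsing_inv_mul (G y) (isUnit_iff_ne_zero.2 (hG.det_ne y hy))
  have h := congrFun (congrFun this i) j
  rwa [Matrix.mul_apply, Matrix.one_apply] at h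

lemma lower_christoffel {y : E4} (hy : y ∈ s) (i j m : Fin 4) :
    ∑ k, G y k m * christoffel G y k i j = 1 / 2 * (pd (fun z => G z m j) i y
      + pd (fun z => G z m i) j y - pd (fun z => G z i j) m y) := by
  simp only [christoffel, Finset.mul_sum]
  rw [Finset.sum_comm]
  have : ∀ l, ∑ k, G y k m * (1 / 2 * ((G y)⁻¹ k l * (pd (fun z => G z l j) i y +
      pd (fun z => G z l i) j y - pd (fun z => G z i j) l y))) =
      (if m = l then 1 else 0) * (1 / 2 * (pd (fun z => G z l j) i y +
      pd (fun z => G z l i) j y - pd (fun z => G z i j) l y)) := fun l => by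
    rw [← hG.mul_inv hy, Finset.sum_mul]
    exact Finset.sum_congr rfl fun k _ => by rw [hG.symm y hy k m]; ring
  simp only [this]
  simp

/-- The Koszul formula is linear in each of the three vectors, so it is enough to check it on
coordinate vectors, where it is the definition of the Christoffel symbols with an index lowered. -/
lemma localGeometry : LocalGeometry s (bil G) (chr G) where
  regular := hG.relOpen.isRegularDomain
  symm y hy u v := by
    rw [bil_apply, bil_apply, Finset.sum_comm]
    exact Finset.sum_congr rfl fun i _ => Finset.sum_congr rfl fun j _ => by
      rw [hG.symm y hy j i]; ring
  nondeg y hy u h := by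
    have h1 : ∀ j, ∑ i, u i * G y i j = 0 := fun j => by
      have := h (coordVec j)
      rw [bil_apply] at this
      simp only [coordVec_apply, mul_ite, mul_one, mul_zero, Finset.sum_ite_eq', Finset.mem_univ,
        if_true] at this
      rw [← this]
      exact Finset.sum_congr rfl fun i _ => mul_comm _ _
    have h2 : Matrix.vecMul u (G y) = 0 := by
      ext j; exact h1 j
    have h3 := Matrix.eq_zero_of_vecMul_eq_zero (hG.det_ne y hy) h2
    ext i
    exact congrFun h3 i
  smooth_g := hG.contDiffOn_bil
  smooth_Γ := hG.contDiffOn_chr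
  koszul y hy u v w := by
    have hb : ∀ i j m : Fin 4, 2 * bil G y (chr G y (coordVec i) (coordVec j)) (coordVec m) =
        fderivWithin ℝ (bil G) s y (coordVec i) (coordVec j) (coordVec m)
        + fderivWithin ℝ (bil G) s y (coordVec j) (coordVec i) (coordVec m)
        - fderivWithin ℝ (bil G) s y (coordVec m) (coordVec i) (coordVec j) := by
      intro i j m
      have e1 : bil G y (chr G y (coordVec i) (coordVec j)) (coordVec m) =
          ∑ k, G y k m * christoffel G y k i j := by
        rw [bil_apply]
        simp only [chr_coordVec, coordVec_apply]
        simp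
      have e2 : ∀ a b c : Fin 4,
          fderivWithin ℝ (bil G) s y (coordVec a) (coordVec b) (coordVec c) =
          pd (fun z => G z b c) a y := fun a b c => by
        rw [hG.fderivWithin_bil hy, hG.relOpen.pd_eq _ _ hy]
      have e3 : ∀ a b c : Fin 4, pd (fun z => G z b c) a y = pd (fun z => G z c b) a y :=
        fun a b c => by
          rw [hG.relOpen.pd_eq _ _ hy, hG.relOpen.pd_eq _ _ hy,
            fderivWithin_congr (fun z hz => hG.symm z hz b c) (hG.symm y hy b c)]
      rw [e1, hG.lower_christoffel hy, e2, e2, e2, e3 i j m, e3 j i m]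
      ring
    refine eq_of_coordVec (f := fun u => 2 * bil G y (chr G y u v) w)
      (g := fun u => fderivWithin ℝ (bil G) s y u v w + fderivWithin ℝ (bil G) s y v u w
        - fderivWithin ℝ (bil G) s y w u v) ?_ ?_ (fun i => ?_) u
    · constructor <;> intros <;> simp <;> ring
    · constructor <;> intros <;> simp <;> ring
    refine eq_of_coordVec (f := fun v => 2 * bil G y (chr G y (coordVec i) v) w)
      (g := fun v => fderivWithin ℝ (bil G) s y (coordVec i) v w
        + fderivWithin ℝ (bil G) s y v (coordVec i) w
        - fderivWithin ℝ (bil G) s y w (coordVec i) v) ?_ ?_ (fun j => ?_) v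
    · constructor <;> intros <;> simp <;> ring
    · constructor <;> intros <;> simp <;> ring
    refine eq_of_coordVec (f := fun w => 2 * bil G y (chr G y (coordVec i) (coordVec j)) w)
      (g := fun w => fderivWithin ℝ (bil G) s y (coordVec i) (coordVec j) w
        + fderivWithin ℝ (bil G) s y (coordVec j) (coordVec i) w
        - fderivWithin ℝ (bil G) s y w (coordVec i) (coordVec j)) ?_ ?_ (hb i j) w
    · constructor <;> intros <;> simp <;> ring
    · constructor <;> intros <;> simp <;> ring

end IsMetricMatrix

end Bridge

/-! ### The trace-free part of a curvature tensor and its conformal behaviour. -/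

section WeylPart

variable {V : Type*} [AddCommGroup V] [Module ℝ V]

/-- The trace of a bilinear expression with respect to a null frame. -/
def frameTrace (B : V → V → ℝ) (l k e₁ e₂ : V) : ℝ := -B l k - B k l + B e₁ e₁ + B e₂ e₂

/-- The algebraic symmetries of a curvature tensor. -/
structure IsCurvatureTensor (R : Tens4 V) : Prop where
  linear : ∀ b c d, IsLinearMap ℝ fun a => R a b c d
  antisymm₁₂ : ∀ a b c d, R b a c d = -R a b c d
  antisymm₃₄ : ∀ a b c d, R a b d c = -R a b c d
  pair_symm : ∀ a b c d, R c d a b = R a b c d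
  cyclic : ∀ a b c d, R a b c d + R b c a d + R c a b d = 0

/-- The Ricci contraction in a null frame. -/
def ricciPart (R : Tens4 V) (l k e₁ e₂ u v : V) : ℝ :=
  frameTrace (fun a b => R a u b v) l k e₁ e₂

/-- The scalar curvature in a null frame. -/
def scalarPart (R : Tens4 V) (l k e₁ e₂ : V) : ℝ :=
  frameTrace (ricciPart R l k e₁ e₂) l k e₁ e₂

/-- The Kulkarni-Nomizu product. -/
def kulkarni (g K : V → V → ℝ) : Tens4 V :=
  fun a b c d => g a c * K b d - g a d * K b c - g b c * K a d + g b d * K a c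

/-- The totally tracefree part of a curvature tensor. -/
def weylPart (g : V → V → ℝ) (l k e₁ e₂ : V) (R : Tens4 V) : Tens4 V :=
  fun a b c d => R a b c d - 1 / 2 * kulkarni g (ricciPart R l k e₁ e₂) a b c d
    + scalarPart R l k e₁ e₂ / 6 * (g a c * g b d - g a d * g b c)

variable {g : LinearMap.BilinForm ℝ V} {l k e₁ e₂ : V} {R : Tens4 V}

namespace IsCurvatureTensor

variable (hR : IsCurvatureTensor R)
include hR

lemma linear₂ (a c d : V) : IsLinearMap ℝ fun b => R a b c d := by
  have h := hR.linear a c d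
  constructor
  · intro x y; have := h.map_add x y; simp only [hR.antisymm₁₂ a] at this; linarith
  · intro r x; have := h.map_smul r x
    simp only [hR.antisymm₁₂ a, smul_eq_mul] at this ⊢; linarith

lemma linear₃ (a b d : V) : IsLinearMap ℝ fun c => R a b c d := by
  have h := hR.linear d a b
  constructor
  · intro x y; have := h.map_add x y; simpa only [hR.pair_symm a b] using this
  · intro r x; have := h.map_smul r x; simpa only [hR.pair_symm a b] using this

lemma linear₄ (a b c : V) : IsLinearMap ℝ fun d => R a b c d := by
  have h := hR.linear₂ c a b
  constructor
  · intro x y; have := h.map_add x y; simpa only [hR.pair_symm a b] using this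
  · intro r x; have := h.map_smul r x; simpa only [hR.pair_symm a b] using this

lemma ricciPart_symm (u v : V) : ricciPart R l k e₁ e₂ u v = ricciPart R l k e₁ e₂ v u := by
  simp only [ricciPart, frameTrace]
  rw [hR.pair_symm k v l u, hR.pair_symm l v k u, hR.pair_symm e₁ v e₁ u,
    hR.pair_symm e₂ v e₂ u]
  ring

lemma ricciPart_linear (v : V) : IsLinearMap ℝ fun u => ricciPart R l k e₁ e₂ u v := by
  constructor
  · intro x y
    simp only [ricciPart, frameTrace, (hR.linear₂ _ _ _).map_add]; ring
  · intro r x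
    simp only [ricciPart, frameTrace, (hR.linear₂ _ _ _).map_smul, smul_eq_mul]; ring

end IsCurvatureTensor

namespace IsNullFrame

variable (hF : IsNullFrame g l k e₁ e₂)
include hF

/-- Contraction of the metric with a linear form. -/
lemma frameTrace_left {f : V → ℝ} (hf : IsLinearMap ℝ f) (v : V) :
    frameTrace (fun a b => g a v * f b) l k e₁ e₂ = f v := by
  conv_rhs => rw [hF.expand v]
  simp only [frameTrace, hf.map_add, hf.map_smul, smul_eq_mul]
  ring

lemma frameTrace_right {f : V → ℝ} (hf : IsLinearMap ℝ f) (v : V) :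
    frameTrace (fun a b => g v b * f a) l k e₁ e₂ = f v := by
  conv_rhs => rw [hF.expand v]
  simp only [frameTrace, hf.map_add, hf.map_smul, smul_eq_mul, hF.symm v]
  ring

lemma frameTrace_metric : frameTrace (fun a b => g a b) l k e₁ e₂ = 4 := by
  simp only [frameTrace, hF.lk, hF.kl, hF.e₁e₁, hF.e₂e₂]; norm_num

/-- The coefficient 2 is `dim - 2`; this contraction drives both tracelessness of the Weyl part and
its conformal invariance. -/
lemma ricciPart_kulkarni {K : V → V → ℝ} (hK : ∀ v, IsLinearMap ℝ fun u => K u v)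
    (hs : ∀ u v, K u v = K v u) (u v : V) :
    ricciPart (kulkarni (fun u v => g u v) K) l k e₁ e₂ u v =
      2 * K u v + g u v * frameTrace K l k e₁ e₂ := by
  have hK' : ∀ u, IsLinearMap ℝ fun v => K u v := fun u => by
    simpa only [hs u] using hK u
  have h1 := hF.frameTrace_left (hK' u) v
  have h2 := hF.frameTrace_right (hK v) u
  have h3 := hF.frameTrace_metric
  simp only [ricciPart, kulkarni, frameTrace] at h1 h2 h3 ⊢
  linear_combination (-1 : ℝ) * h1 - h2 + K u v * h3

/-- The constants `1/2` and `1/6` are those of dimension four: the trace is `Ric - (1/2)(2 Ric + S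
g) + (S/6)(4 g - g) = 0`. -/
lemma isWeylCandidate_weylPart (hR : IsCurvatureTensor R) :
    IsWeylCandidate g (weylPart (fun u v => g u v) l k e₁ e₂ R) := by
  have hs : ∀ u v, ricciPart R l k e₁ e₂ u v = ricciPart R l k e₁ e₂ v u := hR.ricciPart_symm
  have hl : ∀ v, IsLinearMap ℝ fun u => ricciPart R l k e₁ e₂ u v := hR.ricciPart_linear
  have hlin : ∀ b c d, IsLinearMap ℝ fun a => weylPart (fun u v => g u v) l k e₁ e₂ R a b c d := by
    intro b c d
    constructor
    · intro x y
      simp only [weylPart, kulkarni, (hR.linear _ _ _).map_add, (hl _).map_add, map_add,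
        LinearMap.add_apply]
      ring
    · intro r x
      simp only [weylPart, kulkarni, (hR.linear _ _ _).map_smul, (hl _).map_smul, map_smul,
        LinearMap.smul_apply, smul_eq_mul]
      ring
  have hpair : ∀ a b c d, weylPart (fun u v => g u v) l k e₁ e₂ R c d a b =
      weylPart (fun u v => g u v) l k e₁ e₂ R a b c d := by
    intro a b c d
    simp only [weylPart, kulkarni]
    rw [hR.pair_symm a b c d, hs a c, hs b d, hs a d, hs b c, hF.symm c a, hF.symm d b,
      hF.symm c b, hF.symm d a]
    ring
  refine ⟨hlin, ?_, ?_, hpair, ?_, ?_⟩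
  · intro a b c d
    simp only [weylPart, kulkarni]
    rw [hR.antisymm₁₂ a b c d]
    ring
  · intro a b c d
    simp only [weylPart, kulkarni]
    rw [hR.antisymm₃₄ a b c d]
    ring
  · intro a b c d
    simp only [weylPart, kulkarni]
    have := hR.cyclic a b c d
    rw [hF.symm b a, hF.symm c a, hF.symm c b, hs b a, hs c a, hs c b]
    linear_combination this
  · intro b u v
    have hlin3 : ∀ u v w, IsLinearMap ℝ fun c =>
        weylPart (fun u v => g u v) l k e₁ e₂ R u v c w := fun a b d => by
      have h := hlin d a b
      constructor
      · intro x y; have := h.map_add x y; simpa only [hpair a b] using this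
      · intro r x; have := h.map_smul r x; simpa only [hpair a b] using this
    let B : V →ₗ[ℝ] V →ₗ[ℝ] ℝ := LinearMap.mk₂ ℝ
      (fun x y => weylPart (fun u v => g u v) l k e₁ e₂ R x u y v)
      (fun x x' y => (hlin u y v).map_add x x') (fun r x y => (hlin u y v).map_smul r x)
      (fun x y y' => (hlin3 x u v).map_add y y')
      (fun r x y => (hlin3 x u v).map_smul r y)
    have h1 := hF.trace_eq b B
    have e : ∀ x y, B x y = weylPart (fun u v => g u v) l k e₁ e₂ R x u y v := fun x y => rfl
    simp only [e] at h1
    rw [trace13, h1]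
    have h2 := hF.ricciPart_kulkarni hl hs u v
    have h4 := hF.frameTrace_metric
    have h5 := hF.frameTrace_left (f := fun b => g u b)
      ⟨fun _ _ => map_add _ _ _, fun _ _ => map_smul _ _ _⟩ v
    have h7 : frameTrace (ricciPart R l k e₁ e₂) l k e₁ e₂ = scalarPart R l k e₁ e₂ := rfl
    rw [h7] at h2
    simp only [ricciPart, frameTrace] at h2 h4 h5
    simp only [weylPart]
    linear_combination -1 / 2 * h2 + scalarPart R l k e₁ e₂ / 6 * (g u v * h4 - h5)

end IsNullFrame

lemma IsNullTetrad.smul (h : IsNullTetrad g l k e₁ e₂) {r : ℝ} (hr : r ≠ 0) :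
    IsNullTetrad ((r ^ 2)⁻¹ • g) (r • l) (r • k) (r • e₁) (r • e₂) := by
  obtain ⟨ll, kk, lk, e11, e22, e12, l1, l2, k1, k2⟩ := h
  constructor <;> simp [*] <;> field_simp

lemma IsNullFrame.smul (h : IsNullFrame g l k e₁ e₂) {r : ℝ} (hr : r ≠ 0) :
    IsNullFrame ((r ^ 2)⁻¹ • g) (r • l) (r • k) (r • e₁) (r • e₂) where
  toIsNullTetrad := h.toIsNullTetrad.smul hr
  symm u v := by simp [h.symm u v]
  expand u := by
    conv_lhs => rw [h.expand u]
    simp only [LinearMap.smul_apply, map_smul, smul_smul, smul_eq_mul]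
    field_simp

lemma IsLorentzian.smul (h : IsLorentzian g) {r : ℝ} (hr : r ≠ 0) :
    IsLorentzian ((r ^ 2)⁻¹ • g) := by
  obtain ⟨b, hb⟩ := h
  refine ⟨b.unitsSMul fun _ => Units.mk0 r hr, fun i j => ?_⟩
  simp only [Module.Basis.unitsSMul_apply, LinearMap.smul_apply, map_smul, smul_eq_mul,
    Units.smul_mk0, hb]
  split_ifs <;> field_simp

/-- A Lorentzian form has a null frame. -/
lemma IsLorentzian.exists_isNullFrame (hg : IsLorentzian g) :
    ∃ l k e₁ e₂, IsNullFrame g l k e₁ e₂ := by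
  obtain ⟨b, hb⟩ := id hg
  refine ⟨b 0 + b 1, (1 / 2 : ℝ) • (b 0 - b 1), b 2, b 3, IsNullTetrad.isNullFrame hg ?_⟩
  constructor <;> simp [hb] <;> norm_num

/-- Behaviour of the Ricci contraction under a conformal change of the metric. -/
lemma IsNullFrame.ricciPart_conformal (hF : IsNullFrame g l k e₁ e₂) {K : V → V → ℝ}
    (hK : ∀ v, IsLinearMap ℝ fun u => K u v) (hs : ∀ u v, K u v = K v u) {r : ℝ} (hr : r ≠ 0)
    {R' : Tens4 V}
    (hR : IsCurvatureTensor R)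
    (hR' : ∀ a b c d, R' a b c d =
      (r ^ 2)⁻¹ * (R a b c d - kulkarni (fun u v => g u v) K a b c d)) (u v : V) :
    ricciPart R' (r • l) (r • k) (r • e₁) (r • e₂) u v =
      ricciPart R l k e₁ e₂ u v - (2 * K u v + g u v * frameTrace K l k e₁ e₂) := by
  have hK' : ∀ u, IsLinearMap ℝ fun v => K u v := fun u => by
    simpa only [hs u] using hK u
  rw [← hF.ricciPart_kulkarni hK hs]
  simp only [ricciPart, frameTrace, hR', kulkarni, (hR.linear _ _ _).map_smul,
    (hR.linear₃ _ _ _).map_smul, (hK _).map_smul, (hK' _).map_smul, map_smul,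
    LinearMap.smul_apply, smul_eq_mul]
  field_simp
  ring

/-- Tracing the Ricci formula turns `2 K + g tr K` into `(2 + 4) tr K`; the factor `r ^ 2` comes
from the rescaled frame. -/
lemma IsNullFrame.scalarPart_conformal (hF : IsNullFrame g l k e₁ e₂) {K : V → V → ℝ}
    (hK : ∀ v, IsLinearMap ℝ fun u => K u v) (hs : ∀ u v, K u v = K v u) {r : ℝ} (hr : r ≠ 0)
    {R' : Tens4 V}
    (hR : IsCurvatureTensor R)
    (hR' : ∀ a b c d, R' a b c d =
      (r ^ 2)⁻¹ * (R a b c d - kulkarni (fun u v => g u v) K a b c d)) :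
    scalarPart R' (r • l) (r • k) (r • e₁) (r • e₂) =
      r ^ 2 * (scalarPart R l k e₁ e₂ - 6 * frameTrace K l k e₁ e₂) := by
  have h := hF.ricciPart_conformal hK hs hr hR hR'
  have hK' : ∀ u, IsLinearMap ℝ fun v => K u v := fun u => by
    simpa only [hs u] using hK u
  have hl : ∀ v, IsLinearMap ℝ fun u => ricciPart R l k e₁ e₂ u v := hR.ricciPart_linear
  have hl' : ∀ u, IsLinearMap ℝ fun v => ricciPart R l k e₁ e₂ u v := fun u => by
    simpa only [hR.ricciPart_symm u] using hl u
  have h3 := hF.frameTrace_metric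
  rw [scalarPart, frameTrace, h, h, h, h, scalarPart]
  simp only [(hl _).map_smul, (hl' _).map_smul, (hK _).map_smul, (hK' _).map_smul, map_smul,
    LinearMap.smul_apply, smul_eq_mul]
  simp only [frameTrace] at h3 ⊢
  linear_combination -r ^ 2 * (-K l k - K k l + K e₁ e₁ + K e₂ e₂) * h3

/-- The Weyl tensor with all indices down is a conformal density. -/
lemma IsNullFrame.weylPart_conformal (hF : IsNullFrame g l k e₁ e₂) {K : V → V → ℝ}
    (hK : ∀ v, IsLinearMap ℝ fun u => K u v) (hs : ∀ u v, K u v = K v u) {r : ℝ} (hr : r ≠ 0)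
    {R' : Tens4 V}
    (hR : IsCurvatureTensor R)
    (hR' : ∀ a b c d, R' a b c d =
      (r ^ 2)⁻¹ * (R a b c d - kulkarni (fun u v => g u v) K a b c d)) (a b c d : V) :
    weylPart (fun u v => ((r ^ 2)⁻¹ • g) u v) (r • l) (r • k) (r • e₁) (r • e₂) R' a b c d =
      (r ^ 2)⁻¹ * weylPart (fun u v => g u v) l k e₁ e₂ R a b c d := by
  have h := hF.ricciPart_conformal hK hs hr hR hR'
  have h' := hF.scalarPart_conformal hK hs hr hR hR'
  simp only [weylPart, hR', h', kulkarni, h, LinearMap.smul_apply, smul_eq_mul]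
  field_simp
  ring

end WeylPart

/-! ### Coordinate curvature expressions as frame contractions. -/

section CoordinateCurvature

lemma IsCurvatureTensor.eq_sum {R : Tens4 E4} (hR : IsCurvatureTensor R) (u v w x : E4) :
    ∑ a, ∑ b, ∑ c, ∑ d, R (coordVec a) (coordVec b) (coordVec c) (coordVec d)
      * u a * v b * w c * x d = R u v w x := by
  have h : ∀ f : E4 → ℝ, IsLinearMap ℝ f → ∀ u, ∑ i, f (coordVec i) * u i = f u := by
    intro f hf u
    have h1 := map_sum (hf.mk' f) (fun i => u i • coordVec i) Finset.univ
    rw [sum_coordVec] at h1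
    simp only [IsLinearMap.mk'_apply, hf.map_smul, smul_eq_mul] at h1
    rw [h1]
    exact Finset.sum_congr rfl fun i _ => mul_comm _ _
  rw [← h _ (hR.linear v w x) u]
  refine Finset.sum_congr rfl fun a _ => ?_
  rw [← h _ (hR.linear₂ (coordVec a) w x) v, Finset.sum_mul]
  refine Finset.sum_congr rfl fun b _ => ?_
  rw [← h _ (hR.linear₃ (coordVec a) (coordVec b) x) w, Finset.sum_mul, Finset.sum_mul]
  refine Finset.sum_congr rfl fun c _ => ?_
  rw [← h _ (hR.linear₄ (coordVec a) (coordVec b) (coordVec c)) x, Finset.sum_mul, Finset.sum_mul,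
    Finset.sum_mul]
  exact Finset.sum_congr rfl fun d _ => by ring

lemma IsWeylCandidate.isCurvatureTensor {V : Type*} [AddCommGroup V] [Module ℝ V]
    {g : LinearMap.BilinForm ℝ V} {W : Tens4 V} (hW : IsWeylCandidate g W) :
    IsCurvatureTensor W :=
  ⟨hW.linear, hW.antisymm₁₂, hW.antisymm₃₄, hW.pair_symm, hW.cyclic⟩

/-- The coordinate basis. -/
def coordBasis : Module.Basis (Fin 4) ℝ E4 := (EuclideanSpace.basisFun (Fin 4) ℝ).toBasis

lemma coordBasis_apply (i : Fin 4) : coordBasis i = coordVec i := by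
  simp [coordBasis, coordVec]

/-- The curvature tensor with all indices down. -/
def riem (G : E4 → Matrix (Fin 4) (Fin 4) ℝ) (s : Set E4) (y : E4) : Tens4 E4 :=
  fun u v w x => bil G y (curv (chr G) s y v u w) x

namespace IsMetricMatrix

variable {s : Set E4} {G : E4 → Matrix (Fin 4) (Fin 4) ℝ} (hG : IsMetricMatrix s G)
  {y : E4} (hy : y ∈ s)
include hG hy

lemma isCurvatureTensor_riem : IsCurvatureTensor (riem G s y) := by
  have L := hG.localGeometry
  have h12 : ∀ a b c d, riem G s y b a c d = -riem G s y a b c d := fun a b c d => by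
    simp only [riem]; rw [LocalGeometry.curv_antisymm]; simp
  refine ⟨fun b c d => ?_, h12, fun a b c d => ?_, fun a b c d => ?_, fun a b c d => ?_⟩
  · constructor <;> intros <;> simp [riem, curv] <;> ring
  · simp only [riem]
    rw [L.curv_skew hy b a c d, L.symm y hy]
    simp
  · simp only [riem]
    rw [L.curv_pair hy b a c d, LocalGeometry.curv_antisymm, map_neg, neg_apply,
      L.curv_skew hy c d a b, L.symm y hy, neg_neg]
  · have h := congrArg (fun z => bil G y z d) (L.curv_bianchi hy a b c)
    simp only [map_add, add_apply, map_zero, zero_apply] at h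
    simp only [riem]
    rw [LocalGeometry.curv_antisymm (y := y) a b c, LocalGeometry.curv_antisymm (y := y) b c a, LocalGeometry.curv_antisymm (y := y) c a b]
    simp only [map_neg, neg_apply]
    linarith

/-- The coordinate convention is fixed by the action on covectors, which has the opposite sign to
the action on vectors; hence the exchange of `a` and `b`. -/
lemma riemannUp_eq (a b c d : Fin 4) :
    riemannUp G y a b c d = curv (chr G) s y (coordVec b) (coordVec a) (coordVec c) d := by
  have e1 : ∀ a b c : Fin 4, pd (fun z => christoffel G z d a c) b y =
      fderivWithin ℝ (chr G) s y (coordVec b) (coordVec a) (coordVec c) d := fun a b c => by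
    rw [hG.fderivWithin_chr hy, hG.relOpen.pd_eq _ _ hy]
  have e2 : ∀ a b c : Fin 4, chr G y (coordVec b) (chr G y (coordVec a) (coordVec c)) d =
      ∑ r, christoffel G y r a c * christoffel G y d r b := fun a b c => by
    rw [hG.localGeometry.christoffel_symm hy (coordVec b), chr_apply]
    simp only [chr_coordVec]
    simp [coordVec_apply, mul_comm]
  rw [riemannUp, e1, e1, Finset.sum_sub_distrib, ← e2 a b c, ← e2 b a c]
  simp only [curv, PiLp.add_apply, PiLp.sub_apply]
  ring

lemma riemann_eq (a b c d : Fin 4) :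
    riemann G y a b c d = riem G s y (coordVec a) (coordVec b) (coordVec c) (coordVec d) := by
  rw [riemann, riem, bil_apply]
  refine Finset.sum_congr rfl fun i _ => ?_
  rw [hG.riemannUp_eq hy]
  simp only [coordVec_apply]
  simp [mul_comm]

variable {g : LinearMap.BilinForm ℝ E4} (hg : ∀ u v, bil G y u v = g u v) {l k e₁ e₂ : E4}
  (hF : IsNullFrame g l k e₁ e₂)
include hg hF

omit hG hy in
lemma frameTrace_eq (B : E4 →ₗ[ℝ] E4 →ₗ[ℝ] ℝ) :
    ∑ i, ∑ j, (G y)⁻¹ i j * B (coordVec i) (coordVec j) =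
      frameTrace (fun u v => B u v) l k e₁ e₂ := by
  have h := hF.trace_eq coordBasis B
  have e : (Matrix.of fun i j : Fin 4 => g (coordBasis i) (coordBasis j)) = G y := by
    ext i j
    rw [Matrix.of_apply, coordBasis_apply, coordBasis_apply, ← hg, bil_coordVec]
  rw [e] at h
  simp only [coordBasis_apply] at h
  exact h

/-- Coordinates contract the second and fourth index, the frame the first and third; the two
antisymmetries reconcile them. -/
lemma ricci_eq (a c : Fin 4) : ricci G y a c =
    ricciPart (riem G s y) l k e₁ e₂ (coordVec a) (coordVec c) := by
  have hR := hG.isCurvatureTensor_riem hy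
  let B : E4 →ₗ[ℝ] E4 →ₗ[ℝ] ℝ := LinearMap.mk₂ ℝ
    (fun u v => riem G s y (coordVec a) u (coordVec c) v)
    (fun _ _ _ => (hR.linear₂ _ _ _).map_add _ _) (fun _ _ _ => (hR.linear₂ _ _ _).map_smul _ _)
    (fun _ _ _ => (hR.linear₄ _ _ _).map_add _ _)
    (fun _ _ _ => (hR.linear₄ _ _ _).map_smul _ _)
  have h := frameTrace_eq hg hF B
  have e : ∀ u v, B u v = riem G s y (coordVec a) u (coordVec c) v := fun u v => rfl
  have e2 : ∀ u v, B u v = riem G s y u (coordVec a) v (coordVec c) := fun u v => by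
    rw [e, hR.antisymm₁₂, hR.antisymm₃₄, neg_neg]
  rw [ricciPart]
  simp only [e2] at h
  rw [← h, ricci]
  refine Finset.sum_congr rfl fun b _ => ?_
  have e3 : ∀ j, riem G s y (coordVec b) (coordVec a) (coordVec j) (coordVec c) =
      ∑ m, riemannUp G y a b c m * G y m j := fun j => by
    rw [← e2, e, ← hG.riemann_eq hy, riemann]
  simp only [e3, Finset.mul_sum]
  rw [Finset.sum_comm]
  have e4 : ∀ m, ∑ j, (G y)⁻¹ b j * (riemannUp G y a b c m * G y m j) =
      (if b = m then 1 else 0) * riemannUp G y a b c m := fun m => by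
    rw [← hG.inv_mul hy, Finset.sum_mul]
    exact Finset.sum_congr rfl fun j _ => by rw [hG.symm y hy m j]; ring
  simp only [e4]
  simp

lemma scalarCurv_eq : scalarCurv G y = scalarPart (riem G s y) l k e₁ e₂ := by
  have hR := hG.isCurvatureTensor_riem hy
  have hl : ∀ v, IsLinearMap ℝ fun u => ricciPart (riem G s y) l k e₁ e₂ u v :=
    hR.ricciPart_linear
  have hl' : ∀ u, IsLinearMap ℝ fun v => ricciPart (riem G s y) l k e₁ e₂ u v := fun u => by
    simpa only [hR.ricciPart_symm u] using hl u
  let B : E4 →ₗ[ℝ] E4 →ₗ[ℝ] ℝ := LinearMap.mk₂ ℝ (ricciPart (riem G s y) l k e₁ e₂)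
    (fun x x' y => (hl y).map_add x x') (fun r x y => (hl y).map_smul r x)
    (fun x y y' => (hl' x).map_add y y') (fun r x y => (hl' x).map_smul r y)
  have h := frameTrace_eq hg hF B
  have e : ∀ u v, B u v = ricciPart (riem G s y) l k e₁ e₂ u v := fun u v => rfl
  simp only [e] at h
  rw [scalarCurv, scalarPart, ← h]
  simp only [hG.ricci_eq hy hg hF]

/-- Frees the coordinate Weyl tensor from coordinates, so that its symmetries and its conformal
weight can be proved in a null frame. -/
lemma weylCoord_sum (u v w x : E4) :
    ∑ a, ∑ b, ∑ c, ∑ d, weylCoord G y a b c d * u a * v b * w c * x d =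
      weylPart (fun u v => g u v) l k e₁ e₂ (riem G s y) u v w x := by
  have hR := hG.isCurvatureTensor_riem hy
  have hW := (hF.isWeylCandidate_weylPart hR).isCurvatureTensor
  rw [← hW.eq_sum]
  refine Finset.sum_congr rfl fun a _ => Finset.sum_congr rfl fun b _ =>
    Finset.sum_congr rfl fun c _ => Finset.sum_congr rfl fun d _ => ?_
  congr 4
  simp only [weylCoord, weylPart, kulkarni, hG.riemann_eq hy, hG.ricci_eq hy hg hF,
    hG.scalarCurv_eq hy hg hF, ← hg, bil_coordVec]

end IsMetricMatrix

end CoordinateCurvature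

/-! ### Conformal change in coordinates. -/

section ConformalCoordinates

/-- The gradient in coordinates. -/
def gradCoord (G : E4 → Matrix (Fin 4) (Fin 4) ℝ) (F : E4 → ℝ) (y : E4) : E4 :=
  ∑ i, (∑ j, (G y)⁻¹ i j * pd F j y) • coordVec i

/-- The components of the Hessian in coordinates. -/
def hessCoord (G : E4 → Matrix (Fin 4) (Fin 4) ℝ) (F : E4 → ℝ) (y : E4) (i j : Fin 4) : ℝ :=
  pd (pd F j) i y - ∑ k, christoffel G y k i j * pd F k y

lemma gradCoord_apply (G : E4 → Matrix (Fin 4) (Fin 4) ℝ) (F : E4 → ℝ) (y : E4) (i : Fin 4) :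
    gradCoord G F y i = ∑ j, (G y)⁻¹ i j * pd F j y := by
  simp [gradCoord, coordVec_apply]

namespace IsMetricMatrix

variable {s : Set E4} {G : E4 → Matrix (Fin 4) (Fin 4) ℝ} (hG : IsMetricMatrix s G)
include hG

lemma fderivWithin_eq_sum (F : E4 → ℝ) {y : E4} (hy : y ∈ s) (u : E4) :
    fderivWithin ℝ F s y u = ∑ i, pd F i y * u i := by
  conv_lhs => rw [← sum_coordVec u]
  simp only [map_sum, map_smul, smul_eq_mul, hG.relOpen.pd_eq F _ hy]
  exact Finset.sum_congr rfl fun i _ => mul_comm _ _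

lemma bil_gradCoord (F : E4 → ℝ) {y : E4} (hy : y ∈ s) (u : E4) :
    bil G y (gradCoord G F y) u = fderivWithin ℝ F s y u := by
  rw [hG.fderivWithin_eq_sum F hy, bil_apply, Finset.sum_comm]
  refine Finset.sum_congr rfl fun m _ => ?_
  rw [← Finset.sum_mul]
  congr 1
  simp only [gradCoord_apply, Finset.mul_sum]
  rw [Finset.sum_comm]
  have : ∀ j, ∑ i, G y i m * ((G y)⁻¹ i j * pd F j y) = (if m = j then 1 else 0) * pd F j y :=
    fun j => by
      rw [← hG.mul_inv hy, Finset.sum_mul]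
      exact Finset.sum_congr rfl fun i _ => by rw [hG.symm y hy i m]; ring
  simp only [this]
  simp

lemma contDiffOn_gradCoord {F : E4 → ℝ} (hF : ContDiffOn ℝ ∞ F s) :
    ContDiffOn ℝ ∞ (gradCoord G F) s :=
  ContDiffOn.sum fun i _ => (ContDiffOn.sum fun j _ =>
    (contDiffOn_matrix_inv hG.smooth hG.det_ne i j).mul (hG.relOpen.contDiffOn_pd hF j)).smul
      contDiffOn_const

lemma contDiffOn_hessCoord {F : E4 → ℝ} (hF : ContDiffOn ℝ ∞ F s) (i j : Fin 4) :
    ContDiffOn ℝ ∞ (fun y => hessCoord G F y i j) s :=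
  (hG.relOpen.contDiffOn_pd (hG.relOpen.contDiffOn_pd hF j) i).sub (ContDiffOn.sum fun k _ =>
    (contDiffOn_christoffel hG.relOpen hG.smooth hG.det_ne k i j).mul
      (hG.relOpen.contDiffOn_pd hF k))

lemma hessCoord_eq {F : E4 → ℝ} (hF : ContDiffOn ℝ ∞ F s) {y : E4} (hy : y ∈ s) (i j : Fin 4) :
    fderivWithin ℝ (fderivWithin ℝ F s) s y (coordVec i) (coordVec j)
      - fderivWithin ℝ F s y (chr G y (coordVec i) (coordVec j)) = hessCoord G F y i j := by
  have hF' : ContDiffOn ℝ ∞ (fderivWithin ℝ F s) s :=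
    hF.fderivWithin hG.relOpen.isRegularDomain.unique (by simp)
  rw [hessCoord, hG.fderivWithin_eq_sum F hy]
  congr 1
  · have h1 := (hasFDerivWithinAt_of_contDiffOn hF' hy).clm_apply
      (hasFDerivWithinAt_const (coordVec j) y s)
    have h2 := hG.relOpen.isRegularDomain.fderiv_eq hy h1
      (hasFDerivWithinAt_of_contDiffOn (hG.relOpen.contDiffOn_pd hF j) hy)
      fun z hz => (hG.relOpen.pd_eq F j hz).symm
    rw [hG.relOpen.pd_eq _ _ hy, ← h2]
    simp
  · simp only [chr_coordVec]
    exact Finset.sum_congr rfl fun k _ => mul_comm _ _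

variable {G' : E4 → Matrix (Fin 4) (Fin 4) ℝ} (hG' : IsMetricMatrix s G') {F : E4 → ℝ}
  (hF : ContDiffOn ℝ ∞ F s) (hF0 : ∀ y ∈ s, F y ≠ 0)
  (hGG' : ∀ y ∈ s, ∀ i j, G' y i j = (F y ^ 2)⁻¹ * G y i j)
include hG' hF hF0 hGG'

/-- The curvature changes by a Kulkarni-Nomizu product of `g` with `K = -Ω⁻¹ ∇∇Ω + (1/2) Ω⁻² |dΩ|²
g`, where `Ω` is `F`. Such a product is pure trace, and its traces are all that the scalar curvature
sees. -/
lemma riem_conformal {y : E4} (hy : y ∈ s) : ∃ K : E4 → E4 → ℝ,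
    (∀ v, IsLinearMap ℝ fun u => K u v) ∧ (∀ u v, K u v = K v u) ∧
    (∀ i j, K (coordVec i) (coordVec j) = -(F y)⁻¹ * hessCoord G F y i j
      + (F y ^ 2)⁻¹ * (∑ k, pd F k y * gradCoord G F y k) / 2 * G y i j) ∧
    ∀ u v w x, riem G' s y u v w x = (F y ^ 2)⁻¹ * (riem G s y u v w x
      - kulkarni (fun u v => bil G y u v) K u v w x) := by
  have hb : ∀ y ∈ s, ∀ u v, bil G' y u v = (F y ^ 2)⁻¹ * bil G y u v := fun y hy u v => by
    rw [bil_apply, bil_apply, Finset.mul_sum]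
    refine Finset.sum_congr rfl fun i _ => ?_
    rw [Finset.mul_sum]
    exact Finset.sum_congr rfl fun j _ => by rw [hGG' y hy]; ring
  obtain ⟨h1, h2, h3⟩ := hG.localGeometry.curv_conformal hG'.localGeometry hF hF0 hb
    (hG.contDiffOn_gradCoord hF) (fun y hy => hG.bil_gradCoord F hy) hy (K := fun u =>
      -(F y)⁻¹ • (fderivWithin ℝ (gradCoord G F) s y u + chr G y u (gradCoord G F y))
      + ((F y ^ 2)⁻¹ * fderivWithin ℝ F s y (gradCoord G F y) / 2) • u) fun u => rfl
  refine ⟨_, fun v => ?_, h1, fun i j => ?_, fun u v w x => ?_⟩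
  · constructor <;> intros <;> simp <;> ring
  · rw [h2, hG.hessCoord_eq hF hy, hG.fderivWithin_eq_sum F hy, bil_coordVec]
  · simp only [riem]
    rw [hb y hy, h3]
    simp only [kulkarni, map_add, map_sub, map_smul, add_apply, sub_apply, smul_apply,
      smul_eq_mul]
    ring

variable {y : E4} (hy : y ∈ s) {g : LinearMap.BilinForm ℝ E4} (hg : ∀ u v, bil G y u v = g u v)
  (hL : IsLorentzian g)
include hy hg hL

lemma weylCoord_conformal (u v w x : E4) :
    ∑ a, ∑ b, ∑ c, ∑ d, weylCoord G' y a b c d * u a * v b * w c * x d =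
      (F y ^ 2)⁻¹ * ∑ a, ∑ b, ∑ c, ∑ d, weylCoord G y a b c d * u a * v b * w c * x d := by
  obtain ⟨l, k, e₁, e₂, hN⟩ := hL.exists_isNullFrame
  obtain ⟨K, hK, hs, -, hR⟩ := hG.riem_conformal hG' hF hF0 hGG' hy
  have hg' : ∀ u v, bil G' y u v = ((F y ^ 2)⁻¹ • g) u v := fun u v => by
    rw [LinearMap.smul_apply, LinearMap.smul_apply, ← hg, bil_apply, bil_apply, smul_eq_mul,
      Finset.mul_sum]
    refine Finset.sum_congr rfl fun i _ => ?_
    rw [Finset.mul_sum]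
    exact Finset.sum_congr rfl fun j _ => by rw [hGG' y hy]; ring
  have h0 := hF0 y hy
  rw [hG.weylCoord_sum hy hg hN, hG'.weylCoord_sum hy hg' (hN.smul h0),
    hN.weylPart_conformal hK hs h0 (hG.isCurvatureTensor_riem hy)]
  simpa only [hg] using hR

/-- The conformal change is `-6 F² tr K`. Multiplied out, it has no negative powers of `F`, so the
right-hand side makes sense at `F = 0`, where only `-12 |dF|²` remains. -/
lemma scalarCurv_conformal : scalarCurv G' y = F y ^ 2 * scalarCurv G y
    + 6 * F y * ∑ i, ∑ j, (G y)⁻¹ i j * hessCoord G F y i j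
    - 12 * ∑ k, pd F k y * gradCoord G F y k := by
  obtain ⟨l, k, e₁, e₂, hN⟩ := hL.exists_isNullFrame
  obtain ⟨K, hK, hs, hKc, hR⟩ := hG.riem_conformal hG' hF hF0 hGG' hy
  have hg' : ∀ u v, bil G' y u v = ((F y ^ 2)⁻¹ • g) u v := fun u v => by
    rw [LinearMap.smul_apply, LinearMap.smul_apply, ← hg, bil_apply, bil_apply, smul_eq_mul,
      Finset.mul_sum]
    refine Finset.sum_congr rfl fun i _ => ?_
    rw [Finset.mul_sum]
    exact Finset.sum_congr rfl fun j _ => by rw [hGG' y hy]; ring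
  have h0 := hF0 y hy
  have hK' : ∀ u, IsLinearMap ℝ fun v => K u v := fun u => by
    simpa only [hs u] using hK u
  let B : E4 →ₗ[ℝ] E4 →ₗ[ℝ] ℝ := LinearMap.mk₂ ℝ K
    (fun _ _ _ => (hK _).map_add _ _) (fun _ _ _ => (hK _).map_smul _ _)
    (fun _ _ _ => (hK' _).map_add _ _) (fun _ _ _ => (hK' _).map_smul _ _)
  have h := frameTrace_eq hg hN B
  have h4 := frameTrace_eq hg hN g
  rw [hN.frameTrace_metric] at h4
  have e : ∀ u v, B u v = K u v := fun u v => rfl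
  simp only [e] at h
  rw [hG.scalarCurv_eq hy hg hN, hG'.scalarCurv_eq hy hg' (hN.smul h0),
    hN.scalarPart_conformal hK hs h0 (hG.isCurvatureTensor_riem hy) (by simpa only [hg] using hR),
    ← h]
  simp only [← hg, bil_coordVec] at h4
  have e2 : ∑ i, ∑ j, (G y)⁻¹ i j * K (coordVec i) (coordVec j) =
      -(F y)⁻¹ * ∑ i, ∑ j, (G y)⁻¹ i j * hessCoord G F y i j
      + (F y ^ 2)⁻¹ * (∑ k, pd F k y * gradCoord G F y k) / 2 *
        ∑ i, ∑ j, (G y)⁻¹ i j * G y i j := by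
    simp only [Finset.mul_sum (Finset.univ) (fun i => ∑ j, _), Finset.mul_sum (Finset.univ)
      (fun j => (G y)⁻¹ _ j * _), ← Finset.sum_add_distrib, hKc]
    exact Finset.sum_congr rfl fun i _ => Finset.sum_congr rfl fun j _ => by ring
  rw [e2, h4]
  field_simp
  ring

end IsMetricMatrix

end ConformalCoordinates

lemma IsNullFrame.map {V V' : Type*} [AddCommGroup V] [Module ℝ V] [AddCommGroup V'] [Module ℝ V']
    {g : LinearMap.BilinForm ℝ V} {g' : LinearMap.BilinForm ℝ V'} {l k e₁ e₂ : V}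
    (h : IsNullFrame g l k e₁ e₂) (J : V →ₗ[ℝ] V') (hJ : Function.Surjective J)
    (hg : ∀ u v, g' (J u) (J v) = g u v) : IsNullFrame g' (J l) (J k) (J e₁) (J e₂) where
  toIsNullTetrad := by
    obtain ⟨ll, kk, lk, e11, e22, e12, l1, l2, k1, k2⟩ := h.toIsNullTetrad
    constructor <;> rw [hg] <;> assumption
  symm u v := by
    obtain ⟨u, rfl⟩ := hJ u
    obtain ⟨v, rfl⟩ := hJ v
    rw [hg, hg, h.symm]
  expand u := by
    obtain ⟨u, rfl⟩ := hJ u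
    simp only [hg]
    conv_lhs => rw [h.expand u]
    simp only [map_add, map_smul]

/-- The bilinear form of a component matrix. -/
def bilForm (G : E4 → Matrix (Fin 4) (Fin 4) ℝ) (y : E4) : LinearMap.BilinForm ℝ E4 :=
  LinearMap.mk₂ ℝ (fun u v => bil G y u v) (by intros; simp) (by intros; simp) (by intros; simp)
    (by intros; simp)

lemma bilForm_apply (G : E4 → Matrix (Fin 4) (Fin 4) ℝ) (y u v : E4) :
    bilForm G y u v = bil G y u v := rfl

/-- Invariance of the scalar curvature under a change of coordinates. -/
lemma IsMetricMatrix.scalarCurv_transform {s s' : Set E4} {G G' : E4 → Matrix (Fin 4) (Fin 4) ℝ}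
    (hG : IsMetricMatrix s G) (hG' : IsMetricMatrix s' G') {φ : E4 → E4}
    (hφ : ContDiffOn ℝ ∞ φ s) (hm : MapsTo φ s s')
    (hg : ∀ y ∈ s, ∀ u v, bil G y u v =
      bil G' (φ y) (fderivWithin ℝ φ s y u) (fderivWithin ℝ φ s y v))
    (hsurj : ∀ y ∈ s, Function.Surjective (fderivWithin ℝ φ s y)) {y : E4} (hy : y ∈ s)
    (hL : IsLorentzian (bilForm G y)) : scalarCurv G y = scalarCurv G' (φ y) := by
  obtain ⟨l, k, e₁, e₂, hN⟩ := hL.exists_isNullFrame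
  have hN' : IsNullFrame (bilForm G' (φ y)) (fderivWithin ℝ φ s y l) (fderivWithin ℝ φ s y k)
      (fderivWithin ℝ φ s y e₁) (fderivWithin ℝ φ s y e₂) :=
    hN.map (fderivWithin ℝ φ s y : E4 →ₗ[ℝ] E4) (hsurj y hy) fun u v => (hg y hy u v).symm
  have hR : ∀ u v w x, riem G' s' (φ y) (fderivWithin ℝ φ s y u) (fderivWithin ℝ φ s y v)
      (fderivWithin ℝ φ s y w) (fderivWithin ℝ φ s y x) = riem G s y u v w x := fun u v w x => by
    simp only [riem]
    rw [← hG.localGeometry.curv_transform hG'.localGeometry hφ hm hg hsurj hy, ← hg y hy]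
  rw [hG.scalarCurv_eq hy (fun _ _ => rfl) hN, hG'.scalarCurv_eq (hm hy) (fun _ _ => rfl) hN']
  simp only [scalarPart, ricciPart, frameTrace, hR]

/-! ### Metric fields on a manifold and independence of the chart. -/

section MetricField

variable {M : Type*} [TopologicalSpace M] [ChartedSpace (EuclideanHalfSpace 4) M]
  [IsManifold I4 ∞ M]

/-- The tangent vector at `p` with given components in the chart at `x`. -/
def toTan (x p : M) : E4 →ₗ[ℝ] TangentSpace I4 p :=
  show E4 →ₗ[ℝ] E4 from (tangentCoordChange I4 x p p : E4 →L[ℝ] E4)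

/-- The components in the chart at `x` of a tangent vector at `p`. -/
def ofTan (x p : M) : TangentSpace I4 p →ₗ[ℝ] E4 :=
  show E4 →ₗ[ℝ] E4 from (tangentCoordChange I4 p x p : E4 →L[ℝ] E4)

lemma ofTan_toTan {x p : M} (hp : p ∈ (extChartAt I4 x).source) (u : E4) :
    ofTan x p (toTan x p u) = u := by
  have h := tangentCoordChange_comp (I := I4) (w := x) (x := p) (y := x) (z := p) (v := u)
    ⟨⟨hp, mem_extChartAt_source p⟩, hp⟩
  exact h.trans (tangentCoordChange_self hp)

lemma toTan_ofTan {x p : M} (hp : p ∈ (extChartAt I4 x).source) (u : TangentSpace I4 p) :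
    toTan x p (ofTan x p u) = u := by
  have h := tangentCoordChange_comp (I := I4) (w := p) (x := x) (y := p) (z := p) (v := u)
    ⟨⟨mem_extChartAt_source p, hp⟩, mem_extChartAt_source p⟩
  exact h.trans (tangentCoordChange_self (mem_extChartAt_source p))

lemma ofTan_self (p : M) (u : TangentSpace I4 p) : ofTan p p u = (show E4 from u) :=
  tangentCoordChange_self (mem_extChartAt_source p)

lemma toTan_self (p : M) (u : E4) : toTan p p u = (show TangentSpace I4 p from u) :=
  tangentCoordChange_self (I := I4) (x := p) (z := p) (v := u) (mem_extChartAt_source p)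

lemma tangentCoordChange_ofTan {x x' p : M} (hp : p ∈ (extChartAt I4 x).source)
    (hp' : p ∈ (extChartAt I4 x').source) (u : TangentSpace I4 p) :
    tangentCoordChange I4 x x' p (ofTan x p u) = ofTan x' p u :=
  tangentCoordChange_comp (I := I4) (w := p) (x := x) (y := x') (z := p) (v := u)
    ⟨⟨mem_extChartAt_source p, hp⟩, hp'⟩

/-- The part of the domain of a chart that corresponds to `U`. -/
def chartDom (U : Set M) (x : M) : Set E4 :=
  (extChartAt I4 x).target ∩ (extChartAt I4 x).symm ⁻¹' U

omit [IsManifold I4 ∞ M] in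
lemma isRelOpen_chartDom {U : Set M} (hU : IsOpen U) (x : M) : IsRelOpen (chartDom U x) where
  subset := fun _ hy => extChartAt_target_subset_range x hy.1
  mem_nhds y hy := by
    have h1 : (extChartAt I4 x).target ∈ 𝓝[range I4] y :=
      extChartAt_target_mem_nhdsWithin_of_mem hy.1
    have h2 : (extChartAt I4 x).symm ⁻¹' U ∈ 𝓝[(extChartAt I4 x).target] y :=
      (continuousOn_extChartAt_symm x y hy.1).preimage_mem_nhdsWithin (hU.mem_nhds hy.2)
    have h3 : 𝓝[range I4] y ≤ 𝓝[(extChartAt I4 x).target] y :=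
      nhdsWithin_le_iff.2 h1
    exact inter_mem h1 (h3 h2)

omit [IsManifold I4 ∞ M] in
lemma extChartAt_mem_chartDom {U : Set M} {x p : M} (hp : p ∈ (extChartAt I4 x).source)
    (hU : p ∈ U) : extChartAt I4 x p ∈ chartDom U x :=
  ⟨(extChartAt I4 x).map_source hp, by
    rw [mem_preimage, (extChartAt I4 x).left_inv hp]; exact hU⟩

omit [IsManifold I4 ∞ M] in
lemma chartDom_mono {U U' : Set M} (h : U ⊆ U') (x : M) : chartDom U x ⊆ chartDom U' x :=
  fun _ hy => ⟨hy.1, h hy.2⟩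

/-- The transition map between two charts. -/
def transition (x x' : M) (y : E4) : E4 := extChartAt I4 x' ((extChartAt I4 x).symm y)

lemma contDiffOn_transition {U : Set M} {x x' : M} (hU : U ⊆ (extChartAt I4 x').source) :
    ContDiffOn ℝ ∞ (transition x x') (chartDom U x) :=
  (contDiffOn_ext_coord_change (I := I4) (n := ∞) x' x).mono fun y hy => by
    rw [PartialEquiv.trans_source, PartialEquiv.symm_source]
    exact ⟨hy.1, hU hy.2⟩

/-- Identifies the Jacobian of the transition map with the change of trivialisation of the tangent
bundle, so that the local transformation laws apply to tangent vectors. -/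
lemma fderivWithin_transition {U : Set M} (hU : IsOpen U) {x x' : M} {y : E4}
    (hy : y ∈ chartDom U x) : fderivWithin ℝ (transition x x') (chartDom U x) y =
      tangentCoordChange I4 x x' ((extChartAt I4 x).symm y) := by
  rw [← (isRelOpen_chartDom hU x).fderivWithin_eq _ hy, tangentCoordChange_def,
    (extChartAt I4 x).right_inv hy.1]
  rfl

omit [IsManifold I4 ∞ M] in
lemma mapsTo_transition {U : Set M} {x x' : M} (hU : U ⊆ (extChartAt I4 x').source) :
    MapsTo (transition x x') (chartDom U x) (chartDom U x') :=
  fun _ hy => extChartAt_mem_chartDom (hU hy.2) hy.2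

lemma surjective_tangentCoordChange {x x' p : M} (hp : p ∈ (extChartAt I4 x).source)
    (hp' : p ∈ (extChartAt I4 x').source) :
    Function.Surjective (tangentCoordChange I4 x x' p) := fun u =>
  ⟨ofTan x p (toTan x' p u), by rw [tangentCoordChange_ofTan hp hp', ofTan_toTan hp']⟩

lemma bil_comps (g : ∀ p : M, LinearMap.BilinForm ℝ (TangentSpace I4 p)) (x : M) (y u v : E4) :
    bil (comps g x) y u v = g ((extChartAt I4 x).symm y) (toTan x _ u) (toTan x _ v) := by
  conv_rhs => rw [← sum_coordVec u, ← sum_coordVec v]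
  simp only [map_sum, map_smul, LinearMap.sum_apply, LinearMap.smul_apply, smul_eq_mul, bil_apply,
    Finset.mul_sum]
  rw [Finset.sum_comm]
  exact Finset.sum_congr rfl fun i _ => Finset.sum_congr rfl fun j _ => by
    rw [show comps g x y j i = g ((extChartAt I4 x).symm y) (toTan x _ (coordVec j))
      (toTan x _ (coordVec i)) from rfl]
    ring

lemma bil_comps_apply (g : ∀ p : M, LinearMap.BilinForm ℝ (TangentSpace I4 p)) {x p : M}
    (hp : p ∈ (extChartAt I4 x).source) (u v : TangentSpace I4 p) :
    bil (comps g x) (extChartAt I4 x p) (ofTan x p u) (ofTan x p v) = g p u v := by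
  rw [bil_comps]
  have : ∀ q, q = p → g q (toTan x q (ofTan x p u)) (toTan x q (ofTan x p v)) = g p u v := by
    rintro q rfl
    rw [toTan_ofTan hp, toTan_ofTan hp]
  exact this _ ((extChartAt I4 x).left_inv hp)

/-- A smooth Lorentzian metric on an open subset. -/
structure IsMetricField (U : Set M) (g : ∀ p : M, LinearMap.BilinForm ℝ (TangentSpace I4 p)) :
    Prop where
  isOpen : IsOpen U
  lorentzian : ∀ p ∈ U, IsLorentzian (g p)
  smooth : ∀ (x : M) (i j : Fin 4), ContDiffOn ℝ ∞ (fun y => comps g x y i j) (chartDom U x)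

namespace IsMetricField

variable {U : Set M} {g : ∀ p : M, LinearMap.BilinForm ℝ (TangentSpace I4 p)}
  (hg : IsMetricField U g)
include hg

lemma isLorentzian_bilForm {x : M} {y : E4} (hy : y ∈ chartDom U x) :
    IsLorentzian (bilForm (comps g x) y) := by
  obtain ⟨b, hb⟩ := hg.lorentzian _ hy.2
  have hs := (extChartAt I4 x).map_target hy.1
  let e : TangentSpace I4 ((extChartAt I4 x).symm y) ≃ₗ[ℝ] E4 :=
    LinearEquiv.ofLinearMap (ofTan x _) (toTan x _) (LinearMap.ext fun u => ofTan_toTan hs u)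
      (LinearMap.ext fun u => toTan_ofTan hs u)
  refine ⟨b.map e, fun i j => ?_⟩
  rw [← hb i j, bilForm_apply, bil_comps]
  simp only [Module.Basis.map_apply]
  have : ∀ u, toTan x _ (e u) = u := fun u => toTan_ofTan hs u
  rw [this, this]

lemma mono {U' : Set M} (hU' : IsOpen U') (h : U' ⊆ U) : IsMetricField U' g where
  isOpen := hU'
  lorentzian p hp := hg.lorentzian p (h hp)
  smooth x i j := (hg.smooth x i j).mono (chartDom_mono h x)

lemma isMetricMatrix (x : M) : IsMetricMatrix (chartDom U x) (comps g x) where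
  relOpen := isRelOpen_chartDom hg.isOpen x
  smooth := hg.smooth x
  det_ne y hy := by
    intro h0
    obtain ⟨v, hv, hv'⟩ := Matrix.exists_vecMul_eq_zero_iff.2 h0
    refine hv ?_
    have hL := hg.isLorentzian_bilForm hy
    have : (WithLp.toLp 2 v : E4) = 0 := hL.eq_zero_of_forall fun w => by
      rw [bilForm_apply, bil_apply, Finset.sum_comm]
      refine Finset.sum_eq_zero fun j _ => ?_
      rw [← Finset.sum_mul]
      have h1 := congrFun hv' j
      simp only [Matrix.vecMul, dotProduct, Pi.zero_apply] at h1
      rw [show ∑ i, comps g x y i j * (WithLp.toLp 2 v : E4) i = 0 from by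
        rw [← h1]; exact Finset.sum_congr rfl fun i _ => mul_comm _ _, zero_mul]
    funext i
    exact congrArg (fun z : E4 => z i) this
  symm y hy i j := (hg.lorentzian _ hy.2).symm _ _

lemma bil_transition {x x' : M} (hU : U ⊆ (extChartAt I4 x').source) {y : E4}
    (hy : y ∈ chartDom U x) (u v : E4) : bil (comps g x) y u v =
      bil (comps g x') (transition x x' y)
        (fderivWithin ℝ (transition x x') (chartDom U x) y u)
        (fderivWithin ℝ (transition x x') (chartDom U x) y v) := by
  rw [fderivWithin_transition hg.isOpen hy, bil_comps, transition]
  have hp := (extChartAt I4 x).map_target hy.1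
  have hp' := hU hy.2
  have e : ∀ u, tangentCoordChange I4 x x' ((extChartAt I4 x).symm y) u =
      ofTan x' _ (toTan x ((extChartAt I4 x).symm y) u) := fun u => by
    rw [← tangentCoordChange_ofTan hp hp', ofTan_toTan hp]
  rw [e, e, bil_comps_apply g hp']

lemma surjective_transition {x x' : M} (hU : U ⊆ (extChartAt I4 x').source) {y : E4}
    (hy : y ∈ chartDom U x) :
    Function.Surjective (fderivWithin ℝ (transition x x') (chartDom U x) y) := by
  rw [fderivWithin_transition hg.isOpen hy]
  exact surjective_tangentCoordChange ((extChartAt I4 x).map_target hy.1) (hU hy.2)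

/-- The scalar curvature does not depend on the chart. -/
lemma scalarCurv_eq {x x' p : M} (hp : p ∈ (extChartAt I4 x).source)
    (hp' : p ∈ (extChartAt I4 x').source) (hpU : p ∈ U) :
    scalarCurv (comps g x) (extChartAt I4 x p) = scalarCurv (comps g x') (extChartAt I4 x' p) := by
  have hO : IsOpen (U ∩ (extChartAt I4 x').source) := hg.isOpen.inter (isOpen_extChartAt_source x')
  have h' := hg.mono hO inter_subset_left
  have hy : extChartAt I4 x p ∈ chartDom (U ∩ (extChartAt I4 x').source) x :=
    extChartAt_mem_chartDom hp ⟨hpU, hp'⟩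
  have h := (h'.isMetricMatrix x).scalarCurv_transform (h'.isMetricMatrix x')
    (contDiffOn_transition inter_subset_right) (mapsTo_transition inter_subset_right)
    (fun y hy => h'.bil_transition inter_subset_right hy)
    (fun y hy => h'.surjective_transition inter_subset_right hy) hy (h'.isLorentzian_bilForm hy)
  rw [h, transition, (extChartAt I4 x).left_inv hp]

end IsMetricField

end MetricField

/-! ### The conformal completion: Weyl tensor, gradient, causal character of the boundary. -/

section Completion

lemma IsMetricMatrix.contDiffOn_scalarCurv {s : Set E4} {G : E4 → Matrix (Fin 4) (Fin 4) ℝ}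
    (hG : IsMetricMatrix s G) : ContDiffOn ℝ ∞ (scalarCurv G) s := by
  have hC := contDiffOn_christoffel hG.relOpen hG.smooth hG.det_ne
  refine ContDiffOn.sum fun a _ => ContDiffOn.sum fun c _ =>
    (contDiffOn_matrix_inv hG.smooth hG.det_ne a c).mul (ContDiffOn.sum fun b _ => ?_)
  exact ((hG.relOpen.contDiffOn_pd (hC b a c) b).sub (hG.relOpen.contDiffOn_pd (hC b b c) a)).add
    (ContDiffOn.sum fun r _ => ((hC r a c).mul (hC b r b)).sub ((hC r b c).mul (hC b r a)))

variable {M : Type*} [TopologicalSpace M] [ChartedSpace (EuclideanHalfSpace 4) M]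
  [IsManifold I4 ∞ M]

/-- The expression of a function in a chart. -/
def inChart (f : M → ℝ) (x : M) (y : E4) : ℝ := f ((extChartAt I4 x).symm y)

lemma contDiffOn_inChart {f : M → ℝ} (hf : ContMDiff I4 𝓘(ℝ, ℝ) ∞ f) (x : M) (U : Set M) :
    ContDiffOn ℝ ∞ (inChart f x) (chartDom U x) :=
  (contMDiffOn_iff_contDiffOn.1
    (hf.comp_contMDiffOn (contMDiffOn_extChartAt_symm x))).mono inter_subset_left

/-- The differential at `p` is defined through the chart at `p`; along a curve it has to be
expressed in one fixed chart, by the chain rule for the transition map. -/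
lemma differential_eq {f : M → ℝ} (hf : ContMDiff I4 𝓘(ℝ, ℝ) ∞ f) {U : Set M} (hU : IsOpen U)
    {x p : M} (hp : p ∈ (extChartAt I4 x).source) (hpU : p ∈ U) (u : TangentSpace I4 p) :
    differential f p u =
      fderivWithin ℝ (inChart f x) (chartDom U x) (extChartAt I4 x p) (ofTan x p u) := by
  have h1 : differential f p u =
      fderivWithin ℝ (inChart f p) (range I4) (extChartAt I4 p p) (show E4 from u) := by
    exact congrArg (fun L : E4 →L[ℝ] ℝ => L u) ((hf p).mdifferentiableAt (by simp)).mfderiv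
  have hpp := mem_extChartAt_source (I := I4) p
  set O := U ∩ (extChartAt I4 x).source with hO
  have hOo : IsOpen O := hU.inter (isOpen_extChartAt_source x)
  have hy : extChartAt I4 p p ∈ chartDom O p := extChartAt_mem_chartDom hpp ⟨hpU, hp⟩
  have hyU : extChartAt I4 x p ∈ chartDom U x := extChartAt_mem_chartDom hp hpU
  rw [h1, (isRelOpen_chartDom hOo p).fderivWithin_eq _ hy]
  have hm : MapsTo (transition p x) (chartDom O p) (chartDom U x) := fun z hz =>
    chartDom_mono inter_subset_left x (mapsTo_transition (U := O) inter_subset_right hz)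
  have e1 : transition p x (extChartAt I4 p p) = extChartAt I4 x p := by
    rw [transition, (extChartAt I4 p).left_inv hpp]
  have h2 := hasFDerivWithinAt_of_contDiffOn (contDiffOn_inChart hf x U) hyU
  rw [← e1] at h2
  have h3 := h2.comp _ (hasFDerivWithinAt_of_contDiffOn
    (contDiffOn_transition (U := O) inter_subset_right) hy) hm
  have h4 := (isRelOpen_chartDom hOo p).isRegularDomain.fderiv_eq hy
    (hasFDerivWithinAt_of_contDiffOn (contDiffOn_inChart hf p O) hy) h3 fun z hz => by
      simp only [inChart, transition, Function.comp]
      rw [(extChartAt I4 x).left_inv hz.2.2]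
  rw [h4, ← e1]
  refine (ContinuousLinearMap.comp_apply _ _ _).trans ?_
  rw [fderivWithin_transition hOo hy, (extChartAt I4 p).left_inv hpp]
  rfl

namespace PenroseCompletion

variable {Λ : ℝ} (S : PenroseCompletion M Λ)

lemma isMetricField : IsMetricField univ S.g where
  isOpen := isOpen_univ
  lorentzian p _ := S.lorentzian p
  smooth x i j := (S.smooth_g x i j).mono inter_subset_left

/-- The region in which the physical metric is defined. -/
def regular : Set M := {p | S.Ω p ≠ 0}

lemma isOpen_regular : IsOpen S.regular :=
  isOpen_ne.preimage S.smooth_Ω.continuous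

lemma comps_ghat (x : M) (y : E4) (i j : Fin 4) :
    comps S.ghat x y i j = (inChart S.Ω x y ^ 2)⁻¹ * comps S.g x y i j := rfl

lemma isMetricField_ghat : IsMetricField S.regular S.ghat where
  isOpen := S.isOpen_regular
  lorentzian p hp := (S.lorentzian p).smul hp
  smooth x i j :=
    (((contDiffOn_inChart S.smooth_Ω x S.regular).pow 2).inv
      fun _ hy => pow_ne_zero 2 hy.2).mul ((S.smooth_g x i j).mono inter_subset_left)

lemma g_self (p : M) (u v : TangentSpace I4 p) :
    bil (comps S.g p) (extChartAt I4 p p) u v = S.g p u v := by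
  have := bil_comps_apply S.g (mem_extChartAt_source (I := I4) p) u v
  rwa [ofTan_self, ofTan_self] at this

lemma isWeylCandidate_weyl (p : M) : IsWeylCandidate (S.g p) (weyl S.g p) := by
  obtain ⟨l, k, e₁, e₂, hN⟩ := (S.lorentzian p).exists_isNullFrame
  have hy : extChartAt I4 p p ∈ chartDom univ p :=
    extChartAt_mem_chartDom (mem_extChartAt_source p) (mem_univ _)
  have hG := S.isMetricField.isMetricMatrix p
  have h := hN.isWeylCandidate_weylPart (hG.isCurvatureTensor_riem hy)
  have e : weyl S.g p = weylPart (fun u v => S.g p u v) l k e₁ e₂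
      (riem (comps S.g p) (chartDom univ p) (extChartAt I4 p p)) := by
    funext u v w x
    exact hG.weylCoord_sum hy (S.g_self p) hN u v w x
  rw [e]
  exact h

/-- Division by `Ω` confines the argument to `Ω ≠ 0`; the endpoint is reached by continuity in
`dTens_endpoint`. -/
lemma isWeylCandidate_dTens {p : M} (hp : p ∈ S.regular) :
    IsWeylCandidate (S.g p) (S.dTens p) := by
  have hp' : S.Ω p ≠ 0 := hp
  have h := S.isWeylCandidate_weyl p
  have e : ∀ u v w x, S.dTens p u v w x = (S.Ω p)⁻¹ * weyl S.g p u v w x := fun u v w x => by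
    rw [S.weyl_eq, dTens]; field_simp
  refine ⟨fun b c d => ?_, fun a b c d => ?_, fun a b c d => ?_, fun a b c d => ?_,
    fun a b c d => ?_, fun b u v => ?_⟩
  · constructor <;> intros <;> simp [dTens]
  · rw [e, e, h.antisymm₁₂]; ring
  · rw [e, e, h.antisymm₃₄]; ring
  · rw [e, e, h.pair_symm]
  · rw [e, e, e, ← mul_add, ← mul_add, h.cyclic, mul_zero]
  · have := h.traceless b u v
    simp only [trace13] at this ⊢
    simp only [e]
    rw [← mul_zero (S.Ω p)⁻¹, ← this, Finset.mul_sum]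
    refine Finset.sum_congr rfl fun i _ => ?_
    rw [Finset.mul_sum]
    exact Finset.sum_congr rfl fun j _ => by ring

/-- The Weyl tensor of the physical metric in terms of the rescaled Weyl tensor. -/
lemma weyl_ghat {p : M} (hp : p ∈ S.regular) (u v w x : TangentSpace I4 p) :
    weyl S.ghat p u v w x = (S.Ω p)⁻¹ * S.dTens p u v w x := by
  have hp' : S.Ω p ≠ 0 := hp
  have hG := S.isMetricField.mono S.isOpen_regular (subset_univ _)
  have hy : extChartAt I4 p p ∈ chartDom S.regular p :=
    extChartAt_mem_chartDom (mem_extChartAt_source p) hp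
  have h := (hG.isMetricMatrix p).weylCoord_conformal (S.isMetricField_ghat.isMetricMatrix p)
    (contDiffOn_inChart S.smooth_Ω p S.regular) (fun y hy => hy.2)
    (fun y hy i j => S.comps_ghat p y i j) hy (S.g_self p) (S.lorentzian p) u v w x
  have h' : weyl S.ghat p u v w x = (S.Ω p ^ 2)⁻¹ * weyl S.g p u v w x := by
    have e : inChart S.Ω p (extChartAt I4 p p) = S.Ω p := by
      rw [inChart, (extChartAt I4 p).left_inv (mem_extChartAt_source p)]
    rw [e] at h
    exact h
  rw [h', S.weyl_eq, dTens]
  field_simp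

lemma interior_subset_regular : I4.interior M ⊆ S.regular := fun p hp => (S.Ω_pos p hp).ne'

lemma N_eq (p : M) : (S.N p : E4) =
    gradCoord (comps S.g p) (inChart S.Ω p) (extChartAt I4 p p) := by
  have hy : extChartAt I4 p p ∈ chartDom univ p :=
    extChartAt_mem_chartDom (mem_extChartAt_source p) (mem_univ _)
  have e1 : ∀ i, (chartVec p p i : E4) = coordVec i := fun i => toTan_self p _
  have e2 : ∀ i, differential S.Ω p (chartVec p p i) =
      pd (inChart S.Ω p) i (extChartAt I4 p p) := fun i => by
    rw [differential_eq S.smooth_Ω isOpen_univ (mem_extChartAt_source p) (mem_univ p),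
      (S.isMetricField.isMetricMatrix p).relOpen.pd_eq _ _ hy, ofTan_self, e1]
  show (gradient S.g S.Ω p : E4) = _
  rw [gradient, gradCoord]
  simp only [e2]
  exact Finset.sum_congr rfl fun i _ => congrArg _ (e1 i)

lemma g_N (p : M) (u : TangentSpace I4 p) : S.g p (S.N p) u = differential S.Ω p u := by
  have hy : extChartAt I4 p p ∈ chartDom univ p :=
    extChartAt_mem_chartDom (mem_extChartAt_source p) (mem_univ _)
  refine (S.g_self p (S.N p) u).symm.trans ?_
  refine (congrArg (fun z : E4 => bil (comps S.g p) (extChartAt I4 p p) z u) (S.N_eq p)).trans ?_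
  refine ((S.isMetricField.isMetricMatrix p).bil_gradCoord _ hy _).trans ?_
  rw [differential_eq S.smooth_Ω isOpen_univ (mem_extChartAt_source p) (mem_univ p), ofTan_self]

/-- Trace of the field equations in dimension four: `R - 2 R + 4 Λ = κ T`. -/
lemma metricTrace_eq {p : M} (hp : p ∈ I4.interior M) :
    S.κ * metricTrace S.ghat S.T p =
      4 * Λ - scalarCurv (comps S.ghat p) (extChartAt I4 p p) := by
  have hp' := S.interior_subset_regular hp
  have hy : extChartAt I4 p p ∈ chartDom S.regular p :=
    extChartAt_mem_chartDom (mem_extChartAt_source p) hp'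
  have hG := S.isMetricField_ghat.isMetricMatrix p
  have h4 : ∑ i, ∑ j, (comps S.ghat p (extChartAt I4 p p))⁻¹ i j *
      comps S.ghat p (extChartAt I4 p p) i j = 4 := by
    have : ∀ i, ∑ j, (comps S.ghat p (extChartAt I4 p p))⁻¹ i j *
        comps S.ghat p (extChartAt I4 p p) i j = 1 := fun i => by
      have := hG.inv_mul hy i i
      rw [if_pos rfl] at this
      rw [← this]
      exact Finset.sum_congr rfl fun j _ => by rw [hG.symm _ hy i j]
    rw [Finset.sum_congr rfl fun i _ => this i]
    simp
  have hE : ∀ i j, S.κ * comps S.T p (extChartAt I4 p p) i j =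
      ricci (comps S.ghat p) (extChartAt I4 p p) i j
      - 1 / 2 * comps S.ghat p (extChartAt I4 p p) i j *
          scalarCurv (comps S.ghat p) (extChartAt I4 p p)
      + Λ * comps S.ghat p (extChartAt I4 p p) i j := fun i j => (S.einstein p hp i j).symm
  have hs : ∀ A B : Fin 4 → Fin 4 → ℝ, ∀ a b : ℝ, ∑ i, ∑ j, (a * A i j + b * B i j) =
      a * ∑ i, ∑ j, A i j + b * ∑ i, ∑ j, B i j := fun A B a b => by
    simp only [Finset.sum_add_distrib, Finset.mul_sum]
  have h5 := hs (fun i j => (comps S.ghat p (extChartAt I4 p p))⁻¹ i j *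
      ricci (comps S.ghat p) (extChartAt I4 p p) i j)
    (fun i j => (comps S.ghat p (extChartAt I4 p p))⁻¹ i j *
      comps S.ghat p (extChartAt I4 p p) i j) 1
    (Λ - scalarCurv (comps S.ghat p) (extChartAt I4 p p) / 2)
  rw [h4] at h5
  have h6 : ∑ i, ∑ j, (comps S.ghat p (extChartAt I4 p p))⁻¹ i j *
      ricci (comps S.ghat p) (extChartAt I4 p p) i j =
      scalarCurv (comps S.ghat p) (extChartAt I4 p p) := rfl
  rw [h6] at h5
  rw [metricTrace, Finset.mul_sum]
  simp only [Finset.mul_sum]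
  rw [show 4 * Λ - scalarCurv (comps S.ghat p) (extChartAt I4 p p) =
    1 * scalarCurv (comps S.ghat p) (extChartAt I4 p p) +
      (Λ - scalarCurv (comps S.ghat p) (extChartAt I4 p p) / 2) * 4 by ring, ← h5]
  refine Finset.sum_congr rfl fun i _ => Finset.sum_congr rfl fun j _ => ?_
  rw [mul_left_comm, hE]
  ring

/-- The causal character of the boundary. -/
lemma g_N_N {p : M} (hp : p ∈ I4.boundary M) (hne : (𝓝[I4.interior M] p).NeBot) :
    S.g p (S.N p) (S.N p) = -Λ / 3 := by
  have hpp := mem_extChartAt_source (I := I4) p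
  have hG := S.isMetricField.isMetricMatrix p
  have hy : extChartAt I4 p p ∈ chartDom univ p :=
    extChartAt_mem_chartDom hpp (mem_univ _)
  have hF := contDiffOn_inChart S.smooth_Ω p univ
  -- The conformal expression for the physical scalar curvature. Unlike the physical metric, it is
  -- smooth up to the boundary, and its boundary value is `-12 N·N`.
  let A : E4 → ℝ := fun y => inChart S.Ω p y ^ 2 * scalarCurv (comps S.g p) y
    + 6 * inChart S.Ω p y * ∑ i, ∑ j, (comps S.g p y)⁻¹ i j *
      hessCoord (comps S.g p) (inChart S.Ω p) y i j
    - 12 * ∑ k, pd (inChart S.Ω p) k y * gradCoord (comps S.g p) (inChart S.Ω p) y k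
  have hA : ContDiffOn ℝ ∞ A (chartDom univ p) := by
    have h1 : ∀ k, ContDiffOn ℝ ∞
        (fun y => gradCoord (comps S.g p) (inChart S.Ω p) y k) (chartDom univ p) := fun k =>
      (EuclideanSpace.proj (𝕜 := ℝ) k : E4 →L[ℝ] ℝ).contDiff.comp_contDiffOn
        (hG.contDiffOn_gradCoord hF)
    exact (((hF.pow 2).mul hG.contDiffOn_scalarCurv).add ((contDiffOn_const.mul hF).mul
      (ContDiffOn.sum fun i _ => ContDiffOn.sum fun j _ =>
        (contDiffOn_matrix_inv hG.smooth hG.det_ne i j).mul (hG.contDiffOn_hessCoord hF i j)))).sub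
      (contDiffOn_const.mul (ContDiffOn.sum fun k _ =>
        (hG.relOpen.contDiffOn_pd hF k).mul (h1 k)))
  have h0 : inChart S.Ω p (extChartAt I4 p p) = 0 := by
    rw [inChart, (extChartAt I4 p).left_inv hpp, S.Ω_zero p hp]
  have hA0 : A (extChartAt I4 p p) = -12 * S.g p (S.N p) (S.N p) := by
    rw [S.g_N, differential_eq S.smooth_Ω isOpen_univ hpp (mem_univ p), ofTan_self,
      hG.fderivWithin_eq_sum _ hy]
    simp only [A, h0, ← S.N_eq]
    ring
  have hev : ∀ᶠ q in 𝓝[I4.interior M] p, S.κ * metricTrace S.ghat S.T q =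
      4 * Λ - A (extChartAt I4 p q) := by
    filter_upwards [self_mem_nhdsWithin,
      mem_nhdsWithin_of_mem_nhds (extChartAt_source_mem_nhds (I := I4) p)] with q hq hqs
    have hqr := S.interior_subset_regular hq
    -- The trace at `q` is computed in the chart at `q`; a limit requires the fixed chart at `p`,
    -- hence the invariance of the scalar curvature.
    rw [S.metricTrace_eq hq, S.isMetricField_ghat.scalarCurv_eq (mem_extChartAt_source q) hqs hqr]
    have hyq : extChartAt I4 p q ∈ chartDom S.regular p := extChartAt_mem_chartDom hqs hqr
    have hGr := S.isMetricField.mono S.isOpen_regular (subset_univ _)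
    rw [(hGr.isMetricMatrix p).scalarCurv_conformal (S.isMetricField_ghat.isMetricMatrix p)
      (contDiffOn_inChart S.smooth_Ω p S.regular) (fun y hy => hy.2)
      (fun y hy i j => S.comps_ghat p y i j) hyq (g := bilForm (comps S.g p) (extChartAt I4 p q))
      (fun _ _ => rfl) (hGr.isLorentzian_bilForm hyq)]
  have hlim1 : Tendsto (fun q => S.κ * metricTrace S.ghat S.T q) (𝓝[I4.interior M] p)
      (𝓝 (S.κ * 0)) := (S.matter_decay p hp).const_mul S.κ
  have hcont : Tendsto (fun q => extChartAt I4 p q) (𝓝[I4.interior M] p)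
      (𝓝[chartDom univ p] (extChartAt I4 p p)) := by
    refine tendsto_nhdsWithin_iff.2 ⟨(continuousAt_extChartAt p).tendsto.mono_left
      nhdsWithin_le_nhds, ?_⟩
    filter_upwards [mem_nhdsWithin_of_mem_nhds (extChartAt_source_mem_nhds (I := I4) p)] with q hq
    exact extChartAt_mem_chartDom hq (mem_univ _)
  have hlim2 : Tendsto (fun q => 4 * Λ - A (extChartAt I4 p q)) (𝓝[I4.interior M] p)
      (𝓝 (4 * Λ - A (extChartAt I4 p p))) :=
    ((hA.continuousOn _ hy).tendsto.comp hcont).const_sub _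
  have := tendsto_nhds_unique (hlim1.congr' hev) hlim2
  rw [hA0] at this
  linarith

end PenroseCompletion

end Completion

/-! ### Linear differential equations with a uniform existence time. -/

section LinearODE

open NNReal

variable {E : Type*} [NormedAddCommGroup E] [NormedSpace ℝ E] [CompleteSpace E]

/-- Solutions of linear equations on short intervals of a length that does not depend on the
initial value. -/
lemma exists_linear_ode {A : ℝ → E →L[ℝ] E} {a b K : ℝ} (hA : ContinuousOn A (Icc a b))
    (hK : ∀ t ∈ Icc a b, ‖A t‖ ≤ K) (hab : 2 * K * (b - a) ≤ 1) {t₀ : ℝ} (ht₀ : t₀ ∈ Icc a b)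
    (x₀ : E) : ∃ V : ℝ → E, V t₀ = x₀ ∧
      ∀ t ∈ Icc a b, HasDerivWithinAt V (A t (V t)) (Icc a b) t := by
  have hK0 : 0 ≤ K := (norm_nonneg _).trans (hK t₀ ht₀)
  have hba : 0 ≤ b - a := sub_nonneg.2 (ht₀.1.trans ht₀.2)
  -- On the ball of radius `‖x₀‖ + 1` the speed is at most `K (2‖x₀‖ + 1)`. Radius and speed both
  -- grow linearly in `‖x₀‖`, so the bound on `b - a` does not involve `x₀`.
  have hpl : IsPicardLindelof (fun t x => A t x) (⟨t₀, ht₀⟩ : Icc a b) x₀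
      ⟨‖x₀‖ + 1, by positivity⟩ 0 ⟨K * (2 * ‖x₀‖ + 1), by positivity⟩ ⟨K, hK0⟩ := by
    refine ⟨fun t ht => ?_, fun x _ => hA.clm_apply continuousOn_const, fun t ht x hx => ?_, ?_⟩
    · refine ((A t).lipschitz.weaken ?_).lipschitzOnWith
      exact hK t ht
    · have hx' : ‖x‖ ≤ 2 * ‖x₀‖ + 1 := by
        have h1 : ‖x - x₀‖ ≤ ‖x₀‖ + 1 := by
          rw [Metric.mem_closedBall, dist_eq_norm] at hx
          exact hx
        have h2 := norm_le_norm_add_norm_sub' x x₀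
        linarith
      exact ((A t).le_opNorm x).trans (mul_le_mul (hK t ht) hx' (norm_nonneg _) hK0)
    · have h1 : max (b - t₀) (t₀ - a) ≤ b - a :=
        max_le (by linarith [ht₀.1]) (by linarith [ht₀.2])
      show K * (2 * ‖x₀‖ + 1) * max (b - t₀) (t₀ - a) ≤ ‖x₀‖ + 1 - 0
      have h2 : K * (2 * ‖x₀‖ + 1) * max (b - t₀) (t₀ - a) ≤ K * (2 * ‖x₀‖ + 1) * (b - a) :=
        mul_le_mul_of_nonneg_left h1 (by positivity)
      nlinarith [norm_nonneg x₀, mul_nonneg hK0 hba]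
  exact hpl.exists_eq_forall_mem_Icc_hasDerivWithinAt₀

end LinearODE

/-! ### The equation of parallel transport in an arbitrary chart. -/

section Curves

variable {M : Type*} [TopologicalSpace M] [ChartedSpace (EuclideanHalfSpace 4) M]
  [IsManifold I4 ∞ M]

/-- `w` is the velocity of `γ` on `s`. -/
def IsVelocity (γ : ℝ → M) (w : ∀ t, TangentSpace I4 (γ t)) (s : Set ℝ) : Prop :=
  ∀ t ∈ s, ContinuousWithinAt γ s t ∧
    HasDerivWithinAt (fun r => extChartAt I4 (γ t) (γ r)) (show E4 from w t) s t

/-- The equation of parallel transport at `t`, in the chart at `x`. -/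
def IsParallelIn (g : ∀ p : M, LinearMap.BilinForm ℝ (TangentSpace I4 p)) (γ : ℝ → M)
    (w V : ∀ t, TangentSpace I4 (γ t)) (x : M) (s : Set ℝ) (t : ℝ) : Prop :=
  HasDerivWithinAt (fun r => ofTan x (γ r) (V r))
    (-chr (comps g x) (extChartAt I4 x (γ t)) (ofTan x (γ t) (w t)) (ofTan x (γ t) (V t))) s t

/-- Parallel transport along a curve with given velocity. -/
def IsParallelOn (g : ∀ p : M, LinearMap.BilinForm ℝ (TangentSpace I4 p)) (γ : ℝ → M)
    (w V : ∀ t, TangentSpace I4 (γ t)) (s : Set ℝ) : Prop :=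
  ∀ t ∈ s, IsParallelIn g γ w V (γ t) s t

variable {g : ∀ p : M, LinearMap.BilinForm ℝ (TangentSpace I4 p)} {γ : ℝ → M}
  {w V W : ∀ t, TangentSpace I4 (γ t)} {s : Set ℝ} {U : Set M}

/-- `velocity` depends on the parameter set; a separate velocity field `w` stays the same when the
interval is shrunk. -/
lemma isParallelAlong_iff : IsParallelAlong g γ s V ↔ IsParallelOn g γ (velocity γ s) V s := by
  refine forall₂_congr fun t _ => ?_
  rw [IsParallelIn, ofTan_self, ofTan_self, chr_apply]
  rfl

omit [IsManifold I4 ∞ M] in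
lemma IsVelocity.mono (h : IsVelocity γ w s) {s' : Set ℝ} (hs : s' ⊆ s) : IsVelocity γ w s' :=
  fun t ht => ⟨(h t (hs ht)).1.mono hs, (h t (hs ht)).2.mono hs⟩

omit [IsManifold I4 ∞ M] in
lemma IsVelocity.mem_nhdsWithin (h : IsVelocity γ w s) {t : ℝ} (ht : t ∈ s) {O : Set M}
    (hO : IsOpen O) (hγ : γ t ∈ O) : s ∩ γ ⁻¹' O ∈ 𝓝[s] t :=
  inter_mem self_mem_nhdsWithin ((h t ht).1.preimage_mem_nhdsWithin (hO.mem_nhds hγ))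

lemma IsVelocity.hasDerivWithinAt (h : IsVelocity γ w s) {t : ℝ} (ht : t ∈ s) {x : M}
    (hx : γ t ∈ (extChartAt I4 x).source) :
    HasDerivWithinAt (fun r => extChartAt I4 x (γ r)) (ofTan x (γ t) (w t)) s t := by
  have hm : MapsTo (fun r => extChartAt I4 (γ t) (γ r)) s (range I4) := fun r _ => by
    rw [extChartAt_coe]
    exact mem_range_self _
  have h1 := (hasFDerivWithinAt_tangentCoordChange (I := I4) (x := γ t) (y := x) (z := γ t)
    ⟨mem_extChartAt_source _, hx⟩).comp_hasDerivWithinAt t (h t ht).2 hm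
  refine h1.congr_of_eventuallyEq ?_ ?_
  · filter_upwards [h.mem_nhdsWithin ht (isOpen_extChartAt_source (γ t))
      (mem_extChartAt_source (I := I4) (γ t))] with r hr
    simp only [Function.comp]
    rw [(extChartAt I4 (γ t)).left_inv hr.2]
  · simp only [Function.comp]
    rw [(extChartAt I4 (γ t)).left_inv (mem_extChartAt_source (γ t))]

omit [IsManifold I4 ∞ M] in
lemma isVelocity_velocity (hγ : ContMDiffOn 𝓘(ℝ, ℝ) I4 ∞ γ s) : IsVelocity γ (velocity γ s) s := by
  intro t ht
  have hd := (hγ t ht).mdifferentiableWithinAt (by simp)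
  refine ⟨hd.continuousWithinAt, ?_⟩
  have h1 := hd.hasMFDerivWithinAt.2
  simp only [mfld_simps] at h1
  let L : ℝ →L[ℝ] E4 := mfderivWithin 𝓘(ℝ, ℝ) I4 γ s t
  have h2 : HasFDerivWithinAt (fun r => extChartAt I4 (γ t) (γ r)) L s t := h1
  exact h2.hasDerivWithinAt

omit [IsManifold I4 ∞ M] in
lemma IsVelocity.velocity_eq (h : IsVelocity γ w s) {t : ℝ} (ht : t ∈ s)
    (hu : UniqueDiffWithinAt ℝ s t) : velocity γ s t = w t := by
  have h0 := (h t ht).2.hasFDerivWithinAt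
  have h1 : HasMFDerivWithinAt 𝓘(ℝ, ℝ) I4 γ s t _ := ⟨(h t ht).1, by
    simp only [mfld_simps]
    exact h0⟩
  rw [velocity, h1.mfderivWithin hu.uniqueMDiffWithinAt]
  exact one_smul ℝ (show E4 from w t)

/-- The equation of parallel transport does not depend on the chart. -/
lemma IsParallelIn.change_chart (hg : IsMetricField U g) (hw : IsVelocity γ w s) {t : ℝ}
    (ht : t ∈ s) (hU : γ t ∈ U) {x x' : M} (hx : γ t ∈ (extChartAt I4 x).source)
    (hx' : γ t ∈ (extChartAt I4 x').source) (h : IsParallelIn g γ w V x s t) :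
    IsParallelIn g γ w V x' s t := by
  set O := U ∩ (extChartAt I4 x').source with hOdef
  have hO : IsOpen O := hg.isOpen.inter (isOpen_extChartAt_source x')
  have hg' := hg.mono hO inter_subset_left
  set s' := s ∩ γ ⁻¹' (O ∩ (extChartAt I4 x).source) with hs'
  have hmem : s' ∈ 𝓝[s] t := hw.mem_nhdsWithin ht (hO.inter (isOpen_extChartAt_source x))
    ⟨⟨hU, hx'⟩, hx⟩
  have ht' : t ∈ s' := ⟨ht, ⟨hU, hx'⟩, hx⟩
  have hy : extChartAt I4 x (γ t) ∈ chartDom O x := extChartAt_mem_chartDom hx ⟨hU, hx'⟩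
  have hm : MapsTo (fun r => extChartAt I4 x (γ r)) s' (chartDom O x) := fun r hr =>
    extChartAt_mem_chartDom hr.2.2 hr.2.1
  have hφ : ContDiffOn ℝ ∞ (transition x x') (chartDom O x) :=
    contDiffOn_transition inter_subset_right
  have hJ := hφ.fderivWithin (isRelOpen_chartDom hO x).isRegularDomain.unique
    (m := ∞) (by simp)
  have hc := (hw.hasDerivWithinAt ht hx).mono (inter_subset_left : s' ⊆ s)
  have h1 := (hasFDerivWithinAt_of_contDiffOn hJ hy).comp_hasDerivWithinAt t hc hm
  have h2 := h1.clm_apply (h.mono (inter_subset_left : s' ⊆ s))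
  have eJ : ∀ r ∈ s', fderivWithin ℝ (transition x x') (chartDom O x) (extChartAt I4 x (γ r)) =
      tangentCoordChange I4 x x' (γ r) := fun r hr => by
    rw [fderivWithin_transition hO (hm hr), (extChartAt I4 x).left_inv hr.2.2]
  have h3 : HasDerivWithinAt (fun r => ofTan x' (γ r) (V r)) _ s' t :=
    h2.congr (fun r hr => by
      simp only [Function.comp]
      rw [eJ r hr, tangentCoordChange_ofTan hr.2.2 hr.2.1.2]) (by
      simp only [Function.comp]
      rw [eJ t ht', tangentCoordChange_ofTan hx hx'])
  -- The second derivative of the transition map, produced by differentiating the Jacobian along the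
  -- curve, cancels the inhomogeneous term of the transformed connection.
  have hT := (hg'.isMetricMatrix x).localGeometry.transform (hg'.isMetricMatrix x').localGeometry
    hφ (mapsTo_transition inter_subset_right)
    (fun y hy => hg'.bil_transition inter_subset_right hy)
    (fun y hy => hg'.surjective_transition inter_subset_right hy) hy
    (ofTan x (γ t) (w t)) (ofTan x (γ t) (V t))
  refine (h3.congr_deriv ?_).mono_of_mem_nhdsWithin hmem
  have e2 : transition x x' (extChartAt I4 x (γ t)) = extChartAt I4 x' (γ t) := by
    rw [transition, (extChartAt I4 x).left_inv hx]
  rw [e2, eJ t ht', tangentCoordChange_ofTan hx hx', tangentCoordChange_ofTan hx hx'] at hT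
  simp only [Function.comp, map_neg]
  rw [eJ t ht', hT]
  abel

/-- Parallel transport preserves the metric. -/
lemma IsParallelOn.hasDerivWithinAt_metric (hg : IsMetricField U g) (hw : IsVelocity γ w s)
    (hU : MapsTo γ s U) (hV : IsParallelOn g γ w V s) (hW : IsParallelOn g γ w W s) {t : ℝ}
    (ht : t ∈ s) : HasDerivWithinAt (fun r => g (γ r) (V r) (W r)) 0 s t := by
  set x := γ t with hx
  have hxs : γ t ∈ (extChartAt I4 x).source := mem_extChartAt_source (γ t)
  set s' := s ∩ γ ⁻¹' (extChartAt I4 x).source with hs'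
  have hmem : s' ∈ 𝓝[s] t := hw.mem_nhdsWithin ht (isOpen_extChartAt_source x) hxs
  have ht' : t ∈ s' := ⟨ht, hxs⟩
  have hy : extChartAt I4 x (γ t) ∈ chartDom U x := extChartAt_mem_chartDom hxs (hU ht)
  have hm : MapsTo (fun r => extChartAt I4 x (γ r)) s' (chartDom U x) := fun r hr =>
    extChartAt_mem_chartDom hr.2 (hU hr.1)
  have hG := hg.isMetricMatrix x
  have hc := (hw.hasDerivWithinAt ht hxs).mono (inter_subset_left : s' ⊆ s)
  have h1 := (hasFDerivWithinAt_of_contDiffOn hG.contDiffOn_bil hy).comp_hasDerivWithinAt t hc hm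
  have h2 := (h1.clm_apply ((hV t ht).mono (inter_subset_left : s' ⊆ s))).clm_apply
    ((hW t ht).mono (inter_subset_left : s' ⊆ s))
  have h3 : HasDerivWithinAt (fun r => g (γ r) (V r) (W r)) _ s' t :=
    h2.congr (fun r hr => (bil_comps_apply g hr.2 _ _).symm) (bil_comps_apply g hxs _ _).symm
  refine (h3.congr_deriv ?_).mono_of_mem_nhdsWithin hmem
  have hcm := hG.localGeometry.compat hy (ofTan x (γ t) (w t)) (ofTan x (γ t) (V t))
    (ofTan x (γ t) (W t))
  simp only [Function.comp, map_neg, add_apply, neg_apply]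
  rw [hcm]
  ring

lemma IsParallelOn.metric_eq (hg : IsMetricField U g) (hw : IsVelocity γ w s)
    (hU : MapsTo γ s U) (hV : IsParallelOn g γ w V s) (hW : IsParallelOn g γ w W s)
    (hs : Convex ℝ s) {a b : ℝ} (ha : a ∈ s) (hb : b ∈ s) :
    g (γ a) (V a) (W a) = g (γ b) (V b) (W b) := by
  have h := hs.norm_image_sub_le_of_norm_hasDerivWithin_le (C := 0)
    (fun t ht => hV.hasDerivWithinAt_metric hg hw hU hW ht) (fun t _ => by simp) hb ha
  rw [zero_mul, norm_le_zero_iff, sub_eq_zero] at h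
  exact h

lemma IsParallelOn.add (hV : IsParallelOn g γ w V s) (hW : IsParallelOn g γ w W s) :
    IsParallelOn g γ w (fun t => V t + W t) s := fun t ht => by
  have h := HasDerivWithinAt.add (hV t ht) (hW t ht)
  refine (h.congr_deriv ?_).congr (fun r _ => map_add _ _ _) (map_add _ _ _)
  rw [map_add, map_add]
  abel

lemma IsParallelOn.smul (c : ℝ) (hV : IsParallelOn g γ w V s) :
    IsParallelOn g γ w (fun t => c • V t) s := fun t ht => by
  have h := HasDerivWithinAt.const_smul c (hV t ht)
  refine (h.congr_deriv ?_).congr (fun r _ => map_smul _ _ _) (map_smul _ _ _)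
  rw [map_smul, map_smul, smul_neg]

end Curves

/-! ### Existence and smoothness of parallel fields. -/

section Transport

variable {M : Type*} [TopologicalSpace M] [ChartedSpace (EuclideanHalfSpace 4) M]
  [IsManifold I4 ∞ M] {g : ∀ p : M, LinearMap.BilinForm ℝ (TangentSpace I4 p)} {γ : ℝ → M}
  {w V W : ∀ t, TangentSpace I4 (γ t)} {s : Set ℝ} {U : Set M}

lemma contDiffOn_chart_curve (hγ : ContMDiffOn 𝓘(ℝ, ℝ) I4 ∞ γ s) {x : M}
    (hx : MapsTo γ s (extChartAt I4 x).source) :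
    ContDiffOn ℝ ∞ (fun r => extChartAt I4 x (γ r)) s :=
  contMDiffOn_iff_contDiffOn.1
    ((contMDiffOn_extChartAt (I := I4) (n := ∞) (x := x)).comp hγ fun r hr => by
      have := hx hr
      rwa [extChartAt_source] at this)

section Interval

variable {a b : ℝ} (hab : a < b) (hγ : ContMDiffOn 𝓘(ℝ, ℝ) I4 ∞ γ (Icc a b))
  (hw : IsVelocity γ w (Icc a b)) {x : M} (hx : MapsTo γ (Icc a b) (extChartAt I4 x).source)
include hab hγ hw hx

lemma contDiffOn_chart_velocity :
    ContDiffOn ℝ ∞ (fun r => ofTan x (γ r) (w r)) (Icc a b) := by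
  have hu := uniqueDiffOn_Icc hab
  exact ((contDiffOn_chart_curve hγ hx).derivWithin hu (m := ∞) (by simp)).congr fun r hr =>
    ((hw.hasDerivWithinAt hr (hx hr)).derivWithin (hu r hr)).symm

lemma contDiffOn_transport_coeff (hg : IsMetricField U g) (hU : MapsTo γ (Icc a b) U) :
    ContDiffOn ℝ ∞ (fun r => -chr (comps g x) (extChartAt I4 x (γ r)) (ofTan x (γ r) (w r)))
      (Icc a b) :=
  (((hg.isMetricMatrix x).contDiffOn_chr.comp (contDiffOn_chart_curve hγ hx) fun _ hr =>
    extChartAt_mem_chartDom (hx hr) (hU hr)).clm_apply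
      (contDiffOn_chart_velocity hab hγ hw hx)).neg

/-- Parallel fields are smooth. -/
lemma IsParallelOn.contDiffOn (hg : IsMetricField U g) (hU : MapsTo γ (Icc a b) U)
    (hV : IsParallelOn g γ w V (Icc a b)) :
    ContDiffOn ℝ ∞ (fun r => ofTan x (γ r) (V r)) (Icc a b) := by
  have hA := contDiffOn_transport_coeff hab hγ hw hx hg hU
  refine ODE.contDiffOn_enat_Icc_of_hasDerivWithinAt (n := ⊤) (u := univ)
    (f := fun r v => (-chr (comps g x) (extChartAt I4 x (γ r)) (ofTan x (γ r) (w r))) v)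
    ?_ (fun t ht => ?_) (mapsTo_univ _ _)
  · exact (hA.comp contDiffOn_fst fun z hz => hz.1).clm_apply contDiffOn_snd
  · exact (hV t ht).change_chart hg hw ht (hU ht) (mem_extChartAt_source _) (hx ht)

end Interval

/-- Vectors can be transported along `γ` between any two points of the interval. -/
def HasTransport (g : ∀ p : M, LinearMap.BilinForm ℝ (TangentSpace I4 p)) (γ : ℝ → M)
    (w : ∀ t, TangentSpace I4 (γ t)) (a b : ℝ) : Prop :=
  ∀ t ∈ Icc a b, ∀ v : TangentSpace I4 (γ t), ∃ V : ∀ t, TangentSpace I4 (γ t),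
    V t = v ∧ IsParallelOn g γ w V (Icc a b)

lemma IsParallelOn.congr (hV : IsParallelOn g γ w V s) (h : ∀ t ∈ s, W t = V t) :
    IsParallelOn g γ w W s := fun t ht => by
  have := hV t ht
  rw [IsParallelIn, ← h t ht] at this
  exact this.congr (fun r hr => by rw [h r hr]) (by rw [h t ht])

lemma isParallelOn_union {a b c : ℝ} (hab : a ≤ b) (hbc : b ≤ c)
    (h1 : IsParallelOn g γ w V (Icc a b)) (h2 : IsParallelOn g γ w V (Icc b c)) :
    IsParallelOn g γ w V (Icc a c) := by
  intro t ht
  rcases lt_trichotomy t b with h | rfl | h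
  · refine (h1 t ⟨ht.1, h.le⟩).mono_of_mem_nhdsWithin ?_
    filter_upwards [self_mem_nhdsWithin, mem_nhdsWithin_of_mem_nhds (Iic_mem_nhds h)] with r h1 h2
    exact ⟨h1.1, h2⟩
  · have := (h1 t ⟨ht.1, le_rfl⟩).union (h2 t ⟨le_rfl, ht.2⟩)
    rwa [Icc_union_Icc_eq_Icc hab hbc] at this
  · refine (h2 t ⟨h.le, ht.2⟩).mono_of_mem_nhdsWithin ?_
    filter_upwards [self_mem_nhdsWithin, mem_nhdsWithin_of_mem_nhds (Ici_mem_nhds h)] with r h1 h2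
    exact ⟨h2, h1.2⟩

lemma HasTransport.trans {a b c : ℝ} (hab : a ≤ b) (hbc : b ≤ c) (h1 : HasTransport g γ w a b)
    (h2 : HasTransport g γ w b c) : HasTransport g γ w a c := by
  have key : ∀ V₁ V₂ : ∀ t, TangentSpace I4 (γ t), V₁ b = V₂ b →
      IsParallelOn g γ w V₁ (Icc a b) → IsParallelOn g γ w V₂ (Icc b c) →
      ∃ V : ∀ t, TangentSpace I4 (γ t), (∀ t ∈ Icc a b, V t = V₁ t) ∧
        (∀ t ∈ Icc b c, V t = V₂ t) ∧ IsParallelOn g γ w V (Icc a c) := by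
    intro V₁ V₂ hb hV₁ hV₂
    have e1 : ∀ t ∈ Icc a b, (if t ≤ b then V₁ t else V₂ t) = V₁ t := fun t ht => if_pos ht.2
    have e2 : ∀ t ∈ Icc b c, (if t ≤ b then V₁ t else V₂ t) = V₂ t := fun t ht => by
      by_cases h : t ≤ b
      · obtain rfl := le_antisymm h ht.1
        rw [if_pos h, hb]
      · rw [if_neg h]
    exact ⟨_, e1, e2, isParallelOn_union hab hbc (hV₁.congr e1) (hV₂.congr e2)⟩
  intro t ht v
  rcases le_total t b with h | h
  · obtain ⟨V₁, h1v, hV₁⟩ := h1 t ⟨ht.1, h⟩ v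
    obtain ⟨V₂, h2v, hV₂⟩ := h2 b ⟨le_rfl, hbc⟩ (V₁ b)
    obtain ⟨V, hVa, -, hV⟩ := key V₁ V₂ h2v.symm hV₁ hV₂
    exact ⟨V, by rw [hVa t ⟨ht.1, h⟩, h1v], hV⟩
  · obtain ⟨V₂, h2v, hV₂⟩ := h2 t ⟨h, ht.2⟩ v
    obtain ⟨V₁, h1v, hV₁⟩ := h1 b ⟨hab, le_rfl⟩ (V₂ b)
    obtain ⟨V, -, hVb, hV⟩ := key V₁ V₂ h1v hV₁ hV₂
    exact ⟨V, by rw [hVb t ⟨h, ht.2⟩, h2v], hV⟩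

/-- Near `t₀` the curve stays in one chart, where transport is a linear equation with bounded
coefficients. Its existence time depends on the bound alone, so every vector can be transported over
the same short interval. -/
lemma hasTransport_local (hg : IsMetricField U g) {a₀ b₀ : ℝ} (hab : a₀ < b₀)
    (hγ : ContMDiffOn 𝓘(ℝ, ℝ) I4 ∞ γ (Icc a₀ b₀)) (hw : IsVelocity γ w (Icc a₀ b₀))
    (hU : MapsTo γ (Icc a₀ b₀) U) {t₀ : ℝ} (ht₀ : t₀ ∈ Icc a₀ b₀) :
    ∃ δ > 0, ∀ a b, a ≤ b → a ∈ Icc a₀ b₀ → b ∈ Icc a₀ b₀ → |a - t₀| < δ → |b - t₀| < δ →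
      HasTransport g γ w a b := by
  set x := γ t₀ with hxdef
  have hmem := hw.mem_nhdsWithin ht₀ (isOpen_extChartAt_source (I := I4) x)
    (mem_extChartAt_source x)
  obtain ⟨ε, hε, hball⟩ := Metric.mem_nhdsWithin_iff.1 hmem
  set a' := max a₀ (t₀ - ε / 2) with ha'
  set b' := min b₀ (t₀ + ε / 2) with hb'
  have hab' : a' < b' := by
    rw [ha', hb']
    refine max_lt (lt_min hab ?_) (lt_min ?_ ?_) <;> linarith [ht₀.1, ht₀.2]
  have hsub : Icc a' b' ⊆ Icc a₀ b₀ :=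
    Icc_subset_Icc (le_max_left _ _) (min_le_left _ _)
  have hx : MapsTo γ (Icc a' b') (extChartAt I4 x).source := fun r hr => by
    refine (hball ⟨?_, hsub hr⟩).2
    rw [Metric.mem_ball, Real.dist_eq, abs_lt]
    have h1 := (le_max_right a₀ (t₀ - ε / 2)).trans hr.1
    have h2 := hr.2.trans (min_le_right b₀ (t₀ + ε / 2))
    constructor <;> linarith
  have hA := (contDiffOn_transport_coeff hab' (hγ.mono hsub) (hw.mono hsub) hx hg
    (hU.mono_left hsub)).continuousOn
  obtain ⟨K, hK⟩ := isCompact_Icc.exists_bound_of_continuousOn hA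
  have hK0 : 0 ≤ K := (norm_nonneg _).trans (hK a' (left_mem_Icc.2 hab'.le))
  -- The first bound keeps the interval in the chart; the second gives `b - a ≤ 1 / (2 (K + 1))`,
  -- which meets the length condition of `exists_linear_ode`.
  refine ⟨min (ε / 2) (1 / (4 * (K + 1))), lt_min (by positivity) (by positivity),
    fun a b hle ha hb hda hdb => ?_⟩
  rw [abs_lt] at hda hdb
  have m1 := min_le_left (ε / 2) (1 / (4 * (K + 1)))
  have m2 := min_le_right (ε / 2) (1 / (4 * (K + 1)))
  have hsub' : Icc a b ⊆ Icc a' b' :=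
    Icc_subset_Icc (max_le ha.1 (by linarith)) (le_min hb.2 (by linarith))
  have hlen : 2 * K * (b - a) ≤ 1 := by
    have h1 : b - a ≤ 1 / (2 * (K + 1)) := by
      have : 1 / (4 * (K + 1)) + 1 / (4 * (K + 1)) = 1 / (2 * (K + 1)) := by field_simp; norm_num
      linarith
    calc 2 * K * (b - a) ≤ 2 * K * (1 / (2 * (K + 1))) := by gcongr
      _ = K / (K + 1) := by field_simp
      _ ≤ 1 := by rw [div_le_one (by positivity)]; linarith
  intro t ht v
  obtain ⟨X, hXt, hX⟩ := exists_linear_ode (hA.mono hsub') (fun r hr => hK r (hsub' hr)) hlen ht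
    (ofTan x (γ t) v)
  have hws := hw.mono (hsub'.trans hsub)
  refine ⟨fun r => toTan x (γ r) (X r), ?_, fun r hr => ?_⟩
  · show toTan x (γ t) (X t) = v
    rw [hXt, toTan_ofTan (hx (hsub' ht))]
  · refine IsParallelIn.change_chart hg hws hr (hU (hsub (hsub' hr))) (hx (hsub' hr))
      (mem_extChartAt_source _) ?_
    have e : ∀ r ∈ Icc a b, ofTan x (γ r) (toTan x (γ r) (X r)) = X r := fun r hr =>
      ofTan_toTan (hx (hsub' hr)) _
    rw [IsParallelIn, e r hr]
    exact (hX r hr).congr e (e r hr)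

/-- Existence of parallel transport along a smooth curve. -/
lemma hasTransport (hg : IsMetricField U g) {a₀ b₀ : ℝ} (hab : a₀ < b₀)
    (hγ : ContMDiffOn 𝓘(ℝ, ℝ) I4 ∞ γ (Icc a₀ b₀)) (hw : IsVelocity γ w (Icc a₀ b₀))
    (hU : MapsTo γ (Icc a₀ b₀) U) : HasTransport g γ w a₀ b₀ := by
  choose! δ hδ hloc using fun t₀ (ht₀ : t₀ ∈ Icc a₀ b₀) =>
    hasTransport_local hg hab hγ hw hU ht₀
  let c : Icc a₀ b₀ → Set (Icc a₀ b₀) := fun i => {r | |(r : ℝ) - i| < δ i}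
  have hc : ∀ i, IsOpen (c i) := fun i =>
    isOpen_lt (by fun_prop) continuous_const
  have hcov : univ ⊆ ⋃ i, c i := fun r _ => mem_iUnion.2 ⟨r, by
    show |(r : ℝ) - r| < δ r
    rw [sub_self, abs_zero]
    exact hδ r r.2⟩
  -- Compactness gives a finite subdivision each of whose pieces admits transport; the pieces are
  -- glued by induction.
  obtain ⟨t, ht0, hmono, ⟨m, hm⟩, hcov⟩ :=
    exists_monotone_Icc_subset_open_cover_Icc hab.le hc hcov
  have key : ∀ n, HasTransport g γ w a₀ (t n) := by
    intro n
    induction n with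
    | zero =>
      rw [ht0]
      have ha := left_mem_Icc.2 hab.le
      exact hloc a₀ ha a₀ a₀ le_rfl ha ha (by simpa using hδ a₀ ha) (by simpa using hδ a₀ ha)
    | succ n ih =>
      obtain ⟨i, hi⟩ := hcov n
      have hle : t n ≤ t (n + 1) := hmono n.le_succ
      exact ih.trans (t n).2.1 hle (hloc i i.2 _ _ hle (t n).2 (t (n + 1)).2
        (hi (left_mem_Icc.2 hle)) (hi (right_mem_Icc.2 hle)))
  have := key m
  rwa [hm m le_rfl] at this

end Transport

/-! ### Parallel null frames and the parallel propagator. -/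

section Frames

variable {M : Type*} [TopologicalSpace M] [ChartedSpace (EuclideanHalfSpace 4) M]
  [IsManifold I4 ∞ M]

/-- A null frame that is parallel along a curve. -/
structure ParallelFrame (g : ∀ p : M, LinearMap.BilinForm ℝ (TangentSpace I4 p)) (γ : ℝ → M)
    (w : ∀ t, TangentSpace I4 (γ t)) (s : Set ℝ) where
  /-- the first null vector -/
  l : ∀ t, TangentSpace I4 (γ t)
  /-- the second null vector -/
  k : ∀ t, TangentSpace I4 (γ t)
  /-- the first transversal vector -/
  e₁ : ∀ t, TangentSpace I4 (γ t)
  /-- the second transversal vector -/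
  e₂ : ∀ t, TangentSpace I4 (γ t)
  parallel_l : IsParallelOn g γ w l s
  parallel_k : IsParallelOn g γ w k s
  parallel_e₁ : IsParallelOn g γ w e₁ s
  parallel_e₂ : IsParallelOn g γ w e₂ s
  frame : ∀ t ∈ s, IsNullFrame (g (γ t)) (l t) (k t) (e₁ t) (e₂ t)

variable {g : ∀ p : M, LinearMap.BilinForm ℝ (TangentSpace I4 p)} {γ : ℝ → M}
  {w V W : ∀ t, TangentSpace I4 (γ t)} {s : Set ℝ} {U : Set M}

/-- Parallel fields that form a null tetrad at one point. -/
def ParallelFrame.ofParallel (hg : IsMetricField U g) (hw : IsVelocity γ w s) (hU : MapsTo γ s U)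
    (hs : Convex ℝ s) {l k e₁ e₂ : ∀ t, TangentSpace I4 (γ t)} (hl : IsParallelOn g γ w l s)
    (hk : IsParallelOn g γ w k s) (h₁ : IsParallelOn g γ w e₁ s) (h₂ : IsParallelOn g γ w e₂ s)
    {t₀ : ℝ} (ht₀ : t₀ ∈ s) (h : IsNullTetrad (g (γ t₀)) (l t₀) (k t₀) (e₁ t₀) (e₂ t₀)) :
    ParallelFrame g γ w s where
  l := l
  k := k
  e₁ := e₁
  e₂ := e₂
  parallel_l := hl
  parallel_k := hk
  parallel_e₁ := h₁
  parallel_e₂ := h₂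
  frame t ht := by
    refine IsNullTetrad.isNullFrame (hg.lorentzian _ (hU ht)) ⟨?_, ?_, ?_, ?_, ?_, ?_, ?_, ?_, ?_, ?_⟩
    · rw [hl.metric_eq hg hw hU hl hs ht ht₀, h.ll]
    · rw [hk.metric_eq hg hw hU hk hs ht ht₀, h.kk]
    · rw [hl.metric_eq hg hw hU hk hs ht ht₀, h.lk]
    · rw [h₁.metric_eq hg hw hU h₁ hs ht ht₀, h.e₁e₁]
    · rw [h₂.metric_eq hg hw hU h₂ hs ht ht₀, h.e₂e₂]
    · rw [h₁.metric_eq hg hw hU h₂ hs ht ht₀, h.e₁e₂]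
    · rw [hl.metric_eq hg hw hU h₁ hs ht ht₀, h.le₁]
    · rw [hl.metric_eq hg hw hU h₂ hs ht ht₀, h.le₂]
    · rw [hk.metric_eq hg hw hU h₁ hs ht ht₀, h.ke₁]
    · rw [hk.metric_eq hg hw hU h₂ hs ht ht₀, h.ke₂]

namespace ParallelFrame

variable (F : ParallelFrame g γ w s)

/-- The vector with given components. -/
def vec (t : ℝ) (u : Fin 4 → ℝ) : TangentSpace I4 (γ t) :=
  frameVec (F.l t) (F.k t) (F.e₁ t) (F.e₂ t) u

/-- The components of a vector. -/
def coord (t : ℝ) (v : TangentSpace I4 (γ t)) : Fin 4 → ℝ :=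
  frameCoord (g (γ t)) (F.l t) (F.k t) (F.e₁ t) (F.e₂ t) v

lemma vec_coord {t : ℝ} (ht : t ∈ s) (v : TangentSpace I4 (γ t)) : F.vec t (F.coord t v) = v :=
  (F.frame t ht).frameVec_coord v

lemma coord_vec {t : ℝ} (ht : t ∈ s) (u : Fin 4 → ℝ) : F.coord t (F.vec t u) = u :=
  (F.frame t ht).coord_frameVec u

lemma isParallelOn_vec (u : Fin 4 → ℝ) : IsParallelOn g γ w (fun t => F.vec t u) s :=
  (((F.parallel_l.smul (u 0)).add (F.parallel_k.smul (u 1))).add (F.parallel_e₁.smul (u 2))).add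
    (F.parallel_e₂.smul (u 3))

section

variable (hg : IsMetricField U g) (hw : IsVelocity γ w s) (hU : MapsTo γ s U) (hs : Convex ℝ s)
include F hg hw hU hs

/-- Frame components are inner products with parallel fields, hence constant. This yields uniqueness
of parallel transport without a uniqueness theorem for differential equations. -/
lemma coord_eq (hV : IsParallelOn g γ w V s) {a b : ℝ} (ha : a ∈ s) (hb : b ∈ s) :
    F.coord a (V a) = F.coord b (V b) := by
  simp only [coord, frameCoord]
  rw [F.parallel_l.metric_eq hg hw hU hV hs ha hb, F.parallel_k.metric_eq hg hw hU hV hs ha hb,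
    F.parallel_e₁.metric_eq hg hw hU hV hs ha hb, F.parallel_e₂.metric_eq hg hw hU hV hs ha hb]

lemma eq_of_eq (hV : IsParallelOn g γ w V s) (hW : IsParallelOn g γ w W s) {a b : ℝ}
    (ha : a ∈ s) (hb : b ∈ s) (h : V a = W a) : V b = W b := by
  rw [← F.vec_coord hb (V b), ← F.vec_coord hb (W b), ← F.coord_eq hg hw hU hs hV ha hb,
    ← F.coord_eq hg hw hU hs hW ha hb, h]

/-- `propagator` picks some parallel field with the given value; uniqueness identifies it with any
explicitly known one. -/
lemma propagator_eq (hv : ∀ t ∈ s, velocity γ s t = w t) (hV : IsParallelOn g γ w V s) {a b : ℝ}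
    (ha : a ∈ s) (hb : b ∈ s) : propagator g γ s a b (V a) = V b := by
  have hiff : ∀ V : ∀ t, TangentSpace I4 (γ t),
      IsParallelAlong g γ s V ↔ IsParallelOn g γ w V s := fun V => by
    rw [isParallelAlong_iff]
    refine forall₂_congr fun t ht => ?_
    rw [IsParallelIn, IsParallelIn, hv t ht]
  have hex : ∃ W : ∀ t, TangentSpace I4 (γ t), IsParallelAlong g γ s W ∧ W a = V a :=
    ⟨V, (hiff V).2 hV, rfl⟩
  rw [propagator, dif_pos hex]
  have h := Classical.choose_spec hex
  exact F.eq_of_eq hg hw hU hs ((hiff _).1 h.1) hV ha hb h.2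

end

end ParallelFrame

/-- A null tetrad extends to a parallel null frame along a smooth curve. -/
lemma exists_parallelFrame (hg : IsMetricField U g) {a b : ℝ} (hab : a < b)
    (hγ : ContMDiffOn 𝓘(ℝ, ℝ) I4 ∞ γ (Icc a b)) (hw : IsVelocity γ w (Icc a b))
    (hU : MapsTo γ (Icc a b) U) {l : ∀ t, TangentSpace I4 (γ t)}
    (hl : IsParallelOn g γ w l (Icc a b)) {t₀ : ℝ} (ht₀ : t₀ ∈ Icc a b)
    {k e₁ e₂ : TangentSpace I4 (γ t₀)} (h : IsNullTetrad (g (γ t₀)) (l t₀) k e₁ e₂) :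
    ∃ F : ParallelFrame g γ w (Icc a b), F.l = l ∧ F.k t₀ = k ∧ F.e₁ t₀ = e₁ ∧ F.e₂ t₀ = e₂ := by
  have hT := hasTransport hg hab hγ hw hU t₀ ht₀
  obtain ⟨k, rfl, hk⟩ := hT k
  obtain ⟨e₁, rfl, h₁⟩ := hT e₁
  obtain ⟨e₂, rfl, h₂⟩ := hT e₂
  exact ⟨ParallelFrame.ofParallel hg hw hU (convex_Icc a b) hl hk h₁ h₂ ht₀ h, rfl, rfl, rfl, rfl⟩

end Frames

/-! ### Primitives on half-open intervals. -/

section Primitive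

/-- Primitives of continuous functions on a half-open interval. -/
lemma exists_primitive_Ico {h : ℝ → ℝ} {a b : ℝ} (hh : ContinuousOn h (Ico a b)) :
    ∃ Q : ℝ → ℝ, Q a = 0 ∧ ∀ t ∈ Ico a b, HasDerivWithinAt Q (h t) (Ico a b) t := by
  refine ⟨fun t => ∫ r in a..t, h r, by simp, fun t ht => ?_⟩
  -- `h` need not extend to `b`, so differentiation takes place on a compact interval that ends
  -- strictly between `t` and `b`.
  obtain ⟨c, htc, hcb⟩ := exists_between ht.2
  have hac : a ≤ c := ht.1.trans htc.le
  have hcont : ContinuousOn h (Icc a c) := hh.mono fun r hr => ⟨hr.1, hr.2.trans_lt hcb⟩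
  have hcont' : Continuous (IccExtend hac ((Icc a c).domRestrict h)) :=
    (continuousOn_iff_continuous_domRestrict.1 hcont).Icc_extend'
  have e : ∀ r ∈ Icc a c, IccExtend hac ((Icc a c).domRestrict h) r = h r := fun r hr => by
    rw [IccExtend_of_mem hac _ hr, domRestrict_apply]
  have h1 := (hcont'.integral_hasStrictDerivAt a t).hasDerivAt.hasDerivWithinAt (s := Icc a c)
  rw [e t ⟨ht.1, htc.le⟩] at h1
  have e2 : ∀ r ∈ Icc a c, ∫ x in a..r, h x =
      ∫ x in a..r, IccExtend hac ((Icc a c).domRestrict h) x := fun r hr => by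
    refine intervalIntegral.integral_congr fun x hx => ?_
    rw [uIcc_of_le hr.1] at hx
    exact (e x ⟨hx.1, hx.2.trans hr.2⟩).symm
  refine (h1.congr e2 (e2 t ⟨ht.1, htc.le⟩)).mono_of_mem_nhdsWithin ?_
  filter_upwards [self_mem_nhdsWithin, mem_nhdsWithin_of_mem_nhds (Iic_mem_nhds htc)] with r h1 h2
  exact ⟨h1.1, h2⟩

end Primitive

/-! ### Explicit solution of physical parallel transport. -/

section PhysicalTransport

/-- The difference of the two connections along the first vector of a null frame. -/
lemma IsNullFrame.frameVec_conformal {V : Type*} [AddCommGroup V] [Module ℝ V]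
    {g : LinearMap.BilinForm ℝ V} {l k e₁ e₂ : V} (hF : IsNullFrame g l k e₁ e₂) (N : V) (o : ℝ)
    (v : Fin 4 → ℝ) :
    frameVec l k e₁ e₂ ![o * (2 * g N l * v 0 + (g N e₁ * v 2 + g N e₂ * v 3)), 0,
      o * (g N l * v 2 + v 1 * g N e₁), o * (g N l * v 3 + v 1 * g N e₂)] =
      (o * g N l) • frameVec l k e₁ e₂ v + (o * g N (frameVec l k e₁ e₂ v)) • l
        - (o * g l (frameVec l k e₁ e₂ v)) • N := by
  have h1 : g N (frameVec l k e₁ e₂ v) = v 0 * g N l + v 1 * g N k + v 2 * g N e₁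
      + v 3 * g N e₂ := by
    simp [frameVec]
  have h2 : g l (frameVec l k e₁ e₂ v) = -v 1 := by
    simp [frameVec, hF.ll, hF.lk, hF.le₁, hF.le₂]
  have hN := hF.expand N
  rw [hF.symm k N, hF.symm l N, hF.symm e₁ N, hF.symm e₂ N] at hN
  rw [h1, h2]
  simp only [frameVec, Matrix.cons_val]
  generalize g N l = a, g N k = b, g N e₁ = c, g N e₂ = d at hN ⊢
  rw [hN]
  module

variable {M : Type*} [TopologicalSpace M] [ChartedSpace (EuclideanHalfSpace 4) M]
  [IsManifold I4 ∞ M] {γ : ℝ → M} {w V : ∀ t, TangentSpace I4 (γ t)} {s : Set ℝ}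
  {g : ∀ p : M, LinearMap.BilinForm ℝ (TangentSpace I4 p)} {U : Set M}

lemma IsVelocity.hasDerivWithinAt_comp (hw : IsVelocity γ w s) {f : M → ℝ}
    (hf : ContMDiff I4 𝓘(ℝ, ℝ) ∞ f) {t : ℝ} (ht : t ∈ s) :
    HasDerivWithinAt (fun r => f (γ r)) (differential f (γ t) (w t)) s t := by
  set x := γ t
  have hxs : γ t ∈ (extChartAt I4 x).source := mem_extChartAt_source (γ t)
  set s' := s ∩ γ ⁻¹' (extChartAt I4 x).source with hs'
  have hmem : s' ∈ 𝓝[s] t := hw.mem_nhdsWithin ht (isOpen_extChartAt_source x) hxs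
  have hy : extChartAt I4 x (γ t) ∈ chartDom univ x := extChartAt_mem_chartDom hxs (mem_univ _)
  have hm : MapsTo (fun r => extChartAt I4 x (γ r)) s' (chartDom univ x) := fun r hr =>
    extChartAt_mem_chartDom hr.2 (mem_univ _)
  have h1 := (hasFDerivWithinAt_of_contDiffOn (contDiffOn_inChart hf x univ) hy).comp_hasDerivWithinAt
    t ((hw.hasDerivWithinAt ht hxs).mono (inter_subset_left : s' ⊆ s)) hm
  have e : ∀ r ∈ s', f (γ r) = inChart f x (extChartAt I4 x (γ r)) := fun r hr => by
    rw [inChart, (extChartAt I4 x).left_inv hr.2]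
  rw [differential_eq hf isOpen_univ hxs (mem_univ _)]
  exact (h1.congr e (e t ⟨ht, hxs⟩)).mono_of_mem_nhdsWithin hmem

lemma IsParallelOn.continuousOn_differential (hw : IsVelocity γ w s) (hV : IsParallelOn g γ w V s)
    {f : M → ℝ} (hf : ContMDiff I4 𝓘(ℝ, ℝ) ∞ f) :
    ContinuousOn (fun r => differential f (γ r) (V r)) s := by
  intro t ht
  set x := γ t
  have hxs : γ t ∈ (extChartAt I4 x).source := mem_extChartAt_source (γ t)
  set s' := s ∩ γ ⁻¹' (extChartAt I4 x).source with hs'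
  have hmem : s' ∈ 𝓝[s] t := hw.mem_nhdsWithin ht (isOpen_extChartAt_source x) hxs
  have hy : extChartAt I4 x (γ t) ∈ chartDom univ x := extChartAt_mem_chartDom hxs (mem_univ _)
  have hm : MapsTo (fun r => extChartAt I4 x (γ r)) s' (chartDom univ x) := fun r hr =>
    extChartAt_mem_chartDom hr.2 (mem_univ _)
  have hd := ((contDiffOn_inChart hf x univ).fderivWithin
    (isRelOpen_chartDom isOpen_univ x).isRegularDomain.unique (m := ∞) (by simp)).continuousOn _ hy
  have h1 := (ContinuousWithinAt.comp (f := fun r => extChartAt I4 x (γ r)) (x := t) hd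
    ((hw.hasDerivWithinAt ht hxs).continuousWithinAt.mono (inter_subset_left : s' ⊆ s)) hm).clm_apply
    ((hV t ht).continuousWithinAt.mono (inter_subset_left : s' ⊆ s))
  have e : ∀ r ∈ s', differential f (γ r) (V r) =
      fderivWithin ℝ (inChart f x) (chartDom univ x) (extChartAt I4 x (γ r))
        (ofTan x (γ r) (V r)) := fun r hr => differential_eq hf isOpen_univ hr.2 (mem_univ _) _
  exact (h1.congr e (e t ⟨ht, hxs⟩)).mono_of_mem_nhdsWithin hmem

namespace PenroseCompletion

variable {Λ : ℝ} (S : PenroseCompletion M Λ)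

lemma chr_ghat {p : M} (hp : p ∈ S.regular) (u v : TangentSpace I4 p) :
    chr (comps S.ghat p) (extChartAt I4 p p) (ofTan p p u) (ofTan p p v) =
      chr (comps S.g p) (extChartAt I4 p p) (ofTan p p u) (ofTan p p v)
      - ofTan p p (((S.Ω p)⁻¹ * differential S.Ω p u) • v
        + ((S.Ω p)⁻¹ * differential S.Ω p v) • u - ((S.Ω p)⁻¹ * S.g p u v) • S.N p) := by
  have hpp := mem_extChartAt_source (I := I4) p
  have hy : extChartAt I4 p p ∈ chartDom S.regular p := extChartAt_mem_chartDom hpp hp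
  have hG := (S.isMetricField.mono S.isOpen_regular (subset_univ _)).isMetricMatrix p
  have hG' := S.isMetricField_ghat.isMetricMatrix p
  have hb : ∀ y ∈ chartDom S.regular p, ∀ u v, bil (comps S.ghat p) y u v =
      (inChart S.Ω p y ^ 2)⁻¹ * bil (comps S.g p) y u v := fun y _ u v => by
    rw [bil_comps, bil_comps]
    rfl
  have h := hG.localGeometry.christoffel_conformal hG'.localGeometry
    (contDiffOn_inChart S.smooth_Ω p S.regular) (fun y hy => hy.2) hb
    (fun y hy => hG.bil_gradCoord (inChart S.Ω p) hy) hy (ofTan p p u) (ofTan p p v)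
  have e : inChart S.Ω p (extChartAt I4 p p) = S.Ω p := by
    rw [inChart, (extChartAt I4 p).left_inv hpp]
  have eN : gradCoord (comps S.g p) (inChart S.Ω p) (extChartAt I4 p p) = ofTan p p (S.N p) := by
    rw [← S.N_eq, ofTan_self]
  rw [e, ← differential_eq S.smooth_Ω S.isOpen_regular hpp hp,
    ← differential_eq S.smooth_Ω S.isOpen_regular hpp hp, bil_comps_apply S.g hpp, eN] at h
  rw [h, map_sub, map_add, map_smul, map_smul, map_smul]
  abel

variable {S} {t₁ : ℝ} (hγ : S.IsNullGeodesicToScri γ t₁)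
include hγ

lemma IsNullGeodesicToScri.isVelocity : IsVelocity γ (velocity γ (Icc t₁ 0)) (Icc t₁ 0) :=
  isVelocity_velocity hγ.smooth

lemma IsNullGeodesicToScri.regular {t : ℝ} (ht : t ∈ Ico t₁ 0) : γ t ∈ S.regular :=
  S.interior_subset_regular (hγ.physical t ht)

variable (F : ParallelFrame S.g γ (velocity γ (Icc t₁ 0)) (Icc t₁ 0))
  (hl : F.l = velocity γ (Icc t₁ 0))
include hl

/-- The fields that are parallel with respect to the physical metric. -/
lemma isParallelOn_ghat {Q₂ Q₃ : ℝ → ℝ}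
    (h₂ : ∀ t ∈ Ico t₁ 0, HasDerivWithinAt Q₂
      (differential S.Ω (γ t) (F.e₁ t) / S.Ω (γ t) ^ 2) (Ico t₁ 0) t)
    (h₃ : ∀ t ∈ Ico t₁ 0, HasDerivWithinAt Q₃
      (differential S.Ω (γ t) (F.e₂ t) / S.Ω (γ t) ^ 2) (Ico t₁ 0) t) (c : ℝ) (u : Fin 4 → ℝ) :
    IsParallelOn S.ghat γ (velocity γ (Icc t₁ 0)) (fun t => F.vec t
      (boostRot (S.Ω (γ t) * c) (S.Ω (γ t) * Q₂ t) (S.Ω (γ t) * Q₃ t) u)) (Ico t₁ 0) := by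
  intro t ht
  have hsub : Ico t₁ 0 ⊆ Icc t₁ 0 := Ico_subset_Icc_self
  have ht' := hsub ht
  have hr := hγ.regular ht
  have h0 : S.Ω (γ t) ≠ 0 := hr
  set a := differential S.Ω (γ t) (velocity γ (Icc t₁ 0) t) with ha
  set n₂ := differential S.Ω (γ t) (F.e₁ t) with hn₂
  set n₃ := differential S.Ω (γ t) (F.e₂ t) with hn₃
  -- In frame components the physical equation is triangular. It is solved with `s = Ω c`, `q = Ω Q`
  -- because `s' = (Ω'/Ω) s` and `q' = (Ω'/Ω) q + n/Ω`; the `k` component is constant.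
  have hO : HasDerivWithinAt (fun r => S.Ω (γ r)) a (Ico t₁ 0) t :=
    (hγ.isVelocity.mono hsub).hasDerivWithinAt_comp S.smooth_Ω ht
  have hs := hO.mul_const c
  have hq₂ := hO.mul (h₂ t ht)
  have hq₃ := hO.mul (h₃ t ht)
  set v := boostRot (S.Ω (γ t) * c) (S.Ω (γ t) * Q₂ t) (S.Ω (γ t) * Q₃ t) u with hv
  have hb0 : HasDerivWithinAt (fun r => boostRot (S.Ω (γ r) * c) (S.Ω (γ r) * Q₂ r)
      (S.Ω (γ r) * Q₃ r) u 0) ((S.Ω (γ t))⁻¹ * (2 * a * v 0 + (n₂ * v 2 + n₃ * v 3)))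
      (Ico t₁ 0) t := by
    have := ((((hs.pow 2).mul_const (u 0)).add (hs.mul ((hq₂.mul_const (u 2)).add
      (hq₃.mul_const (u 3))))).add ((((hq₂.pow 2).add (hq₃.pow 2)).const_mul (u 1)).div_const 2))
    refine this.congr_deriv ?_
    simp only [hv, boostRot, Matrix.cons_val, Pi.mul_apply, Pi.add_apply]
    field_simp
    ring
  have hb1 : HasDerivWithinAt (fun r => boostRot (S.Ω (γ r) * c) (S.Ω (γ r) * Q₂ r)
      (S.Ω (γ r) * Q₃ r) u 1) 0 (Ico t₁ 0) t := hasDerivWithinAt_const _ _ _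
  have hb2 : HasDerivWithinAt (fun r => boostRot (S.Ω (γ r) * c) (S.Ω (γ r) * Q₂ r)
      (S.Ω (γ r) * Q₃ r) u 2) ((S.Ω (γ t))⁻¹ * (a * v 2 + v 1 * n₂)) (Ico t₁ 0) t := by
    refine ((hs.mul_const (u 2)).add (hq₂.const_mul (u 1))).congr_deriv ?_
    simp only [hv, boostRot, Matrix.cons_val]
    field_simp
    ring
  have hb3 : HasDerivWithinAt (fun r => boostRot (S.Ω (γ r) * c) (S.Ω (γ r) * Q₂ r)
      (S.Ω (γ r) * Q₃ r) u 3) ((S.Ω (γ t))⁻¹ * (a * v 3 + v 1 * n₃)) (Ico t₁ 0) t := by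
    refine ((hs.mul_const (u 3)).add (hq₃.const_mul (u 1))).congr_deriv ?_
    simp only [hv, boostRot, Matrix.cons_val]
    field_simp
    ring
  have hF := F.frame t ht'
  have hE := (((hb0.smul ((F.parallel_l t ht').mono hsub)).add
    (hb1.smul ((F.parallel_k t ht').mono hsub))).add
    (hb2.smul ((F.parallel_e₁ t ht').mono hsub))).add (hb3.smul ((F.parallel_e₂ t ht').mono hsub))
  have hvec : ∀ r, ofTan (γ t) (γ r) (F.vec r (boostRot (S.Ω (γ r) * c) (S.Ω (γ r) * Q₂ r)
      (S.Ω (γ r) * Q₃ r) u)) = _ := fun r => by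
    rw [ParallelFrame.vec, frameVec, map_add, map_add, map_add, map_smul, map_smul, map_smul,
      map_smul]
  refine (hE.congr_deriv ?_).congr (fun r _ => hvec r) (hvec t)
  have hlt : F.l t = velocity γ (Icc t₁ 0) t := congrFun hl t
  have key := hF.frameVec_conformal (S.N (γ t)) (S.Ω (γ t))⁻¹ v
  have ea : differential S.Ω (γ t) (F.l t) = a := by rw [ha, hlt]
  rw [S.g_N, S.g_N, S.g_N, S.g_N, ea, ← hn₂, ← hn₃] at key
  rw [S.chr_ghat hr]
  beta_reduce
  have hvt : F.vec t v = frameVec (F.l t) (F.k t) (F.e₁ t) (F.e₂ t) v := rfl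
  rw [← hv, ← ha, ← hlt, hvt, ← key]
  simp only [frameVec, map_add, map_smul, Matrix.cons_val]
  module

/-- The primitives are normalised to vanish at `t₁`, where `boostRot` is then the identity, so the
explicit fields have the prescribed initial values. -/
lemma exists_physical_transport : ∃ Q₂ Q₃ : ℝ → ℝ,
    (∀ t ∈ Ico t₁ 0, HasDerivWithinAt Q₂
      (differential S.Ω (γ t) (F.e₁ t) / S.Ω (γ t) ^ 2) (Ico t₁ 0) t) ∧
    (∀ t ∈ Ico t₁ 0, HasDerivWithinAt Q₃
      (differential S.Ω (γ t) (F.e₂ t) / S.Ω (γ t) ^ 2) (Ico t₁ 0) t) ∧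
    ∀ t ∈ Ico t₁ 0, ∀ u, propagator S.ghat γ (Ico t₁ 0) t₁ t (F.vec t₁ u) =
      F.vec t (boostRot (S.Ω (γ t) * (S.Ω (γ t₁))⁻¹) (S.Ω (γ t) * Q₂ t) (S.Ω (γ t) * Q₃ t) u) := by
  have hsub : Ico t₁ 0 ⊆ Icc t₁ 0 := Ico_subset_Icc_self
  have hΩ : ∀ t ∈ Ico t₁ 0, S.Ω (γ t) ^ 2 ≠ 0 := fun t ht => pow_ne_zero 2 (hγ.regular ht)
  have hcont : ∀ {V}, IsParallelOn S.g γ (velocity γ (Icc t₁ 0)) V (Icc t₁ 0) →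
      ContinuousOn (fun t => differential S.Ω (γ t) (V t) / S.Ω (γ t) ^ 2) (Ico t₁ 0) :=
    fun hV => ((hV.continuousOn_differential hγ.isVelocity S.smooth_Ω).mono hsub).div
      ((S.smooth_Ω.continuous.comp_continuousOn (hγ.smooth.continuousOn.mono hsub)).pow 2) hΩ
  obtain ⟨Q₂, hQ₂, h₂⟩ := exists_primitive_Ico (hcont F.parallel_e₁)
  obtain ⟨Q₃, hQ₃, h₃⟩ := exists_primitive_Ico (hcont F.parallel_e₂)
  refine ⟨Q₂, Q₃, h₂, h₃, fun t ht u => ?_⟩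
  have ht₁ : t₁ ∈ Ico t₁ 0 := left_mem_Ico.2 hγ.neg
  have hp := isParallelOn_ghat hγ F hl h₂ h₃ (S.Ω (γ t₁))⁻¹
  have hr₁ : S.Ω (γ t₁) ≠ 0 := hγ.regular ht₁
  have hinit : ∀ u, boostRot (S.Ω (γ t₁) * (S.Ω (γ t₁))⁻¹) (S.Ω (γ t₁) * Q₂ t₁)
      (S.Ω (γ t₁) * Q₃ t₁) u = u := fun u => by
    rw [hQ₂, hQ₃, mul_inv_cancel₀ hr₁]
    ext i; fin_cases i <;> simp [boostRot]
  have hw : IsVelocity γ (velocity γ (Icc t₁ 0)) (Ico t₁ 0) := hγ.isVelocity.mono hsub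
  have hU : MapsTo γ (Ico t₁ 0) S.regular := fun t ht => hγ.regular ht
  have hT := (F.frame t₁ (hsub ht₁)).toIsNullTetrad.smul hr₁
  have hv : ∀ a b c d : ℝ, F.vec t₁ ![a, b, c, d] =
      a • F.l t₁ + b • F.k t₁ + c • F.e₁ t₁ + d • F.e₂ t₁ := fun a b c d => by
    simp [ParallelFrame.vec, frameVec]
  -- Rescaling the frame at `t₁` by `Ω` makes it a null tetrad of the physical metric. Its explicit
  -- parallel extension supplies the uniqueness that identifies the physical propagator.
  let F' : ParallelFrame S.ghat γ (velocity γ (Icc t₁ 0)) (Ico t₁ 0) :=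
    ParallelFrame.ofParallel S.isMetricField_ghat hw hU (convex_Ico t₁ 0)
      (hp ![S.Ω (γ t₁), 0, 0, 0]) (hp ![0, S.Ω (γ t₁), 0, 0]) (hp ![0, 0, S.Ω (γ t₁), 0]) (hp ![0, 0, 0, S.Ω (γ t₁)]) ht₁ (by
        rw [hinit, hinit, hinit, hinit, hv, hv, hv, hv]
        simpa [ghat, physMetric] using hT)
  have hvel : ∀ t ∈ Ico t₁ 0, velocity γ (Ico t₁ 0) t = velocity γ (Icc t₁ 0) t := fun t ht =>
    hw.velocity_eq ht (uniqueDiffOn_Ico t₁ 0 t ht)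
  have := F'.propagator_eq S.isMetricField_ghat hw hU (convex_Ico t₁ 0) hvel (hp u) ht₁ ht
  simpa only [hinit] using this

end PenroseCompletion

end PhysicalTransport

/-! ### The five-term decomposition of the transported Weyl tensor. -/

section TransportedWeyl

lemma weylForm_sum {ι : Type*} (s : Finset ι) (c : ι → Fin 5 → ℂ) (u v w x : Fin 4 → ℝ) :
    weylForm (∑ i ∈ s, c i) u v w x = ∑ i ∈ s, weylForm (c i) u v w x := by
  classical
  induction s using Finset.induction_on with
  | empty => simp [weylForm]
  | insert i s hi ih => rw [Finset.sum_insert hi, Finset.sum_insert hi, weylForm_add, ih]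

lemma smul_frameWeyl {V : Type*} [AddCommGroup V] [Module ℝ V] (g : LinearMap.BilinForm ℝ V)
    (l k e₁ e₂ : V) (r : ℝ) (c : Fin 5 → ℂ) :
    r • frameWeyl g l k e₁ e₂ c = frameWeyl g l k e₁ e₂ (r • c) := by
  ext u v w x
  exact (weylForm_smul ..).symm

variable {M : Type*} [TopologicalSpace M] [ChartedSpace (EuclideanHalfSpace 4) M]
  [IsManifold I4 ∞ M] {γ : ℝ → M} {Λ : ℝ} {S : PenroseCompletion M Λ} {t₁ : ℝ}

/-- The components of the rescaled Weyl tensor in a parallel frame. -/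
def ParallelFrame.rescaledComp {w : ∀ t, TangentSpace I4 (γ t)} {s : Set ℝ}
    (F : ParallelFrame S.g γ w s) (t : ℝ) : Fin 5 → ℂ :=
  weylComp (S.dTens (γ t)) (F.l t) (F.k t) (F.e₁ t) (F.e₂ t)

/-- The tensor at parameter `t` with given components in a parallel frame. -/
def ParallelFrame.weylTens {g : ∀ p : M, LinearMap.BilinForm ℝ (TangentSpace I4 p)}
    {w : ∀ t, TangentSpace I4 (γ t)} {s : Set ℝ}
    (F : ParallelFrame g γ w s) (t : ℝ) (c : Fin 5 → ℂ) : Tens4 (TangentSpace I4 (γ t)) :=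
  frameWeyl (g (γ t)) (F.l t) (F.k t) (F.e₁ t) (F.e₂ t) c

namespace PenroseCompletion

variable (hγ : S.IsNullGeodesicToScri γ t₁)
  (F : ParallelFrame S.g γ (velocity γ (Icc t₁ 0)) (Icc t₁ 0))
include hγ

lemma propagator_vec {a b : ℝ} (ha : a ∈ Icc t₁ 0) (hb : b ∈ Icc t₁ 0) (u : Fin 4 → ℝ) :
    propagator S.g γ (Icc t₁ 0) a b (F.vec a u) = F.vec b u :=
  F.propagator_eq S.isMetricField hγ.isVelocity (mapsTo_univ _ _) (convex_Icc t₁ 0)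
    (fun _ _ => rfl) (F.isParallelOn_vec u) ha hb

lemma dTens_eq {t : ℝ} (ht : t ∈ Ico t₁ 0) :
    S.dTens (γ t) = F.weylTens t (F.rescaledComp t) := by
  obtain ⟨b, -⟩ := S.lorentzian (γ t)
  exact (S.isWeylCandidate_dTens (hγ.regular ht)).eq_frameWeyl
    (F.frame t (Ico_subset_Icc_self ht)) b

/-- The components at the endpoint of the five parts of the transported Weyl tensor. -/
def peelComp (F : ParallelFrame S.g γ (velocity γ (Icc t₁ 0)) (Icc t₁ 0)) (Q₂ Q₃ : ℝ → ℝ)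
    (t : ℝ) (a : Fin 5) : ℂ :=
  ((S.Ω (γ t₁) ^ (6 - (a : ℕ)))⁻¹ : ℝ) *
    nullRot ⟨S.Ω (γ t) * Q₂ t, -(S.Ω (γ t) * Q₃ t)⟩ (F.rescaledComp t) a

/-- In a parallel frame the conformal propagators disappear, and the boost weights of
`weylForm_boostRot` sort the five components by powers of `Ω`. -/
lemma transportedWeyl_eq {Q₂ Q₃ : ℝ → ℝ} {t : ℝ} (ht : t ∈ Ico t₁ 0)
    (h : ∀ u, propagator S.ghat γ (Ico t₁ 0) t₁ t (F.vec t₁ u) =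
      F.vec t (boostRot (S.Ω (γ t) * (S.Ω (γ t₁))⁻¹) (S.Ω (γ t) * Q₂ t) (S.Ω (γ t) * Q₃ t) u)) :
    S.transportedWeyl γ t₁ t = ∑ a : Fin 5,
      S.Ω (γ t) ^ (5 - (a : ℕ)) • F.weylTens 0 (Pi.single a (peelComp F Q₂ Q₃ t a)) := by
  have ht' := Ico_subset_Icc_self ht
  have h1 : t₁ ∈ Icc t₁ 0 := left_mem_Icc.2 hγ.neg.le
  have h0 : (0 : ℝ) ∈ Icc t₁ 0 := right_mem_Icc.2 hγ.neg.le
  have hr : S.Ω (γ t) ≠ 0 := hγ.regular ht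
  set B := boostRot (S.Ω (γ t) * (S.Ω (γ t₁))⁻¹) (S.Ω (γ t) * Q₂ t) (S.Ω (γ t) * Q₃ t)
  have hL : ∀ u, propagator S.g γ (Icc t₁ 0) 0 t (S.L γ t₁ t u) = F.vec t (B (F.coord 0 u)) := by
    intro u
    conv_lhs => rw [← F.vec_coord h0 u]
    rw [L, propagator_vec hγ F h0 h1, h, propagator_vec hγ F ht' h0, propagator_vec hγ F h0 ht']
  ext u v w x
  rw [transportedWeyl, toEndpoint]
  beta_reduce
  rw [hL, hL, hL, hL, S.weyl_ghat (hγ.regular ht), dTens_eq hγ F ht]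
  have hc : ∀ u, frameCoord (S.g (γ t)) (F.l t) (F.k t) (F.e₁ t) (F.e₂ t) (F.vec t u) = u :=
    fun u => F.coord_vec ht' u
  rw [ParallelFrame.weylTens, frameWeyl, hc, hc, hc, hc, weylForm_boostRot]
  simp only [Finset.sum_apply, ParallelFrame.weylTens, smul_frameWeyl]
  simp only [frameWeyl]
  rw [← weylForm_sum, ← weylForm_smul]
  congr 1
  ext a
  rw [Finset.sum_apply, Finset.sum_eq_single a]
  -- One of the `6 - a` powers of `Ω` from the boost is used up by the factor `Ω⁻¹` of the physical
  -- Weyl tensor.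
  · have e : 6 - (a : ℕ) = (5 - (a : ℕ)) + 1 := by omega
    have hr' : (S.Ω (γ t) : ℂ) ≠ 0 := by exact_mod_cast hr
    simp only [Pi.smul_apply, Pi.single_eq_same, Complex.real_smul, peelComp]
    push_cast
    rw [mul_pow, e, pow_succ (S.Ω (γ t) : ℂ), inv_pow]
    field_simp
  · intro b _ hb
    rw [Pi.smul_apply, Pi.single_eq_of_ne hb.symm, smul_zero]
  · simp

end PenroseCompletion

end TransportedWeyl

/-! ### Expansions of the null-rotation parameters. -/

section ScalarExpansions

lemma HasExpansion.mk_complex {f g : ℝ → ℝ} (hf : HasExpansion fun t => (f t : ℂ))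
    (hg : HasExpansion fun t => (g t : ℂ)) : HasExpansion fun t => (⟨f t, g t⟩ : ℂ) := by
  refine (hf.add (hg.const_mul Complex.I)).congr' (Eventually.of_forall fun t => ?_)
  beta_reduce
  rw [mul_comm Complex.I]
  exact (Complex.mk_eq_add_mul_I _ _).symm

lemma Iio_le_Icc {a : ℝ} (ha : a < 0) : 𝓝[<] (0 : ℝ) ≤ 𝓝[Icc a 0] 0 := by
  refine le_inf inf_le_left (le_principal_iff.2 ?_)
  filter_upwards [self_mem_nhdsWithin, mem_nhdsWithin_of_mem_nhds (Ioi_mem_nhds ha)] with t h1 h2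
  exact ⟨h2.le, h1.le⟩

lemma isBigO_of_contDiffOn {f : ℝ → ℝ} {a : ℝ} (ha : a < 0) (hf : ContDiffOn ℝ ∞ f (Icc a 0))
    (h0 : f 0 = 0) (n : ℕ) (hn : n ≤ 1 ∨ n ≤ 2 ∧ HasDerivWithinAt f 0 (Icc a 0) 0) :
    f =O[𝓝[<] (0 : ℝ)] fun t => t ^ n := by
  have hu := uniqueDiffOn_Icc ha 0 (right_mem_Icc.2 ha.le)
  rcases hn with hn | ⟨hn, hd⟩
  · refine IsBigO.trans ?_ (isBigO_pow_left_of_le hn)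
    simpa [h0] using isBigO_taylor ha hf 0
  · refine IsBigO.trans ?_ (isBigO_pow_left_of_le hn)
    simpa [Finset.sum_range_succ, h0, iteratedDerivWithin_one, hd.derivWithin hu] using
      isBigO_taylor ha hf 1

lemma HasExpansion.div_pow' {f : ℝ → ℂ} {m : ℕ} (hf : HasExpansion f)
    (h : f =O[𝓝[<] (0 : ℝ)] fun t => t ^ m) : HasExpansion fun t => f t / (t : ℂ) ^ m := by
  refine hf.div_pow h ?_
  filter_upwards [self_mem_nhdsWithin] with t ht
  have : (t : ℂ) ≠ 0 := by exact_mod_cast (ne_of_lt ht)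
  field_simp

/-- If `Ω` has a simple zero at the endpoint, the primitives of `n / Ω²` have an expansion as soon
as `n` vanishes to second order there. -/
lemma hasExpansion_primitive {Ω n Q : ℝ → ℝ} {a : ℝ} (ha : a < 0)
    (hΩ : ContDiffOn ℝ ∞ Ω (Icc a 0)) (hΩ0 : Ω 0 = 0)
    (hΩ1 : HasDerivWithinAt Ω (-1) (Icc a 0) 0) (hn : ContDiffOn ℝ ∞ n (Icc a 0))
    (hn0 : n 0 = 0) (hn1 : HasDerivWithinAt n 0 (Icc a 0) 0)
    (hQ : ∀ t ∈ Ioo a 0, HasDerivAt Q (n t / Ω t ^ 2) t) :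
    HasExpansion (fun t => ((Ω t * Q t : ℝ) : ℂ)) ∧
      Tendsto (fun t => Ω t * Q t) (𝓝[<] 0) (𝓝 0) := by
  have hΩe := hasExpansion_of_contDiffOn ha hΩ
  have hslope : Tendsto (fun t : ℝ => (Ω t : ℂ) / (t : ℂ) ^ 1) (𝓝[<] 0) (𝓝 (-1)) := by
    have h1 := (hasDerivWithinAt_iff_tendsto_slope.1 hΩ1).mono_left
      (le_inf (Iio_le_Icc ha |>.trans inf_le_left) (le_principal_iff.2 ?_) :
        𝓝[<] (0 : ℝ) ≤ 𝓝[Icc a 0 \ {0}] 0)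
    · have h2 := (Complex.continuous_ofReal.tendsto (-1)).comp h1
      push_cast at h2
      refine h2.congr fun t => ?_
      simp [slope_def_field, hΩ0]
    · filter_upwards [Iio_le_Icc ha self_mem_nhdsWithin, self_mem_nhdsWithin] with t h1 h2
      exact ⟨h1, (show t < 0 from h2).ne⟩
  have hbig : (fun t => (Ω t : ℂ)) =O[𝓝[<] (0 : ℝ)] fun t => t ^ 1 :=
    Complex.isBigO_ofReal_left.2 (isBigO_of_contDiffOn ha hΩ hΩ0 1 (Or.inl le_rfl))
  have hbig' : (fun t => (n t : ℂ)) =O[𝓝[<] (0 : ℝ)] fun t => t ^ 2 :=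
    Complex.isBigO_ofReal_left.2 (isBigO_of_contDiffOn ha hn hn0 2 (Or.inr ⟨le_rfl, hn1⟩))
  have e1 := (hΩe.div_pow' hbig).inv (by norm_num) hslope
  -- `n / Ω² = (n / t²) (Ω / t)⁻²`, with `Ω / t → -1`. A simple zero of `n` would leave a pole
  -- `1/t`, and a logarithm in the primitive.
  have e2 := ((hasExpansion_of_contDiffOn ha hn).div_pow' hbig').mul (e1.pow 2)
  have e3 : HasExpansion fun t => ((n t / Ω t ^ 2 : ℝ) : ℂ) := by
    refine e2.congr' ?_
    filter_upwards [self_mem_nhdsWithin] with t ht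
    have : (t : ℂ) ≠ 0 := by exact_mod_cast (ne_of_lt ht)
    push_cast
    rw [pow_one, inv_div, div_pow]
    field_simp
  have e4 : HasExpansion fun t => (Q t : ℂ) :=
    e3.of_hasDerivAt ha fun t ht => (hQ t ht).ofReal_comp
  have e5 := hΩe.mul e4
  refine ⟨e5.congr' (Eventually.of_forall fun t => by push_cast; rfl), ?_⟩
  have h6 : (fun t => Ω t * Q t) =O[𝓝[<] (0 : ℝ)] fun t => t ^ 1 := by
    refine Complex.isBigO_ofReal_left.1 ?_
    simpa using hbig.mul e4.isBigO_one
  simp only [pow_one] at h6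
  exact h6.trans_tendsto
    ((continuous_id.tendsto (0 : ℝ)).mono_left (nhdsWithin_le_nhds (s := Iio 0)))

lemma HasExpansion.exists_coeff_of_tendsto {f : ℝ → ℂ} (hf : HasExpansion f) {z : ℂ}
    (h : Tendsto f (𝓝[<] 0) (𝓝 z)) : ∃ c : ℕ → ℂ, c 0 = z ∧ ∀ n : ℕ,
    (fun t : ℝ => f t - ∑ i ∈ Finset.range (n + 1), (t : ℂ) ^ i * c i)
      =O[𝓝[<] (0 : ℝ)] fun t => t ^ (n + 1) := by
  obtain ⟨c, hc⟩ := hf.exists_coeff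
  refine ⟨c, ?_, hc⟩
  have h1 : Tendsto (fun t : ℝ => f t - c 0) (𝓝[<] 0) (𝓝 0) := by
    have h2 := hc 0
    simp only [zero_add, Finset.sum_range_one, pow_zero, one_mul, pow_one] at h2
    exact h2.trans_tendsto
      ((continuous_id.tendsto (0 : ℝ)).mono_left (nhdsWithin_le_nhds (s := Iio 0)))
  exact (tendsto_nhds_unique h (by simpa using h1.add_const (c 0))).symm

lemma hasExpansion_nullRot {r : ℝ → ℂ} {κ : ℝ → Fin 5 → ℂ} (hr : HasExpansion r)
    (hκ : ∀ a, HasExpansion fun t => κ t a) (a : Fin 5) :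
    HasExpansion fun t => nullRot (r t) (κ t) a := by
  have h := hκ
  fin_cases a
  · exact h 0
  · exact (h 1).add (hr.mul (h 0))
  · exact ((h 2).add ((hr.const_mul 2).mul (h 1))).add ((hr.pow 2).mul (h 0))
  · refine ((((h 3).sub ((hr.const_mul (3 / 2)).mul (h 2))).sub
      (((hr.pow 2).const_mul (3 / 2)).mul (h 1))).sub
      (((hr.pow 3).mul (h 0)).const_mul (1 / 2))).congr' (Eventually.of_forall fun t => ?_)
    simp [nullRot]
    ring
  · refine (((((h 4).sub ((hr.const_mul 2).mul (h 3))).add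
      (((hr.pow 2).const_mul (3 / 2)).mul (h 2))).add
      ((hr.pow 3).mul (h 1))).add
      (((hr.pow 4).mul (h 0)).const_mul (1 / 4))).congr' (Eventually.of_forall fun t => ?_)
    simp [nullRot]
    ring

lemma continuous_nullRot : Continuous fun p : ℂ × (Fin 5 → ℂ) => nullRot p.1 p.2 := by
  refine continuous_pi fun a => ?_
  fin_cases a <;> simp only [nullRot] <;> fun_prop

lemma nullRot_zero (c : Fin 5 → ℂ) : nullRot 0 c = c := by
  ext a
  fin_cases a <;> simp [nullRot]

end ScalarExpansions

/-! ### Smoothness up to the endpoint. -/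

section EndpointSmoothness

lemma forall_of_coordVec {D : E4 →L[ℝ] E4 →L[ℝ] ℝ} {L : E4 →L[ℝ] ℝ} {Γ : E4 →L[ℝ] E4 →L[ℝ] E4}
    (h : ∀ i j, D (coordVec i) (coordVec j) - L (Γ (coordVec i) (coordVec j)) = 0) (u v : E4) :
    D u v - L (Γ u v) = 0 := by
  refine eq_of_coordVec (g := fun _ => (0 : ℝ)) (f := fun u => D u v - L (Γ u v)) ?_ ?_
    (fun i => ?_) u
  · constructor <;> intros <;> simp <;> ring
  · constructor <;> intros <;> simp
  refine eq_of_coordVec (g := fun _ => (0 : ℝ))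
    (f := fun v => D (coordVec i) v - L (Γ (coordVec i) v)) ?_ ?_ (h i) v
  · constructor <;> intros <;> simp <;> ring
  · constructor <;> intros <;> simp

variable {M : Type*} [TopologicalSpace M] [ChartedSpace (EuclideanHalfSpace 4) M]
  [IsManifold I4 ∞ M] {γ : ℝ → M} {w V V₁ V₂ V₃ V₄ : ∀ t, TangentSpace I4 (γ t)}
  {Λ : ℝ} (S : PenroseCompletion M Λ)

lemma IsParallelOn.mono {g : ∀ p : M, LinearMap.BilinForm ℝ (TangentSpace I4 p)} {s s' : Set ℝ}
    (hV : IsParallelOn g γ w V s) (h : s' ⊆ s) : IsParallelOn g γ w V s' := fun t ht =>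
  (hV t (h ht)).mono h

lemma map_toTan {X : Type*} [AddCommMonoid X] [Module ℝ X] {x p : M}
    (A : TangentSpace I4 p →ₗ[ℝ] X) (u : E4) :
    A (toTan x p u) = ∑ i, u i • A (chartVec x p i) := by
  conv_lhs => rw [← sum_coordVec u]
  simp only [map_sum, map_smul]
  rfl

namespace PenroseCompletion

/-- The components of the rescaled Weyl tensor in a chart, as a function of four vectors. -/
def dCoord (x : M) (y u v a b : E4) : ℝ :=
  S.d ((extChartAt I4 x).symm y) (toTan x _ u) (toTan x _ v) (toTan x _ a) (toTan x _ b)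

lemma dCoord_eq_sum (x : M) (y u v a b : E4) : S.dCoord x y u v a b =
    ∑ i, ∑ j, ∑ k, ∑ l, u i * (v j * (a k * (b l * S.d ((extChartAt I4 x).symm y) (chartVec x _ i)
      (chartVec x _ j) (chartVec x _ k) (chartVec x _ l)))) := by
  rw [dCoord, map_toTan (S.d _) u]
  simp only [LinearMap.sum_apply, LinearMap.smul_apply, smul_eq_mul]
  refine Finset.sum_congr rfl fun i _ => ?_
  rw [map_toTan (S.d _ _) v]
  simp only [LinearMap.sum_apply, LinearMap.smul_apply, smul_eq_mul, Finset.mul_sum]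
  refine Finset.sum_congr rfl fun j _ => ?_
  rw [map_toTan (S.d _ _ _) a]
  simp only [LinearMap.sum_apply, LinearMap.smul_apply, smul_eq_mul, Finset.mul_sum]
  refine Finset.sum_congr rfl fun k _ => ?_
  rw [map_toTan (S.d _ _ _ _) b]
  simp only [smul_eq_mul, Finset.mul_sum]

lemma dTens_eq_dCoord {x p : M} (hp : p ∈ (extChartAt I4 x).source)
    (u v a b : TangentSpace I4 p) : S.dTens p u v a b =
      S.dCoord x (extChartAt I4 x p) (ofTan x p u) (ofTan x p v) (ofTan x p a) (ofTan x p b) := by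
  have : ∀ q, q = p → S.d q (toTan x q (ofTan x p u)) (toTan x q (ofTan x p v))
      (toTan x q (ofTan x p a)) (toTan x q (ofTan x p b)) = S.d p u v a b := by
    rintro q rfl
    rw [toTan_ofTan hp, toTan_ofTan hp, toTan_ofTan hp, toTan_ofTan hp]
  exact (this _ ((extChartAt I4 x).left_inv hp)).symm

variable {a b : ℝ} (hab : a < b) (hγ : ContMDiffOn 𝓘(ℝ, ℝ) I4 ∞ γ (Icc a b))
  (hw : IsVelocity γ w (Icc a b)) {x : M} (hx : MapsTo γ (Icc a b) (extChartAt I4 x).source)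
include hab hγ hw hx

lemma contDiffOn_differential (hV : IsParallelOn S.g γ w V (Icc a b)) {f : M → ℝ}
    (hf : ContMDiff I4 𝓘(ℝ, ℝ) ∞ f) :
    ContDiffOn ℝ ∞ (fun t => differential f (γ t) (V t)) (Icc a b) := by
  have hm : MapsTo (fun r => extChartAt I4 x (γ r)) (Icc a b) (chartDom univ x) := fun r hr =>
    extChartAt_mem_chartDom (hx hr) (mem_univ _)
  have h1 := ((contDiffOn_inChart hf x univ).fderivWithin
    (isRelOpen_chartDom isOpen_univ x).isRegularDomain.unique (m := ∞) (by simp)).comp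
      (contDiffOn_chart_curve hγ hx) hm
  have h2 := hV.contDiffOn hab hγ hw hx S.isMetricField (mapsTo_univ _ _)
  exact (h1.clm_apply h2).congr fun t ht => differential_eq hf isOpen_univ (hx ht) (mem_univ _) _

lemma contDiffOn_dTens (h₁ : IsParallelOn S.g γ w V₁ (Icc a b))
    (h₂ : IsParallelOn S.g γ w V₂ (Icc a b)) (h₃ : IsParallelOn S.g γ w V₃ (Icc a b))
    (h₄ : IsParallelOn S.g γ w V₄ (Icc a b)) :
    ContDiffOn ℝ ∞ (fun t => S.dTens (γ t) (V₁ t) (V₂ t) (V₃ t) (V₄ t)) (Icc a b) := by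
  have hm : MapsTo (fun r => extChartAt I4 x (γ r)) (Icc a b) (extChartAt I4 x).target :=
    fun r hr => (extChartAt I4 x).map_source (hx hr)
  have hc : ∀ {V}, IsParallelOn S.g γ w V (Icc a b) → ∀ i : Fin 4,
      ContDiffOn ℝ ∞ (fun r => ofTan x (γ r) (V r) i) (Icc a b) := fun hV i =>
    (EuclideanSpace.proj (𝕜 := ℝ) i : E4 →L[ℝ] ℝ).contDiff.comp_contDiffOn
      (hV.contDiffOn hab hγ hw hx S.isMetricField (mapsTo_univ _ _))
  have : ContDiffOn ℝ ∞ (fun t => ∑ i, ∑ j, ∑ k, ∑ l, ofTan x (γ t) (V₁ t) i *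
      (ofTan x (γ t) (V₂ t) j * (ofTan x (γ t) (V₃ t) k * (ofTan x (γ t) (V₄ t) l *
        S.d ((extChartAt I4 x).symm (extChartAt I4 x (γ t))) (chartVec x _ i)
      (chartVec x _ j) (chartVec x _ k) (chartVec x _ l))))) (Icc a b) :=
    ContDiffOn.sum fun i _ => ContDiffOn.sum fun j _ => ContDiffOn.sum fun k _ =>
      ContDiffOn.sum fun l _ => (hc h₁ i).mul ((hc h₂ j).mul ((hc h₃ k).mul ((hc h₄ l).mul
        ((S.smooth_d x i j k l).comp (contDiffOn_chart_curve hγ hx) hm))))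
  exact this.congr fun t ht => by rw [S.dTens_eq_dCoord (hx ht), dCoord_eq_sum]

omit hab hγ hx in
/-- Where the Hessian vanishes, so does the derivative of the normal component of a parallel
field. -/
lemma hasDerivWithinAt_differential (hV : IsParallelOn S.g γ w V (Icc a b)) {t : ℝ}
    (ht : t ∈ Icc a b) (h : ∀ i j, hessian S.g S.Ω (γ t) i j = 0) :
    HasDerivWithinAt (fun r => differential S.Ω (γ r) (V r)) 0 (Icc a b) t := by
  have hxt := mem_extChartAt_source (I := I4) (γ t)
  set x := γ t with hx_def
  set s' := Icc a b ∩ γ ⁻¹' (extChartAt I4 x).source with hs'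
  have hmem : s' ∈ 𝓝[Icc a b] t := hw.mem_nhdsWithin ht (isOpen_extChartAt_source x) hxt
  have hy : extChartAt I4 x (γ t) ∈ chartDom univ x := extChartAt_mem_chartDom hxt (mem_univ _)
  have hm : MapsTo (fun r => extChartAt I4 x (γ r)) s' (chartDom univ x) := fun r hr =>
    extChartAt_mem_chartDom hr.2 (mem_univ _)
  have hF := contDiffOn_inChart S.smooth_Ω x univ
  have hG := S.isMetricField.isMetricMatrix x
  have hD := (hF.fderivWithin (isRelOpen_chartDom isOpen_univ x).isRegularDomain.unique
    (m := ∞) (by simp))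
  have h1 := (hasFDerivWithinAt_of_contDiffOn hD hy).comp_hasDerivWithinAt
    t ((hw.hasDerivWithinAt ht hxt).mono (inter_subset_left : s' ⊆ Icc a b)) hm
  have h2 := h1.clm_apply ((hV t ht).mono (inter_subset_left : s' ⊆ Icc a b))
  have e : ∀ r ∈ s', differential S.Ω (γ r) (V r) =
      fderivWithin ℝ (inChart S.Ω x) (chartDom univ x) (extChartAt I4 x (γ r))
        (ofTan x (γ r) (V r)) := fun r hr =>
    differential_eq S.smooth_Ω isOpen_univ hr.2 (mem_univ _) _
  have hz : ∀ u v, fderivWithin ℝ (fderivWithin ℝ (inChart S.Ω x) (chartDom univ x))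
      (chartDom univ x) (extChartAt I4 x x) u v - fderivWithin ℝ (inChart S.Ω x) (chartDom univ x)
      (extChartAt I4 x x) (chr (comps S.g x) (extChartAt I4 x x) u v) = 0 := by
    refine forall_of_coordVec fun i j => ?_
    rw [hG.hessCoord_eq hF hy]
    exact h i j
  refine ((h2.congr_deriv ?_).congr e (e t ⟨ht, hxt⟩)).mono_of_mem_nhdsWithin hmem
  rw [map_neg, ← sub_eq_add_neg]
  exact hz _ _

end PenroseCompletion

end EndpointSmoothness

/-! ### Geometry and limits at the endpoint. -/

section Endpoint

variable {M : Type*} [TopologicalSpace M] [ChartedSpace (EuclideanHalfSpace 4) M]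
  [IsManifold I4 ∞ M] {γ : ℝ → M} {Λ : ℝ} {S : PenroseCompletion M Λ} {t₁ : ℝ}

lemma IsNullTetrad.cross_eq_zero {V : Type*} [AddCommGroup V] [Module ℝ V]
    {g : LinearMap.BilinForm ℝ V} {l k e₁ e₂ : V} (h : IsNullTetrad g l k e₁ e₂) (r : ℝ) :
    g (k + r • l) e₁ = 0 ∧ g (k + r • l) e₂ = 0 := by
  simp [h.ke₁, h.ke₂, h.le₁, h.le₂]

namespace PenroseCompletion

variable (hγ : S.IsNullGeodesicToScri γ t₁)
include hγ

/-- The curve itself approaches its endpoint through the interior; this gives the matter condition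
at the boundary its content. -/
lemma neBot_interior : (𝓝[I4.interior M] (γ 0)).NeBot := by
  have h0 : (0 : ℝ) ∈ Icc t₁ 0 := right_mem_Icc.2 hγ.neg.le
  have h1 : Tendsto γ (𝓝[Ico t₁ 0] 0) (𝓝[I4.interior M] (γ 0)) :=
    tendsto_nhdsWithin_of_tendsto_nhds_of_eventually_within _
      ((hγ.smooth.continuousOn 0 h0).mono Ico_subset_Icc_self).tendsto
      (by filter_upwards [self_mem_nhdsWithin] with t ht using hγ.physical t ht)
  have : (𝓝[Ico t₁ 0] (0 : ℝ)).NeBot := by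
    rw [← mem_closure_iff_nhdsWithin_neBot, closure_Ico hγ.neg.ne]
    exact h0
  exact h1.neBot

/-- With `N·N = -Λ/3`, `N·l = -1` and `l·l = 0`, the shift by `-(Λ/6) l` adds exactly `Λ/3` to the
norm of `N`. -/
lemma g_kVec : S.g (γ 0) (S.kVec γ t₁) (S.kVec γ t₁) = 0 ∧
    S.g (γ 0) (S.kVec γ t₁) (velocity γ (Icc t₁ 0) 0) = -1 := by
  have h0 : (0 : ℝ) ∈ Icc t₁ 0 := right_mem_Icc.2 hγ.neg.le
  have hNN := S.g_N_N hγ.endpoint (neBot_interior hγ)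
  have hNl := (S.g_N (γ 0) (velocity γ (Icc t₁ 0) 0)).trans hγ.normalised
  have hlN := ((S.lorentzian (γ 0)).symm (velocity γ (Icc t₁ 0) 0) (S.N (γ 0))).trans hNl
  have hll := hγ.null 0 h0
  constructor <;>
  · simp only [kVec, map_sub, LinearMap.sub_apply, map_smul, LinearMap.smul_apply, smul_eq_mul,
      hNN, hNl, hlN, hll]
    ring

lemma exists_adapted_frame : ∃ F : ParallelFrame S.g γ (velocity γ (Icc t₁ 0)) (Icc t₁ 0),
    F.l = velocity γ (Icc t₁ 0) ∧ F.k 0 = S.kVec γ t₁ := by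
  have h0 : (0 : ℝ) ∈ Icc t₁ 0 := right_mem_Icc.2 hγ.neg.le
  obtain ⟨hkk, hkl⟩ := g_kVec hγ
  obtain ⟨e₁, e₂, h⟩ := (S.lorentzian (γ 0)).exists_nullTetrad (hγ.null 0 h0) hkk
    (((S.lorentzian (γ 0)).symm _ _).trans hkl)
  obtain ⟨F, hl, hk, -, -⟩ := exists_parallelFrame S.isMetricField hγ.neg hγ.smooth hγ.isVelocity
    (mapsTo_univ _ _) (isParallelAlong_iff.1 hγ.geodesic) h0 h
  exact ⟨F, hl, hk⟩

lemma contDiffOn_Ω : ContDiffOn ℝ ∞ (fun t => S.Ω (γ t)) (Icc t₁ 0) :=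
  contMDiffOn_iff_contDiffOn.1 (S.smooth_Ω.comp_contMDiffOn hγ.smooth)

lemma hasDerivWithinAt_Ω : HasDerivWithinAt (fun t => S.Ω (γ t)) (-1) (Icc t₁ 0) 0 :=
  (hγ.isVelocity.hasDerivWithinAt_comp S.smooth_Ω (right_mem_Icc.2 hγ.neg.le)).congr_deriv
    hγ.normalised

lemma derivΩ_zero : S.derivΩ γ t₁ 0 = 0 := by
  rw [derivΩ, iteratedDerivWithin_zero]
  exact S.Ω_zero _ hγ.endpoint

lemma derivΩ_one : S.derivΩ γ t₁ 1 = -1 := by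
  rw [derivΩ, iteratedDerivWithin_one]
  exact (hasDerivWithinAt_Ω hγ).derivWithin
    (uniqueDiffOn_Icc hγ.neg 0 (right_mem_Icc.2 hγ.neg.le))

lemma exists_chart_interval : ∃ a ∈ Ico t₁ 0,
    MapsTo γ (Icc a 0) (extChartAt I4 (γ 0)).source := by
  have h0 : (0 : ℝ) ∈ Icc t₁ 0 := right_mem_Icc.2 hγ.neg.le
  have h1 := hγ.isVelocity.mem_nhdsWithin h0 (isOpen_extChartAt_source (I := I4) (γ 0))
    (mem_extChartAt_source (γ 0))
  obtain ⟨ε, hε, hb⟩ := Metric.mem_nhdsWithin_iff.1 h1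
  refine ⟨max t₁ (-(ε / 2)), ⟨le_max_left _ _, max_lt hγ.neg (by linarith)⟩, fun t ht => ?_⟩
  have h2 := max_le_iff.1 ht.1
  refine (hb ⟨?_, h2.1, ht.2⟩).2
  rw [Metric.mem_ball, Real.dist_eq, sub_zero, abs_lt]
  constructor <;> linarith [ht.2]

variable {F : ParallelFrame S.g γ (velocity γ (Icc t₁ 0)) (Icc t₁ 0)}

lemma hasExpansion_rescaledComp (a : Fin 5) :
    HasExpansion (fun t => F.rescaledComp t a) ∧
      Tendsto (fun t => F.rescaledComp t a) (𝓝[<] 0) (𝓝 (F.rescaledComp 0 a)) := by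
  obtain ⟨b, hb, hx⟩ := exists_chart_interval hγ
  have hsub : Icc b 0 ⊆ Icc t₁ 0 := Icc_subset_Icc_left hb.1
  have key : ∀ f g : ℝ → ℝ, ContDiffOn ℝ ∞ f (Icc b 0) → ContDiffOn ℝ ∞ g (Icc b 0) →
      HasExpansion (fun t => (⟨f t, g t⟩ : ℂ)) ∧
        Tendsto (fun t => (⟨f t, g t⟩ : ℂ)) (𝓝[<] 0) (𝓝 ⟨f 0, g 0⟩) := fun f g hf hg => by
    refine ⟨(hasExpansion_of_contDiffOn hb.2 hf).mk_complex (hasExpansion_of_contDiffOn hb.2 hg),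
      ?_⟩
    have h0 := right_mem_Icc.2 hb.2.le
    have h1 := (hf.continuousOn 0 h0).tendsto.mono_left (Iio_le_Icc hb.2)
    have h2 := (hg.continuousOn 0 h0).tendsto.mono_left (Iio_le_Icc hb.2)
    exact (Complex.equivRealProdCLM.symm.continuous.tendsto (f 0, g 0)).comp (h1.prodMk_nhds h2)
  have hd := fun {V₁ V₂ V₃ V₄} h₁ h₂ h₃ h₄ => S.contDiffOn_dTens (V₁ := V₁) (V₂ := V₂)
    (V₃ := V₃) (V₄ := V₄) hb.2 (hγ.smooth.mono hsub) (hγ.isVelocity.mono hsub) hx h₁ h₂ h₃ h₄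
  have pl := F.parallel_l.mono hsub
  have pk := F.parallel_k.mono hsub
  have p1 := F.parallel_e₁.mono hsub
  have p2 := F.parallel_e₂.mono hsub
  fin_cases a
  · exact key _ _ (hd pl p1 pl p1) (hd pl p1 pl p2)
  · exact key _ _ (hd pl pk pl p1) (hd pl pk pl p2)
  · exact key _ _ (hd pl pk pl pk) (hd pl pk p1 p2)
  · exact key _ _ (hd pl pk pk p1) (hd pl pk pk p2).neg
  · exact key _ _ (hd pk p1 pk p1) (hd pk p1 pk p2).neg

/-- Where `Ω = 0`, the relation `C = Ω d` says nothing about `d`. The algebraic symmetries are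
inherited as a limit along `γ`, by comparing components in the parallel frame. -/
lemma dTens_endpoint : S.dTens (γ 0) = F.weylTens 0 (F.rescaledComp 0) := by
  obtain ⟨b, hb, hx⟩ := exists_chart_interval hγ
  have hsub : Icc b 0 ⊆ Icc t₁ 0 := Icc_subset_Icc_left hb.1
  have h0 : (0 : ℝ) ∈ Icc b 0 := right_mem_Icc.2 hb.2.le
  ext u v w x
  rw [← F.vec_coord (hsub h0) u, ← F.vec_coord (hsub h0) v, ← F.vec_coord (hsub h0) w,
    ← F.vec_coord (hsub h0) x]
  generalize F.coord 0 u = u, F.coord 0 v = v, F.coord 0 w = w, F.coord 0 x = x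
  have hp := fun u => (F.isParallelOn_vec u).mono hsub
  have h1 := ((S.contDiffOn_dTens hb.2 (hγ.smooth.mono hsub) (hγ.isVelocity.mono hsub) hx (hp u)
    (hp v) (hp w) (hp x)).continuousOn 0 h0).tendsto.mono_left (Iio_le_Icc hb.2)
  have hc : ∀ t ∈ Icc t₁ 0, ∀ u,
      frameCoord (S.g (γ t)) (F.l t) (F.k t) (F.e₁ t) (F.e₂ t) (F.vec t u) = u :=
    fun t ht u => F.coord_vec ht u
  have h2 : Tendsto (fun t => weylForm (F.rescaledComp t) u v w x) (𝓝[<] 0)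
      (𝓝 (weylForm (F.rescaledComp 0) u v w x)) := by
    have hcont : Continuous fun c => weylForm c u v w x := by
      unfold weylForm
      fun_prop
    exact (hcont.tendsto _).comp (tendsto_pi_nhds.2 fun a => (hasExpansion_rescaledComp hγ a).2)
  rw [ParallelFrame.weylTens, frameWeyl, hc 0 (hsub h0), hc 0 (hsub h0), hc 0 (hsub h0),
    hc 0 (hsub h0)]
  refine tendsto_nhds_unique h1 (h2.congr' ?_)
  filter_upwards [Iio_le_Icc hγ.neg self_mem_nhdsWithin, self_mem_nhdsWithin] with t ht ht0
  rw [dTens_eq hγ F ⟨ht.1, ht0⟩, ParallelFrame.weylTens, frameWeyl, hc t ht, hc t ht, hc t ht,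
    hc t ht]

variable (hk : F.k 0 = S.kVec γ t₁) (hl : F.l = velocity γ (Icc t₁ 0))
include hk hl

/-- At the endpoint `N = k + (Λ/6) l` lies in the plane of `l` and `k`: this is what singles out the
vector `k`. -/
lemma differential_transversal :
    differential S.Ω (γ 0) (F.e₁ 0) = 0 ∧ differential S.Ω (γ 0) (F.e₂ 0) = 0 := by
  have h0 : (0 : ℝ) ∈ Icc t₁ 0 := right_mem_Icc.2 hγ.neg.le
  have hN : S.N (γ 0) = F.k 0 + (Λ / 6) • F.l 0 := by
    rw [hk, hl, kVec, sub_add_cancel]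
  rw [← S.g_N, ← S.g_N, hN]
  exact (F.frame 0 h0).toIsNullTetrad.cross_eq_zero _

/-- The double zero demanded by `hasExpansion_primitive` has two sources: the value vanishes by the
choice of `k`, the derivative by the gauge condition on the Hessian. -/
lemma hasExpansion_shift {Q : ℝ → ℝ} {e : ∀ t, TangentSpace I4 (γ t)} (he : e = F.e₁ ∨ e = F.e₂)
    (h : ∀ t ∈ Ico t₁ 0, HasDerivWithinAt Q
      (differential S.Ω (γ t) (e t) / S.Ω (γ t) ^ 2) (Ico t₁ 0) t) :
    HasExpansion (fun t => ((S.Ω (γ t) * Q t : ℝ) : ℂ)) ∧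
      Tendsto (fun t => S.Ω (γ t) * Q t) (𝓝[<] 0) (𝓝 0) := by
  obtain ⟨b, hb, hx⟩ := exists_chart_interval hγ
  have hsub : Icc b 0 ⊆ Icc t₁ 0 := Icc_subset_Icc_left hb.1
  have h0 : (0 : ℝ) ∈ Icc b 0 := right_mem_Icc.2 hb.2.le
  have hw := hγ.isVelocity.mono hsub
  have hp : IsParallelOn S.g γ (velocity γ (Icc t₁ 0)) e (Icc b 0) := by
    rcases he with rfl | rfl
    exacts [F.parallel_e₁.mono hsub, F.parallel_e₂.mono hsub]
  have hz : differential S.Ω (γ 0) (e 0) = 0 := by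
    rcases he with rfl | rfl
    exacts [(differential_transversal hγ hk hl).1, (differential_transversal hγ hk hl).2]
  refine hasExpansion_primitive hb.2 ((contDiffOn_Ω hγ).mono hsub) (S.Ω_zero _ hγ.endpoint)
    ((hasDerivWithinAt_Ω hγ).mono hsub)
    (S.contDiffOn_differential hb.2 (hγ.smooth.mono hsub) hw hx hp S.smooth_Ω) hz
    (S.hasDerivWithinAt_differential hw hp h0 (S.gauge _ hγ.endpoint)) fun t ht => ?_
  exact (h t ⟨hb.1.trans ht.1.le, ht.2⟩).hasDerivAt
    (Ico_mem_nhds (hb.1.trans_lt ht.1) ht.2)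

/-- The null rotation tends to the identity, so the limit involves the rescaled Weyl tensor alone,
component by component. -/
lemma hasExpansion_peelComp {Q₂ Q₃ : ℝ → ℝ}
    (h₂ : ∀ t ∈ Ico t₁ 0, HasDerivWithinAt Q₂
      (differential S.Ω (γ t) (F.e₁ t) / S.Ω (γ t) ^ 2) (Ico t₁ 0) t)
    (h₃ : ∀ t ∈ Ico t₁ 0, HasDerivWithinAt Q₃
      (differential S.Ω (γ t) (F.e₂ t) / S.Ω (γ t) ^ 2) (Ico t₁ 0) t) (a : Fin 5) :
    HasExpansion (fun t => peelComp F Q₂ Q₃ t a) ∧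
      Tendsto (fun t => peelComp F Q₂ Q₃ t a) (𝓝[<] 0)
        (𝓝 (((S.Ω (γ t₁) ^ (6 - (a : ℕ)))⁻¹ : ℝ) * F.rescaledComp 0 a)) := by
  obtain ⟨e2, l2⟩ := hasExpansion_shift hγ hk hl (Or.inl rfl) h₂
  obtain ⟨e3, l3⟩ := hasExpansion_shift hγ hk hl (Or.inr rfl) h₃
  refine ⟨(hasExpansion_nullRot (e2.mk_complex (e3.neg.congr' (Eventually.of_forall fun t => ?_)))
    (fun a => (hasExpansion_rescaledComp hγ a).1) a).const_mul _, Tendsto.const_mul _ ?_⟩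
  · push_cast
    rfl
  · have h1 : Tendsto (fun t => (⟨S.Ω (γ t) * Q₂ t, -(S.Ω (γ t) * Q₃ t)⟩ : ℂ)) (𝓝[<] 0) (𝓝 0) := by
      have := (Complex.equivRealProdCLM.symm.continuous.tendsto (0, 0)).comp
        (l2.prodMk_nhds (by simpa using l3.neg))
      rwa [show Complex.equivRealProdCLM.symm (0, 0) = 0 from map_zero _] at this
    have h2 := (continuous_nullRot.tendsto (0, F.rescaledComp 0)).comp
      (h1.prodMk_nhds (tendsto_pi_nhds.2 fun a => (hasExpansion_rescaledComp hγ a).2))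
    rw [nullRot_zero] at h2
    exact tendsto_pi_nhds.1 h2 a

end PenroseCompletion

end Endpoint

/-! ### From components to tensors. -/

section Assembly

variable {V : Type*} [AddCommGroup V] [Module ℝ V]

/-- The tensor with given components in a null frame, as a linear function of the components. -/
def frameWeylₗ (g : LinearMap.BilinForm ℝ V) (l k e₁ e₂ : V) : (Fin 5 → ℂ) →ₗ[ℝ] Tens4 V where
  toFun := frameWeyl g l k e₁ e₂
  map_add' c c' := by
    ext u v w x
    exact weylForm_add ..
  map_smul' r c := (smul_frameWeyl g l k e₁ e₂ r c).symm

lemma weylScalar_smul (r : ℝ) (W : Tens4 V) (l k e₁ e₂ : V) (a : Fin 5) :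
    weylScalar (r • W) l k e₁ e₂ a = r * weylScalar W l k e₁ e₂ a := by
  fin_cases a <;> simp [weylScalar, cext₁, cext₂, Complex.ext_iff, mul_add, mul_sub]

/-- Componentwise evaluation of an asymptotic expansion of Weyl components. -/
lemma frameWeyl_expansion (g : LinearMap.BilinForm ℝ V) (l k e₁ e₂ : V) (a : Fin 5) {f : ℝ → ℂ}
    {c : ℕ → ℂ} {n : ℕ} (h : (fun t : ℝ => f t - ∑ i ∈ Finset.range (n + 1), (t : ℂ) ^ i * c i)
      =O[𝓝[<] (0 : ℝ)] fun t => t ^ (n + 1)) (x₁ x₂ x₃ x₄ : V) :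
    (fun t : ℝ => frameWeylₗ g l k e₁ e₂ (Pi.single a (f t)) x₁ x₂ x₃ x₄
      - ∑ i ∈ Finset.range (n + 1),
        t ^ i * frameWeylₗ g l k e₁ e₂ (Pi.single a (c i)) x₁ x₂ x₃ x₄)
      =O[𝓝[<] (0 : ℝ)] fun t => t ^ (n + 1) := by
  let A : ℂ →ₗ[ℝ] ℝ := LinearMap.proj x₄ ∘ₗ LinearMap.proj x₃ ∘ₗ LinearMap.proj x₂ ∘ₗ
    LinearMap.proj x₁ ∘ₗ frameWeylₗ g l k e₁ e₂ ∘ₗ LinearMap.single ℝ (fun _ => ℂ) a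
  refine ((LinearMap.toContinuousLinearMap A).isBigO_comp _ _ |>.trans h).congr_left fun t => ?_
  rw [LinearMap.coe_toContinuousLinearMap', map_sub, map_sum]
  have e : ∀ i, A ((t : ℂ) ^ i * c i) = t ^ i * A (c i) := fun i => by
    rw [← Complex.ofReal_pow, ← Complex.real_smul, map_smul, smul_eq_mul]
  simp only [e]
  rfl

variable {g : LinearMap.BilinForm ℝ V} {l k e₁ e₂ : V} (hg : IsLorentzian g)
  (hF : IsNullFrame g l k e₁ e₂)
include hg hF

/-- The coefficients of the peeling expansion have the generic types of their order. -/
lemma hasGenericType_coeff (w : ℕ → ℝ) (z : Fin 5 → ℕ → ℂ) {c : Fin 5 → ℕ → Tens4 V}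
    (hc : c = fun a i => frameWeylₗ g l k e₁ e₂ (Pi.single a (z a i))) :
    HasGenericType g l 4 (IsTypeN g) (coeffN c) ∧
    HasGenericType g l 3 (IsTypeIII g) (coeffIII w c) ∧
    HasGenericType g l 2 (IsTypeIIorD g) (coeffIID w c) ∧
    HasGenericType g l 1 (IsTypeI g) (coeffI₄ w c) ∧
    HasGenericType g l 0 (IsTypeI g) (coeffI₅ w c) := by
  set C : Fin 5 → ℕ → Fin 5 → ℂ := fun a i => Pi.single a (z a i) with hC
  have mem : ∀ {m : ℕ} {W : Tens4 V} (hm : m ≤ 4) (y : Fin 5 → ℂ),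
      frameWeylₗ g l k e₁ e₂ y = W → (∀ i : Fin 5, (i : ℕ) < m → y i = 0) →
      W ∈ alignedCandidates g l m := fun hm y hW hy =>
    (mem_alignedCandidates_iff hg hF hm _).2 ⟨y, hy, hW.symm⟩
  refine ⟨⟨mem le_rfl (coeffN C) ?_ ?_, isGenericIn_typeN hg hF⟩,
    ⟨mem (by norm_num) (coeffIII w C) ?_ ?_, isGenericIn_typeIII hg hF⟩,
    ⟨mem (by norm_num) (coeffIID w C) ?_ ?_, isGenericIn_typeIIorD hg hF⟩,
    ⟨mem (by norm_num) (coeffI₄ w C) ?_ ?_, isGenericIn_typeI hg hF le_rfl⟩,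
    ⟨mem (by norm_num) (coeffI₅ w C) ?_ (fun i hi => absurd hi (Nat.not_lt_zero _)),
      isGenericIn_typeI hg hF zero_le_one⟩⟩
  -- The coefficient formulas make sense in any real module. They are evaluated on component
  -- vectors, where alignment can be read off, and carried to tensors by the linear map
  -- `frameWeylₗ`.
  · simp only [coeffN, hc, map_neg, hC]
  · intro i hi
    fin_cases i <;> simp at hi <;> simp [coeffN, hC]
  · simp only [coeffIII, hc, map_add, map_sub, map_smul, hC]
  · intro i hi
    fin_cases i <;> simp at hi <;> simp [coeffIII, hC]
  · simp only [coeffIID, hc, map_add, map_sub, map_neg, map_smul, hC]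
  · intro i hi
    fin_cases i <;> simp at hi <;> simp [coeffIID, hC]
  · simp only [coeffI₄, hc, map_add, map_sub, map_smul, hC]
  · intro i hi
    fin_cases i <;> simp at hi <;> simp [coeffI₄, hC]
  · simp only [coeffI₅, hc, map_add, map_sub, map_neg, map_smul, hC]

omit hg in
/-- The algebraic properties of a tensor with a single Weyl component. -/
lemma IsNullFrame.single_properties (a : Fin 5) (z : ℂ) :
    IsWeylCandidate g (frameWeylₗ g l k e₁ e₂ (Pi.single a z)) ∧
    BelDebever g (frameWeylₗ g l k e₁ e₂ (Pi.single a z)) l a ∧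
    BelDebever g (frameWeylₗ g l k e₁ e₂ (Pi.single a z)) k (4 - (a : ℕ)) ∧
    ∀ f₁ f₂, IsNullTetrad g l k f₁ f₂ →
      ∀ b, b ≠ a → weylScalar (frameWeylₗ g l k e₁ e₂ (Pi.single a z)) l k f₁ f₂ b = 0 := by
  refine ⟨hF.isWeylCandidate _, hF.belDebever_l (by omega) fun i hi => ?_,
    hF.belDebever_k (by omega) fun i hi => ?_,
    fun f₁ f₂ hT b hb => hF.weylScalar_eq_zero hT (Pi.single_eq_of_ne hb _)⟩
  · exact Pi.single_eq_of_ne (by rintro rfl; exact lt_irrefl _ hi) _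
  · exact Pi.single_eq_of_ne (by rintro rfl; omega) _

end Assembly

end Peeling

end

open Peeling in
theorem theorem1 {M : Type*} [TopologicalSpace M] [ChartedSpace (EuclideanHalfSpace 4) M]
    [IsManifold I4 ∞ M] (Λ : ℝ) (S : PenroseCompletion M Λ) (γ : ℝ → M) (t₁ : ℝ)
    (hγ : S.IsNullGeodesicToScri γ t₁)
    (l k : TangentSpace I4 (γ 0)) (hl : l = velocity γ (Icc t₁ 0) 0) (hk : k = S.kVec γ t₁)
    (w : ℕ → ℝ) (hw : w = S.derivΩ γ t₁) :
    S.g (γ 0) k k = 0 ∧ S.g (γ 0) k l = -1 ∧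
    ∃ (C : Fin 5 → ℝ → Tens4 (TangentSpace I4 (γ 0)))
      (c : Fin 5 → ℕ → Tens4 (TangentSpace I4 (γ 0))),
      -- decomposition into five Weyl-tensor candidates
      (∀ t ∈ Ico t₁ 0,
        S.transportedWeyl γ t₁ t = ∑ a : Fin 5, S.Ω (γ t) ^ (5 - (a : ℕ)) • C a t) ∧
      (∀ (a : Fin 5), ∀ t ∈ Ico t₁ 0,
        IsWeylCandidate (S.g (γ 0)) (C a t) ∧
        BelDebever (S.g (γ 0)) (C a t) l a ∧ BelDebever (S.g (γ 0)) (C a t) k (4 - (a : ℕ)) ∧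
        ∀ e₁ e₂, IsNullTetrad (S.g (γ 0)) l k e₁ e₂ →
          ∀ b, b ≠ a → weylScalar (C a t) l k e₁ e₂ b = 0) ∧
      -- their expansions in powers of the affine parameter
      (∀ (a : Fin 5) (n : ℕ) (x₁ x₂ x₃ x₄ : TangentSpace I4 (γ 0)),
        (fun t : ℝ => C a t x₁ x₂ x₃ x₄
            - ∑ i ∈ Finset.range (n + 1), t ^ i * c a i x₁ x₂ x₃ x₄)
          =O[𝓝[<] (0 : ℝ)] fun t => t ^ (n + 1)) ∧
      -- their limits at the endpoint, in terms of the rescaled Weyl tensor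
      (∀ e₁ e₂, IsNullTetrad (S.g (γ 0)) l k e₁ e₂ → ∀ a : Fin 5,
        weylScalar (c a 0) l k e₁ e₂ a =
          (((S.Ω (γ t₁) ^ (6 - (a : ℕ)))⁻¹ : ℝ) : ℂ) *
            weylScalar (S.dTens (γ 0)) l k e₁ e₂ a) ∧
      c 4 0 = (S.Ω (γ t₁) ^ 2)⁻¹ • typeNProj (S.g (γ 0)) l k (S.dTens (γ 0)) ∧
      -- the peeling expansion
      (∀ x₁ x₂ x₃ x₄ : TangentSpace I4 (γ 0),
        (fun t : ℝ => S.transportedWeyl γ t₁ t x₁ x₂ x₃ x₄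
            - (t * coeffN c x₁ x₂ x₃ x₄ + t ^ 2 * coeffIII w c x₁ x₂ x₃ x₄
              + t ^ 3 * coeffIID w c x₁ x₂ x₃ x₄ + t ^ 4 * coeffI₄ w c x₁ x₂ x₃ x₄
              + t ^ 5 * coeffI₅ w c x₁ x₂ x₃ x₄))
          =O[𝓝[<] (0 : ℝ)] fun t => t ^ 6) ∧
      -- the generic Petrov types of the coefficients
      HasGenericType (S.g (γ 0)) l 4 (IsTypeN (S.g (γ 0))) (coeffN c) ∧
      HasGenericType (S.g (γ 0)) l 3 (IsTypeIII (S.g (γ 0))) (coeffIII w c) ∧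
      HasGenericType (S.g (γ 0)) l 2 (IsTypeIIorD (S.g (γ 0))) (coeffIID w c) ∧
      HasGenericType (S.g (γ 0)) l 1 (IsTypeI (S.g (γ 0))) (coeffI₄ w c) ∧
      HasGenericType (S.g (γ 0)) l 0 (IsTypeI (S.g (γ 0))) (coeffI₅ w c) := by
  have h0 : (0 : ℝ) ∈ Icc t₁ 0 := right_mem_Icc.2 hγ.neg.le
  obtain ⟨hkk, hkl⟩ := PenroseCompletion.g_kVec hγ
  obtain ⟨F, hFl, hFk⟩ := PenroseCompletion.exists_adapted_frame hγ
  obtain ⟨Q₂, Q₃, h₂, h₃, hT⟩ := PenroseCompletion.exists_physical_transport hγ F hFl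
  obtain rfl : F.l 0 = l := by rw [hFl, hl]
  obtain rfl : F.k 0 = k := by rw [hFk, hk]
  have hF := F.frame 0 h0
  refine ⟨hF.kk, hF.kl, ?_⟩
  have hexp := PenroseCompletion.hasExpansion_peelComp hγ hFk hFl h₂ h₃
  -- One complex sequence for each `a` determines all coefficient tensors `c a i`, so their
  -- asymptotics hold for all four-tuples of vectors and each has the single Weyl component `a`.
  choose z hz0 hz using fun a => (hexp a).1.exists_coeff_of_tendsto (hexp a).2
  set Φ := frameWeylₗ (S.g (γ 0)) (F.l 0) (F.k 0) (F.e₁ 0) (F.e₂ 0) with hΦ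
  set C : Fin 5 → ℝ → Tens4 (TangentSpace I4 (γ 0)) := fun a t =>
    Φ (Pi.single a (PenroseCompletion.peelComp F Q₂ Q₃ t a)) with hC
  set c : Fin 5 → ℕ → Tens4 (TangentSpace I4 (γ 0)) := fun a i => Φ (Pi.single a (z a i)) with hc
  have hdec : ∀ t ∈ Ico t₁ 0,
      S.transportedWeyl γ t₁ t = ∑ a : Fin 5, S.Ω (γ t) ^ (5 - (a : ℕ)) • C a t := fun t ht =>
    PenroseCompletion.transportedWeyl_eq hγ F ht (hT t ht)
  have hCc : ∀ (a : Fin 5) (n : ℕ) (x₁ x₂ x₃ x₄ : TangentSpace I4 (γ 0)),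
      (fun t : ℝ => C a t x₁ x₂ x₃ x₄
        - ∑ i ∈ Finset.range (n + 1), t ^ i * c a i x₁ x₂ x₃ x₄)
        =O[𝓝[<] (0 : ℝ)] fun t => t ^ (n + 1) := fun a n x₁ x₂ x₃ x₄ =>
    frameWeyl_expansion _ _ _ _ _ a (hz a n) x₁ x₂ x₃ x₄
  have hd : S.dTens (γ 0) = Φ (F.rescaledComp 0) := PenroseCompletion.dTens_endpoint hγ
  refine ⟨C, c, hdec, fun a t _ => hF.single_properties a _, hCc, fun f₁ f₂ hf a => ?_, ?_,
    fun x₁ x₂ x₃ x₄ => ?_, hasGenericType_coeff (S.lorentzian _) hF w z hc⟩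
  · rw [hd, ← weylScalar_smul, ← map_smul]
    refine hF.weylScalar_congr hf ?_
    rw [Pi.single_eq_same, hz0, Pi.smul_apply, Complex.real_smul]
  · have e : typeNProj (S.g (γ 0)) (F.l 0) (F.k 0) (Φ (F.rescaledComp 0)) =
        Φ (Pi.single 4 (F.rescaledComp 0 4)) := hF.typeNProj_frameWeyl _
    rw [hd, e, ← map_smul]
    refine congrArg Φ ?_
    rw [hz0, ← Pi.single_smul, Complex.real_smul]
    rfl
  · have hΩ := isBigO_taylor hγ.neg (PenroseCompletion.contDiffOn_Ω hγ) 5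
    have hp := peeling_expansion (Ω := fun t => S.Ω (γ t)) (w := w)
      (F := fun a t => C a t x₁ x₂ x₃ x₄) (c := fun a i => c a i x₁ x₂ x₃ x₄)
      (by rw [hw]; exact hΩ) (by rw [hw]; exact PenroseCompletion.derivΩ_zero hγ)
      (by rw [hw]; exact PenroseCompletion.derivΩ_one hγ) fun a => hCc a 5 x₁ x₂ x₃ x₄
    refine hp.congr' ?_ EventuallyEq.rfl
    filter_upwards [Iio_le_Icc hγ.neg self_mem_nhdsWithin, self_mem_nhdsWithin] with t ht ht0
    rw [hdec t ⟨ht.1, ht0⟩]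
    simp only [Finset.sum_apply, Pi.smul_apply, smul_eq_mul]
    rfl
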